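/- Let $\rho_r(x)=\exp(-\pi x^2/r^2)$, and let $\mathcal D_{\mathbb Z,r}$ be the distribution on $\mathbb Z$ with probabilities proportional to $\rho_r$. All parameters are functions of $\kappa\in\mathbb N$: integers $n\ge 1$, $q\ge 2$, $\ell\ge 1$ and reals $\alpha,r>0$. \emph{Search $\mathrm{LWE}_{n,q,\alpha}^m$}: the input is $\mathbf A\in\mathbb Z_q^{m\times n}$ and $\mathbf b=\mathbf A\mathbf s+\mathbf e \bmod q$, with $\mathbf A$ and $\mathbf s\in\mathbb Z_q^n$ uniform and the coordinates of $\mathbf e$ independent with law $\mathcal D_{\mathbb Z,\alpha q}$. It is solved if $\mathbf s$ is output with probability at least $(n\log q)^{-c}$ for some constant $c$ and all sufficiently large $\kappa$. \emph{Search $\mathrm{G\text{-}EDCP}_{n,q,r}^\ell$}: the input consists of $\ell$ states, the normalizations of $$\sum_{j\in\mathbb Z}\rho_r(j)\,|j\rangle\,|\mathbf x_k+j\mathbf s \bmod q\rangle ,\qquad 1\le k\le \ell ,$$ with a common $\mathbf s\in\mathbb Z_q^n$ and $\mathbf x_k\in\mathbb Z_q^n$. It is solved if, for some constant $c$ and all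 sufficiently large $\kappa$, for all $\mathbf s,\mathbf x_1,\dots,\mathbf x_\ell\in\mathbb Z_q^n$ the output is $\mathbf s$ with probability at least $(n\log q)^{-c}$. \textbf{Theorem.} There is a (uniform) quantum algorithm $P$ which takes as input $\kappa,n,q,m,\ell$, the binary expansion of $r$ (to be read to any desired precision) and $m$ LWE samples, which outputs $\ell$ quantum registers over $\mathbb Z\times\mathbb Z_q^n$, and for which the following holds. Let $m=\lceil n\log_2 q\rceil$, assume that $m=\Omega(\kappa)$, that $m$, $\ell$ and $\max(0,\log r)$ are bounded by polynomials in $\kappa$, and that for all sufficiently large $\kappa$ $$ r<\frac{1}{32\,m\,\kappa\,\alpha\,\ell\,q^{n/m}} .$$ Then for all sufficiently large $\kappa$ the running time of $P$ (number of bit operations and elementary quantum operations, on every input and in every branch) is at most $\kappa^d$ for a constant $d$, and $P$ is a reduction from $\mathrm{LWE}_{n,q,\alpha}^m$ to $\mathrm{G\text{-}EDCP}_{n,q,r}^\ell$: whenever a family of quantum measurements with outcomes in $\mathbb Z_q^n$ solves search $\mathrm{G\text{-}EDCP}_{n,q,r}^\ell$, the procedure that runs $P$ on the LWE samples, applies this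 measurement once to the output registers and returns its outcome solves search $\mathrm{LWE}_{n,q,\alpha}^m$. -/

import Mathlib

open scoped Matrix

namespace QRed

/-! ## Gaussian weights and the learning with errors distribution -/

/-- The Gaussian weight `ρ_r(j) = exp (-π j² / r²)` on the integers. -/
noncomputable def gaussianWeight (r : ℝ) (j : ℤ) : ℝ :=
  Real.exp (-Real.pi * (j : ℝ) ^ 2 / r ^ 2)

/-- The discrete Gaussian distribution `D_{ℤ,r}`: the probability of `j`. -/
noncomputable def discreteGaussian (r : ℝ) (j : ℤ) : ℝ :=
  gaussianWeight r j / ∑' i : ℤ, gaussianWeight r i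

/-- The second components `b = A s + e mod q` of `m` LWE samples; the first components are
the rows of `A`. -/
def lweVector {m n q : ℕ} (A : Matrix (Fin m) (Fin n) (ZMod q)) (s : Fin n → ZMod q)
    (e : Fin m → ℤ) : Fin m → ZMod q :=
  fun k => (A *ᵥ s) k + (e k : ZMod q)

/-- The probability that a procedure for search `LWE_{n,q,α}^m` succeeds, when `A` and `s` are
uniform and the coordinates of `e` are independent with law `D_{ℤ, α q}`. Here `succ A b s` is the
probability that the procedure outputs `s` on the samples `(A, b)`. -/
noncomputable def lweSuccess (m n q : ℕ) [NeZero q] (α : ℝ)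
    (succ : Matrix (Fin m) (Fin n) (ZMod q) → (Fin m → ZMod q) → (Fin n → ZMod q) → ℝ) : ℝ :=
  (∑ A : Fin m → Fin n → ZMod q, ∑ s : Fin n → ZMod q, ∑' e : Fin m → ℤ,
      (∏ k, discreteGaussian (α * q) (e k)) *
        succ (Matrix.of A) (lweVector (Matrix.of A) s e) s) /
    ((Fintype.card (Fin m → Fin n → ZMod q) : ℝ) * Fintype.card (Fin n → ZMod q))

/-! ## The extrapolated dihedral coset problem -/

/-- Basis labels of `ℓ` registers `|j⟩|y⟩` with `j ∈ ℤ` and `y ∈ ℤ_N^n`. -/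
abbrev EdcpBasis (n N ℓ : ℕ) : Type := Fin ℓ → ℤ × (Fin n → ZMod N)

/-- The Hilbert space of `ℓ` registers, i.e. the `ℓ`-fold tensor power of `ℓ²(ℤ × ℤ_N^n)`. -/
abbrev EdcpSpace (n N ℓ : ℕ) : Type := lp (fun _ : EdcpBasis n N ℓ => ℂ) 2

/-- The amplitude at `(j, y)` of the normalized state `∑_j D(j) |j⟩|x + j s⟩`. -/
noncomputable def cosetAmp {n N : ℕ} (D : ℤ → ℝ) (s x : Fin n → ZMod N)
    (p : ℤ × (Fin n → ZMod N)) : ℝ :=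
  if p.2 = x + p.1 • s then D p.1 / Real.sqrt (∑' i : ℤ, D i ^ 2) else 0

/-- The amplitudes of the product of `ℓ` coset states with common secret `s`. -/
noncomputable def edcpAmp {n N ℓ : ℕ} (D : ℤ → ℝ) (s : Fin n → ZMod N)
    (x : Fin ℓ → Fin n → ZMod N) (ω : EdcpBasis n N ℓ) : ℂ :=
  ((∏ k, cosetAmp D s (x k) (ω k) : ℝ) : ℂ)

theorem summable_cosetAmp_sq {n N : ℕ} (D : ℤ → ℝ) (hD : Summable fun i => D i ^ 2)
    (s x : Fin n → ZMod N) : Summable fun p => cosetAmp D s x p ^ 2 := by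
  classical
  have hinj : Function.Injective (fun j : ℤ => (j, x + j • s)) := by
    intro a b h
    exact congrArg Prod.fst h
  refine (hinj.summable_iff ?_).1 ?_
  · rintro ⟨j, y⟩ hp
    have : y ≠ x + j • s := fun h => hp ⟨j, by simp [h]⟩
    simp only [cosetAmp, if_neg this]
    norm_num
  · have : ((fun p => cosetAmp D s x p ^ 2) ∘ fun j : ℤ => (j, x + j • s)) =
        fun j => D j ^ 2 * ((Real.sqrt (∑' i : ℤ, D i ^ 2))⁻¹) ^ 2 := by
      funext j
      simp [cosetAmp, div_eq_mul_inv, mul_pow]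
    rw [this]
    exact hD.mul_right _

theorem memlp_edcpAmp {n N ℓ : ℕ} (D : ℤ → ℝ) (hD : Summable fun i => D i ^ 2)
    (s : Fin n → ZMod N) (x : Fin ℓ → Fin n → ZMod N) :
    Memℓp (E := fun _ : EdcpBasis n N ℓ => ℂ) (edcpAmp D s x) 2 := by
  classical
  apply memℓp_gen
  have h2 : ∀ ω : EdcpBasis n N ℓ, ‖edcpAmp D s x ω‖ ^ (2 : ENNReal).toReal =
      ∏ k, cosetAmp D s (x k) (ω k) ^ 2 := by
    intro ω
    simp [edcpAmp, Finset.prod_pow, sq_abs, ← Finset.abs_prod]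
  simp_rw [h2]
  refine summable_of_sum_le (c := ∏ k, ∑' p, cosetAmp D s (x k) p ^ 2)
    (fun ω => Finset.prod_nonneg fun _ _ => sq_nonneg _) ?_
  intro u
  have hsub : u ⊆ Fintype.piFinset fun k => u.image fun ω => ω k := by
    intro ω hω
    rw [Fintype.mem_piFinset]
    exact fun k => Finset.mem_image_of_mem _ hω
  refine (Finset.sum_le_sum_of_subset_of_nonneg hsub
    fun ω _ _ => Finset.prod_nonneg fun _ _ => sq_nonneg _).trans ?_
  rw [← Finset.prod_univ_sum (fun k => u.image fun ω => ω k)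
    (fun k p => cosetAmp D s (x k) p ^ 2)]
  exact Finset.prod_le_prod (fun k _ => Finset.sum_nonneg fun _ _ => sq_nonneg _)
    fun k _ => (summable_cosetAmp_sq D hD s (x k)).sum_le_tsum _ fun _ _ => sq_nonneg _

theorem summable_discreteGaussian_sq {r : ℝ} (hr : 0 < r) :
    Summable fun j : ℤ => discreteGaussian r j ^ 2 := by
  have key : Summable fun j : ℤ => Real.exp (-Real.pi * (j : ℝ) ^ 2 * (2 / r ^ 2)) := by
    have him : 0 < (Complex.I * ((2 / r ^ 2 : ℝ) : ℂ)).im := by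
      simp only [Complex.mul_im, Complex.I_re, Complex.I_im, Complex.ofReal_re, Complex.ofReal_im]
      have : 0 < 2 / r ^ 2 := by positivity
      linarith
    have h := ((summable_jacobiTheta₂_term_iff 0 _).2 him).norm
    refine h.congr fun j => ?_
    rw [norm_jacobiTheta₂_term]
    congr 1
    rw [Complex.mul_im, Complex.I_re, Complex.I_im, Complex.ofReal_re, Complex.ofReal_im,
      Complex.zero_im]
    ring
  have : (fun j : ℤ => discreteGaussian r j ^ 2) =
      fun j : ℤ => Real.exp (-Real.pi * (j : ℝ) ^ 2 * (2 / r ^ 2)) *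
        ((∑' i : ℤ, gaussianWeight r i)⁻¹) ^ 2 := by
    funext j
    rw [discreteGaussian, div_eq_mul_inv, mul_pow, gaussianWeight, ← Real.exp_nat_mul]
    congr 2
    push_cast
    ring
  rw [this]
  exact key.mul_right _

/-- The joint state of the `ℓ` inputs of `G-EDCP_{n,N,r}^ℓ`: the tensor product over `k` of the
normalized states `∑_j D_{ℤ,r}(j) |j⟩|x_k + j s mod N⟩`. -/
noncomputable def gEdcpState {n N ℓ : ℕ} {r : ℝ} (hr : 0 < r) (s : Fin n → ZMod N)
    (x : Fin ℓ → Fin n → ZMod N) : EdcpSpace n N ℓ :=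
  ⟨edcpAmp (discreteGaussian r) s x, memlp_edcpAmp _ (summable_discreteGaussian_sq hr) s x⟩

/-- A quantum measurement (POVM) on the `ℓ` registers with outcomes in `ℤ_N^n`. Whatever quantum
algorithm takes `ℓ` registers as input and outputs a vector acts on its input as a POVM. -/
structure Povm (n N ℓ : ℕ) [NeZero N] where
  op : (Fin n → ZMod N) → EdcpSpace n N ℓ →L[ℂ] EdcpSpace n N ℓ
  pos : ∀ t, (op t).IsPositive
  sum_op : ∑ t, op t = 1

/-- The weight `⟨φ, M_t φ⟩` of the outcome `t`; it is the probability of `t` for a unit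
vector `φ`. -/
noncomputable def Povm.weight {n N ℓ : ℕ} [NeZero N] (M : Povm n N ℓ) (t : Fin n → ZMod N)
    (φ : EdcpSpace n N ℓ) : ℝ :=
  (inner ℂ φ (M.op t φ)).re

/-! ## Quantum programs with a running time

A program is one fixed finite text, independent of the size of the input (so algorithms are
uniform). It works on a classical and a quantum memory. Both consist of named two-dimensional arrays
of integers; a basis state of the quantum memory is a content of that memory. The running time is
the bit cost: every evaluation of an operation is charged the bit length of its operands and of its
result, so that up to a polynomial this is the time of a quantum Turing machine. -/

/-- A memory cell: name of the array, row, column. -/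
abbrev Loc : Type := ℕ × ℤ × ℤ

/-- Contents of a memory. -/
abbrev Mem : Type := Loc → ℤ

/-- Integer expressions, over arrays with names in `L`. -/
inductive Expr (L : Type) : Type
  | const (c : ℤ)
  /-- the content of a cell -/
  | read (x : L) (i j : Expr L)
  /-- the binary expansion `⌊2 ^ p * r⌋` of the real input `r`, up to `p` digits -/
  | digits (p : Expr L)
  | add (e f : Expr L)
  | sub (e f : Expr L)
  | mul (e f : Expr L)
  /-- integer division (`0` if the divisor is `0`) -/
  | div (e f : Expr L)
  | mod (e f : Expr L)
  /-- `1` if `e < f`, else `0` -/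
  | lt (e f : Expr L)

/-- The value of an expression for the real input `r` and the memory contents `μ`. -/
noncomputable def Expr.eval {L : Type} (r : ℝ) (μ : L × ℤ × ℤ → ℤ) : Expr L → ℤ
  | const c => c
  | read x i j => μ (x, i.eval r μ, j.eval r μ)
  | digits p => ⌊(2 : ℝ) ^ (p.eval r μ).toNat * r⌋
  | add e f => e.eval r μ + f.eval r μ
  | sub e f => e.eval r μ - f.eval r μ
  | mul e f => e.eval r μ * f.eval r μ
  | div e f => e.eval r μ / f.eval r μ
  | mod e f => e.eval r μ % f.eval r μ
  | lt e f => if e.eval r μ < f.eval r μ then 1 else 0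

/-- The number of bits of an integer, including the sign. -/
def bits (z : ℤ) : ℕ := Nat.size z.natAbs + 1

/-- The bit cost of evaluating an expression: the total bit length of the values of all
subexpressions; asking for `p` binary digits of the real input costs another `p`. -/
noncomputable def Expr.cost {L : Type} (r : ℝ) (μ : L × ℤ × ℤ → ℤ) : Expr L → ℕ
  | const c => bits c
  | read x i j => i.cost r μ + j.cost r μ + bits ((read x i j).eval r μ)
  | digits p => p.cost r μ + (p.eval r μ).natAbs + bits ((digits p).eval r μ)
  | add e f => e.cost r μ + f.cost r μ + bits ((add e f).eval r μ)
  | sub e f => e.cost r μ + f.cost r μ + bits ((sub e f).eval r μ)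
  | mul e f => e.cost r μ + f.cost r μ + bits ((mul e f).eval r μ)
  | div e f => e.cost r μ + f.cost r μ + bits ((div e f).eval r μ)
  | mod e f => e.cost r μ + f.cost r μ + bits ((mod e f).eval r μ)
  | lt e f => e.cost r μ + f.cost r μ + bits ((lt e f).eval r μ)

/-- Expressions over the classical memory. -/
abbrev CExpr : Type := Expr ℕ

/-- Expressions over the classical memory (`Sum.inl`) and the quantum memory (`Sum.inr`); they are
evaluated in superposition. -/
abbrev QExpr : Type := Expr (ℕ ⊕ ℕ)

/-- The contents that a `QExpr` reads in a basis state `Q` of the quantum memory. -/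
def joint (μ Q : Mem) : (ℕ ⊕ ℕ) × ℤ × ℤ → ℤ :=
  fun p => Sum.elim (fun x => μ (x, p.2)) (fun x => Q (x, p.2)) p.1

/-- Quantum programs. -/
inductive Prog : Type
  | skip
  | seq (P P' : Prog)
  /-- classical assignment of `v` to cell `(x, i, j)` -/
  | assign (x : ℕ) (i j v : CExpr)
  /-- runs `P` if the value of `e` is not `0`, else `P'` -/
  | ite (e : CExpr) (P P' : Prog)
  /-- runs `P` once for each of the values `0, 1, …, N - 1` of the classical cell `(x, 0, 0)`, where
  `N` is the value of `e` at the beginning -/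
  | loop (x : ℕ) (e : CExpr) (P : Prog)
  /-- reversible arithmetic: adds `v` to the quantum cell `(x, i, j)`, in superposition; while `v`
  is evaluated that cell counts as `0` -/
  | qadd (x : ℕ) (i j : CExpr) (v : QExpr)
  /-- rotation of the quantum cell `(x, i, j)`, used as a qubit with values `0` and `1`, by the angle
  with squared cosine `u / v`, in superposition; while `u` and `v` are evaluated that cell
  counts as `0` -/
  | rot (x : ℕ) (i j : CExpr) (u v : QExpr)
  /-- measures the quantum cell `(x, i, j)` and writes the outcome to the classical cell of
  the same name -/
  | measure (x : ℕ) (i j : CExpr)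

/-- A branch of a run: the contents of the classical memory, the state vector of the quantum memory
(not renormalized after measurements: its squared norm is the probability of the branch), and the
time used. -/
structure Config where
  mem : Mem
  ket : Mem →₀ ℂ
  time : ℕ

/-- The result of the rotation with squared cosine `p` (cut off to `[0, 1]`) on a basis state: the
matrix on `|0⟩, |1⟩` is `!![√p, -√(1 - p); √(1 - p), √p]`, and other values of the cell are fixed. -/
noncomputable def rotKet (a : Loc) (p : ℝ) (Q : Mem) : Mem →₀ ℂ :=
  let c : ℂ := (Real.sqrt (max 0 (min 1 p)) : ℝ)
  let d : ℂ := (Real.sqrt (1 - max 0 (min 1 p)) : ℝ)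
  if Q a = 0 then Finsupp.single Q c + Finsupp.single (Function.update Q a 1) d
  else if Q a = 1 then Finsupp.single (Function.update Q a 0) (-d) + Finsupp.single Q c
  else Finsupp.single Q 1

open Classical in
/-- All branches of a run of a program with the real input `r`. The cost of an operation in
superposition is its largest cost on a basis state that has a non-zero amplitude. -/
noncomputable def run (r : ℝ) : Prog → Config → Multiset Config
  | .skip, c => {{ c with time := c.time + 1 }}
  | .seq P P', c => (run r P c).bind (run r P')
  | .assign x i j v, c =>
      {{ c with
          mem := Function.update c.mem (x, i.eval r c.mem, j.eval r c.mem) (v.eval r c.mem)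
          time := c.time + i.cost r c.mem + j.cost r c.mem + v.cost r c.mem }}
  | .ite e P P', c =>
      if e.eval r c.mem ≠ 0 then run r P { c with time := c.time + e.cost r c.mem }
      else run r P' { c with time := c.time + e.cost r c.mem }
  | .loop x e P, c =>
      Nat.rec (motive := fun _ => Multiset Config)
        {{ c with time := c.time + e.cost r c.mem }}
        (fun k branches => branches.bind fun c' =>
          run r P { c' with
            mem := Function.update c'.mem (x, 0, 0) (k : ℤ)
            time := c'.time + bits (k : ℤ) })
        (e.eval r c.mem).toNat
  | .qadd x i j v, c =>
      let a : Loc := (x, i.eval r c.mem, j.eval r c.mem)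
      let w : Mem → ℤ := fun Q => v.eval r (joint c.mem (Function.update Q a 0))
      {{ c with
          ket := c.ket.mapDomain fun Q => Function.update Q a (Q a + w Q)
          time := c.time + i.cost r c.mem + j.cost r c.mem +
            c.ket.support.sup fun Q =>
              v.cost r (joint c.mem (Function.update Q a 0)) + bits (Q a + w Q) }}
  | .rot x i j u v, c =>
      let a : Loc := (x, i.eval r c.mem, j.eval r c.mem)
      let m : Mem → (ℕ ⊕ ℕ) × ℤ × ℤ → ℤ := fun Q => joint c.mem (Function.update Q a 0)
      {{ c with
          ket := c.ket.sum fun Q z => z • rotKet a ((u.eval r (m Q) : ℝ) / (v.eval r (m Q) : ℝ)) Q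
          time := c.time + i.cost r c.mem + j.cost r c.mem +
            c.ket.support.sup fun Q => u.cost r (m Q) + v.cost r (m Q) }}
  | .measure x i j, c =>
      let a : Loc := (x, i.eval r c.mem, j.eval r c.mem)
      (c.ket.support.image fun Q => Q a).val.map fun z =>
        { mem := Function.update c.mem a z
          ket := c.ket.filter fun Q => Q a = z
          time := c.time + i.cost r c.mem + j.cost r c.mem + bits z }

/-! ## Reductions from LWE to G-EDCP -/

/-- The initial contents of the classical memory: the integer parameters and the LWE samples. The
only other input is the real parameter `r`, through its binary digits. -/
def inputMem (κ : ℕ) {m n q : ℕ} (ℓ : ℕ) (A : Matrix (Fin m) (Fin n) (ZMod q))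
    (b : Fin m → ZMod q) : Mem := fun a =>
  if a = (0, 0, 0) then κ
  else if a = (1, 0, 0) then n
  else if a = (2, 0, 0) then q
  else if a = (3, 0, 0) then m
  else if a = (4, 0, 0) then ℓ
  else if h : a.1 = 5 ∧ (0 ≤ a.2.1 ∧ a.2.1.toNat < m) ∧ (0 ≤ a.2.2 ∧ a.2.2.toNat < n) then
    ((A ⟨a.2.1.toNat, h.2.1.2⟩ ⟨a.2.2.toNat, h.2.2.2⟩).val : ℤ)
  else if h : a.1 = 6 ∧ (0 ≤ a.2.1 ∧ a.2.1.toNat < m) ∧ a.2.2 = 0 then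
    ((b ⟨a.2.1.toNat, h.2.1.2⟩).val : ℤ)
  else 0

/-- The initial configuration: the quantum memory is in the basis state with all cells `0`. -/
noncomputable def initial (κ : ℕ) {m n q : ℕ} (ℓ : ℕ) (A : Matrix (Fin m) (Fin n) (ZMod q))
    (b : Fin m → ZMod q) : Config where
  mem := inputMem κ ℓ A b
  ket := Finsupp.single 0 1
  time := 0

/-- The output registers of a basis state: `j_k` is in quantum cell `(0, k, 0)`, and the `i`-th
coordinate of `y_k` is represented by the remainder modulo `N` of quantum cell `(1, k, i)`. -/
def outLabel (n N ℓ : ℕ) (Q : Mem) : EdcpBasis n N ℓ :=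
  fun k => (Q (0, (k : ℕ), 0), fun i => (Q (1, (k : ℕ), (i : ℕ)) : ZMod N))

/-- What a basis state holds besides its output registers. Together with the label of the output
registers it determines the basis state. -/
def restLabel (n N ℓ : ℕ) (Q : Mem) : Mem := fun a =>
  if a.1 = 0 ∧ (0 ≤ a.2.1 ∧ a.2.1 < ℓ) ∧ a.2.2 = 0 then 0
  else if a.1 = 1 ∧ (0 ≤ a.2.1 ∧ a.2.1 < ℓ) ∧ (0 ≤ a.2.2 ∧ a.2.2 < n) then Q a / (N : ℤ)
  else Q a

open Classical in
/-- The joint probability of a branch and of the outcome `t` of the measurement `M` on the output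
registers: for every label of the rest of the quantum memory, the corresponding component of the
state vector is measured. -/
noncomputable def outcomeProb {n N ℓ : ℕ} [NeZero N] (M : Povm n N ℓ) (t : Fin n → ZMod N)
    (ket : Mem →₀ ℂ) : ℝ :=
  ∑ h ∈ ket.support.image (restLabel n N ℓ),
    M.weight t (∑ Q ∈ ket.support with restLabel n N ℓ Q = h,
      lp.single 2 (outLabel n N ℓ Q) (ket Q))

/-- The probability that the following procedure outputs `t` on the samples `(A, b)`: run the
program `P`, call `M` once on the output registers, return the answer. -/
noncomputable def reductionProb (P : Prog) (κ : ℕ) (r : ℝ) {m n q ℓ : ℕ} [NeZero q]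
    (M : Povm n q ℓ) (A : Matrix (Fin m) (Fin n) (ZMod q)) (b : Fin m → ZMod q)
    (t : Fin n → ZMod q) : ℝ :=
  ((run r P (initial κ ℓ A b)).map fun c => outcomeProb M t c.ket).sum

/-- The size `n log₂ q` of a secret. -/
noncomputable def secretSize (n q : ℕ) : ℝ := n * Real.logb 2 q

/-- The family `M` of measurements solves search `G-EDCP_{n,q,r}^ℓ`: for every secret and all
shifts it outputs the secret with probability at least an inverse polynomial in `n log q`. -/
def SolvesGEdcp (n q ℓ : ℕ → ℕ) [∀ κ, NeZero (q κ)] {r : ℕ → ℝ} (hr : ∀ κ, 0 < r κ)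
    (M : ∀ κ, Povm (n κ) (q κ) (ℓ κ)) : Prop :=
  ∃ c : ℕ, ∀ᶠ κ in Filter.atTop, ∀ (s : Fin (n κ) → ZMod (q κ))
    (x : Fin (ℓ κ) → Fin (n κ) → ZMod (q κ)),
    1 / secretSize (n κ) (q κ) ^ c ≤ (M κ).weight s (gEdcpState (hr κ) s x)

/-- A family of procedures, given by their success probabilities, solves search `LWE_{n,q,α}^m`: it
outputs the secret with probability at least an inverse polynomial in `n log q`. -/
def SolvesLwe (m n q : ℕ → ℕ) [∀ κ, NeZero (q κ)] (α : ℕ → ℝ)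
    (succ : ∀ κ, Matrix (Fin (m κ)) (Fin (n κ)) (ZMod (q κ)) → (Fin (m κ) → ZMod (q κ)) →
      (Fin (n κ) → ZMod (q κ)) → ℝ) : Prop :=
  ∃ c : ℕ, ∀ᶠ κ in Filter.atTop,
    1 / secretSize (n κ) (q κ) ^ c ≤ lweSuccess (m κ) (n κ) (q κ) (α κ) (succ κ)

end QRed

/-! For every copy the program prepares uniform superpositions of `y` in `ℤ_q^n` and of a mask `w`
in `ℤ_q^m`, and a truncated Gaussian superposition of `j` with `|j| ≤ R`, where `R` is about `√κ *
r`. Since `b = A s + e`, one has `A y - j b = A (y - j s) - j e`. The residues are divided into 8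
intervals of length `q / 8`, and for each coordinate the number of the interval containing `A y - j
b + w` is written into the memory. Nothing is measured: masks and interval numbers stay outside the
output registers, so the final state splits into components, one for each content of the rest of the
memory, and their outcome probabilities add up (`sum_weight_le_outcomeProb`).

Consider the content given by a mask `w` and the intervals of `A x + w`. Suppose that no shift by `j
e` moves a coordinate of `A x + w` into another interval, and that `A z` has all entries shorter
than `q / 8` only for `z = 0` (`NoShort`). Then the pairs `(j, y)` compatible with this content are
exactly those with `y = x + j s` (`cells_iff`), and the component is a multiple of a product of
coset states with secret `s` (`component_restOf`). Different `x` lead to different contents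
(`restOf_injOn`), so the weights of all good components may be summed
(`sum_goodRows_le_outcomeProb`).

How often are the two assumptions met? The mask makes each coordinate of `A x + w` uniform, so a
shift by at most `R |e_i|` changes its interval with probability at most `16 R |e_i| / q`
(`card_unstable_le`). With high probability all `|e_i|` are at most `α q √κ`; the bound on `r` then
makes a union bound over the coordinates give at most `1 / (2 ℓ)` for each copy (`error_box_le`,
`card_goodPairs_ge`). Intervals as long as `q / 8` are affordable because `2 ^ m ≥ q ^ n`: for `x ≠
0` a random row has inner product with `x` uniform in a subgroup of `ℤ_q`, and a union bound
organized by the order of this subgroup shows that a random matrix is `NoShort` with probability at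
least 1/4 (`quarter_le_card_noShort`). For `q = 2` this is replaced by counting invertible matrices
(`quarter_le_card_noShort_two`).

The Gaussian is prepared by rejection: `j` is uniform in `[-R, R]`, and for each bit of `j²` that is
1 a flag is rotated, so that all flags are 0 with probability about `exp (-2 π j² / r²)`. The first
success among `80 κ ℓ` trials is moved to the output register. The rotation angles come from fixed
point arithmetic: `π` from arctangents, exponentials by repeated squaring. Truncation and rounding
change the coset states by an amount exponentially small in `κ` (`truncAmp_close`), which an
arbitrary measurement tolerates (`Povm.weight_ge_of_norm_sub`).

Semantics and running time are handled together by the program logic `WP`. As there are no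
measurements, a run has one branch; as all numbers have polynomially many bits and the program text
is fixed, the time is polynomial (`Prog.tm_le`, `exists_time_bound`). The result `run_reduction`
gives the final state in closed form. -/

namespace QRed

/-! ## Costs of expressions over a bounded memory -/

/-- All cells hold integers of absolute value below `2 ^ S`. -/
def Bdd (S : ℕ) {L : Type} (μ : L × ℤ × ℤ → ℤ) : Prop := ∀ a, (μ a).natAbs < 2 ^ S

/-- Over a memory bounded by `2 ^ S`, the value of `e` is below `2 ^ (e.wt * S)`. -/
def Expr.wt {L : Type} : Expr L → ℕ
  | const c => bits c
  | read _ i j => i.wt + j.wt + 1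
  | digits p => p.wt + 1
  | add e f => e.wt + f.wt + 1
  | sub e f => e.wt + f.wt + 1
  | mul e f => e.wt + f.wt + 1
  | div e f => e.wt + f.wt + 1
  | mod e f => e.wt + f.wt + 1
  | lt e f => e.wt + f.wt + 1

/-- Over a memory bounded by `2 ^ S`, evaluating `e` costs at most `e.wc * S`. -/
def Expr.wc {L : Type} : Expr L → ℕ
  | const c => bits c
  | read x i j => i.wc + j.wc + ((read x i j).wt + 1)
  | digits p => p.wc + 1 + ((digits p).wt + 1)
  | add e f => e.wc + f.wc + ((add e f).wt + 1)
  | sub e f => e.wc + f.wc + ((sub e f).wt + 1)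
  | mul e f => e.wc + f.wc + ((mul e f).wt + 1)
  | div e f => e.wc + f.wc + ((div e f).wt + 1)
  | mod e f => e.wc + f.wc + ((mod e f).wt + 1)
  | lt e f => e.wc + f.wc + ((lt e f).wt + 1)

/-- Only few digits of the real input are requested, and they form an integer below `2 ^ S`. -/
def Expr.DigitsOk {L : Type} (S : ℕ) (r : ℝ) (μ : L × ℤ × ℤ → ℤ) : Expr L → Prop
  | const _ => True
  | read _ i j => i.DigitsOk S r μ ∧ j.DigitsOk S r μ
  | digits p => p.DigitsOk S r μ ∧ (p.eval r μ).natAbs ≤ S ∧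
      ((digits p).eval r μ).natAbs < 2 ^ S
  | add e f => e.DigitsOk S r μ ∧ f.DigitsOk S r μ
  | sub e f => e.DigitsOk S r μ ∧ f.DigitsOk S r μ
  | mul e f => e.DigitsOk S r μ ∧ f.DigitsOk S r μ
  | div e f => e.DigitsOk S r μ ∧ f.DigitsOk S r μ
  | mod e f => e.DigitsOk S r μ ∧ f.DigitsOk S r μ
  | lt e f => e.DigitsOk S r μ ∧ f.DigitsOk S r μ

theorem bits_le_of_lt {z : ℤ} {k : ℕ} (h : z.natAbs < 2 ^ k) : bits z ≤ k + 1 := by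
  unfold bits
  have := Nat.size_le.2 h
  omega

theorem one_le_bits (z : ℤ) : 1 ≤ bits z := by unfold bits; omega

theorem Expr.one_le_wt {L : Type} (e : Expr L) : 1 ≤ e.wt := by
  cases e <;> simp only [Expr.wt] <;> first | exact one_le_bits _ | omega

/-- Multiplication adds bit lengths and addition needs one bit more than the larger operand; since
`S ≥ 1`, the summand 1 in `wt` pays for that bit. -/
theorem Expr.natAbs_eval_lt {L : Type} {S : ℕ} (hS : 1 ≤ S) {r : ℝ} {μ : L × ℤ × ℤ → ℤ}
    (hμ : Bdd S μ) (e : Expr L) (he : e.DigitsOk S r μ) :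
    (e.eval r μ).natAbs < 2 ^ (e.wt * S) := by
  have mono : ∀ {a b : ℕ}, a ≤ b → 2 ^ a ≤ 2 ^ b := fun h => Nat.pow_le_pow_right (by norm_num) h
  induction e with
  | const c =>
    refine lt_of_lt_of_le (Nat.lt_size_self _) (mono ?_)
    simp only [Expr.eval, Expr.wt, bits]; nlinarith
  | read x i j => exact lt_of_lt_of_le (hμ _) (mono (by simp only [Expr.wt]; nlinarith))
  | digits p => exact lt_of_lt_of_le he.2.2 (mono (by simp only [Expr.wt]; nlinarith))
  | add e f ihe ihf =>
    have h1 := ihe he.1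
    have h2 := ihf he.2
    have h3 : (2 : ℕ) ^ (e.wt * S) ≤ 2 ^ ((e.wt + f.wt) * S) := mono (by nlinarith)
    have h4 : (2 : ℕ) ^ (f.wt * S) ≤ 2 ^ ((e.wt + f.wt) * S) := mono (by nlinarith)
    have h5 : (2 : ℕ) ^ ((e.wt + f.wt) * S + 1) ≤ 2 ^ ((e.wt + f.wt + 1) * S) :=
      mono (by nlinarith)
    rw [pow_succ] at h5
    simp only [Expr.eval, Expr.wt]
    omega
  | sub e f ihe ihf =>
    have h1 := ihe he.1
    have h2 := ihf he.2
    have h3 : (2 : ℕ) ^ (e.wt * S) ≤ 2 ^ ((e.wt + f.wt) * S) := mono (by nlinarith)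
    have h4 : (2 : ℕ) ^ (f.wt * S) ≤ 2 ^ ((e.wt + f.wt) * S) := mono (by nlinarith)
    have h5 : (2 : ℕ) ^ ((e.wt + f.wt) * S + 1) ≤ 2 ^ ((e.wt + f.wt + 1) * S) :=
      mono (by nlinarith)
    rw [pow_succ] at h5
    simp only [Expr.eval, Expr.wt]
    omega
  | mul e f ihe ihf =>
    have h1 := ihe he.1
    have h2 := ihf he.2
    simp only [Expr.eval, Expr.wt, Int.natAbs_mul]
    calc _ < 2 ^ (e.wt * S) * 2 ^ (f.wt * S) := Nat.mul_lt_mul'' h1 h2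
      _ = 2 ^ (e.wt * S + f.wt * S) := (pow_add _ _ _).symm
      _ ≤ _ := mono (by nlinarith)
  | div e f ihe ihf =>
    have h1 := ihe he.1
    simp only [Expr.eval, Expr.wt]
    exact lt_of_le_of_lt (Int.natAbs_ediv_le_natAbs _ _)
      (lt_of_lt_of_le h1 (mono (by nlinarith)))
  | mod e f ihe ihf =>
    have h1 := ihe he.1
    have h2 := ihf he.2
    simp only [Expr.eval, Expr.wt]
    by_cases h0 : f.eval r μ = 0
    · rw [h0, Int.emod_zero]
      exact lt_of_lt_of_le h1 (mono (by nlinarith))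
    · have h3 := Int.emod_nonneg (e.eval r μ) h0
      have h4 := Int.emod_lt (e.eval r μ) h0
      exact lt_of_lt_of_le (lt_trans (by omega) h2) (mono (by nlinarith))
  | lt e f ihe ihf =>
    have h5 : (2 : ℕ) ^ 1 ≤ 2 ^ ((e.wt + f.wt + 1) * S) := mono (by nlinarith)
    simp only [Expr.eval, Expr.wt]
    split_ifs
    · exact lt_of_lt_of_le (by norm_num) h5
    · simp

theorem Expr.bits_eval_le {L : Type} {S : ℕ} (hS : 1 ≤ S) {r : ℝ} {μ : L × ℤ × ℤ → ℤ}
    (hμ : Bdd S μ) (e : Expr L) (he : e.DigitsOk S r μ) :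
    bits (e.eval r μ) ≤ (e.wt + 1) * S := by
  have := bits_le_of_lt (e.natAbs_eval_lt hS hμ he)
  nlinarith

theorem Expr.cost_le {L : Type} {S : ℕ} (hS : 1 ≤ S) {r : ℝ} {μ : L × ℤ × ℤ → ℤ}
    (hμ : Bdd S μ) (e : Expr L) (he : e.DigitsOk S r μ) :
    e.cost r μ ≤ e.wc * S := by
  have key := fun (e : Expr L) he => e.bits_eval_le hS (r := r) hμ he
  induction e with
  | const c => simp only [Expr.cost, Expr.wc]; nlinarith
  | read x i j ihi ihj =>
    have := ihi he.1; have := ihj he.2; have := key (read x i j) he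
    simp only [Expr.cost, Expr.wc]; nlinarith
  | digits p ih =>
    have := ih he.1; have := he.2.1; have := key (digits p) he
    simp only [Expr.cost, Expr.wc]; nlinarith
  | add e f ihi ihj =>
    have := ihi he.1; have := ihj he.2; have := key (add e f) he
    simp only [Expr.cost, Expr.wc]; nlinarith
  | sub e f ihi ihj =>
    have := ihi he.1; have := ihj he.2; have := key (sub e f) he
    simp only [Expr.cost, Expr.wc]; nlinarith
  | mul e f ihi ihj =>
    have := ihi he.1; have := ihj he.2; have := key (mul e f) he
    simp only [Expr.cost, Expr.wc]; nlinarith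
  | div e f ihi ihj =>
    have := ihi he.1; have := ihj he.2; have := key (div e f) he
    simp only [Expr.cost, Expr.wc]; nlinarith
  | mod e f ihi ihj =>
    have := ihi he.1; have := ihj he.2; have := key (mod e f) he
    simp only [Expr.cost, Expr.wc]; nlinarith
  | lt e f ihi ihj =>
    have := ihi he.1; have := ihj he.2; have := key (lt e f) he
    simp only [Expr.cost, Expr.wc]; nlinarith

/-! ## A program logic for programs without measurements -/

/-- A bound for the running time when all cells stay below `2 ^ S` and no loop has more than `S`
iterations. -/
def Prog.tm (S : ℕ) : Prog → ℕ
  | skip => 1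
  | seq P P' => P.tm S + P'.tm S
  | assign _ i j v => (i.wc + j.wc + v.wc) * S
  | ite e P P' => e.wc * S + P.tm S + P'.tm S
  | loop _ e P => e.wc * S + S * (P.tm S + S)
  | qadd _ i j v => (i.wc + j.wc + v.wc + (v.wt + 2)) * S
  | rot _ i j u v => (i.wc + j.wc + u.wc + v.wc) * S
  | measure _ _ _ => 0

/-- The program text is fixed while `S` grows: composition takes the maximum of the degrees, and
each loop, having at most `S` passes, raises the degree by a constant. This is the source of the
polynomial running time. -/
theorem Prog.tm_le (P : Prog) : ∃ C e : ℕ, ∀ S : ℕ, 1 ≤ S → P.tm S ≤ C * S ^ e := by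
  have up : ∀ {C e e' S x : ℕ}, 1 ≤ S → x ≤ C * S ^ e → e ≤ e' → x ≤ C * S ^ e' :=
    fun hS h he => h.trans (Nat.mul_le_mul_left _ (Nat.pow_le_pow_right hS he))
  induction P with
  | skip => exact ⟨1, 0, fun S _ => by simp [Prog.tm]⟩
  | seq P P' ih ih' =>
    obtain ⟨C, e, h⟩ := ih
    obtain ⟨C', e', h'⟩ := ih'
    refine ⟨C + C', max e e', fun S hS => ?_⟩
    have h1 := up hS (h S hS) (le_max_left e e')
    have h2 := up hS (h' S hS) (le_max_right e e')
    simp only [Prog.tm, add_mul]; omega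
  | assign x i j v => exact ⟨_, 1, fun S _ => by simp only [Prog.tm, pow_one]; exact le_rfl⟩
  | ite g P P' ih ih' =>
    obtain ⟨C, e, h⟩ := ih
    obtain ⟨C', e', h'⟩ := ih'
    refine ⟨g.wc + C + C', max e e' + 1, fun S hS => ?_⟩
    have h1 := up hS (h S hS) (show e ≤ max e e' + 1 by omega)
    have h2 := up hS (h' S hS) (show e' ≤ max e e' + 1 by omega)
    have h3 : g.wc * S ≤ g.wc * S ^ (max e e' + 1) :=
      Nat.mul_le_mul_left _ (Nat.le_self_pow (by omega) S)
    simp only [Prog.tm, add_mul]; omega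
  | loop x g P ih =>
    obtain ⟨C, e, h⟩ := ih
    refine ⟨g.wc + C + 1, e + 2, fun S hS => ?_⟩
    have h1 : S * P.tm S ≤ C * S ^ (e + 2) := by
      have := up hS (h S hS) (show e ≤ e + 1 by omega)
      calc S * P.tm S ≤ S * (C * S ^ (e + 1)) := Nat.mul_le_mul_left _ this
        _ = C * S ^ (e + 2) := by ring
    have h3 : g.wc * S ≤ g.wc * S ^ (e + 2) :=
      Nat.mul_le_mul_left _ (Nat.le_self_pow (by omega) S)
    have h4 : S * S ≤ S ^ (e + 2) := by
      calc S * S = S ^ 2 := by ring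
        _ ≤ _ := Nat.pow_le_pow_right hS (by omega)
    simp only [Prog.tm, add_mul, mul_add]; omega
  | qadd x i j v => exact ⟨_, 1, fun S _ => by simp only [Prog.tm, pow_one]; exact le_rfl⟩
  | rot x i j u v => exact ⟨_, 1, fun S _ => by simp only [Prog.tm, pow_one]; exact le_rfl⟩
  | measure x i j => exact ⟨0, 0, fun S _ => by simp [Prog.tm]⟩

/-- Started with classical memory `μ` and state vector `f`, the program has a single branch, it
ends with a classical memory and a state vector that satisfy `post`, and it takes time at most
`P.tm S`. -/
def WP (r : ℝ) (S : ℕ) (P : Prog) (post : Mem → (Mem → ℂ) → Prop) (μ : Mem) (f : Mem → ℂ) :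
    Prop :=
  ∀ (ket : Mem →₀ ℂ) (τ : ℕ), ⇑ket = f → ∃ (μ' : Mem) (ket' : Mem →₀ ℂ) (τ' : ℕ),
    run r P ⟨μ, ket, τ⟩ = {⟨μ', ket', τ'⟩} ∧ post μ' ket' ∧ τ' ≤ τ + P.tm S

/-- All basis states of non-zero amplitude are bounded. -/
def QBdd (S : ℕ) (f : Mem → ℂ) : Prop := ∀ Q, f Q ≠ 0 → Bdd S Q

section WP

variable {r : ℝ} {S : ℕ} {post : Mem → (Mem → ℂ) → Prop} {μ : Mem} {f : Mem → ℂ}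

theorem WP.skip (h : post μ f) : WP r S .skip post μ f := by
  intro ket τ hk
  exact ⟨μ, ket, τ + 1, rfl, hk ▸ h, le_rfl⟩

theorem WP.seq {P P' : Prog} (h : WP r S P (fun μ f => WP r S P' post μ f) μ f) :
    WP r S (.seq P P') post μ f := by
  intro ket τ hk
  obtain ⟨μ', ket', τ', h1, h2, h3⟩ := h ket τ hk
  obtain ⟨μ'', ket'', τ'', h4, h5, h6⟩ := h2 ket' τ' rfl
  refine ⟨μ'', ket'', τ'', ?_, h5, ?_⟩
  · simp only [run, h1, Multiset.singleton_bind, h4]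
  · simp only [Prog.tm]; omega

theorem WP.assign {x : ℕ} {i j v : CExpr} (hS : 1 ≤ S) (hμ : Bdd S μ) (hi : i.DigitsOk S r μ)
    (hj : j.DigitsOk S r μ) (hv : v.DigitsOk S r μ)
    (h : post (Function.update μ (x, i.eval r μ, j.eval r μ) (v.eval r μ)) f) :
    WP r S (.assign x i j v) post μ f := by
  intro ket τ hk
  refine ⟨_, ket, _, rfl, hk ▸ h, ?_⟩
  have h1 := i.cost_le hS hμ hi
  have h2 := j.cost_le hS hμ hj
  have h3 := v.cost_le hS hμ hv
  simp only [Prog.tm, add_mul]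
  omega

theorem WP.ite {e : CExpr} {P P' : Prog} (hS : 1 ≤ S) (hμ : Bdd S μ) (he : e.DigitsOk S r μ)
    (h : e.eval r μ ≠ 0 → WP r S P post μ f) (h' : e.eval r μ = 0 → WP r S P' post μ f) :
    WP r S (.ite e P P') post μ f := by
  intro ket τ hk
  have h1 := e.cost_le hS hμ he
  by_cases h0 : e.eval r μ = 0
  · obtain ⟨μ', ket', τ', h3, h4, h5⟩ := h' h0 ket (τ + e.cost r μ) hk
    refine ⟨μ', ket', τ', by simp only [run, h0, ne_eq, not_true, if_false, h3], h4, ?_⟩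
    simp only [Prog.tm]; omega
  · obtain ⟨μ', ket', τ', h3, h4, h5⟩ := h h0 ket (τ + e.cost r μ) hk
    refine ⟨μ', ket', τ', by simp only [run, ne_eq, h0, not_false_iff, if_true, h3], h4, ?_⟩
    simp only [Prog.tm]; omega

theorem WP.loop {x : ℕ} {e : CExpr} {P : Prog} (I : ℕ → Mem → (Mem → ℂ) → Prop) (N : ℕ)
    (hS : 1 ≤ S) (hμ : Bdd S μ) (he : e.DigitsOk S r μ) (hN : e.eval r μ = N) (hNS : N ≤ S)
    (h0 : I 0 μ f)
    (hstep : ∀ k < N, ∀ μ' f', I k μ' f' →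
      WP r S P (I (k + 1)) (Function.update μ' (x, 0, 0) (k : ℤ)) f')
    (hend : ∀ μ' f', I N μ' f' → post μ' f') :
    WP r S (.loop x e P) post μ f := by
  intro ket τ hk
  have h1 := e.cost_le hS hμ he
  have key : ∀ k ≤ N, ∃ (μ' : Mem) (ket' : Mem →₀ ℂ) (τ' : ℕ),
      Nat.rec (motive := fun _ => Multiset Config)
        {{ (⟨μ, ket, τ⟩ : Config) with time := τ + e.cost r μ }}
        (fun k branches => branches.bind fun c' =>
          run r P { c' with
            mem := Function.update c'.mem (x, 0, 0) (k : ℤ)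
            time := c'.time + bits (k : ℤ) }) k = {⟨μ', ket', τ'⟩} ∧ I k μ' ket' ∧
        τ' ≤ τ + e.wc * S + k * (P.tm S + S) := by
    intro k
    induction k with
    | zero => exact fun _ => ⟨μ, ket, _, rfl, hk ▸ h0, by omega⟩
    | succ k ih =>
      intro hkN
      obtain ⟨μ', ket', τ', h3, h4, h5⟩ := ih (by omega)
      obtain ⟨μ'', ket'', τ'', h6, h7, h8⟩ :=
        hstep k (by omega) μ' ket' h4 ket' (τ' + bits (k : ℤ)) rfl
      refine ⟨μ'', ket'', τ'', ?_, h7, ?_⟩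
      · simp only [h3, Multiset.singleton_bind, h6]
      -- A crude bound for writing the counter: `k + 1 ≤ N ≤ S`, which is the summand `S` charged
      -- per pass in `Prog.tm`.
      · have : bits (k : ℤ) ≤ k + 1 := bits_le_of_lt (by simpa using Nat.lt_two_pow_self)
        rw [add_mul]; omega
  obtain ⟨μ', ket', τ', h3, h4, h5⟩ := key N le_rfl
  refine ⟨μ', ket', τ', ?_, hend _ _ h4, ?_⟩
  · simp only [run, hN, Int.toNat_natCast]
    exact h3
  · have : N * (P.tm S + S) ≤ S * (P.tm S + S) := Nat.mul_le_mul_right _ hNS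
    simp only [Prog.tm]; omega

theorem joint_bdd {Q : Mem} (hμ : Bdd S μ) (hQ : Bdd S Q) : Bdd S (joint μ Q) := by
  rintro ⟨x | x, p⟩
  · exact hμ _
  · exact hQ _

theorem Bdd.update {Q : Mem} (hQ : Bdd S Q) (a : Loc) {z : ℤ} (hz : z.natAbs < 2 ^ S) :
    Bdd S (Function.update Q a z) := by
  intro b
  by_cases h : b = a
  · subst h; simpa using hz
  · simpa [Function.update_of_ne h] using hQ b

theorem Bdd.zero (Q : Mem) (hQ : Bdd S Q) (a : Loc) : Bdd S (Function.update Q a 0) :=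
  hQ.update a (by simp)

/-- The state vector after adding `w` (which must not depend on the cell `a`) to the cell `a`. -/
def addTo (a : Loc) (w : Mem → ℤ) (f : Mem → ℂ) : Mem → ℂ :=
  fun Q => f (Function.update Q a (Q a - w (Function.update Q a 0)))

/-- Because `v` is evaluated with the target cell set to 0, the added amount can be recomputed from
the result. The map on basis states is therefore injective, and pushing the state vector forward
along it is the same as composing with its inverse, which is `addTo`. -/
theorem WP.qadd {x : ℕ} {i j : CExpr} {v : QExpr} (a : Loc) (w : Mem → ℤ) (hS : 1 ≤ S)
    (hμ : Bdd S μ) (hi : i.DigitsOk S r μ)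
    (hj : j.DigitsOk S r μ) (hf : QBdd S f) (ha : (x, i.eval r μ, j.eval r μ) = a)
    (hv : ∀ Q, v.DigitsOk S r (joint μ Q)) (hw : ∀ Q, v.eval r (joint μ Q) = w Q)
    (h : post μ (addTo a w f)) :
    WP r S (.qadd x i j v) post μ f := by
  intro ket τ hk
  subst ha
  set a : Loc := (x, i.eval r μ, j.eval r μ)
  refine ⟨_, _, _, rfl, ?_, ?_⟩
  · convert h using 1
    funext Q
    set g : Mem → Mem := fun Q => Function.update Q a
      (Q a + v.eval r (joint μ (Function.update Q a 0)))
    set Q' := Function.update Q a (Q a - w (Function.update Q a 0))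
    have hg : g Q' = Q := by
      simp only [g, Q', hw, Function.update_idem, Function.update_self, sub_add_cancel,
        Function.update_eq_self]
    have inj : Function.Injective g := by
      intro Q1 Q2 h12
      have h1 : Function.update Q1 a 0 = Function.update Q2 a 0 := by
        have := congrArg (fun Q => Function.update Q a 0) h12
        simpa [g] using this
      have h2 := congrFun h12 a
      simp only [g, Function.update_self, h1, add_left_inj] at h2
      funext b
      by_cases hb : b = a
      · rw [hb, h2]
      · simpa [Function.update_of_ne hb] using congrFun h1 b
    conv_lhs => rw [← hg]
    change Finsupp.mapDomain g ket (g Q') = _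
    rw [Finsupp.mapDomain_apply inj, hk]
    rfl
  · have h1 := i.cost_le hS hμ hi
    have h2 := j.cost_le hS hμ hj
    have h3 : (ket.support.sup fun Q => v.cost r (joint μ (Function.update Q a 0)) +
        bits (Q a + v.eval r (joint μ (Function.update Q a 0)))) ≤ (v.wc + (v.wt + 2)) * S := by
      refine Finset.sup_le fun Q hQ => ?_
      have hQ' : Bdd S Q := hf Q (by rw [← hk]; simpa using hQ)
      have h4 := v.cost_le hS (joint_bdd hμ (hQ'.zero _ a)) (hv _)
      have h5 := v.natAbs_eval_lt hS (joint_bdd hμ (hQ'.zero _ a)) (hv _)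
      have h6 := hQ' a
      have h7 : (Q a + v.eval r (joint μ (Function.update Q a 0))).natAbs <
          2 ^ ((v.wt + 1) * S) := by
        have h8 : (2 : ℕ) ^ S ≤ 2 ^ (v.wt * S) :=
          Nat.pow_le_pow_right (by norm_num) (by nlinarith [v.one_le_wt])
        have h9 : (2 : ℕ) ^ (v.wt * S + 1) ≤ 2 ^ ((v.wt + 1) * S) :=
          Nat.pow_le_pow_right (by norm_num) (by nlinarith)
        rw [pow_succ] at h9
        omega
      have h10 := bits_le_of_lt h7
      nlinarith
    simp only [Prog.tm, add_mul] at h3 ⊢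
    simp only [a] at h3
    omega

/-- The state vector after the rotation of the cell `a`, which must hold `0`, with squared cosine
`p`. -/
noncomputable def rotAt (a : Loc) (p : Mem → ℝ) (f : Mem → ℂ) : Mem → ℂ := fun Q =>
  if Q a = 0 then ((Real.sqrt (max 0 (min 1 (p Q))) : ℝ) : ℂ) * f Q
  else if Q a = 1 then
    ((Real.sqrt (1 - max 0 (min 1 (p (Function.update Q a 0)))) : ℝ) : ℂ) *
      f (Function.update Q a 0)
  else 0

/-- When the cell holds 0 throughout the support, only the first column of the rotation matrix
matters, and each basis state receives at most one contribution: from itself if the qubit is 0, from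
the state with the qubit reset if it is 1. -/
theorem WP.rot {x : ℕ} {i j : CExpr} {u v : QExpr} (a : Loc) (p : Mem → ℝ) (hS : 1 ≤ S)
    (hμ : Bdd S μ) (hi : i.DigitsOk S r μ)
    (hj : j.DigitsOk S r μ) (hf : QBdd S f) (ha : (x, i.eval r μ, j.eval r μ) = a)
    (hf0 : ∀ Q, f Q ≠ 0 → Q a = 0)
    (hu : ∀ Q, u.DigitsOk S r (joint μ Q)) (hv : ∀ Q, v.DigitsOk S r (joint μ Q))
    (hp : ∀ Q, (u.eval r (joint μ Q) : ℝ) / (v.eval r (joint μ Q) : ℝ) = p Q)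
    (h : post μ (rotAt a p f)) :
    WP r S (.rot x i j u v) post μ f := by
  classical
  intro ket τ hk
  subst ha
  set a : Loc := (x, i.eval r μ, j.eval r μ)
  refine ⟨_, _, _, rfl, ?_, ?_⟩
  · convert h using 1
    funext Q
    have key : ∀ Q0 ∈ ket.support,
        (ket Q0 • rotKet a ((u.eval r (joint μ (Function.update Q0 a 0)) : ℝ) /
          (v.eval r (joint μ (Function.update Q0 a 0)) : ℝ)) Q0) Q =
        (if Q0 = Q then ((Real.sqrt (max 0 (min 1 (p Q))) : ℝ) : ℂ) * f Q else 0) +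
        (if Q0 = Function.update Q a 0 ∧ Q a = 1 then
          ((Real.sqrt (1 - max 0 (min 1 (p (Function.update Q a 0)))) : ℝ) : ℂ) *
          f (Function.update Q a 0) else 0) := by
      intro Q0 hQ0
      have h0 : Q0 a = 0 := hf0 Q0 (by rw [← hk]; simpa using hQ0)
      have hup : Function.update Q0 a 0 = Q0 := by rw [← h0, Function.update_eq_self]
      rw [hup, hp, rotKet, if_pos h0]
      have e1 : Function.update Q0 a 1 = Q ↔ Q0 = Function.update Q a 0 ∧ Q a = 1 := by
        constructor
        · rintro rfl
          simp [hup]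
        · rintro ⟨h1, h2⟩
          rw [h1, Function.update_idem, ← h2, Function.update_eq_self]
      simp only [Finsupp.smul_apply, Finsupp.add_apply, Finsupp.single_apply, smul_eq_mul, e1,
        mul_add, ← hk]
      congr 1
      · split_ifs with h1
        · rw [h1]; ring
        · simp
      · split_ifs with h1
        · rw [← h1.1]; ring
        · simp
    change (ket.sum fun Q z => z • rotKet a _ Q) Q = _
    rw [Finsupp.sum, Finsupp.finsetSum_apply, Finset.sum_congr rfl key, Finset.sum_add_distrib]
    simp only [Finset.sum_ite_eq', ite_and]
    simp only [rotAt]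
    have z1 : Q ∉ ket.support → f Q = 0 := by rw [← hk]; simp
    have z2 : Function.update Q a 0 ∉ ket.support → f (Function.update Q a 0) = 0 := by
      rw [← hk]; simp
    have z3 : Q a ≠ 0 → f Q = 0 := fun h => by
      by_contra h'
      exact h (hf0 Q h')
    by_cases q0 : Q a = 0
    · simp only [q0, if_true]
      simp only [zero_ne_one, if_false, ite_self, add_zero]
      split_ifs with h1
      · rfl
      · rw [z1 h1, mul_zero]
    · rw [if_neg q0, z3 q0]
      simp only [mul_zero, ite_self, zero_add]
      by_cases q1 : Q a = 1
      · simp only [q1, if_true]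
        split_ifs with h1
        · rfl
        · rw [z2 h1, mul_zero]
      · simp only [q1, if_false, ite_self]
  · have h1 := i.cost_le hS hμ hi
    have h2 := j.cost_le hS hμ hj
    have h3 : (ket.support.sup fun Q => u.cost r (joint μ (Function.update Q a 0)) +
        v.cost r (joint μ (Function.update Q a 0))) ≤ (u.wc + v.wc) * S := by
      refine Finset.sup_le fun Q hQ => ?_
      have hQ' : Bdd S Q := hf Q (by rw [← hk]; simpa using hQ)
      have h4 := v.cost_le hS (joint_bdd hμ (hQ'.zero _ a)) (hv _)
      have h5 := u.cost_le hS (joint_bdd hμ (hQ'.zero _ a)) (hu _)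
      nlinarith
    simp only [Prog.tm, add_mul] at h3 ⊢
    simp only [a] at h3
    omega

end WP

end QRed


namespace QRed

/-! ## Preparing superpositions bit by bit -/

/-- `μ'` differs from `μ` only in arrays with names in `W`. -/
def Same (W : Finset ℕ) (μ μ' : Mem) : Prop := ∀ a : Loc, a.1 ∉ W → μ' a = μ a

theorem Same.refl (W : Finset ℕ) (μ : Mem) : Same W μ μ := fun _ _ => rfl

theorem Same.trans {W : Finset ℕ} {μ μ' μ'' : Mem} (h : Same W μ μ') (h' : Same W μ' μ'') :
    Same W μ μ'' := fun a ha => (h' a ha).trans (h a ha)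

theorem Same.mono {W W' : Finset ℕ} {μ μ' : Mem} (h : Same W μ μ') (hW : W ⊆ W') :
    Same W' μ μ' := fun a ha => h a fun h' => ha (hW h')

theorem Same.update {W : Finset ℕ} {μ μ' : Mem} (h : Same W μ μ') {a : Loc} (ha : a.1 ∈ W)
    (z : ℤ) : Same W μ (Function.update μ' a z) := by
  intro b hb
  rw [Function.update_of_ne (by rintro rfl; exact hb ha)]
  exact h b hb

/-- Cutting off to `[0, 1]`. -/
noncomputable def clamp (p : ℝ) : ℝ := max 0 (min 1 p)

theorem clamp_nonneg (p : ℝ) : 0 ≤ clamp p := le_max_left _ _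

theorem clamp_le_one (p : ℝ) : clamp p ≤ 1 := max_le zero_le_one (min_le_left _ _)

/-- The amplitude of the value `X` of a cell after its `d` uppermost bits among `K` bits have been
prepared, where `p i Y` is the probability that bit `i` is `0` if the upper bits form `Y`. -/
noncomputable def amplPre (p : ℕ → ℤ → ℝ) (K : ℕ) : ℕ → ℤ → ℝ
  | 0, X => if X = 0 then 1 else 0
  | d + 1, X =>
    if X / 2 ^ (K - 1 - d) % 2 = 0 then √(clamp (p (K - 1 - d) X)) * amplPre p K d X
    else √(1 - clamp (p (K - 1 - d) (X - 2 ^ (K - 1 - d)))) *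
      amplPre p K d (X - 2 ^ (K - 1 - d))

/-- The amplitude of the value `X` of a cell after all its `K` bits have been prepared. -/
noncomputable def ampl (p : ℕ → ℤ → ℝ) (K : ℕ) (X : ℤ) : ℝ := amplPre p K K X

theorem amplPre_support {p : ℕ → ℤ → ℝ} {K d : ℕ} (hd : d ≤ K) {X : ℤ}
    (h : amplPre p K d X ≠ 0) : (2 : ℤ) ^ (K - d) ∣ X ∧ 0 ≤ X ∧ X < 2 ^ K := by
  induction d generalizing X with
  | zero =>
    simp only [amplPre] at h
    have : X = 0 := by by_contra h'; simp [h'] at h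
    subst this
    exact ⟨dvd_zero _, le_rfl, by positivity⟩
  | succ d ih =>
    have e : K - d = (K - (d + 1)) + 1 := by omega
    have e' : K - 1 - d = K - (d + 1) := by omega
    rw [amplPre, e'] at h
    split_ifs at h with hb
    · obtain ⟨h1, h2, h3⟩ := ih (by omega) (right_ne_zero_of_mul h)
      exact ⟨(pow_dvd_pow _ (by omega)).trans h1, h2, h3⟩
    · obtain ⟨h1, h2, h3⟩ := ih (by omega) (right_ne_zero_of_mul h)
      have hp : (0 : ℤ) < 2 ^ (K - (d + 1)) := by positivity
      rw [e, pow_succ] at h1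
      obtain ⟨c, hc⟩ := h1
      refine ⟨⟨2 * c + 1, by linear_combination hc⟩, by omega, ?_⟩
      have hK : (2 : ℤ) ^ K = 2 ^ (K - (d + 1)) * (2 * 2 ^ d) := by
        rw [← pow_succ', ← pow_add]; congr 1; omega
      rw [hK] at h3 ⊢
      -- Dividing by the power of two gives `2 c < 2 * 2 ^ d`, and the odd number `2 c + 1` then
      -- fits as well.
      have h4 : (2 : ℤ) ^ (K - (d + 1)) * (2 * c) < 2 ^ (K - (d + 1)) * (2 * 2 ^ d) := by
        linarith
      have h5 : 2 * c < 2 * 2 ^ d := lt_of_mul_lt_mul_left h4 hp.le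
      have h6 : X = 2 ^ (K - (d + 1)) * (2 * c + 1) := by linear_combination hc
      rw [h6]
      exact mul_lt_mul_of_pos_left (by omega) hp

theorem ampl_support {p : ℕ → ℤ → ℝ} {K : ℕ} {X : ℤ} (h : ampl p K X ≠ 0) :
    0 ≤ X ∧ X < 2 ^ K := (amplPre_support le_rfl h).2

/-- Preparing a bit splits each squared amplitude in the proportions `clamp p` and `1 - clamp p`.
The two parts land on values whose bit `i` is 0 respectively 1, so they never interfere. -/
theorem hasSum_amplPre_sq (p : ℕ → ℤ → ℝ) {K d : ℕ} (hd : d ≤ K) :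
    HasSum (fun X => amplPre p K d X ^ 2) 1 := by
  induction d with
  | zero =>
    convert hasSum_ite_eq (0 : ℤ) (1 : ℝ) using 2 with X
    simp only [amplPre]
    split_ifs <;> simp
  | succ d ih =>
    have ih := ih (by omega)
    set i := K - 1 - d with hi
    have bit : ∀ X, amplPre p K d X ≠ 0 → (2 : ℤ) ^ (i + 1) ∣ X := fun X h => by
      have := (amplPre_support (by omega) h).1
      rwa [show K - d = i + 1 by omega] at this
    have hpi : (2 : ℤ) ^ i ≠ 0 := by positivity
    set g1 : ℤ → ℝ := fun X => clamp (p i X) * amplPre p K d X ^ 2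
    set g2 : ℤ → ℝ := fun X => (1 - clamp (p i X)) * amplPre p K d X ^ 2
    have s1 : Summable g1 := by
      refine Summable.of_nonneg_of_le (fun X => mul_nonneg (clamp_nonneg _) (sq_nonneg _))
        (fun X => ?_) ih.summable
      exact mul_le_of_le_one_left (sq_nonneg _) (clamp_le_one _)
    have s2 : Summable g2 := by
      refine Summable.of_nonneg_of_le
        (fun X => mul_nonneg (sub_nonneg.2 (clamp_le_one _)) (sq_nonneg _)) (fun X => ?_) ih.summable
      exact mul_le_of_le_one_left (sq_nonneg _) (by linarith [clamp_nonneg (p i X)])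
    have h2 : HasSum (fun X => g2 (X - 2 ^ i)) (∑' X, g2 X) := by
      have := (Equiv.subRight ((2 : ℤ) ^ i)).hasSum_iff.2 s2.hasSum
      exact this
    have h12 : (∑' X, g1 X) + ∑' X, g2 X = 1 := by
      rw [← s1.tsum_add s2, ← ih.tsum_eq]
      refine tsum_congr fun X => ?_
      simp only [g1, g2]; ring
    rw [← h12]
    refine (s1.hasSum.add h2).congr_fun fun X => ?_
    simp only [amplPre, g1, g2]
    rw [← hi]
    have z1 : X / 2 ^ i % 2 ≠ 0 → amplPre p K d X = 0 := by
      intro h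
      by_contra h'
      obtain ⟨c, hc⟩ := bit X h'
      apply h
      rw [hc, pow_succ, mul_assoc, Int.mul_ediv_cancel_left _ hpi]
      omega
    have z2 : X / 2 ^ i % 2 = 0 → amplPre p K d (X - 2 ^ i) = 0 := by
      intro h
      by_contra h'
      obtain ⟨c, hc⟩ := bit _ h'
      have : X = 2 ^ i * (2 * c + 1) := by rw [pow_succ] at hc; linear_combination hc
      rw [this, Int.mul_ediv_cancel_left _ hpi] at h
      omega
    split_ifs with h
    · rw [z2 h, mul_pow, Real.sq_sqrt (clamp_nonneg _)]; ring
    · rw [z1 h, mul_pow, Real.sq_sqrt (sub_nonneg.2 (clamp_le_one _))]; ring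

theorem hasSum_ampl_sq (p : ℕ → ℤ → ℝ) (K : ℕ) : HasSum (fun X => ampl p K X ^ 2) 1 :=
  hasSum_amplPre_sq p le_rfl

theorem ampl_zero (p : ℕ → ℤ → ℝ) (K : ℕ) :
    ampl p K 0 = ∏ i ∈ Finset.range K, √(clamp (p i 0)) := by
  have : ∀ d ≤ K, amplPre p K d 0 = ∏ i ∈ Finset.range d, √(clamp (p (K - 1 - i) 0)) := by
    intro d
    induction d with
    | zero => simp [amplPre]
    | succ d ih =>
      intro hd
      rw [Finset.prod_range_succ, ← ih (by omega), amplPre]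
      simp [mul_comm]
  rw [ampl, this K le_rfl]
  exact Finset.prod_range_reflect (fun i => √(clamp (p i 0))) K

/-- The bit probabilities for the uniform superposition of `0, …, N - 1`. -/
noncomputable def unifProb (N : ℤ) (i : ℕ) (Y : ℤ) : ℝ :=
  ((2 : ℤ) ^ i : ℤ) / ((if N - Y < 2 ^ i * 2 then N - Y else 2 ^ i * 2 : ℤ) : ℝ)

/-- The squared amplitude of a prefix `X` is the share of the numbers in `[0, N)` that begin with
it, of which there are `min (N - X) (2 ^ (K - d))`. `unifProb` divides the size of the lower
half-block by this count; when the upper half lies beyond `N` the quotient may exceed 1 and is cut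
off by `clamp`. -/
theorem amplPre_unif {N : ℤ} {K d : ℕ} (hN : 0 < N) (hK : N ≤ 2 ^ K) (hd : d ≤ K) (X : ℤ) :
    amplPre (unifProb N) K d X =
      if 0 ≤ X ∧ X < N ∧ 2 ^ (K - d) ∣ X then √((min (N - X) (2 ^ (K - d)) : ℤ) / N) else 0 := by
  have hN' : (0 : ℝ) < N := by exact_mod_cast hN
  induction d generalizing X with
  | zero =>
    simp only [amplPre]
    by_cases h : X = 0
    · subst h
      simp only [if_true, le_refl, hN, dvd_zero, and_self, sub_zero, Nat.sub_zero]
      rw [min_eq_left hK, div_self hN'.ne', Real.sqrt_one]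
    · rw [if_neg h, if_neg]
      rintro ⟨h1, h2, h3⟩
      have := Int.le_of_dvd (by omega) h3
      rw [Nat.sub_zero] at this
      omega
  | succ d ih =>
    have e' : K - 1 - d = K - (d + 1) := by omega
    have e : K - d = (K - (d + 1)) + 1 := by omega
    rw [amplPre, ih (by omega), ih (by omega), e', e]
    set i := K - (d + 1)
    have hpi : (0 : ℤ) < 2 ^ i := by positivity
    have hpi' : (0 : ℝ) < 2 ^ i := by positivity
    have dv : (2 : ℤ) ^ (i + 1) ∣ X ↔ 2 ^ i ∣ X ∧ X / 2 ^ i % 2 = 0 := by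
      constructor
      · rintro ⟨c, rfl⟩
        refine ⟨(pow_dvd_pow _ (by omega)).mul_right _, ?_⟩
        rw [pow_succ, mul_assoc, Int.mul_ediv_cancel_left _ hpi.ne']; omega
      · rintro ⟨⟨c, rfl⟩, h⟩
        rw [Int.mul_ediv_cancel_left _ hpi.ne'] at h
        rw [pow_succ]
        exact mul_dvd_mul_left _ (Int.dvd_of_emod_eq_zero h)
    have dv' : (2 : ℤ) ^ (i + 1) ∣ X - 2 ^ i ↔ 2 ^ i ∣ X ∧ X / 2 ^ i % 2 ≠ 0 := by
      constructor
      · rintro ⟨c, hc⟩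
        have : X = 2 ^ i * (2 * c + 1) := by rw [pow_succ] at hc; linear_combination hc
        rw [this, Int.mul_ediv_cancel_left _ hpi.ne']
        exact ⟨dvd_mul_right _ _, by omega⟩
      · rintro ⟨⟨c, rfl⟩, h⟩
        rw [Int.mul_ediv_cancel_left _ hpi.ne'] at h
        rw [pow_succ, show (2 : ℤ) ^ i * c - 2 ^ i = 2 ^ i * (c - 1) by ring]
        exact mul_dvd_mul_left _ (by omega)
    simp only [dv, dv']
    by_cases hb : X / 2 ^ i % 2 = 0
    · simp only [hb, if_true, and_true]
      by_cases hc : 0 ≤ X ∧ X < N ∧ 2 ^ i ∣ X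
      · rw [if_pos hc, if_pos hc, ← Real.sqrt_mul (clamp_nonneg _)]
        congr 1
        have hX : (0 : ℝ) < N - X := by have := hc.2.1; exact_mod_cast (by omega : 0 < N - X)
        unfold clamp unifProb
        rw [pow_succ]
        push_cast
        rcases le_or_gt (N - X) (2 ^ i) with h1 | h1
        · have h1' : (N : ℝ) - X ≤ 2 ^ i := by exact_mod_cast h1
          rw [if_pos (by omega), min_eq_left h1', min_eq_left (by linarith : (N : ℝ) - X ≤ 2 ^ i * 2),
            min_eq_left (by rw [le_div_iff₀ hX]; linarith), max_eq_right zero_le_one, one_mul]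
        · have h1' : (2 : ℝ) ^ i < N - X := by exact_mod_cast h1
          rw [min_eq_right h1'.le]
          split_ifs with h2
          · have h2' : (N : ℝ) - X < 2 ^ i * 2 := by exact_mod_cast h2
            rw [min_eq_left h2'.le, min_eq_right (by rw [div_le_iff₀ hX]; linarith),
              max_eq_right (by positivity)]
            field_simp
          · have h2' : (2 : ℝ) ^ i * 2 ≤ N - X := by exact_mod_cast not_lt.1 h2
            rw [min_eq_right h2', min_eq_right (by rw [div_le_iff₀ (by positivity)]; linarith),
              max_eq_right (by positivity)]
            field_simp
      · rw [if_neg hc, if_neg hc, mul_zero]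
    · simp only [hb, if_false, and_true, not_false_iff, ne_eq]
      by_cases hc : 0 ≤ X ∧ X < N ∧ 2 ^ i ∣ X
      · have hXi : 2 ^ i ≤ X := by
          refine Int.le_of_dvd (lt_of_le_of_ne hc.1 ?_) hc.2.2
          rintro rfl
          simp at hb
        rw [if_pos hc, if_pos ⟨by omega, by omega, hc.2.2⟩,
          ← Real.sqrt_mul (sub_nonneg.2 (clamp_le_one _))]
        congr 1
        have hX : (0 : ℝ) < N - X := by have := hc.2.1; exact_mod_cast (by omega : 0 < N - X)
        unfold clamp unifProb
        rw [pow_succ]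
        push_cast
        have hX' : (0 : ℝ) < N - (X - 2 ^ i) := by linarith
        split_ifs with h2
        · have h2' : (N : ℝ) - (X - 2 ^ i) < 2 ^ i * 2 := by exact_mod_cast h2
          rw [min_eq_left h2'.le, min_eq_right (by rw [div_le_iff₀ hX']; linarith),
              max_eq_right (by positivity), min_eq_left (by linarith : (N : ℝ) - X ≤ 2 ^ i)]
          field_simp
          ring
        · have h2' : (2 : ℝ) ^ i * 2 ≤ N - (X - 2 ^ i) := by exact_mod_cast not_lt.1 h2
          rw [min_eq_right h2', min_eq_right (by rw [div_le_iff₀ (by positivity)]; linarith),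
            max_eq_right (by positivity), min_eq_right (by linarith : (2 : ℝ) ^ i ≤ (N : ℝ) - X)]
          field_simp
          ring
      · rw [if_neg hc]
        -- Here the upper half of the block that starts at `X - 2 ^ i` begins at or beyond `N`; the
        -- bit is 0 with probability 1, so `X` gets amplitude 0.
        by_cases hc' : 0 ≤ X - 2 ^ i ∧ X - 2 ^ i < N ∧ 2 ^ i ∣ X
        · have hX : N ≤ X := by
            by_contra h
            exact hc ⟨by omega, by omega, hc'.2.2⟩
          have h3 : (N : ℝ) - (X - 2 ^ i) ≤ 2 ^ i := by
            have : (N : ℝ) ≤ X := by exact_mod_cast hX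
            linarith
          have h4 : (0 : ℝ) < (N : ℝ) - (X - 2 ^ i) := by
            have : ((X - 2 ^ i : ℤ) : ℝ) < N := by exact_mod_cast hc'.2.1
            push_cast at this
            linarith
          have : clamp (unifProb N i (X - 2 ^ i)) = 1 := by
            unfold clamp unifProb
            rw [if_pos (by omega)]
            push_cast
            rw [min_eq_left (by rw [le_div_iff₀ h4]; linarith), max_eq_right zero_le_one]
          rw [this, sub_self, Real.sqrt_zero, zero_mul]
        · rw [if_neg hc', mul_zero]

theorem ampl_unif {N : ℤ} {K : ℕ} (hN : 0 < N) (hK : N ≤ 2 ^ K) (X : ℤ) :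
    ampl (unifProb N) K X = if 0 ≤ X ∧ X < N then √(1 / N) else 0 := by
  rw [ampl, amplPre_unif hN hK le_rfl]
  simp only [Nat.sub_self, pow_zero, one_dvd, and_true]
  split_ifs with h
  · rw [min_eq_right (by omega)]; simp
  · rfl

end QRed


namespace QRed

/-! ## The text of the program -/

/-- The content of the cell `(x, 0, 0)`. -/
def Expr.rd {L : Type} (x : L) : Expr L := .read x (.const 0) (.const 0)

/-- The value `v` is written to the cell `(x, 0, 0)`. -/
def Prog.set (x : ℕ) (v : CExpr) : Prog := .assign x (.const 0) (.const 0) v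

open QRed.Expr QRed.Prog

/-- The content of the entry of the array `x` of the quantum memory with coordinates the classical
loop variables `30` and `31`. -/
def cur (x : ℕ) : QExpr := .read (Sum.inr x) (rd (Sum.inl 30)) (rd (Sum.inl 31))

/-- The power of two with exponent the classical variable `41`. -/
def curPow : QExpr := .read (Sum.inl 27) (rd (Sum.inl 41)) (.const 0)

/-- Prepares the cell `(x, [30], [31])` bit by bit; the probability that bit number `[41]` is `0`
is `u / v`. -/
def sampler (x : ℕ) (K : CExpr) (u v : QExpr) : Prog :=
  loop 40 K
    (seq (set 41 (sub (sub K (const 1)) (rd 40)))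
    (seq (rot 12 (const 0) (const 0) u v)
    (seq (qadd x (rd 30) (rd 31) (mul (rd (Sum.inr 12)) curPow))
      (qadd 12 (const 0) (const 0) (sub (const 0) (mod (div (cur x) curPow) (const 2)))))))

/-- Prepares the uniform superposition of `0, …, N - 1` for the content `N` of the classical
cell `y`. -/
def sampleUnif (x : ℕ) (K : CExpr) (y : ℕ) : Prog :=
  sampler x K curPow
    (add (mul (lt (sub (rd (Sum.inl y)) (cur x)) (mul curPow (const 2)))
        (sub (rd (Sum.inl y)) (cur x)))
      (mul (sub (const 1) (lt (sub (rd (Sum.inl y)) (cur x)) (mul curPow (const 2))))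
        (mul curPow (const 2))))

/-- Prepares flags that are all `0` with probability close to `exp (-2 π j² / r²)`, where `j` is
the content of the entry `(8, [30], [31])`. -/
def sampleFlags : Prog :=
  sampler 9 (rd 26)
    (sub (rd (Sum.inl 15)) (mul (mod (div (mul (cur 8) (cur 8)) curPow) (const 2))
      (sub (rd (Sum.inl 15))
        (.read (Sum.inl 24) (add (rd (Sum.inl 23)) (rd (Sum.inl 41))) (const 0)))))
    (rd (Sum.inl 15))

/-- `1` if there was no success so far and the current attempt succeeds, else `0`. -/
def selected : QExpr :=
  mul (lt (.read (Sum.inr 10) (rd (Sum.inl 30)) (const 0)) (const 1)) (lt (cur 9) (const 1))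

/-- The output register of the copy `[30]`. -/
def outReg : QExpr := .read (Sum.inr 0) (rd (Sum.inl 30)) (const 0)

/-- One attempt to prepare a Gaussian superposition, which is moved to the output register if it
is the first successful one. -/
def attempt : Prog :=
  seq (sampleUnif 8 (rd 26) 21)
  (seq (qadd 8 (rd 30) (rd 31) (sub (const 0) (rd (Sum.inl 20))))
  (seq sampleFlags
  (seq (qadd 0 (rd 30) (const 0) (mul selected (cur 8)))
  (seq (qadd 8 (rd 30) (rd 31) (sub (const 0) (mul selected outReg)))
    (qadd 10 (rd 30) (const 0) (lt (cur 9) (const 1)))))))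

/-- Adds (`c = 1`) or subtracts (`c = -1`) the inner product of row `[31]` of `A` with the current
vector, minus `j` times the entry of `b`. -/
def addRow (c : ℤ) : Prog :=
  seq (loop 32 (rd 1) (qadd 7 (rd 30) (rd 31)
    (mul (const c) (mul (.read (Sum.inl 5) (rd (Sum.inl 31)) (rd (Sum.inl 32)))
      (.read (Sum.inr 1) (rd (Sum.inl 30)) (rd (Sum.inl 32)))))))
  (qadd 7 (rd 30) (rd 31)
    (mul (const (-c)) (mul (.read (Sum.inl 6) (rd (Sum.inl 31)) (const 0)) outReg)))

/-- Writes the number of the interval that contains the shifted coordinate `[31]` of `A x - j b`. -/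
def locate : Prog :=
  seq (addRow 1)
  (seq (qadd 11 (rd 30) (rd 31)
    (div (mul (const 8) (mod (cur 7) (rd (Sum.inl 2)))) (rd (Sum.inl 2))))
  (addRow (-1)))

/-- The quantum part of the program. -/
def quantumPart : Prog :=
  loop 30 (rd 4)
    (seq (loop 31 (rd 1) (sampleUnif 1 (rd 3) 2))
    (seq (loop 31 (rd 3) (sampleUnif 7 (rd 3) 2))
    (seq (loop 31 (rd 25) attempt)
      (loop 31 (rd 3) locate))))

/-- The integer square root of `κ`. -/
def progSqrt : Prog :=
  seq (set 10 (const 0))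
  (loop 42 (rd 0)
    (ite (lt (rd 0) (mul (add (rd 10) (const 1)) (add (rd 10) (const 1)))) skip
      (set 10 (add (rd 10) (const 1)))))

/-- A power `2 ^ B` that is at least `⌊r⌋`, by repeated squaring. -/
def progSize : Prog :=
  seq (set 11 (digits (const 0)))
  (seq (set 12 (const 1))
  (seq (set 13 (const 2))
  (loop 42 (rd 0)
    (ite (lt (rd 13) (rd 11))
      (seq (set 12 (mul (const 2) (rd 12))) (set 13 (mul (rd 13) (rd 13)))) skip))))

/-- The powers of two. -/
def progPow : Prog :=
  seq (set 14 (add (add (rd 12) (rd 0)) (const 1)))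
  (seq (set 28 (add (mul (const 32) (rd 14)) (rd 3)))
  (seq (assign 27 (const 0) (const 0) (const 1))
  (loop 42 (rd 28)
    (assign 27 (add (rd 42) (const 1)) (const 0)
      (mul (const 2) (read 27 (rd 42) (const 0)))))))

/-- Fixed point approximation of `π`. -/
def progPi : Prog :=
  seq (set 15 (read 27 (rd 28) (const 0)))
  (seq (set 17 (const 0))
  (seq (set 18 (const 0))
  (seq (loop 42 (rd 28)
    (seq (set 17 (sub (div (rd 15)
        (add (mul (const 2) (sub (sub (rd 28) (const 1)) (rd 42))) (const 1)))
        (div (rd 17) (const 4))))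
      (set 18 (sub (div (rd 15)
        (add (mul (const 2) (sub (sub (rd 28) (const 1)) (rd 42))) (const 1)))
        (div (rd 18) (const 9))))))
  (set 19 (add (mul (const 2) (rd 17)) (div (mul (const 4) (rd 18)) (const 3)))))))

/-- Fixed point approximations of the exponentials, and the remaining parameters. -/
def progExp : Prog :=
  seq (set 16 (digits (rd 28)))
  (seq (set 23 (mul (const 16) (rd 14)))
  (seq (set 26 (mul (const 2) (rd 14)))
  (seq (set 25 (mul (const 80) (mul (rd 0) (rd 4))))
  (seq (set 20 (div (mul (rd 10) (rd 16)) (rd 15)))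
  (seq (set 21 (add (mul (const 2) (rd 20)) (const 1)))
  (seq (set 24 (sub (rd 15) (div (mul (const 2) (mul (rd 19) (mul (rd 15) (rd 15))))
    (mul (mul (rd 16) (rd 16)) (read 27 (rd 23) (const 0))))))
  (seq (set 24 (mul (lt (const 0) (rd 24)) (rd 24)))
  (loop 42 (add (rd 23) (rd 26))
    (assign 24 (add (rd 42) (const 1)) (const 0)
      (div (mul (read 24 (rd 42) (const 0)) (read 24 (rd 42) (const 0))) (rd 15)))))))))))

/-- The reduction. -/
def reduction : Prog :=
  seq progSqrt (seq progSize (seq progPow (seq progPi (seq progExp quantumPart))))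

/-! ## Correctness of the sampling macro -/

/-- The state vector after preparing `d` of the `K` bits of the cell `a`. -/
noncomputable def samplePre (a : Loc) (p : Mem → ℕ → ℤ → ℝ) (K d : ℕ) (f : Mem → ℂ) : Mem → ℂ :=
  fun Q => ((amplPre (p (Function.update Q a 0)) K d (Q a) : ℝ) : ℂ) * f (Function.update Q a 0)

/-- The state vector after preparing the cell `a`. -/
noncomputable def sample (a : Loc) (p : Mem → ℕ → ℤ → ℝ) (K : ℕ) (f : Mem → ℂ) : Mem → ℂ :=
  fun Q => ((ampl (p (Function.update Q a 0)) K (Q a) : ℝ) : ℂ) * f (Function.update Q a 0)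

/-- The location of the scratch qubit. -/
abbrev scratch : Loc := (12, 0, 0)

/-- Before bit `i` is prepared, the cell is a multiple of `2 ^ (i + 1)`. After the scratch qubit
times `2 ^ i` has been added, bit `i` of the cell therefore equals the scratch qubit, and
subtracting it restores the scratch to 0. Read backwards from a final content, the scratch must have
held bit `i`; if its final content is not 0, both sides vanish. -/
theorem samplePre_succ {a : Loc} {p : Mem → ℕ → ℤ → ℝ} {K d : ℕ} {f : Mem → ℂ} (hd : d < K)
    (has : a ≠ scratch) (hpS : ∀ Q z, p (Function.update Q scratch z) = p Q)
    (hf : ∀ Q, f Q ≠ 0 → Q scratch = 0) :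
    addTo scratch (fun Q => -(Q a / 2 ^ (K - 1 - d) % 2))
      (addTo a (fun Q => Q scratch * 2 ^ (K - 1 - d))
        (rotAt scratch (fun Q => p (Function.update Q a 0) (K - 1 - d) (Q a))
          (samplePre a p K d f))) = samplePre a p K (d + 1) f := by
  funext Q
  set i := K - 1 - d with hi
  have hpi : (2 : ℤ) ^ i ≠ 0 := by positivity
  have bit : ∀ {p : ℕ → ℤ → ℝ} {X}, amplPre p K d X ≠ 0 → X / 2 ^ i % 2 = 0 := fun {p X} h => by
    obtain ⟨c, hc⟩ := (amplPre_support (by omega) h).1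
    rw [show K - d = i + 1 by omega] at hc
    rw [hc, pow_succ, mul_assoc, Int.mul_ediv_cancel_left _ hpi]
    omega
  have bit' : ∀ X : ℤ, (X - 2 ^ i) / 2 ^ i = X / 2 ^ i - 1 := fun X => by
    rw [show X - 2 ^ i = X + 2 ^ i * (-1) by ring, Int.add_mul_ediv_left _ _ hpi]; ring
  simp only [addTo, sub_neg_eq_add, Function.update_of_ne has.symm, Function.update_of_ne has,
    Function.update_self]
  set s := Q scratch with hs
  set X := Q a with hX
  have hb : X / 2 ^ i % 2 = 0 ∨ X / 2 ^ i % 2 = 1 := by omega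
  have F0 : s ≠ 0 → f (Function.update Q a 0) = 0 := fun h => by
    by_contra h'
    exact h (by simpa [Function.update_of_ne has.symm] using hf _ h')
  have Fs : f (Function.update (Function.update Q scratch 0) a 0) =
      if s = 0 then f (Function.update Q a 0)
      else f (Function.update (Function.update Q scratch 0) a 0) := by
    split_ifs with h
    · rw [← h, hs, Function.update_eq_self]
    · rfl
  have C1 : ∀ z y z', Function.update (Function.update (Function.update Q scratch z) a y) scratch z' =
      Function.update (Function.update Q scratch z') a y := fun z y z' => by
    rw [Function.update_comm has.symm, Function.update_idem, Function.update_comm has]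
  have P1 : ∀ z, p (Function.update (Function.update Q scratch z) a 0) = p (Function.update Q a 0) :=
    fun z => by rw [Function.update_comm has.symm, hpS]
  have D1 : amplPre (p (Function.update Q a 0)) K (d + 1) X =
    if X / 2 ^ i % 2 = 0 then √(clamp (p (Function.update Q a 0) i X)) *
        amplPre (p (Function.update Q a 0)) K d X
    else √(1 - clamp (p (Function.update Q a 0) i (X - 2 ^ i))) *
      amplPre (p (Function.update Q a 0)) K d (X - 2 ^ i) := rfl
  rw [samplePre, D1]
  have R1 : rotAt scratch (fun Q => p (Function.update Q a 0) i (Q a)) (samplePre a p K d f)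
      (Function.update (Function.update Q scratch (s + X / 2 ^ i % 2)) a
        (X - (s + X / 2 ^ i % 2) * 2 ^ i)) =
      if s + X / 2 ^ i % 2 = 0 then
        ((√(clamp (p (Function.update Q a 0) i X)) *
          amplPre (p (Function.update Q a 0)) K d X : ℝ) : ℂ) *
          f (Function.update (Function.update Q scratch 0) a 0)
      else if s + X / 2 ^ i % 2 = 1 then
        ((√(1 - clamp (p (Function.update Q a 0) i (X - 2 ^ i))) *
          amplPre (p (Function.update Q a 0)) K d (X - 2 ^ i) : ℝ) : ℂ) *
          f (Function.update (Function.update Q scratch 0) a 0)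
      else 0 := by
    simp only [rotAt, samplePre, Function.update_of_ne has.symm, Function.update_self, C1, P1,
      Function.update_idem]
    split_ifs with h1 h2
    · rw [h1, zero_mul, sub_zero]; push_cast; rw [mul_assoc]; rfl
    · rw [h2, one_mul]; push_cast; rw [mul_assoc]; rfl
    · rfl
  rw [R1]
  have b1 : X / 2 ^ i % 2 = 1 → amplPre (p (Function.update Q a 0)) K d X = 0 := by
    intro h
    by_contra h'
    have := bit h'
    omega
  have b2 : X / 2 ^ i % 2 = 0 → amplPre (p (Function.update Q a 0)) K d (X - 2 ^ i) = 0 := by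
    intro h
    by_contra h'
    have := bit h'
    rw [bit'] at this
    omega
  by_cases h0 : s = 0
  · rw [Fs, if_pos h0]
    rcases hb with h | h
    · rw [if_pos (by omega), if_pos h]
    · rw [if_neg (by omega), if_pos (by omega), if_neg (by omega)]
  · rw [F0 h0, mul_zero]
    rcases hb with h | h
    · rw [b2 h]
      rw [if_neg (by omega)]
      simp
    · rw [b1 h]
      split_ifs
      · simp
      · omega
      · rfl

theorem samplePre_support {a : Loc} {p : Mem → ℕ → ℤ → ℝ} {K d : ℕ} {f : Mem → ℂ} (hd : d ≤ K)
    {Q : Mem} (h : samplePre a p K d f Q ≠ 0) :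
    0 ≤ Q a ∧ Q a < 2 ^ K ∧ f (Function.update Q a 0) ≠ 0 := by
  have h1 := left_ne_zero_of_mul h
  have h2 := right_ne_zero_of_mul h
  have h3 := (amplPre_support hd (by exact_mod_cast h1)).2
  exact ⟨h3.1, h3.2, h2⟩

theorem Bdd.of_update {S : ℕ} {Q : Mem} {a : Loc} {z : ℤ} (h : Bdd S (Function.update Q a z))
    (hz : (Q a).natAbs < 2 ^ S) : Bdd S Q := by
  have := h.update a hz
  rwa [Function.update_idem, Function.update_eq_self] at this

theorem WP.sampler {r : ℝ} {S : ℕ} {post : Mem → (Mem → ℂ) → Prop} {μ : Mem} {f : Mem → ℂ}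
    {x : ℕ} {K : CExpr} {u v : QExpr} {k j : ℤ} {Kn : ℕ} (p : Mem → ℕ → ℤ → ℝ)
    (hS : 1 ≤ S) (hμ : Bdd S μ) (hx : x ≠ 12) (hk : μ (30, 0, 0) = k) (hj : μ (31, 0, 0) = j)
    (hpow : ∀ i : ℕ, i < Kn → μ (27, i, 0) = 2 ^ i)
    (hK : ∀ μ', Same {40, 41} μ μ' → K.eval r μ' = Kn) (hKd : ∀ μ', K.DigitsOk S r μ')
    (hKS : Kn < S) (hud : ∀ ν, u.DigitsOk S r ν) (hvd : ∀ ν, v.DigitsOk S r ν)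
    (hp : ∀ μ' (i : ℕ), i < Kn → Same {40, 41} μ μ' → μ' (41, 0, 0) = i → ∀ Q,
      (u.eval r (joint μ' Q) : ℝ) / (v.eval r (joint μ' Q) : ℝ) =
        p (Function.update Q (x, k, j) 0) i (Q (x, k, j)))
    (hpS : ∀ Q z, p (Function.update Q scratch z) = p Q)
    (hf : ∀ Q, f Q ≠ 0 → Bdd S Q ∧ Q (x, k, j) = 0 ∧ Q scratch = 0)
    (h : ∀ μ', Same {40, 41} μ μ' → Bdd S μ' → post μ' (sample (x, k, j) p Kn f)) :
    WP r S (sampler x K u v) post μ f := by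
  set a : Loc := (x, k, j) with ha
  have has : a ≠ scratch := fun h => hx (congrArg Prod.fst h)
  have hf0 : ∀ Q, f Q ≠ 0 → Q a = 0 := fun Q h => (hf Q h).2.1
  have hfs : ∀ Q, f Q ≠ 0 → Q scratch = 0 := fun Q h => (hf Q h).2.2
  have pw : (2 : ℤ) ^ Kn < 2 ^ S := by
    exact_mod_cast Nat.pow_lt_pow_right (by norm_num) hKS
  have pw' : (2 : ℤ) ^ Kn = ((2 ^ Kn : ℕ) : ℤ) := by push_cast; rfl
  have pw'' : (2 : ℤ) ^ S = ((2 ^ S : ℕ) : ℤ) := by push_cast; rfl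
  have bs : ∀ d ≤ Kn, ∀ Q, samplePre a p Kn d f Q ≠ 0 → Bdd S Q ∧ Q scratch = 0 := by
    intro d hd Q hQ
    obtain ⟨h1, h2, h3⟩ := samplePre_support hd hQ
    refine ⟨(hf _ h3).1.of_update (by omega), ?_⟩
    simpa [Function.update_of_ne has.symm] using hfs _ h3
  refine WP.loop (fun d μ' f' => Same {40, 41} μ μ' ∧ Bdd S μ' ∧ f' = samplePre a p Kn d f) Kn hS
    hμ (hKd _) (hK μ (Same.refl _ _)) (by omega) ⟨Same.refl _ _, hμ, ?_⟩ ?_ ?_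
  · funext Q
    simp only [samplePre, amplPre]
    split_ifs with h0
    · rw [← h0, Function.update_eq_self]; simp
    · rw [Complex.ofReal_zero, zero_mul]
      by_contra h'
      exact h0 (hf0 _ h')
  · rintro d hd μ1 f1 ⟨hs1, hb1, rfl⟩
    have hs2 : Same {40, 41} μ (Function.update μ1 (40, 0, 0) (d : ℤ)) := hs1.update (by simp) _
    have hb2 : Bdd S (Function.update μ1 (40, 0, 0) (d : ℤ)) := hb1.update _ (by
      have := @Nat.lt_two_pow_self S; simp only [Int.natAbs_natCast]; omega)
    set μ2 := Function.update μ1 (40, 0, 0) (d : ℤ) with hμ2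
    have ev : (Expr.sub (Expr.sub K (Expr.const 1)) (rd 40)).eval r μ2 = ((Kn - 1 - d : ℕ) : ℤ) := by
      have e40 : μ2 (40, 0, 0) = d := Function.update_self ..
      simp only [Expr.eval, rd, hK _ hs2, e40]
      omega
    refine WP.seq (WP.assign hS hb2 trivial trivial ⟨⟨hKd _, trivial⟩, trivial, trivial⟩ ?_)
    rw [ev]
    set i := Kn - 1 - d with hi
    have hs3 : Same {40, 41} μ (Function.update μ2 (41, 0, 0) (i : ℤ)) := hs2.update (by simp) _
    have hb3 : Bdd S (Function.update μ2 (41, 0, 0) (i : ℤ)) := hb2.update _ (by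
      have := @Nat.lt_two_pow_self S; simp only [Int.natAbs_natCast]; omega)
    have h41 : (Function.update μ2 (41, 0, 0) (i : ℤ)) (41, 0, 0) = i := Function.update_self ..
    simp only [Expr.eval]
    set μ3 := Function.update μ2 (41, 0, 0) (i : ℤ) with hμ3
    have e30 : μ3 (30, 0, 0) = k := (hs3 _ (by simp)).trans hk
    have e31 : μ3 (31, 0, 0) = j := (hs3 _ (by simp)).trans hj
    have epow : μ3 (27, (i : ℤ), 0) = 2 ^ i := (hs3 _ (by simp)).trans (hpow i (by omega))
    have i1 : (2 : ℤ) ^ i < 2 ^ S := by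
      exact_mod_cast Nat.pow_lt_pow_right (by norm_num) (by omega)
    have one_lt : (1 : ℤ) < 2 ^ S := by
      exact_mod_cast Nat.one_lt_two_pow (by omega)
    have b1 : ∀ Q, rotAt scratch (fun Q => p (Function.update Q a 0) i (Q a))
        (samplePre a p Kn d f) Q ≠ 0 → Bdd S Q ∧ 0 ≤ Q a ∧ Q a < 2 ^ Kn ∧
          (2 : ℤ) ^ (i + 1) ∣ Q a ∧ 0 ≤ Q scratch ∧ Q scratch ≤ 1 := by
      intro Q hQ
      have key : ∀ z, samplePre a p Kn d f (Function.update Q scratch z) ≠ 0 →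
          (2 : ℤ) ^ (i + 1) ∣ Q a ∧ 0 ≤ Q a ∧ Q a < 2 ^ Kn := by
        intro z hz
        have := amplPre_support hd.le
          (by exact_mod_cast left_ne_zero_of_mul hz : amplPre _ _ _ _ ≠ 0)
        rw [Function.update_of_ne has] at this
        rwa [show Kn - d = i + 1 by omega] at this
      simp only [rotAt] at hQ
      split_ifs at hQ with h1 h2
      · have hQ := right_ne_zero_of_mul hQ
        have := key 0 (by rwa [← h1, Function.update_eq_self])
        exact ⟨(bs d hd.le _ hQ).1, this.2.1, this.2.2, this.1, by omega, by omega⟩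
      · have hQ := right_ne_zero_of_mul hQ
        have := key 0 hQ
        exact ⟨(bs d hd.le _ hQ).1.of_update (by rw [h2]; simp only [Int.natAbs_one]; omega),
          this.2.1, this.2.2, this.1, by omega, by omega⟩
      · simp at hQ
    refine WP.seq (WP.rot scratch (fun Q => p (Function.update Q a 0) i (Q a)) hS hb3 trivial
      trivial (fun Q hQ => (bs d hd.le Q hQ).1) rfl (fun Q hQ => (bs d hd.le Q hQ).2)
      (fun _ => hud _) (fun _ => hvd _) (hp μ3 i (by omega) hs3 h41) ?_)
    refine WP.seq (WP.qadd a (fun Q => Q scratch * 2 ^ i) hS hb3 (by simp [Expr.DigitsOk, rd])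
      (by simp [Expr.DigitsOk, rd]) (fun Q hQ => (b1 Q hQ).1)
      (by simp [Expr.eval, rd, e30, e31, ha])
      (fun _ => by simp [Expr.DigitsOk, rd, curPow])
      (fun Q => by simp [Expr.eval, rd, curPow, joint, h41, epow]) ?_)
    refine WP.qadd scratch (fun Q => -(Q a / 2 ^ i % 2)) hS hb3 trivial trivial ?_ rfl
      (fun _ => by simp [Expr.DigitsOk, rd, curPow, cur])
      (fun Q => by simp [Expr.eval, rd, curPow, cur, joint, h41, epow, e30, e31, ha]) ?_
    · intro Q hQ
      simp only [addTo] at hQ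
      obtain ⟨h1, h2, h3, h3', h4, h5⟩ := b1 _ hQ
      simp only [Function.update_self, Function.update_of_ne has.symm] at h2 h3 h3' h4 h5
      refine h1.of_update ?_
      have t1 : 0 ≤ Q scratch * 2 ^ i := mul_nonneg h4 (by positivity)
      have t2 : Q scratch * 2 ^ i ≤ 2 ^ i := mul_le_of_le_one_left (by positivity) h5
      have t3 : (2 : ℤ) ^ (i + 1) * 2 ^ d = 2 ^ Kn := by
        rw [← pow_add]; congr 1; omega
      -- A multiple of `2 ^ (i + 1)` below `2 ^ Kn` is at most `2 ^ Kn - 2 ^ (i + 1)`, which leaves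
      -- room for the added `2 ^ i`.
      have t4 : Q a - Q scratch * 2 ^ i ≤ 2 ^ Kn - 2 ^ (i + 1) := by
        obtain ⟨c, hc⟩ := h3'
        rw [hc, ← t3] at h3 ⊢
        have hq : (0 : ℤ) < 2 ^ (i + 1) := by positivity
        have := lt_of_mul_lt_mul_left h3 hq.le
        have : c + 1 ≤ 2 ^ d := this
        nlinarith
      have t5 : (2 : ℤ) ^ i ≤ 2 ^ (i + 1) := by rw [pow_succ]; linarith [show (0 : ℤ) < 2 ^ i by positivity]
      omega
    · refine ⟨hs3, hb3, ?_⟩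
      exact samplePre_succ hd has hpS fun Q h => hfs Q h
  · rintro μ' f' ⟨h1, h2, rfl⟩
    exact h μ' h1 h2

end QRed


namespace QRed

open QRed.Expr QRed.Prog

/-! ## The quantum part -/

/-- The parameters that the quantum part of the program uses. -/
structure Par where
  n : ℕ
  q : ℕ
  m : ℕ
  ℓ : ℕ
  H : ℕ
  T : ℕ
  R : ℕ
  V : ℕ
  G : ℕ
  u : ℕ → ℤ
  A : ℕ → ℕ → ℤ
  b : ℕ → ℤ

/-- The classical memory `μ` holds the parameters `c`. -/
structure QEnv (c : Par) (S : ℕ) (μ : Mem) : Prop where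
  bdd : Bdd S μ
  n : μ (1, 0, 0) = c.n
  q : μ (2, 0, 0) = c.q
  m : μ (3, 0, 0) = c.m
  ℓ : μ (4, 0, 0) = c.ℓ
  A : ∀ i j : ℕ, i < c.m → j < c.n → μ (5, i, j) = c.A i j
  b : ∀ i : ℕ, i < c.m → μ (6, i, 0) = c.b i
  V : μ (15, 0, 0) = c.V
  R : μ (20, 0, 0) = c.R
  N : μ (21, 0, 0) = 2 * c.R + 1
  G : μ (23, 0, 0) = c.G
  u : ∀ i : ℕ, i < c.H → μ (24, c.G + i, 0) = c.u i
  T : μ (25, 0, 0) = c.T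
  H : μ (26, 0, 0) = c.H
  powH : ∀ i : ℕ, i < c.H → μ (27, i, 0) = 2 ^ i
  powm : ∀ i : ℕ, i < c.m → μ (27, i, 0) = 2 ^ i

/-- The loop variables of the quantum part. -/
abbrev qVars : Finset ℕ := {30, 31, 32, 40, 41}

theorem QEnv.same {c : Par} {S : ℕ} {μ μ' : Mem} (h : QEnv c S μ) (hs : Same qVars μ μ')
    (hb : Bdd S μ') : QEnv c S μ' where
  bdd := hb
  n := (hs _ (by simp)).trans h.n
  q := (hs _ (by simp)).trans h.q
  m := (hs _ (by simp)).trans h.m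
  ℓ := (hs _ (by simp)).trans h.ℓ
  A := fun i j hi hj => (hs _ (by simp)).trans (h.A i j hi hj)
  b := fun i hi => (hs _ (by simp)).trans (h.b i hi)
  V := (hs _ (by simp)).trans h.V
  R := (hs _ (by simp)).trans h.R
  N := (hs _ (by simp)).trans h.N
  G := (hs _ (by simp)).trans h.G
  u := fun i hi => (hs _ (by simp)).trans (h.u i hi)
  T := (hs _ (by simp)).trans h.T
  H := (hs _ (by simp)).trans h.H
  powH := fun i hi => (hs _ (by simp)).trans (h.powH i hi)
  powm := fun i hi => (hs _ (by simp)).trans (h.powm i hi)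

/-- Size conditions on the parameters. -/
structure Par.Ok (c : Par) (S : ℕ) : Prop where
  q_pos : 0 < c.q
  q_le : c.q ≤ 2 ^ c.m
  R_le : 2 * c.R + 1 ≤ 2 ^ c.H
  n_lt : c.n < S
  m_lt : c.m < S
  H_lt : c.H < S
  T_lt : c.T < S
  ℓ_lt : c.ℓ < S
  size : c.q + c.n * c.q * c.q + c.q * c.R + 16 < 2 ^ S
  A : ∀ i j : ℕ, i < c.m → j < c.n → 0 ≤ c.A i j ∧ c.A i j < c.q
  b : ∀ i : ℕ, i < c.m → 0 ≤ c.b i ∧ c.b i < c.q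

/-- Admissible contents of a cell of the array with name `x`. -/
def okVal (c : Par) (x : ℕ) (z : ℤ) : Prop :=
  if x = 0 ∨ x = 8 then |z| ≤ c.R
  else if x = 1 ∨ x = 7 then 0 ≤ z ∧ z < c.q
  else if x = 9 then 0 ≤ z ∧ z < 2 ^ c.H
  else if x = 10 then 0 ≤ z ∧ z ≤ c.T
  else if x = 11 then 0 ≤ z ∧ z ≤ 8
  else z = 0

/-- Admissible contents `z` of the cell `a` while the copy `k` is being prepared: in row `k` the
array `1` is filled up to `n₁`, the array `7` up to `n₂`, the arrays `8` and `9` up to `n₃`, and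
the array `11` up to `n₄`. -/
def okCell (c : Par) (k n₁ n₂ n₃ n₄ : ℕ) (a : Loc) (z : ℤ) : Prop :=
  okVal c a.1 z ∧ ((k : ℤ) < a.2.1 → z = 0) ∧
    (a.2.1 = k → (a.1 = 1 → n₁ ≤ a.2.2 → z = 0) ∧ (a.1 = 7 → n₂ ≤ a.2.2 → z = 0) ∧
      (a.1 = 8 ∨ a.1 = 9 → n₃ ≤ a.2.2 → z = 0) ∧ (a.1 = 10 → z ≤ n₃) ∧
      (a.1 = 11 → n₄ ≤ a.2.2 → z = 0))

/-- Admissible basis states while the copy `k` is being prepared. -/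
def Supp (c : Par) (k n₁ n₂ n₃ n₄ : ℕ) (Q : Mem) : Prop :=
  (∀ a, okCell c k n₁ n₂ n₃ n₄ a (Q a)) ∧ (Q (10, k, 0) = 0 → Q (0, k, 0) = 0)

/-- All basis states of non-zero amplitude are admissible. -/
def QSupp (c : Par) (k n₁ n₂ n₃ n₄ : ℕ) (f : Mem → ℂ) : Prop :=
  ∀ Q, f Q ≠ 0 → Supp c k n₁ n₂ n₃ n₄ Q

theorem okVal.lt {c : Par} {S : ℕ} (hc : c.Ok S) {x : ℕ} {z : ℤ} (h : okVal c x z) :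
    z.natAbs < 2 ^ S := by
  have h1 := hc.size
  have h2 : 2 ^ c.H < 2 ^ S := Nat.pow_lt_pow_right (by norm_num) hc.H_lt
  have h2' : ((2 ^ c.H : ℕ) : ℤ) = 2 ^ c.H := by push_cast; rfl
  have h3 : c.T < 2 ^ S := hc.T_lt.trans Nat.lt_two_pow_self
  have h4 := hc.R_le
  have h5 : c.q < 2 ^ S := by
    have := Nat.zero_le (c.n * c.q * c.q)
    have := Nat.zero_le (c.q * c.R)
    omega
  unfold okVal at h
  split_ifs at h
  · rw [abs_le] at h; omega
  · omega
  · omega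
  · omega
  · omega
  · rw [h]; simp

theorem Supp.bdd {c : Par} {S k n₁ n₂ n₃ n₄ : ℕ} (hc : c.Ok S) {Q : Mem}
    (h : Supp c k n₁ n₂ n₃ n₄ Q) : Bdd S Q := fun a => (h.1 a).1.lt hc

theorem Supp.scratch {c : Par} {k n₁ n₂ n₃ n₄ : ℕ} {Q : Mem}
    (h : Supp c k n₁ n₂ n₃ n₄ Q) : Q scratch = 0 := by
  have := (h.1 QRed.scratch).1
  simpa [okVal] using this

theorem okVal_zero (c : Par) (x : ℕ) (hc : 0 < c.q) : okVal c x 0 := by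
  unfold okVal
  split_ifs <;> simp; omega

theorem okCell.mono {c : Par} {k n₁ n₂ n₃ n₄ n₁' n₂' n₃' n₄' : ℕ} {a : Loc} {z : ℤ}
    (h : okCell c k n₁ n₂ n₃ n₄ a z) (h1 : n₁ ≤ n₁') (h2 : n₂ ≤ n₂') (h3 : n₃ ≤ n₃')
    (h4 : n₄ ≤ n₄') : okCell c k n₁' n₂' n₃' n₄' a z := by
  obtain ⟨a1, a2, a3⟩ := h
  refine ⟨a1, a2, fun hk => ?_⟩
  obtain ⟨b1, b2, b3, b4, b5⟩ := a3 hk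
  exact ⟨fun h h' => b1 h (by omega), fun h h' => b2 h (by omega), fun h h' => b3 h (by omega),
    fun h => (b4 h).trans (by omega), fun h h' => b5 h (by omega)⟩

theorem Supp.of_update {c : Par} {k n₁ n₂ n₃ n₄ n₁' n₂' n₃' n₄' : ℕ} {Q : Mem} {a : Loc} {z : ℤ}
    (h : Supp c k n₁ n₂ n₃ n₄ (Function.update Q a z)) (h1 : n₁ ≤ n₁') (h2 : n₂ ≤ n₂')
    (h3 : n₃ ≤ n₃') (h4 : n₄ ≤ n₄') (ha : okCell c k n₁' n₂' n₃' n₄' a (Q a))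
    (hl : Q (10, k, 0) = 0 → Q (0, k, 0) = 0) : Supp c k n₁' n₂' n₃' n₄' Q := by
  refine ⟨fun b => ?_, hl⟩
  by_cases hb : b = a
  · rw [hb]; exact ha
  · have := h.1 b
    rw [Function.update_of_ne hb] at this
    exact this.mono h1 h2 h3 h4

/-- All rows after `k` are still empty, so the fill levels start again at 0 for row `k + 1`. -/
theorem Supp.next {c : Par} {k n₁ n₂ n₃ n₄ : ℕ} {Q : Mem} (h : Supp c k n₁ n₂ n₃ n₄ Q) :
    Supp c (k + 1) 0 0 0 0 Q := by
  have z : ∀ a : Loc, (k : ℤ) < a.2.1 → Q a = 0 := fun a ha => (h.1 a).2.1 ha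
  refine ⟨fun a => ⟨(h.1 a).1, fun h' => z a (by push_cast at h'; omega), fun h' => ?_⟩,
    fun _ => z _ (by push_cast; simp)⟩
  have h0 := z a (by rw [h']; push_cast; omega)
  simp [h0]

section Steps

variable {c : Par} {r : ℝ} {S : ℕ} {post : Mem → (Mem → ℂ) → Prop} {μ : Mem} {f : Mem → ℂ}

theorem WP.sampleUnif {x y N : ℕ} {K : CExpr} {k j : ℤ} {Kn : ℕ}
    (hS : 1 ≤ S) (hμ : Bdd S μ) (hx : x ≠ 12) (hk : μ (30, 0, 0) = k) (hj : μ (31, 0, 0) = j)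
    (hpow : ∀ i : ℕ, i < Kn → μ (27, i, 0) = 2 ^ i)
    (hK : ∀ μ', Same {40, 41} μ μ' → K.eval r μ' = Kn) (hKd : ∀ μ', K.DigitsOk S r μ')
    (hKS : Kn < S) (hy : y ≠ 40 ∧ y ≠ 41) (hN : μ (y, 0, 0) = N)
    (hf : ∀ Q, f Q ≠ 0 → Bdd S Q ∧ Q (x, k, j) = 0 ∧ Q QRed.scratch = 0)
    (h : ∀ μ', Same {40, 41} μ μ' → Bdd S μ' →
      post μ' (sample (x, k, j) (fun _ => unifProb N) Kn f)) :
    WP r S (sampleUnif x K y) post μ f := by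
  refine WP.sampler _ hS hμ hx hk hj hpow hK hKd hKS
    (fun _ => by simp [Expr.DigitsOk, rd, curPow])
    (fun _ => by simp [Expr.DigitsOk, rd, curPow, cur]) ?_ (fun _ _ => rfl) hf h
  intro μ' i hi hs h41 Q
  have e1 : μ' (27, (i : ℤ), 0) = 2 ^ i := (hs _ (by simp)).trans (hpow i hi)
  have e2 : μ' (30, 0, 0) = k := (hs _ (by simp)).trans hk
  have e3 : μ' (31, 0, 0) = j := (hs _ (by simp)).trans hj
  have e4 : μ' (y, 0, 0) = N := (hs _ (by simp [hy.1, hy.2])).trans hN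
  simp only [Expr.eval, curPow, rd, cur, joint, Sum.elim_inl, Sum.elim_inr, h41, e1, e2, e3, e4,
    unifProb]
  congr 2
  split_ifs <;> ring

/-- The bit probabilities of the flags. -/
noncomputable def flagProb (c : Par) (j : ℤ) (i : ℕ) (_Y : ℤ) : ℝ :=
  ((c.V - j * j / 2 ^ i % 2 * (c.V - c.u i) : ℤ) : ℝ) / (c.V : ℤ)

theorem WP.sampleFlags (hS : 1 ≤ S) (hE : QEnv c S μ) (hc : c.Ok S) {k t : ℤ}
    (hk : μ (30, 0, 0) = k) (hj : μ (31, 0, 0) = t)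
    (hf : ∀ Q, f Q ≠ 0 → Bdd S Q ∧ Q (9, k, t) = 0 ∧ Q QRed.scratch = 0)
    (h : ∀ μ', Same {40, 41} μ μ' → Bdd S μ' →
      post μ' (sample (9, k, t) (fun Q => flagProb c (Q (8, k, t))) c.H f)) :
    WP r S sampleFlags post μ f := by
  refine WP.sampler _ hS hE.bdd (by norm_num) hk hj hE.powH
    (fun μ' hs => (hs _ (by simp)).trans hE.H) (fun _ => by simp [Expr.DigitsOk, rd]) hc.H_lt
    (fun _ => by simp [Expr.DigitsOk, rd, curPow, cur])
    (fun _ => by simp [Expr.DigitsOk, rd]) ?_ (fun _ _ => by simp [Function.update]) hf h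
  intro μ' i hi hs h41 Q
  have e1 : μ' (27, (i : ℤ), 0) = 2 ^ i := (hs _ (by simp)).trans (hE.powH i hi)
  have e2 : μ' (30, 0, 0) = k := (hs _ (by simp)).trans hk
  have e3 : μ' (31, 0, 0) = t := (hs _ (by simp)).trans hj
  have e4 : μ' (15, 0, 0) = c.V := (hs _ (by simp)).trans hE.V
  have e5 : μ' (23, 0, 0) = c.G := (hs _ (by simp)).trans hE.G
  have e6 : μ' (24, (c.G : ℤ) + i, 0) = c.u i := (hs _ (by simp)).trans (hE.u i hi)
  simp [Expr.eval, curPow, rd, cur, joint, h41, e1, e2, e3, e4, e5, e6, flagProb]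

theorem sample_support {a : Loc} {p : Mem → ℕ → ℤ → ℝ} {K : ℕ} {Q : Mem}
    (h : sample a p K f Q ≠ 0) :
    0 ≤ Q a ∧ Q a < 2 ^ K ∧ f (Function.update Q a 0) ≠ 0 := by
  have h1 := left_ne_zero_of_mul h
  have h3 := ampl_support (by exact_mod_cast h1 : ampl _ _ _ ≠ 0)
  exact ⟨h3.1, h3.2, right_ne_zero_of_mul h⟩

theorem sample_unif_support {a : Loc} {N K : ℕ} (hN : 0 < N) (hK : N ≤ 2 ^ K) {Q : Mem}
    (h : sample a (fun _ => unifProb N) K f Q ≠ 0) :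
    0 ≤ Q a ∧ Q a < N ∧ f (Function.update Q a 0) ≠ 0 := by
  have h1 := left_ne_zero_of_mul h
  rw [ampl_unif (by exact_mod_cast hN) (by exact_mod_cast hK)] at h1
  split_ifs at h1 with h2
  · exact ⟨h2.1, h2.2, right_ne_zero_of_mul h⟩
  · simp at h1

/-- Uniform superpositions of `0, …, q - 1` in the first `i` entries of row `k` of the array `x`. -/
noncomputable def sampleRow (c : Par) (x k : ℕ) : ℕ → (Mem → ℂ) → Mem → ℂ
  | 0, f => f
  | i + 1, f => sample (x, k, i) (fun _ => unifProb c.q) c.m (sampleRow c x k i f)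

theorem sampleRow_one_supp (hc : c.Ok S) {k i : ℕ} (hf : QSupp c k 0 0 0 0 f) :
    QSupp c k i 0 0 0 (sampleRow c 1 k i f) := by
  induction i with
  | zero => exact hf
  | succ i ih =>
    intro Q hQ
    obtain ⟨h1, h2, h3⟩ := sample_unif_support hc.q_pos hc.q_le hQ
    have h := ih _ h3
    refine h.of_update (by omega) le_rfl le_rfl le_rfl ⟨by simp [okVal, h1, h2], ?_, ?_⟩ ?_
    · simp
    · intro _; simp
    · have := h.2
      rwa [Function.update_of_ne (by simp), Function.update_of_ne (by simp)] at this

theorem sampleRow_seven_supp (hc : c.Ok S) {k n₁ i : ℕ} (hf : QSupp c k n₁ 0 0 0 f) :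
    QSupp c k n₁ i 0 0 (sampleRow c 7 k i f) := by
  induction i with
  | zero => exact hf
  | succ i ih =>
    intro Q hQ
    obtain ⟨h1, h2, h3⟩ := sample_unif_support hc.q_pos hc.q_le hQ
    have h := ih _ h3
    refine h.of_update le_rfl (by omega) le_rfl le_rfl ⟨by simp [okVal, h1, h2], ?_, ?_⟩ ?_
    · simp
    · intro _; simp
    · have := h.2
      rwa [Function.update_of_ne (by simp), Function.update_of_ne (by simp)] at this

theorem Same.qVars {μ' : Mem} {W : Finset ℕ} (h : Same W μ μ') (hW : W ⊆ qVars := by decide) :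
    Same qVars μ μ' := h.mono hW

theorem Bdd.nat {μ : Mem} (h : Bdd S μ) (a : Loc) {k : ℕ} (hk : k < S) :
    Bdd S (Function.update μ a (k : ℤ)) :=
  h.update a (by simpa using hk.trans Nat.lt_two_pow_self)

theorem WP.sampleRow {x cnt k : ℕ} {e : CExpr} (hS : 1 ≤ S) (hE : QEnv c S μ) (hc : c.Ok S)
    (hx : x ≠ 12) (hk : μ (30, 0, 0) = k) (he : ∀ μ, e.DigitsOk S r μ) (hcnt : e.eval r μ = cnt)
    (hcS : cnt < S)
    (hf : ∀ i < cnt, ∀ Q, QRed.sampleRow c x k i f Q ≠ 0 →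
      Bdd S Q ∧ Q (x, k, i) = 0 ∧ Q QRed.scratch = 0)
    (h : ∀ μ', Same {31, 40, 41} μ μ' → Bdd S μ' → post μ' (QRed.sampleRow c x k cnt f)) :
    WP r S (.loop 31 e (QRed.sampleUnif x (rd 3) 2)) post μ f := by
  refine WP.loop (fun i μ' f' => Same {31, 40, 41} μ μ' ∧ Bdd S μ' ∧
    f' = QRed.sampleRow c x k i f) cnt hS hE.bdd (he _) hcnt hcS.le
    ⟨Same.refl _ _, hE.bdd, rfl⟩ ?_ ?_
  · rintro i hi μ1 f1 ⟨hs, hb, rfl⟩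
    have hb' := hb.nat (31, 0, 0) (hi.trans hcS)
    have hs' : Same {31, 40, 41} μ (Function.update μ1 (31, 0, 0) (i : ℤ)) := hs.update (by simp) _
    have h31 : Function.update μ1 (31, 0, 0) (i : ℤ) (31, 0, 0) = i := Function.update_self ..
    generalize Function.update μ1 (31, 0, 0) (i : ℤ) = μ2 at hb' hs' h31
    have hE2 : QEnv c S μ2 := hE.same (hs'.qVars) hb'
    refine WP.sampleUnif (K := rd 3) hS hb' hx ((hs' _ (by simp)).trans hk) h31 hE2.powm
      (fun μ' h' => (h' _ (by simp)).trans hE2.m) (fun _ => by simp [Expr.DigitsOk, rd]) hc.m_lt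
      (by norm_num) hE2.q (hf i hi) ?_
    intro μ' h1 h2
    exact ⟨hs'.trans (h1.mono (by decide)), h2, rfl⟩
  · rintro μ' f' ⟨h1, h2, rfl⟩
    exact h μ' h1 h2

end Steps

end QRed


/-! ### Rejection sampling of a Gaussian superposition -/

namespace QRed

open QRed.Expr QRed.Prog

/-- Whether the attempt `t` of copy `k` is the first successful one. -/
def sel (k t : ℕ) (Q : Mem) : ℤ :=
  (if Q (10, k, 0) < 1 then 1 else 0) * (if Q (9, k, t) < 1 then 1 else 0)

/-- The state vector after preparing the value and the flags of an attempt. -/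
noncomputable def attemptPrep (c : Par) (k t : ℕ) (f : Mem → ℂ) : Mem → ℂ :=
  sample (9, k, t) (fun Q => flagProb c (Q (8, k, t))) c.H
    (addTo (8, k, t) (fun _ => -c.R)
      (sample (8, k, t) (fun _ => unifProb (2 * c.R + 1 : ℕ)) c.H f))

/-- The state vector after an attempt. -/
noncomputable def attemptStep (c : Par) (k t : ℕ) (f : Mem → ℂ) : Mem → ℂ :=
  addTo (10, k, 0) (fun Q => if Q (9, k, t) < 1 then 1 else 0)
    (addTo (8, k, t) (fun Q => -(sel k t Q * Q (0, k, 0)))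
      (addTo (0, k, 0) (fun Q => sel k t Q * Q (8, k, t)) (attemptPrep c k t f)))

/-- The state vector after `t` attempts. -/
noncomputable def attempts (c : Par) (k : ℕ) : ℕ → (Mem → ℂ) → Mem → ℂ
  | 0, f => f
  | t + 1, f => attemptStep c k t (attempts c k t f)

section Attempt

variable {c : Par} {r : ℝ} {S : ℕ} {post : Mem → (Mem → ℂ) → Prop} {μ : Mem} {f : Mem → ℂ}
  {k t n₁ n₂ : ℕ}

theorem sample_eight_supp (hc : c.Ok S) (hf : QSupp c k n₁ n₂ t 0 f) {Q : Mem}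
    (hQ : sample (8, k, t) (fun _ => unifProb (2 * c.R + 1 : ℕ)) c.H f Q ≠ 0) :
    0 ≤ Q (8, k, t) ∧ Q (8, k, t) < 2 * c.R + 1 ∧
      Supp c k n₁ n₂ t 0 (Function.update Q (8, k, t) 0) := by
  obtain ⟨h1, h2, h3⟩ := sample_unif_support (by omega) hc.R_le hQ
  exact ⟨h1, by exact_mod_cast h2, hf _ h3⟩

theorem okCell_zero (hc : c.Ok S) {n₃ n₄ : ℕ} {a : Loc} : okCell c k n₁ n₂ n₃ n₄ a 0 :=
  ⟨okVal_zero c _ hc.q_pos, fun _ => rfl, fun _ => by simp⟩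

theorem attemptPrep_supp (hc : c.Ok S) (hf : QSupp c k n₁ n₂ t 0 f) {Q : Mem}
    (hQ : attemptPrep c k t f Q ≠ 0) :
    |Q (8, k, t)| ≤ c.R ∧ 0 ≤ Q (9, k, t) ∧ Q (9, k, t) < 2 ^ c.H ∧
      Supp c k n₁ n₂ t 0 (Function.update (Function.update Q (9, k, t) 0) (8, k, t) 0) := by
  obtain ⟨h1, h2, h3⟩ := sample_support hQ
  simp only [addTo] at h3
  obtain ⟨h4, h5, h6⟩ := sample_eight_supp hc hf h3
  simp only [Function.update_self, Function.update_idem] at h4 h5 h6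
  rw [Function.update_of_ne (by simp)] at h4 h5
  exact ⟨abs_le.2 (by omega), h1, h2, h6⟩

/-- The support of the state during an attempt, for a state `Q` with the entries `j` and `F`
of the arrays `8` and `9`. -/
theorem attemptPrep_supp' (hc : c.Ok S) (hf : QSupp c k n₁ n₂ t 0 f) {Q : Mem}
    (hQ : attemptPrep c k t f Q ≠ 0) : Supp c k n₁ n₂ (t + 1) 0 Q ∧ Q (10, k, 0) ≤ t := by
  obtain ⟨h1, h2, h3, h4⟩ := attemptPrep_supp hc hf hQ
  have hl := h4.2
  have hD := h4.1 (10, k, 0)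
  simp only [Function.update_of_ne (show ((10 : ℕ), (k : ℤ), (0 : ℤ)) ≠ (8, (k : ℤ), (t : ℤ)) by simp),
    Function.update_of_ne (show ((0 : ℕ), (k : ℤ), (0 : ℤ)) ≠ (8, (k : ℤ), (t : ℤ)) by simp),
    Function.update_of_ne (show ((10 : ℕ), (k : ℤ), (0 : ℤ)) ≠ (9, (k : ℤ), (t : ℤ)) by simp),
    Function.update_of_ne (show ((0 : ℕ), (k : ℤ), (0 : ℤ)) ≠ (9, (k : ℤ), (t : ℤ)) by simp)]
    at hl hD
  refine ⟨?_, by have := hD.2.2 rfl; simpa using this⟩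
  have h5 : Supp c k n₁ n₂ (t + 1) 0 (Function.update Q (9, k, t) 0) := by
    refine h4.of_update le_rfl le_rfl (by omega) le_rfl ⟨?_, by simp, by simp⟩ ?_
    · simpa [okVal] using h1
    · simpa using hl
  refine h5.of_update le_rfl le_rfl le_rfl le_rfl ⟨?_, by simp, by simp⟩ hl
  simpa [okVal] using ⟨h2, h3⟩

/-- A selected attempt has counter 0, and by the second clause of `Supp` the output register was
then 0 before the addition. So it now equals the entry of array `8`: it stays within `R`, and the
next subtraction clears that entry. -/
theorem addTo_zero_supp (hc : c.Ok S) (hf : QSupp c k n₁ n₂ t 0 f) {Q : Mem}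
    (hQ : addTo (0, k, 0) (fun Q => sel k t Q * Q (8, k, t)) (attemptPrep c k t f) Q ≠ 0) :
    (∀ a, okCell c k n₁ n₂ (t + 1) 0 a (Q a)) ∧ Q (10, k, 0) ≤ t ∧
      (sel k t Q = 0 → Q (10, k, 0) = 0 → Q (0, k, 0) = 0) ∧
      (sel k t Q ≠ 0 → Q (0, k, 0) = Q (8, k, t)) := by
  simp only [addTo] at hQ
  obtain ⟨h1, h2⟩ := attemptPrep_supp' hc hf hQ
  have hs : ∀ z, sel k t (Function.update Q (0, k, 0) z) = sel k t Q := fun z => by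
    simp [sel]
  have h8 : ∀ z, Function.update Q (0, k, 0) z (8, k, t) = Q (8, k, t) := fun z => by simp
  have h10 : ∀ z, Function.update Q (0, k, 0) z (10, k, 0) = Q (10, k, 0) := fun z => by simp
  rw [hs, h8] at h1 h2
  rw [h10] at h2
  have hl := h1.2
  rw [h10, Function.update_self] at hl
  have hJ := h1.1 (8, k, t)
  rw [h8] at hJ
  have sel01 : sel k t Q = 0 ∨ sel k t Q = 1 ∧ Q (10, k, 0) < 1 := by
    unfold sel
    split_ifs <;> simp_all
  have hD : 0 ≤ Q (10, k, 0) := by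
    have := (h1.1 (10, k, 0)).1
    rw [h10] at this
    simp [okVal] at this
    exact this.1
  have hO : Q (0, k, 0) = if sel k t Q = 0 then Q (0, k, 0) else Q (8, k, t) := by
    split_ifs with h
    · rfl
    · rcases sel01 with h' | ⟨h', h''⟩
      · exact absurd h' h
      · have := hl (by omega)
        rw [h'] at this
        omega
  refine ⟨fun a => ?_, h2, fun h h' => ?_, fun h => by rw [hO, if_neg h]⟩
  · by_cases ha : a = (0, (k : ℤ), 0)
    · subst ha
      rw [hO]
      split_ifs with h
      · have := h1.1 (0, k, 0)
        simpa [h] using this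
      · have := hJ.1
        refine ⟨?_, by simp, by simp⟩
        simpa [okVal] using this
    · have := h1.1 a
      rwa [Function.update_of_ne ha] at this
  · have := hl h'
    simpa [h] using this

theorem addTo_eight_supp (hc : c.Ok S) (hf : QSupp c k n₁ n₂ t 0 f) {Q : Mem}
    (hQ : addTo (8, k, t) (fun Q => -(sel k t Q * Q (0, k, 0)))
      (addTo (0, k, 0) (fun Q => sel k t Q * Q (8, k, t)) (attemptPrep c k t f)) Q ≠ 0) :
    (∀ a, okCell c k n₁ n₂ (t + 1) 0 a (Q a)) ∧ Q (10, k, 0) ≤ t ∧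
      (sel k t Q = 0 → Q (10, k, 0) = 0 → Q (0, k, 0) = 0) := by
  rw [addTo] at hQ
  obtain ⟨h1, h2, h3, h4⟩ := addTo_zero_supp hc hf hQ
  have hs : ∀ z, sel k t (Function.update Q (8, k, t) z) = sel k t Q := fun z => by
    simp [sel]
  have h8 : ∀ z, Function.update Q (8, k, t) z (0, k, 0) = Q (0, k, 0) := fun z => by simp
  have h10 : ∀ z, Function.update Q (8, k, t) z (10, k, 0) = Q (10, k, 0) := fun z => by simp
  simp only [hs, h8, h10, Function.update_self] at h1 h2 h3 h4
  refine ⟨fun a => ?_, h2, h3⟩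
  by_cases ha : a = (8, (k : ℤ), (t : ℤ))
  · subst ha
    have h5 := h1 (8, k, t)
    rw [Function.update_self] at h5
    have sel01 : sel k t Q = 0 ∨ sel k t Q = 1 := by
      unfold sel
      split_ifs <;> simp
    rcases sel01 with h' | h'
    · simpa [h'] using h5
    · have h6 := h4 (by omega)
      rw [h'] at h6
      have : Q (8, k, t) = 0 := by omega
      rw [this]
      exact okCell_zero hc
  · have := h1 a
    rwa [Function.update_of_ne ha] at this

theorem attemptStep_supp (hc : c.Ok S) (htT : t < c.T) (hf : QSupp c k n₁ n₂ t 0 f) :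
    QSupp c k n₁ n₂ (t + 1) 0 (attemptStep c k t f) := by
  intro Q hQ
  rw [attemptStep, addTo] at hQ
  obtain ⟨h1, h2, h3⟩ := addTo_eight_supp hc hf hQ
  have h8 : ∀ z, Function.update Q (10, k, 0) z (0, k, 0) = Q (0, k, 0) := fun z => by simp
  have h9 : ∀ z, Function.update Q (10, k, 0) z (9, k, t) = Q (9, k, t) := fun z => by simp
  simp only [h9, h8, Function.update_self] at h1 h2 h3
  have hD : 0 ≤ Q (10, k, 0) - (if Q (9, k, t) < 1 then 1 else 0) := by
    have := (h1 (10, k, 0)).1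
    simp [okVal] at this
    split_ifs at this ⊢ <;> omega
  refine ⟨fun a => ?_, fun h => ?_⟩
  · by_cases ha : a = (10, (k : ℤ), 0)
    · subst ha
      refine ⟨?_, by simp, fun _ => ?_⟩
      · simp only [okVal]
        norm_num
        split_ifs at hD h2 <;> omega
      · norm_num
        split_ifs at hD h2 <;> omega
    · have := h1 a
      rwa [Function.update_of_ne ha] at this
  · split_ifs at hD h3 with h0
    · omega
    · exact h3 (by simp [sel, h0]) (by omega)

theorem attempts_supp (hc : c.Ok S) (ht : t ≤ c.T) (hf : QSupp c k n₁ n₂ 0 0 f) :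
    QSupp c k n₁ n₂ t 0 (attempts c k t f) := by
  induction t with
  | zero => exact hf
  | succ t ih => exact attemptStep_supp hc (by omega) (ih (by omega))

theorem WP.attempt (hS : 1 ≤ S) (hE : QEnv c S μ) (hc : c.Ok S)
    (hk : μ (30, 0, 0) = k) (ht : μ (31, 0, 0) = t) (hf : QSupp c k n₁ n₂ t 0 f)
    (h : ∀ μ', Same {40, 41} μ μ' → Bdd S μ' → post μ' (attemptStep c k t f)) :
    WP r S attempt post μ f := by
  have d30 : ∀ μ : Mem, (rd 30 : CExpr).DigitsOk S r μ := fun _ => by simp [Expr.DigitsOk, rd]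
  have d31 : ∀ μ : Mem, (rd 31 : CExpr).DigitsOk S r μ := fun _ => by simp [Expr.DigitsOk, rd]
  have hRS : 2 ^ c.H < 2 ^ S := Nat.pow_lt_pow_right (by norm_num) hc.H_lt
  refine WP.seq (WP.sampleUnif (N := 2 * c.R + 1) hS hE.bdd (by norm_num) hk ht hE.powH
    (fun μ' hs => (hs _ (by simp)).trans hE.H) (fun _ => by simp [Expr.DigitsOk, rd]) hc.H_lt
    (by norm_num) (by rw [hE.N]; push_cast; rfl) (fun Q hQ => ?_) fun μ1 hs1 hb1 => ?_)
  · have h0 := hf Q hQ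
    exact ⟨h0.bdd hc, ((h0.1 (8, k, t)).2.2 rfl).2.2.1 (by simp) le_rfl, h0.scratch⟩
  have hE1 : QEnv c S μ1 := hE.same (hs1.mono (by decide)) hb1
  have k1 : μ1 (30, 0, 0) = k := (hs1 _ (by simp)).trans hk
  have t1 : μ1 (31, 0, 0) = t := (hs1 _ (by simp)).trans ht
  refine WP.seq (WP.qadd (8, k, t) (fun _ => -c.R) hS hb1 (d30 _) (d31 _) (fun Q hQ => ?_)
    (by simp [Expr.eval, rd, k1, t1]) (fun _ => by simp [Expr.DigitsOk, rd])
    (fun Q => by simp [Expr.eval, rd, joint, hE1.R]) ?_)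
  · obtain ⟨h1, h2, h3⟩ := sample_eight_supp hc hf hQ
    have := hc.R_le
    exact (h3.bdd hc).of_update (by omega)
  refine WP.seq (WP.sampleFlags hS hE1 hc k1 t1 (fun Q hQ => ?_) fun μ2 hs2 hb2 => ?_)
  · simp only [addTo] at hQ
    obtain ⟨h1, h2, h3⟩ := sample_eight_supp hc hf hQ
    simp only [Function.update_self, Function.update_idem] at h1 h2 h3
    have := hc.R_le
    refine ⟨(h3.bdd hc).of_update (by omega), ?_, ?_⟩
    · have := ((h3.1 (9, k, t)).2.2 rfl).2.2.1 (by simp) le_rfl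
      simpa using this
    · have := h3.scratch
      simpa using this
  have hs12 := hs1.trans hs2
  have hE2 : QEnv c S μ2 := hE1.same (hs2.mono (by decide)) hb2
  have k2 : μ2 (30, 0, 0) = k := (hs2 _ (by simp)).trans k1
  have t2 : μ2 (31, 0, 0) = t := (hs2 _ (by simp)).trans t1
  refine WP.seq (WP.qadd (0, k, 0) (fun Q => sel k t Q * Q (8, k, t)) hS hb2 (d30 _) trivial
    (fun Q hQ => (attemptPrep_supp' hc hf hQ).1.bdd hc) (by simp [Expr.eval, rd, k2])
    (fun _ => by simp [Expr.DigitsOk, rd, selected, cur])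
    (fun Q => by simp [Expr.eval, rd, joint, selected, cur, k2, t2, sel]) ?_)
  refine WP.seq (WP.qadd (8, k, t) (fun Q => -(sel k t Q * Q (0, k, 0))) hS hb2 (d30 _) (d31 _)
    (fun Q hQ a => ((addTo_zero_supp hc hf hQ).1 a).1.lt hc) (by simp [Expr.eval, rd, k2, t2])
    (fun _ => by simp [Expr.DigitsOk, rd, selected, cur, outReg])
    (fun Q => by simp [Expr.eval, rd, joint, selected, cur, outReg, k2, t2, sel]) ?_)
  refine WP.qadd (10, k, 0) (fun Q => if Q (9, k, t) < 1 then 1 else 0) hS hb2 (d30 _) trivial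
    (fun Q hQ a => ((addTo_eight_supp hc hf hQ).1 a).1.lt hc) (by simp [Expr.eval, rd, k2])
    (fun _ => by simp [Expr.DigitsOk, rd, cur])
    (fun Q => by simp [Expr.eval, rd, joint, cur, k2, t2]) ?_
  exact h μ2 hs12 hb2

theorem WP.attempts (hS : 1 ≤ S) (hE : QEnv c S μ) (hc : c.Ok S)
    (hk : μ (30, 0, 0) = k) (hf : QSupp c k n₁ n₂ 0 0 f)
    (h : ∀ μ', Same {31, 40, 41} μ μ' → Bdd S μ' → post μ' (QRed.attempts c k c.T f)) :
    WP r S (.loop 31 (rd 25) QRed.attempt) post μ f := by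
  refine WP.loop (fun i μ' f' => Same {31, 40, 41} μ μ' ∧ Bdd S μ' ∧
    f' = QRed.attempts c k i f) c.T hS hE.bdd (by simp [Expr.DigitsOk, rd]) hE.T hc.T_lt.le
    ⟨Same.refl _ _, hE.bdd, rfl⟩ ?_ ?_
  · rintro i hi μ1 f1 ⟨hs, hb, rfl⟩
    have hb' := hb.nat (31, 0, 0) (hi.trans hc.T_lt)
    have hs' : Same {31, 40, 41} μ (Function.update μ1 (31, 0, 0) (i : ℤ)) := hs.update (by simp) _
    have h31 : Function.update μ1 (31, 0, 0) (i : ℤ) (31, 0, 0) = i := Function.update_self ..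
    generalize Function.update μ1 (31, 0, 0) (i : ℤ) = μ2 at hb' hs' h31
    refine WP.attempt hS (hE.same hs'.qVars hb') hc ((hs' _ (by simp)).trans hk) h31
      (attempts_supp hc hi.le hf) ?_
    intro μ' h1 h2
    exact ⟨hs'.trans (h1.mono (by decide)), h2, rfl⟩
  · rintro μ' f' ⟨h1, h2, rfl⟩
    exact h μ' h1 h2

end Attempt

/-! ### Locating the shifted vector -/

/-- The inner product of the row `i` of `A` with the first `d` coordinates in copy `k`, minus
`j` times the entry of `b`. -/
def rowVal (c : Par) (k i : ℕ) (Q : Mem) : ℤ :=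
  (∑ l ∈ Finset.range c.n, c.A i l * Q (1, k, l)) - c.b i * Q (0, k, 0)

/-- The state vector after writing the number of the interval for coordinate `i`. -/
def locateStep (c : Par) (k i : ℕ) (f : Mem → ℂ) : Mem → ℂ :=
  addTo (11, k, i) (fun Q => 8 * ((Q (7, k, i) + rowVal c k i Q) % c.q) / c.q) f

/-- The state vector after writing the numbers of the intervals for the first `i` coordinates. -/
def locates (c : Par) (k : ℕ) : ℕ → (Mem → ℂ) → Mem → ℂ
  | 0, f => f
  | i + 1, f => locateStep c k i (locates c k i f)

section Locate

variable {c : Par} {r : ℝ} {S : ℕ} {post : Mem → (Mem → ℂ) → Prop} {μ : Mem} {f : Mem → ℂ}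
  {k i n₁ n₂ n₃ : ℕ}

theorem locates_supp (hc : c.Ok S) (hf : QSupp c k n₁ n₂ n₃ 0 f) :
    QSupp c k n₁ n₂ n₃ i (locates c k i f) := by
  induction i with
  | zero => exact hf
  | succ i ih =>
    intro Q hQ
    have h := ih _ hQ
    have hq : (0 : ℤ) < c.q := by exact_mod_cast hc.q_pos
    refine h.of_update le_rfl le_rfl le_rfl (by omega) ⟨?_, by simp, by simp⟩ ?_
    · have h0 := ((h.1 (11, k, i)).2.2 rfl).2.2.2.2 rfl le_rfl
      rw [Function.update_self, sub_eq_zero] at h0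
      rw [h0]
      have h1 := fun y : ℤ => Int.emod_nonneg y hq.ne'
      have h2 := fun y : ℤ => Int.emod_lt_of_pos y hq
      simp only [okVal]
      norm_num
      refine ⟨Int.ediv_nonneg (mul_nonneg (by norm_num) (h1 _)) hq.le, ?_⟩
      exact Int.ediv_le_of_le_mul hq (by linarith [h2 (Q (7, k, i) +
        rowVal c k i (Function.update Q (11, k, i) 0))])
    · have := h.2
      rwa [Function.update_of_ne (by simp), Function.update_of_ne (by simp)] at this

theorem addTo_addTo {a : Loc} {w w' : Mem → ℤ} :
    addTo a w (addTo a w' f) = addTo a (fun Q => w Q + w' Q) f := by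
  funext Q
  simp only [addTo, Function.update_self, Function.update_idem]
  congr 2
  ring

theorem addTo_zero {a : Loc} : addTo a (fun _ => 0) f = f := by
  funext Q
  simp [addTo]

/-- The partial sums of `addRow`. -/
def partRow (c : Par) (k i d : ℕ) (Q : Mem) : ℤ :=
  ∑ l ∈ Finset.range d, c.A i l * Q (1, k, l)

theorem abs_partRow_le (hc : c.Ok S) (hi : i < c.m) {Q : Mem} (hQ : ∀ l : ℕ, 0 ≤ Q (1, k, l) ∧
    Q (1, k, l) < c.q) {d : ℕ} (hd : d ≤ c.n) : 0 ≤ partRow c k i d Q ∧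
      partRow c k i d Q ≤ c.n * c.q * c.q := by
  have h1 : ∀ l ∈ Finset.range d, 0 ≤ c.A i l * Q (1, k, l) ∧ c.A i l * Q (1, k, l) ≤ c.q * c.q := by
    intro l hl
    have h2 := hc.A i l hi (by simp at hl; omega)
    exact ⟨mul_nonneg h2.1 (hQ l).1, mul_le_mul h2.2.le (hQ l).2.le (hQ l).1 (by positivity)⟩
  refine ⟨Finset.sum_nonneg fun l hl => (h1 l hl).1, ?_⟩
  calc partRow c k i d Q ≤ ∑ l ∈ Finset.range d, (c.q : ℤ) * c.q :=
        Finset.sum_le_sum fun l hl => (h1 l hl).2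
    _ = d * (c.q * c.q) := by simp
    _ ≤ c.n * (c.q * c.q) := by
      refine mul_le_mul_of_nonneg_right (by exact_mod_cast hd) (by positivity)
    _ = _ := by ring

theorem abs_rowVal_sub_le (hc : c.Ok S) (hi : i < c.m) {Q : Mem} (hQ : ∀ l : ℕ, 0 ≤ Q (1, k, l) ∧
    Q (1, k, l) < c.q) (hO : |Q (0, k, 0)| ≤ c.R) {d : ℕ} (hd : d ≤ c.n) :
    |rowVal c k i Q - partRow c k i d Q| ≤ c.n * c.q * c.q + c.q * c.R := by
  have h1 := abs_partRow_le hc hi hQ le_rfl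
  have h2 := abs_partRow_le hc hi hQ hd
  have h3 : |c.b i * Q (0, k, 0)| ≤ c.q * c.R := by
    rw [abs_mul, abs_of_nonneg (hc.b i hi).1]
    exact mul_le_mul (hc.b i hi).2.le hO (abs_nonneg _) (by positivity)
  have h4 : rowVal c k i Q = partRow c k i c.n Q - c.b i * Q (0, k, 0) := rfl
  rw [abs_le] at h3 ⊢
  constructor <;> linarith

/-- The partial sums are accumulated as integers, without reduction modulo `q`, and the cost is
charged over the support; hence boundedness is demanded after every number `d` of summands. -/
theorem WP.addRow {e : ℤ} (hS : 1 ≤ S) (hE : QEnv c S μ) (hc : c.Ok S) (hi : i < c.m)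
    (hk : μ (30, 0, 0) = k) (hiv : μ (31, 0, 0) = i)
    (hf : ∀ d ≤ c.n, QBdd S (addTo (7, k, i) (fun Q => e * partRow c k i d Q) f))
    (h : ∀ μ', Same {32} μ μ' → Bdd S μ' → post μ' (addTo (7, k, i) (fun Q => e * rowVal c k i Q) f)) :
    WP r S (QRed.addRow e) post μ f := by
  have d30 : ∀ μ : Mem, (rd 30 : CExpr).DigitsOk S r μ := fun _ => by simp [Expr.DigitsOk, rd]
  have d31 : ∀ μ : Mem, (rd 31 : CExpr).DigitsOk S r μ := fun _ => by simp [Expr.DigitsOk, rd]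
  refine WP.seq (WP.loop (fun d μ' f' => Same {32} μ μ' ∧ Bdd S μ' ∧
    f' = addTo (7, k, i) (fun Q => e * partRow c k i d Q) f) c.n hS hE.bdd
    (by simp [Expr.DigitsOk, rd]) hE.n hc.n_lt.le ⟨Same.refl _ _, hE.bdd, ?_⟩ ?_ ?_)
  · simp [partRow, addTo_zero]
  · rintro d hd μ1 f1 ⟨hs, hb, rfl⟩
    have hb' := hb.nat (32, 0, 0) (hd.trans hc.n_lt)
    have hs' : Same {32} μ (Function.update μ1 (32, 0, 0) (d : ℤ)) := hs.update (by simp) _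
    have h32 : Function.update μ1 (32, 0, 0) (d : ℤ) (32, 0, 0) = d := Function.update_self ..
    generalize Function.update μ1 (32, 0, 0) (d : ℤ) = μ2 at hb' hs' h32
    have k2 : μ2 (30, 0, 0) = k := (hs' _ (by simp)).trans hk
    have i2 : μ2 (31, 0, 0) = i := (hs' _ (by simp)).trans hiv
    have hE2 : QEnv c S μ2 := hE.same (hs'.mono (by decide)) hb'
    refine WP.qadd (7, k, i) (fun Q => e * (c.A i d * Q (1, k, d))) hS hb' (d30 _) (d31 _)
      (hf d hd.le) (by simp [Expr.eval, rd, k2, i2])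
      (fun _ => by simp [Expr.DigitsOk, rd])
      (fun Q => by simp [Expr.eval, rd, joint, k2, i2, h32, hE2.A i d hi hd]) ?_
    refine ⟨hs', hb', ?_⟩
    rw [addTo_addTo]
    congr 1
    funext Q
    rw [partRow, partRow, Finset.sum_range_succ]
    ring
  · rintro μ1 f1 ⟨hs', hb', rfl⟩
    have k2 : μ1 (30, 0, 0) = k := (hs' _ (by simp)).trans hk
    have i2 : μ1 (31, 0, 0) = i := (hs' _ (by simp)).trans hiv
    have hE2 : QEnv c S μ1 := hE.same (hs'.mono (by decide)) hb'
    refine WP.qadd (7, k, i) (fun Q => -e * (c.b i * Q (0, k, 0))) hS hb' (d30 _) (d31 _)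
      (hf _ le_rfl) (by simp [Expr.eval, rd, k2, i2])
      (fun _ => by simp [Expr.DigitsOk, rd, outReg])
      (fun Q => by simp [Expr.eval, rd, joint, k2, i2, outReg, hE2.b i hi]) ?_
    rw [addTo_addTo]
    convert h μ1 hs' hb' using 2
    funext Q
    rw [rowVal, partRow]
    ring

/-- Array `7` temporarily holds the mask plus the row value. The row value does not involve arrays
`7` and `11`, so after the interval number has been copied it can be subtracted again, and the net
effect is an addition to array `11` alone. The temporary integers are controlled by `n q² + q R`,
which is why this expression occurs in `Par.Ok.size`. -/
theorem WP.locate (hS : 1 ≤ S) (hE : QEnv c S μ) (hc : c.Ok S) (hi : i < c.m)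
    (hk : μ (30, 0, 0) = k) (hiv : μ (31, 0, 0) = i) (hf : QSupp c k n₁ n₂ n₃ i f)
    (h : ∀ μ', Same {32} μ μ' → Bdd S μ' → post μ' (locateStep c k i f)) :
    WP r S QRed.locate post μ f := by
  have hsz := hc.size
  have hq : (0 : ℤ) < c.q := by exact_mod_cast hc.q_pos
  have n17 : ∀ {x : ℕ} {k' l : ℤ}, x ≠ 7 → (x, k', l) ≠ (7, (k : ℤ), (i : ℤ)) := by
    intro x k' l hx h
    exact hx (congrArg Prod.fst h)
  have n11 : ∀ {x : ℕ} {k' l : ℤ}, x ≠ 11 → (x, k', l) ≠ (11, (k : ℤ), (i : ℤ)) := by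
    intro x k' l hx h
    exact hx (congrArg Prod.fst h)
  have rowC : ∀ d z Q, partRow c k i d (Function.update Q (7, k, i) z) = partRow c k i d Q :=
    fun d z Q => by simp [partRow]
  have rowC' : ∀ z Q, rowVal c k i (Function.update Q (7, k, i) z) = rowVal c k i Q :=
    fun z Q => by simp [rowVal]
  have rowD : ∀ d z Q, partRow c k i d (Function.update Q (11, k, i) z) = partRow c k i d Q :=
    fun d z Q => by simp [partRow]
  have rowD' : ∀ z Q, rowVal c k i (Function.update Q (11, k, i) z) = rowVal c k i Q :=
    fun z Q => by simp [rowVal]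
  have small : ∀ {Q : Mem} {z : ℤ}, Supp c k n₁ n₂ n₃ i (Function.update Q (7, k, i) z) →
      (∀ l : ℕ, 0 ≤ Q (1, k, l) ∧ Q (1, k, l) < c.q) ∧ |Q (0, k, 0)| ≤ c.R ∧ 0 ≤ z ∧ z < c.q := by
    intro Q z hQ
    refine ⟨fun l => ?_, ?_, ?_⟩
    · have := (hQ.1 (1, k, l)).1
      rw [Function.update_of_ne (n17 (by norm_num))] at this
      simpa [okVal] using this
    · have := (hQ.1 (0, k, 0)).1
      rw [Function.update_of_ne (n17 (by norm_num))] at this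
      simpa [okVal] using this
    · have := (hQ.1 (7, k, i)).1
      rw [Function.update_self] at this
      simpa [okVal] using this
  have hw0 : ∀ y : ℤ, 0 ≤ 8 * (y % c.q) / c.q ∧ 8 * (y % c.q) / c.q ≤ 8 := by
    intro y
    have h1 := Int.emod_nonneg y hq.ne'
    have h2 := Int.emod_lt_of_pos y hq
    exact ⟨Int.ediv_nonneg (mul_nonneg (by norm_num) h1) hq.le,
      Int.ediv_le_of_le_mul hq (by linarith)⟩
  refine WP.seq (WP.addRow hS hE hc hi hk hiv (fun d hd Q hQ => ?_) fun μ1 hs1 hb1 => ?_)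
  · simp only [addTo, rowC, one_mul] at hQ
    have h1 := hf _ hQ
    obtain ⟨h2, h3, h4, h5⟩ := small h1
    have h6 := abs_partRow_le hc hi h2 hd
    refine (h1.bdd hc).of_update ?_
    zify at hsz
    have h7 := mul_nonneg hq.le (Int.natCast_nonneg c.R)
    zify
    rw [abs_lt]
    constructor <;> linarith
  have hE1 : QEnv c S μ1 := hE.same (hs1.mono (by decide)) hb1
  have k1 : μ1 (30, 0, 0) = k := (hs1 _ (by simp)).trans hk
  have i1 : μ1 (31, 0, 0) = i := (hs1 _ (by simp)).trans hiv
  simp only [one_mul]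
  refine WP.seq (WP.qadd (11, k, i) (fun Q => 8 * (Q (7, k, i) % c.q) / c.q) hS hb1
    (by simp [Expr.DigitsOk, rd]) (by simp [Expr.DigitsOk, rd]) (fun Q hQ => ?_)
    (by simp [Expr.eval, rd, k1, i1]) (fun _ => by simp [Expr.DigitsOk, rd, cur])
    (fun Q => by simp [Expr.eval, rd, joint, cur, k1, i1, hE1.q]) ?_)
  · simp only [addTo, rowC'] at hQ
    have h1 := hf _ hQ
    obtain ⟨h2, h3, h4, h5⟩ := small h1
    have h6 := abs_rowVal_sub_le hc hi h2 h3 (Nat.zero_le _)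
    simp only [partRow, Finset.range_zero, Finset.sum_empty, sub_zero] at h6
    rw [abs_le] at h6
    refine (h1.bdd hc).of_update ?_
    zify at hsz
    zify
    rw [abs_lt]
    constructor <;> linarith
  refine WP.addRow hS hE1 hc hi k1 i1 (fun d hd Q hQ => ?_) fun μ2 hs2 hb2 => ?_
  · simp only [addTo, rowC', rowC, rowD', Function.update_of_ne (n17 (show 11 ≠ 7 by norm_num)),
      Function.update_of_ne (n11 (show 7 ≠ 11 by norm_num)), Function.update_self] at hQ
    rw [Function.update_comm (n11 (by norm_num)), Function.update_idem] at hQ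
    have h1 := hf _ hQ
    have h8 := hw0 (Q (7, k, i) - -1 * partRow c k i d Q)
    generalize hx : 8 * ((Q (7, k, i) - -1 * partRow c k i d Q) % c.q) / c.q = x at h1 h8
    generalize hz : Q (7, k, i) - -1 * partRow c k i d Q - rowVal c k i Q = z at h1
    have h1' := h1
    rw [Function.update_comm (show ((11 : ℕ), (k : ℤ), (i : ℤ)) ≠ (7, (k : ℤ), (i : ℤ)) from
      n17 (by norm_num))] at h1'
    obtain ⟨h2, h3, h4, h5⟩ := small h1
    replace h2 : ∀ l : ℕ, 0 ≤ Q (1, k, l) ∧ Q (1, k, l) < c.q := fun l => by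
      have := h2 l
      rwa [Function.update_of_ne (n11 (by norm_num))] at this
    rw [Function.update_of_ne (n11 (by norm_num))] at h3
    have h6 := abs_rowVal_sub_le hc hi h2 h3 hd
    rw [abs_le] at h6
    have h7 := ((h1.1 (11, k, i)).2.2 rfl).2.2.2.2 rfl le_rfl
    rw [Function.update_of_ne (n17 (by norm_num)), Function.update_self] at h7
    have h9 : ∀ z, Bdd S (Function.update Q (7, k, i) z) → Bdd S Q := fun z hz => by
      refine hz.of_update ?_
      zify at hsz
      zify
      rw [abs_lt]
      constructor <;> linarith
    refine h9 z (Bdd.of_update (h1'.bdd hc) ?_)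
    rw [Function.update_of_ne (n17 (by norm_num))]
    have h10 : Q (11, k, i) = x := by linarith
    have h11 := Nat.zero_le (c.n * c.q * c.q)
    have h12 := Nat.zero_le (c.q * c.R)
    rw [h10]
    omega
  · convert h μ2 (hs1.trans hs2) hb2 using 1
    funext Q
    simp only [locateStep, addTo, rowC', rowD', Function.update_of_ne (n17 (show 11 ≠ 7 by norm_num)),
      Function.update_of_ne (n11 (show 7 ≠ 11 by norm_num)), Function.update_self]
    rw [Function.update_comm (n11 (by norm_num)), Function.update_idem,
      Function.update_comm (n17 (by norm_num))]
    rw [show Q (7, k, i) - -1 * rowVal c k i Q - rowVal c k i Q = Q (7, k, i) by ring,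
      Function.update_eq_self, show Q (7, k, i) - -1 * rowVal c k i Q =
        Q (7, k, i) + rowVal c k i Q by ring]

theorem WP.locates (hS : 1 ≤ S) (hE : QEnv c S μ) (hc : c.Ok S)
    (hk : μ (30, 0, 0) = k) (hf : QSupp c k n₁ n₂ n₃ 0 f)
    (h : ∀ μ', Same {31, 32} μ μ' → Bdd S μ' → post μ' (QRed.locates c k c.m f)) :
    WP r S (.loop 31 (rd 3) QRed.locate) post μ f := by
  refine WP.loop (fun i μ' f' => Same {31, 32} μ μ' ∧ Bdd S μ' ∧
    f' = QRed.locates c k i f) c.m hS hE.bdd (by simp [Expr.DigitsOk, rd]) hE.m hc.m_lt.le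
    ⟨Same.refl _ _, hE.bdd, rfl⟩ ?_ ?_
  · rintro i hi μ1 f1 ⟨hs, hb, rfl⟩
    have hb' := hb.nat (31, 0, 0) (hi.trans hc.m_lt)
    have hs' : Same {31, 32} μ (Function.update μ1 (31, 0, 0) (i : ℤ)) := hs.update (by simp) _
    have h31 : Function.update μ1 (31, 0, 0) (i : ℤ) (31, 0, 0) = i := Function.update_self ..
    generalize Function.update μ1 (31, 0, 0) (i : ℤ) = μ2 at hb' hs' h31
    refine WP.locate hS (hE.same (hs'.mono (by decide)) hb') hc hi ((hs' _ (by simp)).trans hk) h31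
      (locates_supp hc hf) ?_
    intro μ' h1 h2
    exact ⟨hs'.trans (h1.mono (by decide)), h2, rfl⟩
  · rintro μ' f' ⟨h1, h2, rfl⟩
    exact h μ' h1 h2

end Locate

/-! ### All copies -/

/-- The state vector after preparing copy `k`. -/
noncomputable def copyStep (c : Par) (k : ℕ) (f : Mem → ℂ) : Mem → ℂ :=
  locates c k c.m (attempts c k c.T (sampleRow c 7 k c.m (sampleRow c 1 k c.n f)))

/-- The state vector after preparing the first `k` copies. -/
noncomputable def copies (c : Par) : ℕ → (Mem → ℂ) → Mem → ℂ
  | 0, f => f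
  | k + 1, f => copyStep c k (copies c k f)

section Copies

variable {c : Par} {r : ℝ} {S : ℕ} {post : Mem → (Mem → ℂ) → Prop} {μ : Mem} {f : Mem → ℂ} {k : ℕ}

theorem copyStep_supp (hc : c.Ok S) (hf : QSupp c k 0 0 0 0 f) :
    QSupp c (k + 1) 0 0 0 0 (copyStep c k f) := fun Q hQ =>
  (locates_supp hc (attempts_supp hc le_rfl
    (sampleRow_seven_supp hc (sampleRow_one_supp hc hf))) Q hQ).next

theorem copies_supp (hc : c.Ok S) (hf : QSupp c 0 0 0 0 0 f) :
    QSupp c k 0 0 0 0 (copies c k f) := by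
  induction k with
  | zero => exact hf
  | succ k ih => exact copyStep_supp hc ih

theorem WP.quantumPart (hS : 1 ≤ S) (hE : QEnv c S μ) (hc : c.Ok S) (hf : QSupp c 0 0 0 0 0 f)
    (h : ∀ μ', post μ' (copies c c.ℓ f)) :
    WP r S QRed.quantumPart post μ f := by
  refine WP.loop (fun k μ' f' => Same qVars μ μ' ∧ Bdd S μ' ∧
    f' = copies c k f) c.ℓ hS hE.bdd (by simp [Expr.DigitsOk, rd]) hE.ℓ hc.ℓ_lt.le
    ⟨Same.refl _ _, hE.bdd, rfl⟩ ?_ ?_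
  · rintro k hk μ1 f1 ⟨hs, hb, rfl⟩
    have hb' := hb.nat (30, 0, 0) (hk.trans hc.ℓ_lt)
    have hs' : Same qVars μ (Function.update μ1 (30, 0, 0) (k : ℤ)) := hs.update (by simp) _
    have h30 : Function.update μ1 (30, 0, 0) (k : ℤ) (30, 0, 0) = k := Function.update_self ..
    generalize Function.update μ1 (30, 0, 0) (k : ℤ) = μ2 at hb' hs' h30
    have hE2 : QEnv c S μ2 := hE.same hs' hb'
    have s0 := copies_supp hc hf (k := k)
    have drd : ∀ x, ∀ μ : Mem, (rd x : CExpr).DigitsOk S r μ := fun _ _ => by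
      simp [Expr.DigitsOk, rd]
    refine WP.seq (WP.sampleRow hS hE2 hc (by norm_num) h30 (drd 1) hE2.n hc.n_lt
      (fun i hi Q hQ => ?_) fun μ3 hs3 hb3 => ?_)
    · have h0 := sampleRow_one_supp hc s0 Q hQ
      exact ⟨h0.bdd hc, ((h0.1 (1, k, i)).2.2 rfl).1 rfl le_rfl, h0.scratch⟩
    have hE3 := hE2.same (hs3.qVars) hb3
    have k3 : μ3 (30, 0, 0) = k := (hs3 _ (by simp)).trans h30
    refine WP.seq (WP.sampleRow hS hE3 hc (by norm_num) k3 (drd 3) hE3.m hc.m_lt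
      (fun i hi Q hQ => ?_) fun μ4 hs4 hb4 => ?_)
    · have h0 := sampleRow_seven_supp hc (sampleRow_one_supp hc s0) Q hQ
      exact ⟨h0.bdd hc, ((h0.1 (7, k, i)).2.2 rfl).2.1 rfl le_rfl, h0.scratch⟩
    have hE4 := hE3.same (hs4.qVars) hb4
    have k4 : μ4 (30, 0, 0) = k := (hs4 _ (by simp)).trans k3
    refine WP.seq (WP.attempts hS hE4 hc k4 (sampleRow_seven_supp hc (sampleRow_one_supp hc s0))
      fun μ5 hs5 hb5 => ?_)
    have hE5 := hE4.same (hs5.qVars) hb5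
    have k5 : μ5 (30, 0, 0) = k := (hs5 _ (by simp)).trans k4
    refine WP.locates hS hE5 hc k5 (attempts_supp hc le_rfl
      (sampleRow_seven_supp hc (sampleRow_one_supp hc s0))) fun μ6 hs6 hb6 => ?_
    exact ⟨(((hs'.trans hs3.qVars).trans hs4.qVars).trans hs5.qVars).trans hs6.qVars, hb6, rfl⟩
  · rintro μ' f' ⟨-, -, rfl⟩
    exact h μ'

end Copies

end QRed


namespace QRed

open QRed.Expr QRed.Prog

/-! ## The classical part -/

/-- Fixed point approximation of `V * ∑ i, (-1 / w) ^ i / (2 * i + 1)`, by Horner's rule from the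
term with index `L - 1`. -/
def altFix (V w : ℤ) (L : ℕ) : ℕ → ℤ
  | 0 => 0
  | x + 1 => V / (2 * ((L : ℤ) - 1 - x) + 1) - altFix V w L x / w

/-- Fixed point approximation of `2 ^ L * π`. -/
def piFix (L : ℕ) : ℤ := 2 * altFix (2 ^ L) 4 L L + 4 * altFix (2 ^ L) 9 L L / 3

/-- Fixed point approximations of `exp (-2 π 2 ^ i / (r² 2 ^ G))`, for `D / V ≈ r`. -/
def expFix (V D p W : ℤ) : ℕ → ℤ
  | 0 => max 0 (V - 2 * (p * (V * V)) / (D * D * W))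
  | i + 1 => expFix V D p W i * expFix V D p W i / V

/-- Division by `w ≥ 4` is contracting: a bound `2 V` turns into `V + 2 V / 4` up to rounding, which
is again at most `2 V`. -/
theorem abs_altFix_le {V w : ℤ} (hV : 1 ≤ V) (hw : w = 4 ∨ w = 9) {L x : ℕ} (hx : x ≤ L) :
    |altFix V w L x| ≤ 2 * V := by
  induction x with
  | zero => simp [altFix]; omega
  | succ x ih =>
    have ih := abs_le.1 (ih (by omega))
    have h1 : 0 ≤ V / (2 * ((L : ℤ) - 1 - x) + 1) := Int.ediv_nonneg (by omega) (by omega)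
    have h2 : V / (2 * ((L : ℤ) - 1 - x) + 1) ≤ V := Int.ediv_le_self _ (by omega)
    rw [altFix, abs_le]
    rcases hw with rfl | rfl <;> constructor <;> omega

theorem expFix_bounds {V D p W : ℤ} (hV : 0 < V) (hp : 0 ≤ p) (hW : 0 ≤ W) (i : ℕ) :
    0 ≤ expFix V D p W i ∧ expFix V D p W i ≤ V := by
  induction i with
  | zero =>
    have : 0 ≤ 2 * (p * (V * V)) / (D * D * W) :=
      Int.ediv_nonneg (by positivity) (mul_nonneg (mul_self_nonneg D) hW)
    simp only [expFix]
    omega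
  | succ i ih =>
    simp only [expFix]
    refine ⟨Int.ediv_nonneg (mul_nonneg ih.1 ih.1) hV.le, Int.ediv_le_of_le_mul hV ?_⟩
    exact mul_le_mul ih.2 ih.2 ih.1 hV.le

section Classical

variable {r : ℝ} {S : ℕ} {post : Mem → (Mem → ℂ) → Prop} {μ : Mem} {f : Mem → ℂ}

theorem WP.set {x : ℕ} {v : CExpr} (z : ℤ) (hS : 1 ≤ S) (hμ : Bdd S μ)
    (hv : v.DigitsOk S r μ) (he : v.eval r μ = z) (hz : |z| < 2 ^ S)
    (h : ∀ μ', Same {x} μ μ' → Bdd S μ' → μ' (x, 0, 0) = z → post μ' f) :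
    WP r S (Prog.set x v) post μ f := by
  refine WP.assign hS hμ trivial trivial hv ?_
  rw [he]
  refine h _ ((Same.refl _ _).update (by simp) _) (hμ.update _ ?_) (Function.update_self ..)
  zify; exact hz

theorem digitsOk_rd {L : Type} (x : L) (μ : L × ℤ × ℤ → ℤ) :
    (rd x : Expr L).DigitsOk S r μ := by simp [Expr.DigitsOk, rd]

theorem eval_rd {L : Type} (x : L) (μ : L × ℤ × ℤ → ℤ) :
    (rd x : Expr L).eval r μ = μ (x, 0, 0) := rfl

theorem natCast_lt_two_pow {a S : ℕ} (h : a < S) : |(a : ℤ)| < 2 ^ S := by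
  rw [abs_of_nonneg (by positivity)]
  exact_mod_cast h.trans Nat.lt_two_pow_self

/-- The candidate grows by 1 as long as its successor squared is at most `κ`, so after `i` rounds it
is `min i (Nat.sqrt κ)`, and `κ` rounds suffice. -/
theorem WP.progSqrt {κ : ℕ} (hS : 1 ≤ S) (hμ : Bdd S μ) (hκ : μ (0, 0, 0) = κ) (hκS : κ + 1 < S)
    (h : ∀ μ', Same {10, 42} μ μ' → Bdd S μ' → μ' (10, 0, 0) = Nat.sqrt κ → post μ' f) :
    WP r S QRed.progSqrt post μ f := by
  refine WP.seq (WP.set 0 hS hμ trivial rfl (by simp) fun μ1 hs1 hb1 e1 => ?_)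
  refine WP.loop (fun i μ' f' => Same {10, 42} μ μ' ∧ Bdd S μ' ∧
    μ' (10, 0, 0) = min i (Nat.sqrt κ) ∧ f' = f) κ hS hb1 (digitsOk_rd _ _)
    ((hs1 _ (by simp)).trans hκ) (by omega) ⟨hs1.mono (by decide), hb1, by simpa using e1, rfl⟩ ?_ ?_
  · rintro i hi μ2 f2 ⟨hs, hb, e2, rfl⟩
    have hb' := hb.nat (42, 0, 0) (show i < S by omega)
    have hs' : Same {10, 42} μ (Function.update μ2 (42, 0, 0) (i : ℤ)) := hs.update (by simp) _
    have e3 : Function.update μ2 (42, 0, 0) (i : ℤ) (10, 0, 0) = min i (Nat.sqrt κ) := by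
      rw [Function.update_of_ne (by simp), e2]
    generalize Function.update μ2 (42, 0, 0) (i : ℤ) = μ3 at hb' hs' e3
    have e0 : μ3 (0, 0, 0) = κ := (hs' _ (by simp)).trans hκ
    have hsq : ∀ x : ℕ, x ≤ Nat.sqrt κ ↔ x * x ≤ κ := fun x => Nat.le_sqrt
    have hlt := hsq (min i (Nat.sqrt κ) + 1)
    have hle : min i (Nat.sqrt κ) ≤ κ := (min_le_left _ _).trans hi.le
    have key : (Expr.lt (rd 0) (mul (add (rd 10) (const 1)) (add (rd 10) (const 1)))).eval r μ3 =
        if κ < (min i (Nat.sqrt κ) + 1) * (min i (Nat.sqrt κ) + 1) then 1 else 0 := by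
      simp only [Expr.eval, rd, e0, e3]
      congr 1
      rw [eq_iff_iff]
      norm_cast
    refine WP.ite hS hb' (by simp [Expr.DigitsOk, rd]) (fun h => WP.skip ⟨hs', hb', ?_, rfl⟩)
      fun h => WP.set ((min i (Nat.sqrt κ) + 1 : ℕ) : ℤ) hS hb' (by simp [Expr.DigitsOk, rd])
        (by simp only [Expr.eval, rd, e3]; push_cast; rfl)
        (natCast_lt_two_pow (by omega)) fun μ4 hs4 hb4 e4 =>
          ⟨hs'.trans (hs4.mono (by decide)), hb4, ?_, rfl⟩
    · rw [key] at h
      split_ifs at h with h'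
      · rw [e3]
        norm_cast
        omega
      · exact absurd rfl h
    · rw [key] at h
      split_ifs at h with h'
      · exact absurd h one_ne_zero
      · rw [e4]
        norm_cast
        omega
  · rintro μ' f' ⟨h1, h2, h3, rfl⟩
    refine h μ' h1 h2 ?_
    rw [h3]
    norm_cast
    exact min_eq_right (Nat.sqrt_le_self κ)

/-- The exponent doubles in each round until `2 ^ B ≥ ⌊r⌋`; without stopping it would reach `2 ^ κ ≥
E`. Doubling happens only for `B < E`, which keeps `B` polynomial; the `+ 1` in `2 E + 1` covers the
initial value `B = 1`. The exponent `B + 1` in the bound for `r` makes up for the floor. -/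
theorem WP.progSize {κ E : ℕ} (hS : 1 ≤ S) (hμ : Bdd S μ) (hκ : μ (0, 0, 0) = κ) (hκS : κ < S)
    (hr : 0 ≤ r) (hE : r ≤ 2 ^ E) (hEκ : E ≤ 2 ^ κ) (hES : 2 * E + 2 < S)
    (h : ∀ μ' (B : ℕ), Same {11, 12, 13, 42} μ μ' → Bdd S μ' → B ≤ 2 * E + 1 → r ≤ 2 ^ (B + 1) →
      μ' (12, 0, 0) = B → post μ' f) :
    WP r S QRed.progSize post μ f := by
  have h0 : 0 ≤ ⌊r⌋ := Int.floor_nonneg.2 hr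
  have h1 : ⌊r⌋ ≤ 2 ^ E := by
    have := (Int.floor_le r).trans hE
    exact_mod_cast this
  have h2 : (2 : ℤ) ^ E < 2 ^ S := pow_lt_pow_right₀ (by norm_num) (by omega)
  have h3 : |⌊r⌋| < 2 ^ S := by rw [abs_of_nonneg h0]; omega
  have ev : ∀ μ : Mem, (digits (const 0) : CExpr).eval r μ = ⌊r⌋ := fun μ => by simp [Expr.eval]
  refine WP.seq (WP.set ⌊r⌋ hS hμ ⟨trivial, by simp [Expr.eval], ?_⟩ (ev _) h3
    fun μ1 hs1 hb1 e1 => ?_)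
  · rw [ev]; zify; exact h3
  refine WP.seq (WP.set 1 hS hb1 trivial rfl (natCast_lt_two_pow (a := 1) (by omega))
    fun μ2 hs2 hb2 e2 => ?_)
  refine WP.seq (WP.set 2 hS hb2 trivial rfl (natCast_lt_two_pow (a := 2) (by omega))
    fun μ3 hs3 hb3 e3 => ?_)
  have hs13 : Same {11, 12, 13, 42} μ μ3 :=
    ((hs1.mono (by decide)).trans (hs2.mono (by decide))).trans (hs3.mono (by decide))
  refine WP.loop (fun i μ' f' => Same {11, 12, 13, 42} μ μ' ∧ Bdd S μ' ∧ μ' (11, 0, 0) = ⌊r⌋ ∧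
    (∃ B : ℕ, μ' (12, 0, 0) = B ∧ μ' (13, 0, 0) = 2 ^ B ∧ B ≤ 2 * E + 1 ∧
      (⌊r⌋ ≤ 2 ^ B ∨ B = 2 ^ i)) ∧ f' = f) κ hS hb3 (digitsOk_rd _ _)
    ((hs13 _ (by simp)).trans hκ) (by omega)
    ⟨hs13, hb3, ((hs3 _ (by simp)).trans (hs2 _ (by simp))).trans e1,
      ⟨1, (hs3 _ (by simp)).trans e2, e3, by omega, Or.inr (by simp)⟩, rfl⟩ ?_ ?_
  · rintro i hi μ4 f4 ⟨hs, hb, e11, ⟨B, e12, e13, hB, hB'⟩, rfl⟩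
    have hb' := hb.nat (42, 0, 0) (show i < S by omega)
    have hs' : Same {11, 12, 13, 42} μ (Function.update μ4 (42, 0, 0) (i : ℤ)) :=
      hs.update (by simp) _
    have e11' : Function.update μ4 (42, 0, 0) (i : ℤ) (11, 0, 0) = ⌊r⌋ := by
      rw [Function.update_of_ne (by simp), e11]
    have e12' : Function.update μ4 (42, 0, 0) (i : ℤ) (12, 0, 0) = B := by
      rw [Function.update_of_ne (by simp), e12]
    have e13' : Function.update μ4 (42, 0, 0) (i : ℤ) (13, 0, 0) = 2 ^ B := by
      rw [Function.update_of_ne (by simp), e13]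
    generalize Function.update μ4 (42, 0, 0) (i : ℤ) = μ5 at hb' hs' e11' e12' e13'
    refine WP.ite hS hb' (by simp [Expr.DigitsOk, rd]) (fun h => ?_)
      (fun h => WP.skip ⟨hs', hb', e11', ⟨B, e12', e13', hB, Or.inl ?_⟩, rfl⟩)
    · have hlt : (2 : ℤ) ^ B < ⌊r⌋ := by
        by_contra h'
        simp [Expr.eval, rd, e11', e13', h'] at h
      have hBE : B < E := by
        by_contra h'
        have : (2 : ℤ) ^ E ≤ 2 ^ B := pow_le_pow_right₀ (by norm_num) (by omega)
        omega
      refine WP.seq (WP.set ((2 * B : ℕ) : ℤ) hS hb' (by simp [Expr.DigitsOk, rd])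
        (by simp [Expr.eval, rd, e12']) (natCast_lt_two_pow (by omega)) fun μ6 hs6 hb6 e6 => ?_)
      have p6 : μ6 (13, 0, 0) = 2 ^ B := (hs6 _ (by simp)).trans e13'
      refine WP.set ((2 : ℤ) ^ (2 * B)) hS hb6 (by simp [Expr.DigitsOk, rd])
        (by simp only [Expr.eval, rd, p6]; ring) ?_ fun μ7 hs7 hb7 e7 => ?_
      · rw [abs_of_nonneg (by positivity)]
        exact pow_lt_pow_right₀ (by norm_num) (by omega)
      · refine ⟨(hs'.trans (hs6.mono (by decide))).trans (hs7.mono (by decide)), hb7,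
          ((hs7 _ (by simp)).trans (hs6 _ (by simp))).trans e11', ⟨2 * B,
            (hs7 _ (by simp)).trans e6, e7, by omega, Or.inr ?_⟩, rfl⟩
        rcases hB' with h' | h'
        · omega
        · rw [h', pow_succ]; ring
    · by_contra h'
      have h'' : (2 : ℤ) ^ B < ⌊r⌋ := not_le.1 h'
      simp [Expr.eval, rd, e11', e13', h''] at h
  · rintro μ' f' ⟨hs, hb, -, ⟨B, e12, -, hB, hB'⟩, rfl⟩
    refine h μ' B hs hb hB ?_ e12
    have : ⌊r⌋ ≤ 2 ^ B := by
      rcases hB' with h' | h'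
      · exact h'
      · refine h1.trans (pow_le_pow_right₀ (by norm_num) (by omega))
    have h4 : ((⌊r⌋ : ℤ) : ℝ) ≤ 2 ^ B := by exact_mod_cast this
    have h5 := Int.lt_floor_add_one r
    have h6 : (1 : ℝ) ≤ 2 ^ B := one_le_pow₀ (by norm_num)
    rw [pow_succ]
    linarith

theorem WP.progPow {κ B m : ℕ} (hS : 1 ≤ S) (hμ : Bdd S μ) (hκ : μ (0, 0, 0) = κ)
    (hm : μ (3, 0, 0) = m) (hB : μ (12, 0, 0) = B) (hLS : 32 * (B + κ + 1) + m + 1 < S)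
    (h : ∀ μ', Same {14, 27, 28, 42} μ μ' → Bdd S μ' → μ' (14, 0, 0) = (B + κ + 1 : ℕ) →
      μ' (28, 0, 0) = (32 * (B + κ + 1) + m : ℕ) →
      (∀ i : ℕ, i ≤ 32 * (B + κ + 1) + m → μ' (27, i, 0) = 2 ^ i) → post μ' f) :
    WP r S QRed.progPow post μ f := by
  refine WP.seq (WP.set ((B + κ + 1 : ℕ) : ℤ) hS hμ (by simp [Expr.DigitsOk, rd])
    (by simp [Expr.eval, rd, hκ, hB]) (natCast_lt_two_pow (by omega)) fun μ1 hs1 hb1 e1 => ?_)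
  have m1 : μ1 (3, 0, 0) = m := (hs1 _ (by simp)).trans hm
  refine WP.seq (WP.set ((32 * (B + κ + 1) + m : ℕ) : ℤ) hS hb1 (by simp [Expr.DigitsOk, rd])
    (by simp only [Expr.eval, rd, e1, m1]; push_cast; rfl) (natCast_lt_two_pow (by omega))
    fun μ2 hs2 hb2 e2 => ?_)
  set L := 32 * (B + κ + 1) + m
  have e14 : μ2 (14, 0, 0) = (B + κ + 1 : ℕ) := (hs2 _ (by simp)).trans e1
  have hs12 : Same {14, 27, 28, 42} μ μ2 := (hs1.mono (by decide)).trans (hs2.mono (by decide))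
  refine WP.seq (WP.assign hS hb2 trivial trivial trivial ?_)
  simp only [Expr.eval]
  have hpos : ∀ i ≤ L, (2 : ℤ) ^ i < 2 ^ S := fun i hi => pow_lt_pow_right₀ (by norm_num) (by omega)
  have hb3 : Bdd S (Function.update μ2 (27, 0, 0) 1) := hb2.update _ (by
    have := hpos 0 (by omega); zify; simpa using this)
  have hs3 : Same {14, 27, 28, 42} μ (Function.update μ2 (27, 0, 0) 1) := hs12.update (by simp) _
  have f14 : Function.update μ2 (27, 0, 0) 1 (14, 0, 0) = (B + κ + 1 : ℕ) := by
    rw [Function.update_of_ne (by simp), e14]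
  have f28 : Function.update μ2 (27, 0, 0) 1 (28, 0, 0) = L := by
    rw [Function.update_of_ne (by simp), e2]
  have f27 : Function.update μ2 (27, 0, 0) 1 (27, 0, 0) = 1 := Function.update_self ..
  generalize Function.update μ2 (27, 0, 0) 1 = μ3 at hb3 hs3 f14 f28 f27
  refine WP.loop (fun i μ' f' => Same {14, 27, 28, 42} μ μ' ∧ Bdd S μ' ∧
    μ' (14, 0, 0) = (B + κ + 1 : ℕ) ∧ μ' (28, 0, 0) = L ∧
    (∀ j : ℕ, j ≤ i → μ' (27, j, 0) = 2 ^ j) ∧ f' = f) L hS hb3 (digitsOk_rd _ _)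
    f28 (by omega) ⟨hs3, hb3, f14, f28, fun j hj => by
      obtain rfl : j = 0 := by omega
      simpa using f27, rfl⟩ ?_ ?_
  · rintro i hi μ4 f4 ⟨hs, hb, g14, g28, g27, rfl⟩
    have hb' := hb.nat (42, 0, 0) (show i < S by omega)
    have e42 : Function.update μ4 (42, 0, 0) (i : ℤ) (42, 0, 0) = i := Function.update_self ..
    have hs' : Same {42} μ4 (Function.update μ4 (42, 0, 0) (i : ℤ)) :=
      (Same.refl _ _).update (by simp) _
    generalize Function.update μ4 (42, 0, 0) (i : ℤ) = μ5 at hb' hs' e42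
    have e27 : ∀ j : ℕ, j ≤ i → μ5 (27, j, 0) = 2 ^ j := fun j hj => (hs' _ (by simp)).trans (g27 j hj)
    refine WP.assign hS hb' (by simp [Expr.DigitsOk, rd]) trivial (by simp [Expr.DigitsOk, rd]) ?_
    have ev1 : (add (rd 42) (const 1) : CExpr).eval r μ5 = ((i + 1 : ℕ) : ℤ) := by
      simp [Expr.eval, rd, e42]
    have ev2 : (mul (const 2) (read 27 (rd 42) (const 0)) : CExpr).eval r μ5 = 2 ^ (i + 1) := by
      simp only [Expr.eval, rd, e42, e27 i le_rfl]; ring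
    rw [ev1, ev2]
    simp only [Expr.eval]
    refine ⟨(hs.trans (hs'.mono (by decide))).update (by simp) _, hb'.update _ ?_, ?_, ?_, ?_, trivial⟩
    · have := hpos (i + 1) (by omega)
      zify
      rwa [abs_of_nonneg (by positivity)]
    · rw [Function.update_of_ne (by simp)]
      exact (hs' _ (by simp)).trans g14
    · rw [Function.update_of_ne (by simp)]
      exact (hs' _ (by simp)).trans g28
    · intro j hj
      by_cases hji : j = i + 1
      · subst hji; exact Function.update_self ..
      · rw [Function.update_of_ne (by simp; omega)]
        exact e27 j (by omega)
  · rintro μ' f' ⟨h1, h2, h3, h4, h5, rfl⟩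
    exact h μ' h1 h2 h3 h4 h5

theorem WP.progPi {L : ℕ} (hS : 1 ≤ S) (hμ : Bdd S μ) (hL : μ (28, 0, 0) = L)
    (hV : μ (27, L, 0) = 2 ^ L) (hLS : L + 4 < S)
    (h : ∀ μ', Same {15, 17, 18, 19, 42} μ μ' → Bdd S μ' → μ' (15, 0, 0) = 2 ^ L →
      μ' (19, 0, 0) = piFix L → post μ' f) :
    WP r S QRed.progPi post μ f := by
  have hV1 : (1 : ℤ) ≤ 2 ^ L := one_le_pow₀ (by norm_num)
  have hVS : (2 : ℤ) ^ L * 2 ^ 4 < 2 ^ S := by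
    rw [← pow_add]; exact pow_lt_pow_right₀ (by norm_num) (by omega)
  have bd : ∀ w : ℤ, w = 4 ∨ w = 9 → ∀ x ≤ L, |altFix (2 ^ L) w L x| < 2 ^ S := fun w hw x hx =>
    (abs_altFix_le hV1 hw hx).trans_lt (by linarith)
  refine WP.seq (WP.set ((2 : ℤ) ^ L) hS hμ (by simp [Expr.DigitsOk, rd])
    (by simp [Expr.eval, rd, hL, hV]) (by rw [abs_of_nonneg (by positivity)]; linarith)
    fun μ1 hs1 hb1 e1 => ?_)
  refine WP.seq (WP.set 0 hS hb1 trivial rfl (by simp) fun μ2 hs2 hb2 e2 => ?_)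
  refine WP.seq (WP.set 0 hS hb2 trivial rfl (by simp) fun μ3 hs3 hb3 e3 => ?_)
  have hs13 : Same {15, 17, 18, 19, 42} μ μ3 :=
    ((hs1.mono (by decide)).trans (hs2.mono (by decide))).trans (hs3.mono (by decide))
  refine WP.seq (WP.loop (fun i μ' f' => Same {15, 17, 18, 19, 42} μ μ' ∧ Bdd S μ' ∧
    μ' (15, 0, 0) = 2 ^ L ∧ μ' (17, 0, 0) = altFix (2 ^ L) 4 L i ∧
    μ' (18, 0, 0) = altFix (2 ^ L) 9 L i ∧ f' = f) L hS hb3 (digitsOk_rd _ _)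
    ((hs13 _ (by simp)).trans hL) (by omega)
    ⟨hs13, hb3, ((hs3 _ (by simp)).trans (hs2 _ (by simp))).trans e1,
      (hs3 _ (by simp)).trans e2, e3, rfl⟩ ?_ ?_)
  · rintro i hi μ4 f4 ⟨hs, hb, g15, g17, g18, rfl⟩
    have hb' := hb.nat (42, 0, 0) (show i < S by omega)
    have e42 : Function.update μ4 (42, 0, 0) (i : ℤ) (42, 0, 0) = i := Function.update_self ..
    have hs' : Same {42} μ4 (Function.update μ4 (42, 0, 0) (i : ℤ)) :=
      (Same.refl _ _).update (by simp) _
    generalize Function.update μ4 (42, 0, 0) (i : ℤ) = μ5 at hb' hs' e42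
    have a15 : μ5 (15, 0, 0) = 2 ^ L := (hs' _ (by simp)).trans g15
    have a17 : μ5 (17, 0, 0) = altFix (2 ^ L) 4 L i := (hs' _ (by simp)).trans g17
    have a18 : μ5 (18, 0, 0) = altFix (2 ^ L) 9 L i := (hs' _ (by simp)).trans g18
    have a28 : μ5 (28, 0, 0) = L := (hs' _ (by simp)).trans ((hs _ (by simp)).trans hL)
    refine WP.seq (WP.set (altFix (2 ^ L) 4 L (i + 1)) hS hb' (by simp [Expr.DigitsOk, rd])
      (by simp only [Expr.eval, rd, a15, a17, a28, e42, altFix]) (bd 4 (by simp) _ (by omega))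
      fun μ6 hs6 hb6 e6 => ?_)
    have b15 : μ6 (15, 0, 0) = 2 ^ L := (hs6 _ (by simp)).trans a15
    have b18 : μ6 (18, 0, 0) = altFix (2 ^ L) 9 L i := (hs6 _ (by simp)).trans a18
    have b28 : μ6 (28, 0, 0) = L := (hs6 _ (by simp)).trans a28
    have b42 : μ6 (42, 0, 0) = i := (hs6 _ (by simp)).trans e42
    refine WP.set (altFix (2 ^ L) 9 L (i + 1)) hS hb6 (by simp [Expr.DigitsOk, rd])
      (by simp only [Expr.eval, rd, b15, b18, b28, b42, altFix]) (bd 9 (by simp) _ (by omega))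
      fun μ7 hs7 hb7 e7 => ?_
    exact ⟨((hs.trans (hs'.mono (by decide))).trans (hs6.mono (by decide))).trans
      (hs7.mono (by decide)), hb7, (hs7 _ (by simp)).trans b15, (hs7 _ (by simp)).trans e6, e7, rfl⟩
  · rintro μ4 f4 ⟨hs, hb, g15, g17, g18, rfl⟩
    have h4 := abs_le.1 (abs_altFix_le hV1 (Or.inl rfl) (le_refl L))
    have h9 := abs_le.1 (abs_altFix_le hV1 (Or.inr rfl) (le_refl L))
    refine WP.set (piFix L) hS hb (by simp [Expr.DigitsOk, rd])
      (by simp [Expr.eval, rd, g17, g18, piFix]) ?_ fun μ5 hs5 hb5 e5 => ?_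
    · rw [piFix, abs_lt]
      constructor <;> omega
    · exact h μ5 (hs.trans (hs5.mono (by decide))) hb5 ((hs5 _ (by simp)).trans g15) e5

theorem WP.progExp {κ ℓ X bb L : ℕ} {D : ℤ} (hS : 1 ≤ S) (hμ : Bdd S μ) (h0 : μ (0, 0, 0) = κ)
    (h4 : μ (4, 0, 0) = ℓ) (h10 : μ (10, 0, 0) = X) (h14 : μ (14, 0, 0) = bb)
    (h15 : μ (15, 0, 0) = 2 ^ L) (h19 : μ (19, 0, 0) = piFix L) (h28 : μ (28, 0, 0) = L)
    (hpi : 0 ≤ piFix L ∧ piFix L ≤ 2 ^ L * 2 ^ 3)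
    (h27 : ∀ i : ℕ, i ≤ L → μ (27, i, 0) = 2 ^ i) (hbb : 18 * bb ≤ L) (hLS : 3 * L + 6 < S)
    (hD : ⌊(2 : ℝ) ^ L * r⌋ = D) (hD0 : 0 ≤ D) (hXD : 2 * (X * D) + 1 < 2 ^ S) (hDS : D < 2 ^ S)
    (hT : 80 * (κ * ℓ) < S)
    (h : ∀ μ', Same {16, 20, 21, 23, 24, 25, 26, 42} μ μ' → Bdd S μ' →
      μ' (23, 0, 0) = (16 * bb : ℕ) → μ' (26, 0, 0) = (2 * bb : ℕ) →
      μ' (25, 0, 0) = (80 * (κ * ℓ) : ℕ) → μ' (20, 0, 0) = X * D / 2 ^ L →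
      μ' (21, 0, 0) = 2 * (X * D / 2 ^ L) + 1 →
      (∀ i : ℕ, i ≤ 18 * bb → μ' (24, i, 0) =
        expFix (2 ^ L) D (piFix L) (2 ^ (16 * bb)) i) → post μ' f) :
    WP r S QRed.progExp post μ f := by
  have hV0 : (0 : ℤ) < 2 ^ L := by positivity
  have hV1 : (1 : ℤ) ≤ 2 ^ L := hV0
  have hVS : (2 : ℤ) ^ (3 * L) * 2 ^ 6 < 2 ^ S := by
    rw [← pow_add]; exact pow_lt_pow_right₀ (by norm_num) (by omega)
  have hV3 : (2 : ℤ) ^ L ≤ 2 ^ (3 * L) := pow_le_pow_right₀ (by norm_num) (by omega)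
  have hV3' : (2 : ℤ) ^ (3 * L) = 2 ^ L * (2 ^ L * 2 ^ L) := by rw [← pow_add, ← pow_add]; congr 1; omega
  have hXD0 : (0 : ℤ) ≤ X * D := by positivity
  have hR0 : (0 : ℤ) ≤ X * D / 2 ^ L := Int.ediv_nonneg hXD0 hV0.le
  have hR1 : (X * D / 2 ^ L : ℤ) ≤ X * D := Int.ediv_le_self _ hXD0
  refine WP.seq (WP.set D hS hμ ⟨digitsOk_rd _ _, ?_, ?_⟩ ?_ ?_ fun μ1 hs1 hb1 e1 => ?_)
  · rw [eval_rd, h28]; simp; omega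
  · simp only [Expr.eval, rd, h28, Int.toNat_natCast, hD]; zify; rwa [abs_of_nonneg hD0]
  · simp only [Expr.eval, rd, h28, Int.toNat_natCast, hD]
  · rwa [abs_of_nonneg hD0]
  have a14 : μ1 (14, 0, 0) = bb := (hs1 _ (by simp)).trans h14
  refine WP.seq (WP.set ((16 * bb : ℕ) : ℤ) hS hb1 (by simp [Expr.DigitsOk, rd])
    (by simp [Expr.eval, rd, a14]) (natCast_lt_two_pow (by omega)) fun μ2 hs2 hb2 e2 => ?_)
  have b14 : μ2 (14, 0, 0) = bb := (hs2 _ (by simp)).trans a14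
  refine WP.seq (WP.set ((2 * bb : ℕ) : ℤ) hS hb2 (by simp [Expr.DigitsOk, rd])
    (by simp [Expr.eval, rd, b14]) (natCast_lt_two_pow (by omega)) fun μ3 hs3 hb3 e3 => ?_)
  have hs13 : Same {16, 23, 26} μ μ3 :=
    ((hs1.mono (by decide)).trans (hs2.mono (by decide))).trans (hs3.mono (by decide))
  have c0 : μ3 (0, 0, 0) = κ := (hs13 _ (by simp)).trans h0
  have c4 : μ3 (4, 0, 0) = ℓ := (hs13 _ (by simp)).trans h4
  refine WP.seq (WP.set ((80 * (κ * ℓ) : ℕ) : ℤ) hS hb3 (by simp [Expr.DigitsOk, rd])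
    (by simp [Expr.eval, rd, c0, c4]) (natCast_lt_two_pow hT) fun μ4 hs4 hb4 e4 => ?_)
  have hs14 : Same {16, 23, 25, 26} μ μ4 := (hs13.mono (by decide)).trans (hs4.mono (by decide))
  have d10 : μ4 (10, 0, 0) = X := (hs14 _ (by simp)).trans h10
  have d15 : μ4 (15, 0, 0) = 2 ^ L := (hs14 _ (by simp)).trans h15
  have d16 : μ4 (16, 0, 0) = D :=
    (((hs4 _ (by simp)).trans (hs3 _ (by simp))).trans (hs2 _ (by simp))).trans e1
  refine WP.seq (WP.set (X * D / 2 ^ L : ℤ) hS hb4 (by simp [Expr.DigitsOk, rd])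
    (by simp [Expr.eval, rd, d10, d15, d16]) (by rw [abs_of_nonneg hR0]; linarith)
    fun μ5 hs5 hb5 e5 => ?_)
  refine WP.seq (WP.set (2 * (X * D / 2 ^ L) + 1 : ℤ) hS hb5 (by simp [Expr.DigitsOk, rd])
    (by simp [Expr.eval, rd, e5]) (by rw [abs_of_nonneg (by linarith)]; linarith)
    fun μ6 hs6 hb6 e6 => ?_)
  have hs46 : Same {20, 21} μ4 μ6 := (hs5.mono (by decide)).trans (hs6.mono (by decide))
  have hs16 : Same {16, 20, 21, 23, 25, 26} μ μ6 :=
    (hs14.mono (by decide)).trans (hs46.mono (by decide))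
  have f15 : μ6 (15, 0, 0) = 2 ^ L := (hs16 _ (by simp)).trans h15
  have f16 : μ6 (16, 0, 0) = D := (hs46 _ (by simp)).trans d16
  have f19 : μ6 (19, 0, 0) = piFix L := (hs16 _ (by simp)).trans h19
  have f23 : μ6 (23, 0, 0) = (16 * bb : ℕ) :=
    (hs46 _ (by simp)).trans ((hs4 _ (by simp)).trans ((hs3 _ (by simp)).trans e2))
  have f27 : μ6 (27, (16 * bb : ℕ), 0) = 2 ^ (16 * bb) :=
    (hs16 _ (by simp)).trans (h27 _ (by omega))
  set P := 2 * (piFix L * (2 ^ L * 2 ^ L)) / (D * D * 2 ^ (16 * bb)) with hP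
  have hP0 : 0 ≤ P := Int.ediv_nonneg (by have := hpi.1; positivity) (by positivity)
  -- No lower bound for `D` is available (a zero divisor gives quotient 0), so the quotient is
  -- bounded by its numerator, below `2 ^ (3 L + 5)`. This is why the word length has to exceed `3 L
  -- + 6`.
  have hP1 : P ≤ 2 ^ (3 * L) * 2 ^ 5 := by
    refine (Int.ediv_le_self _ (by have := hpi.1; positivity)).trans ?_
    have := mul_le_mul_of_nonneg_right hpi.2 (show (0 : ℤ) ≤ 2 ^ L * 2 ^ L by positivity)
    rw [hV3']
    calc 2 * (piFix L * (2 ^ L * 2 ^ L)) ≤ 2 * (2 ^ L * 2 ^ 3 * (2 ^ L * 2 ^ L)) := by omega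
      _ ≤ 2 * (2 ^ L * 2 ^ 3 * (2 ^ L * 2 ^ L)) * 2 :=
        le_mul_of_one_le_right (by positivity) (by norm_num)
      _ = _ := by ring
  have hPS : |2 ^ L - P| < 2 ^ S := by
    have h32 : (2 : ℤ) ^ (3 * L) * 2 ^ 6 = 2 * (2 ^ (3 * L) * 2 ^ 5) := by ring
    have h31 : (2 : ℤ) ^ (3 * L) ≤ 2 ^ (3 * L) * 2 ^ 5 :=
      le_mul_of_one_le_right (by positivity) (by norm_num)
    rw [abs_lt]; constructor <;> linarith
  refine WP.seq (WP.set (2 ^ L - P) hS hb6 (by simp [Expr.DigitsOk, rd])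
    (by simp only [Expr.eval, rd, f15, f16, f19, f23, f27, hP]) hPS fun μ7 hs7 hb7 e7 => ?_)
  have hexp := fun i => expFix_bounds hV0 hpi.1 (show (0 : ℤ) ≤ 2 ^ (16 * bb) by positivity)
    (D := D) i
  have bexp : ∀ i, |expFix (2 ^ L) D (piFix L) (2 ^ (16 * bb)) i| < 2 ^ S := fun i => by
    rw [abs_of_nonneg (hexp i).1]
    have := (hexp i).2
    linarith
  refine WP.seq (WP.set (expFix (2 ^ L) D (piFix L) (2 ^ (16 * bb)) 0) hS hb7
    (by simp [Expr.DigitsOk, rd]) ?_ (bexp 0) fun μ8 hs8 hb8 e8 => ?_)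
  · simp only [Expr.eval, rd, e7, expFix, hP]
    split_ifs <;> omega
  have hs68 : Same {24} μ6 μ8 := hs7.trans hs8
  have g15 : μ8 (15, 0, 0) = 2 ^ L := (hs68 _ (by simp)).trans f15
  have hs18 : Same {16, 20, 21, 23, 24, 25, 26, 42} μ μ8 :=
    (hs16.mono (by decide)).trans (hs68.mono (by decide))
  have k23 : μ8 (23, 0, 0) = (16 * bb : ℕ) := (hs68 _ (by simp)).trans f23
  have k26 : μ8 (26, 0, 0) = (2 * bb : ℕ) :=
    (hs68 _ (by simp)).trans ((hs46 _ (by simp)).trans ((hs4 _ (by simp)).trans e3))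
  have k25 : μ8 (25, 0, 0) = (80 * (κ * ℓ) : ℕ) :=
    (hs68 _ (by simp)).trans ((hs46 _ (by simp)).trans e4)
  have k20 : μ8 (20, 0, 0) = X * D / 2 ^ L :=
    (hs68 _ (by simp)).trans ((hs6 _ (by simp)).trans e5)
  have k21 : μ8 (21, 0, 0) = 2 * (X * D / 2 ^ L) + 1 := (hs68 _ (by simp)).trans e6
  refine WP.loop (fun i μ' f' => Same {24, 42} μ8 μ' ∧ Bdd S μ' ∧
    (∀ j : ℕ, j ≤ i → μ' (24, j, 0) = expFix (2 ^ L) D (piFix L) (2 ^ (16 * bb)) j) ∧ f' = f)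
    (18 * bb) hS hb8 (by simp [Expr.DigitsOk, rd])
    (by simp only [Expr.eval, rd, k23, k26]; push_cast; ring) (by omega)
    ⟨Same.refl _ _, hb8, fun j hj => by
      obtain rfl : j = 0 := by omega
      simpa using e8, rfl⟩ ?_ ?_
  · rintro i hi μ9 f9 ⟨hs, hb, g24, rfl⟩
    have hb' := hb.nat (42, 0, 0) (show i < S by omega)
    have e42 : Function.update μ9 (42, 0, 0) (i : ℤ) (42, 0, 0) = i := Function.update_self ..
    have hs' : Same {42} μ9 (Function.update μ9 (42, 0, 0) (i : ℤ)) :=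
      (Same.refl _ _).update (by simp) _
    generalize Function.update μ9 (42, 0, 0) (i : ℤ) = ν at hb' hs' e42
    have e24 : ∀ j : ℕ, j ≤ i → ν (24, j, 0) = expFix (2 ^ L) D (piFix L) (2 ^ (16 * bb)) j :=
      fun j hj => (hs' _ (by simp)).trans (g24 j hj)
    have e15 : ν (15, 0, 0) = 2 ^ L := (hs' _ (by simp)).trans ((hs _ (by simp)).trans g15)
    refine WP.assign hS hb' (by simp [Expr.DigitsOk, rd]) trivial (by simp [Expr.DigitsOk, rd]) ?_
    have ev1 : (add (rd 42) (const 1) : CExpr).eval r ν = ((i + 1 : ℕ) : ℤ) := by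
      simp [Expr.eval, rd, e42]
    have ev2 : (div (mul (read 24 (rd 42) (const 0)) (read 24 (rd 42) (const 0))) (rd 15) :
        CExpr).eval r ν = expFix (2 ^ L) D (piFix L) (2 ^ (16 * bb)) (i + 1) := by
      simp only [Expr.eval, rd, e42, e24 i le_rfl, e15, expFix]
    rw [ev1, ev2]
    simp only [Expr.eval]
    refine ⟨(hs.trans (hs'.mono (by decide))).update (by simp) _, hb'.update _ ?_, ?_, trivial⟩
    · zify; exact bexp (i + 1)
    · intro j hj
      by_cases hji : j = i + 1
      · subst hji; exact Function.update_self ..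
      · rw [Function.update_of_ne (by simp; omega)]
        exact e24 j (by omega)
  · rintro μ' f' ⟨hs, hb, g24, rfl⟩
    exact h μ' (hs18.trans (hs.mono (by decide))) hb ((hs _ (by simp)).trans k23)
      ((hs _ (by simp)).trans k26) ((hs _ (by simp)).trans k25) ((hs _ (by simp)).trans k20)
      ((hs _ (by simp)).trans k21) g24

end Classical

end QRed


namespace QRed

/-! ## Accuracy of the fixed point computations -/

/-- The alternating series that `altFix` approximates. -/
noncomputable def altSum (w : ℝ) (k : ℕ) : ℝ := ∑' i : ℕ, (-w⁻¹) ^ i / (2 * ((k + i : ℕ) : ℝ) + 1)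

theorem abs_altSum_term_le {w : ℝ} (hw : 4 ≤ w) (k i : ℕ) :
    ‖(-w⁻¹) ^ i / (2 * ((k + i : ℕ) : ℝ) + 1)‖ ≤ (1 / 4) ^ i := by
  have h1 : (1 : ℝ) ≤ 2 * ((k + i : ℕ) : ℝ) + 1 := by
    have : (0 : ℝ) ≤ ((k + i : ℕ) : ℝ) := by positivity
    linarith
  have hw' : 0 < w := by linarith
  rw [norm_div, norm_pow, norm_neg, Real.norm_of_nonneg (by positivity : 0 ≤ w⁻¹),
    Real.norm_of_nonneg (by linarith)]
  calc w⁻¹ ^ i / (2 * ((k + i : ℕ) : ℝ) + 1) ≤ w⁻¹ ^ i := div_le_self (by positivity) h1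
    _ ≤ (1 / 4) ^ i := by
      gcongr
      rw [one_div]
      exact inv_anti₀ (by norm_num) hw

theorem summable_altSum {w : ℝ} (hw : 4 ≤ w) (k : ℕ) :
    Summable fun i : ℕ => (-w⁻¹) ^ i / (2 * ((k + i : ℕ) : ℝ) + 1) :=
  Summable.of_norm_bounded (summable_geometric_of_lt_one (by norm_num) (by norm_num))
    (abs_altSum_term_le hw k)

theorem abs_altSum_le {w : ℝ} (hw : 4 ≤ w) (k : ℕ) : |altSum w k| ≤ 2 := by
  have := tsum_of_norm_bounded (hasSum_geometric_of_lt_one (by norm_num) (by norm_num))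
    (abs_altSum_term_le hw k)
  rw [Real.norm_eq_abs] at this
  exact this.trans (by norm_num)

theorem altSum_rec {w : ℝ} (hw : 4 ≤ w) (k : ℕ) :
    altSum w k = 1 / (2 * k + 1) - altSum w (k + 1) / w := by
  rw [altSum, (summable_altSum hw k).tsum_eq_zero_add]
  simp only [pow_zero, add_zero]
  rw [sub_eq_add_neg]
  congr 1
  rw [altSum, ← neg_div, ← tsum_neg, ← tsum_div_const]
  refine tsum_congr fun i => ?_
  rw [pow_succ, show k + (i + 1) = k + 1 + i by ring]
  field_simp

theorem abs_ediv_sub_le (a : ℤ) {b : ℤ} (hb : 0 < b) : (a / b : ℤ) ≤ (a : ℝ) / b ∧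
    (a : ℝ) / b ≤ (a / b : ℤ) + 1 := by
  have hb' : (0 : ℝ) < b := by exact_mod_cast hb
  have h1 : b * (a / b) ≤ a := Int.mul_ediv_self_le hb.ne'
  have h2 : a < b * (a / b) + b := Int.lt_mul_ediv_self_add hb
  constructor
  · rw [le_div_iff₀ hb']
    have : ((b * (a / b) : ℤ) : ℝ) ≤ a := by exact_mod_cast h1
    push_cast at this
    linarith
  · rw [div_le_iff₀ hb']
    have : (a : ℝ) < ((b * (a / b) + b : ℤ) : ℝ) := by exact_mod_cast h2
    push_cast at this
    linarith

/-- One step of Horner's rule divides the inherited error by at least 4 and adds at most 1 for each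
of the two floors, and `4 / 4 + 2 ≤ 4`. The second summand is the cost of starting from 0 in place
of a tail of size at most 2. -/
theorem altFix_approx {L x : ℕ} {w : ℤ} (hw : 4 ≤ w) (hx : x ≤ L) :
    |(altFix (2 ^ L) w L x : ℝ) - 2 ^ L * altSum w (L - x)| ≤ 4 + 2 ^ L * 2 / 4 ^ x := by
  have hw' : (4 : ℝ) ≤ w := by exact_mod_cast hw
  induction x with
  | zero =>
    simp only [altFix, Int.cast_zero, zero_sub, abs_neg, abs_mul, pow_zero, div_one]
    have := abs_altSum_le hw' (L - 0)
    rw [abs_of_nonneg (by positivity : (0 : ℝ) ≤ 2 ^ L)]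
    nlinarith [show (0 : ℝ) < 2 ^ L by positivity]
  | succ x ih =>
    have ih := ih (by omega)
    obtain ⟨k, rfl⟩ : ∃ k, L = k + (x + 1) := ⟨L - (x + 1), by omega⟩
    have e1 : k + (x + 1) - (x + 1) = k := by omega
    have e2 : k + (x + 1) - x = k + 1 := by omega
    have e3 : 2 * (((k + (x + 1) : ℕ) : ℤ) - 1 - x) + 1 = 2 * k + 1 := by push_cast; ring
    rw [e2] at ih
    rw [e1, altFix, e3, altSum_rec hw']
    set V : ℤ := 2 ^ (k + (x + 1))
    set a := altFix V w (k + (x + 1)) x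
    have h1 := abs_ediv_sub_le V (b := 2 * k + 1) (by positivity)
    have h2 := abs_ediv_sub_le a (b := w) (by omega)
    have hV : (V : ℝ) = 2 ^ (k + (x + 1)) := by simp [V]
    rw [← hV] at ih ⊢
    push_cast at h1 ⊢
    have h3 : |(a : ℝ) / w - V * altSum w (k + 1) / w| ≤ (4 + V * 2 / 4 ^ x) / 4 := by
      rw [← sub_div, abs_div, abs_of_pos (by linarith : (0 : ℝ) < w)]
      have : (0 : ℝ) ≤ V := by rw [hV]; positivity
      exact div_le_div₀ (by positivity) ih (by norm_num) hw'
    have h4 : (V : ℝ) * (1 / (2 * k + 1) - altSum w (k + 1) / w) =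
      V / (2 * k + 1) - V * altSum w (k + 1) / w := by ring
    have h5 : (V : ℝ) * 2 / 4 ^ (x + 1) = (V * 2 / 4 ^ x) / 4 := by rw [pow_succ]; field_simp
    rw [h4, h5]
    rw [abs_le] at h3 ⊢
    constructor <;> linarith [h1.1, h1.2, h2.1, h2.2, h3.1, h3.2]

theorem altSum_sq_zero {x : ℝ} (hx0 : 0 < x) (hx : x ≤ 1 / 2) :
    altSum ((x ^ 2)⁻¹) 0 = Real.arctan x / x := by
  have h := Real.hasSum_arctan (x := x) (by rw [Real.norm_of_nonneg hx0.le]; linarith)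
  rw [altSum, ← h.tsum_eq, ← tsum_div_const]
  refine tsum_congr fun i => ?_
  rw [inv_inv, zero_add, neg_pow, ← pow_mul, pow_succ]
  push_cast
  field_simp

/-- `π / 4 = arctan (1/2) + arctan (1/3)`, and the arctangent series turn this into `π = 2 * altSum
4 0 + (4/3) * altSum 9 0`. Each fixed point sum is off by at most 6, and the last division by at
most 1: `12 + 8 + 1 = 21`. -/
theorem piFix_approx (L : ℕ) : |(piFix L : ℝ) - 2 ^ L * Real.pi| ≤ 21 := by
  have h4 := altFix_approx (w := 4) le_rfl (le_refl L)
  have h9 := altFix_approx (w := 9) (by norm_num) (le_refl L)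
  have hs : (2 : ℝ) ^ L * 2 / 4 ^ L ≤ 2 := by
    rw [div_le_iff₀ (by positivity)]
    have : (2 : ℝ) ^ L ≤ 4 ^ L := pow_le_pow_left₀ (by norm_num) (by norm_num) _
    linarith
  have s4 : altSum ((4 : ℤ) : ℝ) (L - L) = 2 * Real.arctan 2⁻¹ := by
    have := altSum_sq_zero (x := 2⁻¹) (by norm_num) (by norm_num)
    norm_num at this ⊢
    rw [this]; ring
  have s9 : altSum ((9 : ℤ) : ℝ) (L - L) = 3 * Real.arctan 3⁻¹ := by
    have := altSum_sq_zero (x := 3⁻¹) (by norm_num) (by norm_num)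
    norm_num at this ⊢
    rw [this]; ring
  rw [s4] at h4
  rw [s9] at h9
  have hd := abs_ediv_sub_le (4 * altFix (2 ^ L) 9 L L) (b := 3) (by norm_num)
  have hpi := Real.arctan_inv_2_add_arctan_inv_3
  have e : Real.pi = 4 * (Real.arctan 2⁻¹ + Real.arctan 3⁻¹) := by linarith
  rw [piFix, e]
  push_cast at hd ⊢
  rw [abs_le] at h4 h9 ⊢
  constructor <;> linarith [hd.1, hd.2, h4.1, h4.2, h9.1, h9.2]

theorem piFix_bounds {L : ℕ} (hL : 5 ≤ L) : 0 ≤ piFix L ∧ piFix L ≤ 2 ^ L * 2 ^ 3 := by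
  have h := abs_le.1 (piFix_approx L)
  have h1 := Real.pi_gt_three
  have h2 := Real.pi_lt_four
  have h3 : (2 : ℝ) ^ 5 ≤ 2 ^ L := pow_le_pow_right₀ (by norm_num) hL
  norm_num at h3
  constructor
  · have : (0 : ℝ) ≤ piFix L := by nlinarith [h.1]
    exact_mod_cast this
  · have : (piFix L : ℝ) ≤ 2 ^ L * 2 ^ 3 := by nlinarith [h.2]
    exact_mod_cast this

/-- Squaring numbers in `[0, 1]` at most doubles the error, and the rounded division adds `1 / V`.
The error plus `1 / V` therefore at most doubles, which is why the claim is stated for that sum. -/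
theorem expFix_error {V D p W : ℤ} {δ η : ℝ} (hV : 0 < V) (hp : 0 ≤ p) (hW : 0 ≤ W) (hδ : 0 ≤ δ)
    (h0 : |(expFix V D p W 0 : ℝ) / V - Real.exp (-δ)| ≤ η) (i : ℕ) :
    |(expFix V D p W i : ℝ) / V - Real.exp (-(δ * 2 ^ i))| + 1 / V ≤ 2 ^ i * (η + 1 / V) := by
  have hV' : (0 : ℝ) < V := by exact_mod_cast hV
  induction i with
  | zero => simpa using h0
  | succ i ih =>
    set u := expFix V D p W i
    have hb := expFix_bounds hV hp hW (D := D) i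
    have hd := abs_ediv_sub_le (u * u) hV
    set e := Real.exp (-(δ * 2 ^ i)) with he
    have he1 : Real.exp (-(δ * 2 ^ (i + 1))) = e * e := by
      rw [he, ← Real.exp_add]; congr 1; ring
    have e0 : 0 ≤ e := (Real.exp_pos _).le
    have e1 : e ≤ 1 := Real.exp_le_one_iff.2 (by have : 0 ≤ δ * 2 ^ i := by positivity
                                                 linarith)
    set y : ℝ := (u : ℝ) / V with hy
    have y0 : 0 ≤ y := div_nonneg (by exact_mod_cast hb.1) hV'.le
    have y1 : y ≤ 1 := by rw [hy, div_le_one hV']; exact_mod_cast hb.2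
    have h1 : |y * y - e * e| ≤ 2 * |y - e| := by
      rw [show y * y - e * e = (y + e) * (y - e) by ring, abs_mul, abs_of_nonneg (by linarith)]
      exact mul_le_mul_of_nonneg_right (by linarith) (abs_nonneg _)
    have h2 : |(expFix V D p W (i + 1) : ℝ) / V - y * y| ≤ 1 / V := by
      have e2 : expFix V D p W (i + 1) = u * u / V := rfl
      have e3 : y * y = ((u * u : ℤ) : ℝ) / V / V := by rw [hy]; push_cast; field_simp
      rw [e2, e3, ← sub_div, abs_div, abs_of_pos hV']
      refine div_le_div_of_nonneg_right ?_ hV'.le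
      rw [abs_le]
      constructor <;> linarith [hd.1, hd.2]
    rw [he1]
    have h3 := abs_add_le ((expFix V D p W (i + 1) : ℝ) / V - y * y) (y * y - e * e)
    rw [sub_add_sub_cancel] at h3
    rw [pow_succ]
    linarith

/-- The three summands are the rounding of the division, the use of approximations to `π` and `r`,
and the replacement of `exp (-δ)` by `1 - δ`. The assumption `2 ≤ V r` keeps the approximation of
`r` above `r / 2`. -/
theorem expFix_zero_error {r : ℝ} {V D W : ℤ} {p : ℤ} (hV : 0 < V) (hW : 0 < W)
    (hr : 0 < r) (hD : D = ⌊(V : ℝ) * r⌋) (hrV : 2 ≤ V * r) (hp : |(p : ℝ) - V * Real.pi| ≤ 21)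
    (hδ : 2 * Real.pi / (r ^ 2 * W) ≤ 1) :
    |(expFix V D p W 0 : ℝ) / V - Real.exp (-(2 * Real.pi / (r ^ 2 * W)))| ≤
      1 / (V : ℝ) + 2 / (W : ℝ) * ((84 / r ^ 2 + 32 / r ^ 3) / (V : ℝ)) +
        (2 * Real.pi / (r ^ 2 * W)) ^ 2 := by
  set δ := 2 * Real.pi / (r ^ 2 * W) with hδd
  have hV' : (0 : ℝ) < V := by exact_mod_cast hV
  have hW' : (0 : ℝ) < W := by exact_mod_cast hW
  have hD1 : (D : ℝ) ≤ V * r := by rw [hD]; exact Int.floor_le _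
  have hD2 : V * r < D + 1 := by rw [hD]; exact Int.lt_floor_add_one _
  have hD0 : (0 : ℝ) < D := by linarith
  have hDi : 0 < D := by exact_mod_cast hD0
  set d : ℝ := D / V with hd
  have hd1 : d ≤ r := by rw [hd, div_le_iff₀ hV']; linarith
  have hd2 : r - 1 / V ≤ d := by
    rw [hd, le_div_iff₀ hV', sub_mul, one_div, inv_mul_cancel₀ hV'.ne']; linarith
  have hd3 : r / 2 ≤ d := by rw [hd, le_div_iff₀ hV']; linarith
  have hd0 : 0 < d := by positivity
  set y : ℝ := p / V with hy
  have hy1 : |y - Real.pi| ≤ 21 / V := by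
    rw [hy, show (p : ℝ) / V - Real.pi = (p - V * Real.pi) / V by field_simp, abs_div,
      abs_of_pos hV']
    exact div_le_div_of_nonneg_right hp hV'.le
  have hδ0 : 0 ≤ δ := by positivity
  set P : ℤ := 2 * (p * (V * V)) / (D * D * W)
  have hP := abs_ediv_sub_le (2 * (p * (V * V))) (b := D * D * W) (by positivity)
  have hPe : ((2 * (p * (V * V)) : ℤ) : ℝ) / ((D * D * W : ℤ) : ℝ) = V * (2 / W * (y / d ^ 2)) := by
    rw [hy, hd]; push_cast; field_simp
  rw [hPe] at hP
  have h1 : |(P : ℝ) / V - 2 / W * (y / d ^ 2)| ≤ 1 / (V : ℝ) := by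
    rw [show (P : ℝ) / V - 2 / W * (y / d ^ 2) = ((P : ℝ) - V * (2 / W * (y / d ^ 2))) / V by
        field_simp,
      abs_div, abs_of_pos hV']
    refine div_le_div_of_nonneg_right ?_ hV'.le
    rw [abs_le]; constructor <;> linarith [hP.1, hP.2]
  have h2 : |y / d ^ 2 - Real.pi / r ^ 2| ≤ (84 / r ^ 2 + 32 / r ^ 3) / V := by
    have i1 : 1 / d ^ 2 ≤ 4 / r ^ 2 := by
      rw [div_le_div_iff₀ (by positivity) (by positivity)]
      nlinarith
    have i2 : 0 ≤ 1 / d ^ 2 - 1 / r ^ 2 := by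
      rw [sub_nonneg]
      exact one_div_le_one_div_of_le (by positivity) (by gcongr)
    have i3 : 1 / d ^ 2 - 1 / r ^ 2 ≤ 8 / r ^ 3 / V := by
      have : 1 / d ^ 2 - 1 / r ^ 2 = (r - d) * (r + d) * (1 / d ^ 2) / r ^ 2 := by field_simp; ring
      rw [this]
      have j1 : (r - d) * (r + d) ≤ 1 / V * (2 * r) :=
        mul_le_mul (by linarith) (by linarith) (by linarith) (by positivity)
      have j2 : (r - d) * (r + d) * (1 / d ^ 2) ≤ 1 / V * (2 * r) * (4 / r ^ 2) :=
        mul_le_mul j1 i1 (by positivity) (by positivity)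
      calc _ ≤ 1 / V * (2 * r) * (4 / r ^ 2) / r ^ 2 := by gcongr
        _ = _ := by field_simp; norm_num
    have e : y / d ^ 2 - Real.pi / r ^ 2 =
      (y - Real.pi) * (1 / d ^ 2) + Real.pi * (1 / d ^ 2 - 1 / r ^ 2) := by ring
    rw [e]
    refine (abs_add_le _ _).trans ?_
    rw [abs_mul, abs_mul, abs_of_nonneg i2, abs_of_pos Real.pi_pos,
      abs_of_nonneg (by positivity : (0 : ℝ) ≤ 1 / d ^ 2)]
    have k1 : |y - Real.pi| * (1 / d ^ 2) ≤ 21 / V * (4 / r ^ 2) :=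
      mul_le_mul hy1 i1 (by positivity) (by positivity)
    have k2 : Real.pi * (1 / d ^ 2 - 1 / r ^ 2) ≤ 4 * (8 / r ^ 3 / V) :=
      mul_le_mul Real.pi_lt_four.le i3 i2 (by norm_num)
    calc _ ≤ 21 / V * (4 / r ^ 2) + 4 * (8 / r ^ 3 / V) := add_le_add k1 k2
      _ = _ := by field_simp; ring
  have h3 : |2 / W * (y / d ^ 2) - δ| ≤ 2 / W * ((84 / r ^ 2 + 32 / r ^ 3) / V) := by
    have : 2 / W * (y / d ^ 2) - δ = 2 / W * (y / d ^ 2 - Real.pi / r ^ 2) := by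
      rw [hδd]; field_simp
    rw [this, abs_mul, abs_of_nonneg (by positivity : (0 : ℝ) ≤ 2 / W)]
    exact mul_le_mul_of_nonneg_left h2 (by positivity)
  have h4 : |Real.exp (-δ) - 1 - -δ| ≤ (-δ) ^ 2 :=
    Real.abs_exp_sub_one_sub_id_le (by rw [abs_neg, abs_of_nonneg hδ0]; exact hδ)
  rw [neg_sq] at h4
  -- Replacing a negative value by 0 only moves it towards the positive number `exp (-δ)`.
  have h5 : |(expFix V D p W 0 : ℝ) / V - Real.exp (-δ)| ≤ |1 - (P : ℝ) / V - Real.exp (-δ)| := by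
    have e0 := (Real.exp_pos (-δ)).le
    have : (expFix V D p W 0 : ℝ) / V = max 0 (1 - (P : ℝ) / V) := by
      simp only [expFix]
      change ((max 0 (V - P) : ℤ) : ℝ) / V = _
      push_cast
      rw [← max_div_div_right hV'.le, zero_div, sub_div, div_self hV'.ne']
    rw [this]
    rcases le_total 0 (1 - (P : ℝ) / V) with h | h
    · rw [max_eq_right h]
    · rw [max_eq_left h, zero_sub, abs_neg, abs_of_nonneg e0, abs_of_nonpos (by linarith)]
      linarith
  refine h5.trans ?_
  rw [abs_le] at h1 h3 h4 ⊢
  constructor <;> linarith [h1.1, h1.2, h3.1, h3.2, h4.1, h4.2]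

end QRed



namespace QRed

/-! ## The run of the program -/

/-- The classical input that `inputMem` stores in row `i` and column `j` of the matrix. -/
theorem inputMem_matrix {κ m n q ℓ : ℕ} (A : Matrix (Fin m) (Fin n) (ZMod q)) (b : Fin m → ZMod q)
    (i : Fin m) (j : Fin n) : inputMem κ ℓ A b (5, (i : ℕ), (j : ℕ)) = ((A i j).val : ℤ) := by
  simp [inputMem]

theorem inputMem_vector {κ m n q ℓ : ℕ} (A : Matrix (Fin m) (Fin n) (ZMod q)) (b : Fin m → ZMod q)
    (i : Fin m) : inputMem κ ℓ A b (6, (i : ℕ), 0) = ((b i).val : ℤ) := by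
  simp [inputMem]

theorem inputMem_bdd {κ m n q ℓ S : ℕ} [NeZero q] (A : Matrix (Fin m) (Fin n) (ZMod q))
    (b : Fin m → ZMod q) (hκ : κ < S) (hn : n < S) (hm : m < S) (hℓ : ℓ < S) (hq : q ≤ 2 ^ m) :
    Bdd S (inputMem κ ℓ A b) := by
  have h2 : 2 ^ m < 2 ^ S := Nat.pow_lt_pow_right (by norm_num) hm
  intro a
  unfold inputMem
  split_ifs
  · exact hκ.trans Nat.lt_two_pow_self
  · exact hn.trans Nat.lt_two_pow_self
  · exact hq.trans_lt h2
  · exact hm.trans Nat.lt_two_pow_self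
  · exact hℓ.trans Nat.lt_two_pow_self
  · exact (ZMod.val_lt _).trans_le hq |>.trans h2
  · exact (ZMod.val_lt _).trans_le hq |>.trans h2
  · simp

/-- The number of binary digits of `r` that the program uses. -/
def precision (κ B m : ℕ) : ℕ := 32 * (B + κ + 1) + m

/-- The truncation bound for the superpositions. -/
noncomputable def truncation (κ B m : ℕ) (r : ℝ) : ℤ :=
  Nat.sqrt κ * ⌊(2 : ℝ) ^ precision κ B m * r⌋ / 2 ^ precision κ B m

/-- The parameters that the classical part of the program computes. -/
noncomputable def mkPar (κ B : ℕ) (r : ℝ) {m n q : ℕ} (ℓ : ℕ) (A : Matrix (Fin m) (Fin n) (ZMod q))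
    (b : Fin m → ZMod q) : Par where
  n := n
  q := q
  m := m
  ℓ := ℓ
  H := 2 * (B + κ + 1)
  T := 80 * (κ * ℓ)
  R := (truncation κ B m r).toNat
  V := 2 ^ precision κ B m
  G := 16 * (B + κ + 1)
  u := fun i => expFix (2 ^ precision κ B m) ⌊(2 : ℝ) ^ precision κ B m * r⌋
    (piFix (precision κ B m)) (2 ^ (16 * (B + κ + 1))) (16 * (B + κ + 1) + i)
  A := fun i j => inputMem κ ℓ A b (5, i, j)
  b := fun i => inputMem κ ℓ A b (6, i, 0)

theorem truncation_nonneg {κ B m : ℕ} {r : ℝ} (hr : 0 < r) : 0 ≤ truncation κ B m r := by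
  have : 0 ≤ ⌊(2 : ℝ) ^ precision κ B m * r⌋ := Int.floor_nonneg.2 (by positivity)
  unfold truncation
  positivity

theorem truncation_le {κ B m : ℕ} {r : ℝ} :
    (truncation κ B m r : ℝ) ≤ Nat.sqrt κ * r := by
  have h := (abs_ediv_sub_le (Nat.sqrt κ * ⌊(2 : ℝ) ^ precision κ B m * r⌋)
    (show (0 : ℤ) < 2 ^ precision κ B m by positivity)).1
  refine h.trans ?_
  push_cast
  rw [div_le_iff₀ (by positivity)]
  calc (Nat.sqrt κ : ℝ) * (⌊(2 : ℝ) ^ precision κ B m * r⌋ : ℝ)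
      ≤ Nat.sqrt κ * ((2 : ℝ) ^ precision κ B m * r) := by gcongr; exact Int.floor_le _
    _ = _ := by ring

theorem truncation_bound {κ B m : ℕ} {r : ℝ} (hr : 0 < r) (hB : r ≤ 2 ^ (B + 1)) :
    2 * (truncation κ B m r).toNat + 1 ≤ 2 ^ (2 * (B + κ + 1)) := by
  have h1 := truncation_le (κ := κ) (B := B) (m := m) (r := r)
  have h2 : (truncation κ B m r : ℝ) ≤ κ * 2 ^ (B + 1) := by
    refine h1.trans ?_
    have : (Nat.sqrt κ : ℝ) ≤ κ := by exact_mod_cast Nat.sqrt_le_self κ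
    gcongr
  have h3 : truncation κ B m r ≤ κ * 2 ^ (B + 1) := by exact_mod_cast h2
  have h4 : (truncation κ B m r).toNat ≤ κ * 2 ^ (B + 1) := Int.toNat_le.2 (by exact_mod_cast h3)
  have h5 : κ + 1 ≤ 2 ^ κ := Nat.lt_two_pow_self
  calc 2 * (truncation κ B m r).toNat + 1 ≤ 2 * (κ * 2 ^ (B + 1)) + 2 * 2 ^ (B + 1) := by
        have : 1 ≤ 2 ^ (B + 1) := Nat.one_le_two_pow
        omega
    _ = 2 * ((κ + 1) * 2 ^ (B + 1)) := by ring
    _ ≤ 2 * (2 ^ κ * 2 ^ (B + 1)) := by gcongr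
    _ = 2 ^ (κ + B + 2) := by ring
    _ ≤ _ := Nat.pow_le_pow_right (by norm_num) (by omega)

/-- A bound for the bit lengths of all numbers in a run of the program. -/
def bitBound (κ E n m ℓ : ℕ) : ℕ := 600 * (E + κ + m + n + ℓ + 1) + 80 * (κ * ℓ)

theorem mkPar_ok {κ B E m n q ℓ : ℕ} [NeZero q] {r : ℝ} (hr : 0 < r) (hBE : B ≤ 2 * E + 1)
    (hB : r ≤ 2 ^ (B + 1)) (hq : q ≤ 2 ^ m) (A : Matrix (Fin m) (Fin n) (ZMod q))
    (b : Fin m → ZMod q) : (mkPar κ B r ℓ A b).Ok (bitBound κ E n m ℓ) where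
  q_pos := NeZero.pos q
  q_le := hq
  R_le := truncation_bound hr hB
  n_lt := by simp only [mkPar, bitBound]; omega
  m_lt := by simp only [mkPar, bitBound]; omega
  H_lt := by simp only [mkPar, bitBound]; omega
  T_lt := by simp only [mkPar, bitBound]; omega
  ℓ_lt := by simp only [mkPar, bitBound]; omega
  size := by
    have hR := truncation_bound (κ := κ) (m := m) hr hB
    have hR' : (truncation κ B m r).toNat ≤ 2 ^ (2 * (B + κ + 1)) := by omega
    have hn : n ≤ 2 ^ n := Nat.lt_two_pow_self.le
    simp only [mkPar]
    set Z := 2 * (B + κ + 1) + n + 2 * m with hZ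
    have p1 : q ≤ 2 ^ Z := hq.trans (Nat.pow_le_pow_right (by norm_num) (by omega))
    have p2 : n * q * q ≤ 2 ^ Z := by
      calc n * q * q ≤ 2 ^ n * 2 ^ m * 2 ^ m := by gcongr
        _ = 2 ^ (n + m + m) := by rw [pow_add, pow_add]
        _ ≤ _ := Nat.pow_le_pow_right (by norm_num) (by omega)
    have p3 : q * (truncation κ B m r).toNat ≤ 2 ^ Z := by
      calc q * (truncation κ B m r).toNat ≤ 2 ^ m * 2 ^ (2 * (B + κ + 1)) := by gcongr
        _ = 2 ^ (m + 2 * (B + κ + 1)) := by rw [pow_add]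
        _ ≤ _ := Nat.pow_le_pow_right (by norm_num) (by omega)
    have p4 : 1 ≤ 2 ^ Z := Nat.one_le_two_pow
    calc q + n * q * q + q * (truncation κ B m r).toNat + 16 < 2 ^ Z * 2 ^ 5 := by omega
      _ = 2 ^ (Z + 5) := (pow_add 2 Z 5).symm
      _ ≤ _ := Nat.pow_le_pow_right (by norm_num) (by simp only [bitBound]; omega)
  A := fun i j hi hj => by
    have h := inputMem_matrix (κ := κ) (ℓ := ℓ) A b ⟨i, hi⟩ ⟨j, hj⟩
    simp only [mkPar] at h ⊢
    rw [h]
    exact ⟨by positivity, by exact_mod_cast ZMod.val_lt _⟩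
  b := fun i hi => by
    have h := inputMem_vector (κ := κ) (ℓ := ℓ) A b ⟨i, hi⟩
    simp only [mkPar] at h ⊢
    rw [h]
    exact ⟨by positivity, by exact_mod_cast ZMod.val_lt _⟩

theorem qSupp_single {c : Par} (hc : 0 < c.q) :
    QSupp c 0 0 0 0 0 ⇑(Finsupp.single (0 : Mem) (1 : ℂ)) := by
  intro Q hQ
  have : Q = 0 := by
    by_contra h
    exact hQ (Finsupp.single_eq_of_ne h)
  subst this
  exact ⟨fun a => ⟨okVal_zero c _ hc, fun _ => rfl, fun _ => ⟨fun _ _ => rfl, fun _ _ => rfl,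
    fun _ _ => rfl, fun _ => by simp, fun _ _ => rfl⟩⟩, fun _ => rfl⟩

/-- All phases joined by the program logic. There is a single branch, so every later argument
concerns one explicit state vector; `B` is existential because the program finds it. The assumption
`E ≤ 2 ^ κ` ensures that `κ` squarings reach the size of `r`. -/
theorem run_reduction {κ E m n q ℓ : ℕ} [NeZero q] {r : ℝ} (hr : 0 < r) (hE : r ≤ 2 ^ E)
    (hEκ : E ≤ 2 ^ κ) (hq : q ≤ 2 ^ m) (A : Matrix (Fin m) (Fin n) (ZMod q)) (b : Fin m → ZMod q) :
    ∃ (B : ℕ) (c : Config), r ≤ 2 ^ (B + 1) ∧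
      (mkPar κ B r ℓ A b).Ok (bitBound κ E n m ℓ) ∧
      run r reduction (initial κ ℓ A b) = {c} ∧ c.time ≤ reduction.tm (bitBound κ E n m ℓ) ∧
      ⇑c.ket = copies (mkPar κ B r ℓ A b) ℓ ⇑(Finsupp.single (0 : Mem) (1 : ℂ)) := by
  set S := bitBound κ E n m ℓ with hSdef
  have hS : 600 * (E + κ + m + n + ℓ + 1) + 80 * (κ * ℓ) = S := rfl
  have hS1 : 1 ≤ S := by omega
  suffices hwp : WP r S reduction (fun _ f => ∃ B, r ≤ 2 ^ (B + 1) ∧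
      (mkPar κ B r ℓ A b).Ok S ∧
      f = copies (mkPar κ B r ℓ A b) ℓ ⇑(Finsupp.single (0 : Mem) (1 : ℂ)))
      (inputMem κ ℓ A b) ⇑(Finsupp.single (0 : Mem) (1 : ℂ)) by
    obtain ⟨μ', ket', τ', h1, ⟨B, h2, h3, h4⟩, h5⟩ := hwp _ 0 rfl
    exact ⟨B, ⟨μ', ket', τ'⟩, h2, h3, h1, by simpa using h5, h4⟩
  have hb0 : Bdd S (inputMem κ ℓ A b) :=
    inputMem_bdd A b (by omega) (by omega) (by omega) (by omega) hq
  refine WP.seq (WP.progSqrt (κ := κ) hS1 hb0 (by simp [inputMem]) (by omega)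
    fun μ1 hs1 hb1 e1 => ?_)
  refine WP.seq (WP.progSize (κ := κ) (E := E) hS1 hb1 ((hs1 _ (by simp)).trans (by simp [inputMem]))
    (by omega) hr.le hE hEκ (by omega) fun μ2 B hs2 hb2 hBE hB e2 => ?_)
  have hs12 : Same {10, 11, 12, 13, 42} (inputMem κ ℓ A b) μ2 :=
    (hs1.mono (by decide)).trans (hs2.mono (by decide))
  set L := precision κ B m with hL
  have hL' : 32 * (B + κ + 1) + m = L := rfl
  refine WP.seq (WP.progPow (κ := κ) (B := B) (m := m) hS1 hb2
    ((hs12 _ (by simp)).trans (by simp [inputMem])) ((hs12 _ (by simp)).trans (by simp [inputMem]))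
    e2 (by omega) fun μ3 hs3 hb3 e14 e28 e27 => ?_)
  rw [hL'] at e28 e27
  have hs13 : Same {10, 11, 12, 13, 14, 27, 28, 42} (inputMem κ ℓ A b) μ3 :=
    (hs12.mono (by decide)).trans (hs3.mono (by decide))
  refine WP.seq (WP.progPi (L := L) hS1 hb3 e28 (e27 L le_rfl) (by omega)
    fun μ4 hs4 hb4 e15 e19 => ?_)
  have hs14 : Same {10, 11, 12, 13, 14, 15, 17, 18, 19, 27, 28, 42} (inputMem κ ℓ A b) μ4 :=
    (hs13.mono (by decide)).trans (hs4.mono (by decide))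
  have hok := mkPar_ok (κ := κ) (ℓ := ℓ) hr hBE hB hq A b
  have hD0 : 0 ≤ ⌊(2 : ℝ) ^ L * r⌋ := Int.floor_nonneg.2 (by positivity)
  have hD1 : ⌊(2 : ℝ) ^ L * r⌋ ≤ 2 ^ (L + E) := by
    have : (⌊(2 : ℝ) ^ L * r⌋ : ℝ) ≤ 2 ^ (L + E) := by
      refine (Int.floor_le _).trans ?_
      rw [pow_add]
      gcongr
    exact_mod_cast this
  have hX : (Nat.sqrt κ : ℤ) ≤ 2 ^ κ := by
    exact_mod_cast (Nat.sqrt_le_self κ).trans Nat.lt_two_pow_self.le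
  have hXD : (Nat.sqrt κ : ℤ) * ⌊(2 : ℝ) ^ L * r⌋ ≤ 2 ^ (κ + L + E) := by
    calc (Nat.sqrt κ : ℤ) * ⌊(2 : ℝ) ^ L * r⌋ ≤ 2 ^ κ * 2 ^ (L + E) := by gcongr
      _ = _ := by rw [← pow_add, ← add_assoc]
  refine WP.seq (WP.progExp (κ := κ) (ℓ := ℓ) (X := Nat.sqrt κ) (bb := B + κ + 1) (L := L)
    (D := ⌊(2 : ℝ) ^ L * r⌋) hS1 hb4 ((hs14 _ (by simp)).trans (by simp [inputMem]))
    ((hs14 _ (by simp)).trans (by simp [inputMem]))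
    ((hs4 _ (by simp)).trans ((hs3 _ (by simp)).trans ((hs2 _ (by simp)).trans e1)))
    ((hs4 _ (by simp)).trans e14) e15 e19 ((hs4 _ (by simp)).trans e28)
    (piFix_bounds (by omega)) (fun i hi => (hs4 _ (by simp)).trans (e27 i hi)) (by omega) (by omega)
    rfl hD0 ?_ ?_ (by omega) fun μ5 hs5 hb5 e23 e26 e25 e20 e21 e24 => ?_)
  · calc 2 * ((Nat.sqrt κ : ℤ) * ⌊(2 : ℝ) ^ L * r⌋) + 1 ≤ 2 * 2 ^ (κ + L + E) + 1 := by gcongr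
      _ < 2 ^ (κ + L + E) * 2 ^ 2 := by
        have : (1 : ℤ) ≤ 2 ^ (κ + L + E) := one_le_pow₀ (by norm_num)
        omega
      _ = 2 ^ (κ + L + E + 2) := by rw [← pow_add]
      _ ≤ _ := pow_le_pow_right₀ (by norm_num) (by omega)
  · exact hD1.trans_lt (pow_lt_pow_right₀ (by norm_num) (by omega))
  have hs15 : Same {10, 11, 12, 13, 14, 15, 16, 17, 18, 19, 20, 21, 23, 24, 25, 26, 27, 28, 42}
      (inputMem κ ℓ A b) μ5 := (hs14.mono (by decide)).trans (hs5.mono (by decide))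
  have hT0 : ((truncation κ B m r).toNat : ℤ) = truncation κ B m r :=
    Int.toNat_of_nonneg (truncation_nonneg hr)
  refine WP.quantumPart (c := mkPar κ B r ℓ A b) hS1 ?_ hok
    (qSupp_single hok.q_pos) fun μ' => ⟨B, hB, hok, rfl⟩
  exact {
    bdd := hb5
    n := (hs15 _ (by simp)).trans (by simp [inputMem, mkPar])
    q := (hs15 _ (by simp)).trans (by simp [inputMem, mkPar])
    m := (hs15 _ (by simp)).trans (by simp [inputMem, mkPar])
    ℓ := (hs15 _ (by simp)).trans (by simp [inputMem, mkPar])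
    A := fun i j _ _ => hs15 _ (by simp)
    b := fun i _ => hs15 _ (by simp)
    V := ((hs5 _ (by simp)).trans e15).trans (by simp [mkPar, hL])
    R := e20.trans (by simp only [mkPar]; rw [hT0]; rfl)
    N := e21.trans (by simp only [mkPar]; rw [hT0]; rfl)
    G := e23
    u := fun i hi => by
      have := e24 (16 * (B + κ + 1) + i) (by simp only [mkPar] at hi; omega)
      simp only [mkPar]
      rw [← this]
      push_cast
      rfl
    T := e25
    H := e26
    powH := fun i hi => (hs5 _ (by simp)).trans ((hs4 _ (by simp)).trans
      (e27 i (by simp only [mkPar] at hi; omega)))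
    powm := fun i hi => (hs5 _ (by simp)).trans ((hs4 _ (by simp)).trans
      (e27 i (by simp only [mkPar] at hi; omega))) }

theorem exists_time_bound (n m ℓ : ℕ → ℕ) (hnm : ∀ κ, n κ ≤ m κ)
    {a : ℕ} (h : ∀ᶠ κ : ℕ in Filter.atTop, m κ ≤ κ ^ a ∧ ℓ κ ≤ κ ^ a) :
    ∃ d : ℕ, ∀ᶠ κ : ℕ in Filter.atTop,
      reduction.tm (bitBound κ (κ ^ a) (n κ) (m κ) (ℓ κ)) ≤ κ ^ d := by
  obtain ⟨C, e, hC⟩ := Prog.tm_le reduction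
  refine ⟨1 + (a + 2) * e + e, ?_⟩
  -- `3680 = 6 * 600 + 80` counts the terms of `bitBound`, each at most `κ ^ (a + 2)`. One factor
  -- `κ` absorbs this constant, another one absorbs `C`.
  filter_upwards [h, Filter.eventually_ge_atTop (C + 3680)] with κ hκ hκC
  have hS : bitBound κ (κ ^ a) (n κ) (m κ) (ℓ κ) ≤ κ ^ (a + 2) * κ := by
    have h1 : 1 ≤ κ := by omega
    have p1 : κ ^ a ≤ κ ^ (a + 2) := Nat.pow_le_pow_right h1 (by omega)
    have p2 : κ ≤ κ ^ (a + 2) := by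
      calc κ = κ ^ 1 := (pow_one _).symm
        _ ≤ _ := Nat.pow_le_pow_right h1 (by omega)
    have p3 : κ * ℓ κ ≤ κ ^ (a + 2) := by
      calc κ * ℓ κ ≤ κ * κ ^ a := by gcongr; exact hκ.2
        _ = κ ^ (a + 1) := by ring
        _ ≤ _ := Nat.pow_le_pow_right h1 (by omega)
    have p4 : 1 ≤ κ ^ (a + 2) := Nat.one_le_pow _ _ h1
    have := hnm κ
    calc bitBound κ (κ ^ a) (n κ) (m κ) (ℓ κ) ≤ κ ^ (a + 2) * 3680 := by
          unfold bitBound; omega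
      _ ≤ _ := by gcongr; omega
  have hS1 : 1 ≤ bitBound κ (κ ^ a) (n κ) (m κ) (ℓ κ) := by unfold bitBound; omega
  calc reduction.tm (bitBound κ (κ ^ a) (n κ) (m κ) (ℓ κ))
      ≤ C * bitBound κ (κ ^ a) (n κ) (m κ) (ℓ κ) ^ e := hC _ hS1
    _ ≤ κ * (κ ^ (a + 2) * κ) ^ e := by gcongr; omega
    _ = κ ^ (1 + (a + 2) * e + e) := by rw [mul_pow, ← pow_mul, pow_add, pow_add, pow_one]; ring

theorem eventually_pow_le_two_pow (a : ℕ) : ∀ᶠ κ : ℕ in Filter.atTop, κ ^ a ≤ 2 ^ κ := by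
  have h := (isLittleO_pow_const_const_pow_of_one_lt (R := ℝ) a (r := 2) (by norm_num)).bound
    (show (0 : ℝ) < 1 by norm_num)
  filter_upwards [h] with κ hκ
  have h' : (κ : ℝ) ^ a ≤ 2 ^ κ := by simpa using hκ
  exact_mod_cast h'

end QRed



namespace QRed

/-! ## Amplitudes of the final state -/

/-- Sets the first `i` entries of row `k` of the array `x` to `0`. -/
def clear (x k i : ℕ) (Q : Mem) : Mem := fun a =>
  if a.1 = x ∧ a.2.1 = k ∧ 0 ≤ a.2.2 ∧ a.2.2 < i then 0 else Q a

/-- The number of the interval that contains coordinate `i` of copy `k`. -/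
def cellOf (c : Par) (k i : ℕ) (Q : Mem) : ℤ := 8 * ((Q (7, k, i) + rowVal c k i Q) % c.q) / c.q

theorem update_clear (x k i : ℕ) (Q : Mem) :
    clear x k i (Function.update Q (x, (k : ℤ), (i : ℤ)) 0) = clear x k (i + 1) Q := by
  funext ⟨x', k', j⟩
  simp only [clear, Function.update_apply, Prod.mk.injEq]
  by_cases h1 : x' = x <;> by_cases h2 : k' = k <;> simp only [h1, h2, true_and, false_and, if_false] <;>
    first | rfl | (split_ifs <;> omega)

theorem clear_zero (x k : ℕ) (Q : Mem) : clear x k 0 Q = Q := by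
  funext a
  simp only [clear]
  rw [if_neg]
  push_cast
  omega

section

variable {c : Par} {S : ℕ} {f : Mem → ℂ} {k n₁ n₂ n₃ : ℕ}

theorem cellOf_update (c : Par) (k i : ℕ) (Q : Mem) (j : ℤ) (z : ℤ) :
    cellOf c k i (Function.update Q (11, (k : ℤ), j) z) = cellOf c k i Q := by
  simp [cellOf, rowVal]

/-- Cell `(11, k, i)` is still 0 on the support when coordinate `i` is treated, so the addition
writes the interval number into it, and amplitude survives only where the content agrees with that
number. -/
theorem locates_eval (hc : c.Ok S) (hf : QSupp c k n₁ n₂ n₃ 0 f) (i : ℕ) (Q : Mem) :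
    locates c k i f Q =
      if ∀ l < i, Q (11, k, l) = cellOf c k l Q then f (clear 11 k i Q) else 0 := by
  induction i generalizing Q with
  | zero => simp [locates, clear_zero]
  | succ i ih =>
    have e : locates c k (i + 1) f Q =
        locates c k i f (Function.update Q (11, (k : ℤ), (i : ℤ))
          (Q (11, k, i) - cellOf c k i Q)) := by
      rw [← cellOf_update c k i Q i 0]
      rfl
    rw [e]
    by_cases hi : Q (11, k, i) = cellOf c k i Q
    · rw [hi, sub_self, ih, update_clear]
      congr 1
      rw [eq_iff_iff]
      simp only [cellOf_update]
      constructor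
      · intro h l hl
        rcases Nat.lt_succ_iff_lt_or_eq.1 hl with h' | rfl
        · have := h l h'
          rwa [Function.update_of_ne (by simp; omega)] at this
        · exact hi
      · intro h l hl
        rw [Function.update_of_ne (by simp; omega)]
        exact h l (by omega)
    · rw [if_neg (fun h => hi (h i (by omega)))]
      by_contra hne
      have := ((locates_supp hc hf _ hne).1 (11, k, i)).2.2 rfl
      have := this.2.2.2.2 rfl le_rfl
      rw [Function.update_self] at this
      exact hi (by omega)

theorem sampleRow_eval (x i : ℕ) (Q : Mem) :
    sampleRow c x k i f Q =
      ((∏ l ∈ Finset.range i, ampl (unifProb c.q) c.m (Q (x, k, l)) : ℝ) : ℂ) *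
        f (clear x k i Q) := by
  induction i generalizing Q with
  | zero => simp [sampleRow, clear_zero]
  | succ i ih =>
    rw [sampleRow, sample, ih, update_clear, Finset.prod_range_succ]
    have : ∀ l ∈ Finset.range i, ampl (unifProb c.q) c.m
        (Function.update Q (x, (k : ℤ), (i : ℤ)) 0 (x, (k : ℤ), (l : ℤ))) =
        ampl (unifProb c.q) c.m (Q (x, k, l)) := by
      intro l hl
      rw [Finset.mem_range] at hl
      rw [Function.update_of_ne (by simp; omega)]
    rw [Finset.prod_congr rfl this]
    push_cast
    ring

/-- The amplitude of the value `j` and the flags `Y` in an attempt. -/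
noncomputable def attAmp (c : Par) (j Y : ℤ) : ℝ :=
  ampl (flagProb c j) c.H Y * ampl (unifProb (2 * c.R + 1 : ℕ)) c.H (j + c.R)

theorem attemptPrep_eval (t : ℕ) (Q : Mem) :
    attemptPrep c k t f Q = (attAmp c (Q (8, k, t)) (Q (9, k, t)) : ℂ) *
      f (Function.update (Function.update Q (9, k, t) 0) (8, k, t) 0) := by
  simp [attemptPrep, sample, addTo, attAmp, mul_assoc]

/-- The state before attempt `t`, with counter `D` and output `O`, from which the attempts lead
to `Q`. -/
def trim (k t : ℕ) (D O : ℤ) (Q : Mem) : Mem := fun a =>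
  if (a.1 = 8 ∨ a.1 = 9) ∧ a.2.1 = k ∧ (t : ℤ) ≤ a.2.2 then 0
  else if a = (10, (k : ℤ), 0) then D else if a = (0, (k : ℤ), 0) then O else Q a

theorem trim_step (k t : ℕ) (D O D' O' J' : ℤ) (Q : Mem) :
    Function.update (Function.update (Function.update (Function.update (Function.update
      (trim k (t + 1) D O Q) (10, (k : ℤ), 0) D') (8, (k : ℤ), (t : ℤ)) J') (0, (k : ℤ), 0) O')
      (9, (k : ℤ), (t : ℤ)) 0) (8, (k : ℤ), (t : ℤ)) 0 = trim k t D' O' Q := by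
  funext ⟨x, k', j⟩
  simp only [Function.update_apply, trim, Prod.mk.injEq]
  by_cases h1 : k' = k
  · by_cases h8 : x = 8
    · subst h8; simp [h1]; split_ifs <;> omega
    · by_cases h9 : x = 9
      · subst h9; simp [h1]; split_ifs <;> omega
      · by_cases h10 : x = 10
        · subst h10; simp [h1]; split_ifs <;> omega
        · simp [h1, h8, h9, h10]
          split_ifs <;> omega
  · simp [h1]

/-- Each `addTo` evaluates the earlier state at the point where its addition is undone. Undoing goes
in reverse order: counter, value, output. `D'`, `J'`, `O'` are the contents before the additions,
and `s` is the selection bit, recomputed from `D'`. -/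
theorem attemptStep_eval (t : ℕ) (P : Mem) {D' J' O' s : ℤ}
    (hD : D' = P (10, k, 0) - if P (9, k, t) < 1 then 1 else 0)
    (hs : s = (if D' < 1 then 1 else 0) * if P (9, k, t) < 1 then 1 else 0)
    (hJ : J' = P (8, k, t) + s * P (0, k, 0)) (hO : O' = P (0, k, 0) - s * J') :
    attemptStep c k t f P = attemptPrep c k t f (Function.update (Function.update (Function.update
      P (10, (k : ℤ), 0) D') (8, (k : ℤ), (t : ℤ)) J') (0, (k : ℤ), 0) O') := by
  subst hO hJ hs hD
  simp [attemptStep, addTo, sel]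

theorem attemptStep_trim {t : ℕ} {D O D' J' O' s : ℤ} {Q : Mem}
    (hD : D' = D - if Q (9, k, t) < 1 then 1 else 0)
    (hs : s = (if D' < 1 then 1 else 0) * if Q (9, k, t) < 1 then 1 else 0)
    (hJ : J' = Q (8, k, t) + s * O) (hO : O' = O - s * J') :
    attemptStep c k t f (trim k (t + 1) D O Q) =
      (attAmp c J' (Q (9, k, t)) : ℂ) * f (trim k t D' O' Q) := by
  have e8 : trim k (t + 1) D O Q (8, (k : ℤ), (t : ℤ)) = Q (8, k, t) := by simp [trim]
  have e9 : trim k (t + 1) D O Q (9, (k : ℤ), (t : ℤ)) = Q (9, k, t) := by simp [trim]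
  have e10 : trim k (t + 1) D O Q (10, (k : ℤ), 0) = D := by simp [trim]
  have e0 : trim k (t + 1) D O Q (0, (k : ℤ), 0) = O := by simp [trim]
  rw [attemptStep_eval (D' := D') (J' := J') (O' := O') (s := s) t _ (by rw [e10, e9]; exact hD)
    (by rw [e9]; exact hs) (by rw [e8, e0]; exact hJ) (by rw [e0]; exact hO), attemptPrep_eval,
    trim_step]
  congr 3
  simp

/-- The first attempt of copy `k` with all flags `0` is attempt `t₀`. -/
structure FirstAt (c : Par) (k t₀ : ℕ) (Q : Mem) : Prop where
  lt : t₀ < c.T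
  before : ∀ t < t₀, 1 ≤ Q (9, k, t)
  flags : Q (9, k, t₀) = 0
  value : Q (8, k, t₀) = 0
  nonneg : ∀ t, t₀ < t → 0 ≤ Q (9, k, t)

/-- The number of attempts before `t` with all flags `0`. -/
def countZero (k t : ℕ) (Q : Mem) : ℤ :=
  ∑ i ∈ Finset.range t, if Q (9, k, i) = 0 then 1 else 0

/-- Traced backwards, an attempt after `t₀` finds a positive counter and one before `t₀` has a flag
raised; neither is selected. Attempt `t₀` is selected, and its value, since moved, is found in the
output register: hence `Q (0, k, 0)` takes the place of `Q (8, k, t₀)`. -/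
theorem attempts_eval {t₀ t : ℕ} {Q : Mem} (h : FirstAt c k t₀ Q) :
    attempts c k t f (trim k t (countZero k t Q) (if t₀ < t then Q (0, k, 0) else 0) Q) =
      ((∏ i ∈ Finset.range t, attAmp c (if i = t₀ then Q (0, k, 0) else Q (8, k, i))
        (Q (9, k, i)) : ℝ) : ℂ) * f (trim k 0 0 0 Q) := by
  have hc0 : ∀ t ≤ t₀, countZero k t Q = 0 := fun t ht =>
    Finset.sum_eq_zero fun i hi => if_neg (by
      have := h.before i (by rw [Finset.mem_range] at hi; omega)
      omega)
  have hc1 : ∀ t, t₀ < t → 1 ≤ countZero k t Q := fun t ht => by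
    have := Finset.single_le_sum (f := fun i : ℕ => if Q (9, k, i) = 0 then (1 : ℤ) else 0)
      (fun i _ => by split_ifs <;> simp) (Finset.mem_range.2 ht)
    rwa [h.flags, if_pos rfl] at this
  induction t with
  | zero => simp [attempts, countZero]
  | succ t ih =>
    have hsucc : countZero k (t + 1) Q = countZero k t Q + if Q (9, k, t) = 0 then 1 else 0 :=
      Finset.sum_range_succ _ _
    rw [attempts, Finset.prod_range_succ]
    rcases lt_trichotomy t t₀ with ht | rfl | ht
    · have h9 := h.before t ht
      rw [attemptStep_trim (D' := countZero k t Q) (J' := Q (8, k, t)) (O' := 0) (s := 0)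
        (by rw [hsucc]; split_ifs <;> omega) (by rw [if_neg (show ¬ Q (9, k, t) < 1 by omega)]; simp)
        (by simp) (by simp; omega), if_neg (by omega)]
      rw [if_neg (by omega)] at ih
      rw [ih]
      push_cast
      ring
    · have h9 := h.flags
      rw [if_pos (by omega), attemptStep_trim (D' := countZero k t Q) (J' := Q (0, k, 0))
        (O' := 0) (s := 1)
        (by rw [hsucc]; split_ifs <;> omega) (by rw [hc0 t le_rfl, h9]; simp)
        (by rw [h.value]; simp) (by simp), if_pos rfl]
      rw [if_neg (by omega)] at ih
      rw [ih]
      push_cast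
      ring
    · have h9 := h.nonneg t ht
      have hc := hc1 t ht
      rw [if_pos (by omega), attemptStep_trim (D' := countZero k t Q) (J' := Q (8, k, t))
        (O' := Q (0, k, 0)) (s := 0)
        (by rw [hsucc]; split_ifs <;> omega)
        (by rw [if_neg (show ¬ countZero k t Q < 1 by omega)]; simp)
        (by simp) (by simp), if_neg (by omega)]
      rw [if_pos ht] at ih
      rw [ih]
      push_cast
      ring

/-- `Q` has non-zero entries only in the registers of `c.ℓ` copies. -/
structure Clean (c : Par) (Q : Mem) : Prop where
  row : ∀ a, Q a ≠ 0 → 0 ≤ a.2.1 ∧ a.2.1 < c.ℓ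
  zero : ∀ k j : ℤ, j ≠ 0 → Q (0, k, j) = 0
  one : ∀ k j : ℤ, ¬(0 ≤ j ∧ j < c.n) → Q (1, k, j) = 0
  seven : ∀ k j : ℤ, ¬(0 ≤ j ∧ j < c.m) → Q (7, k, j) = 0
  eight : ∀ k j : ℤ, ¬(0 ≤ j ∧ j < c.T) → Q (8, k, j) = 0
  nine : ∀ k j : ℤ, ¬(0 ≤ j ∧ j < c.T) → Q (9, k, j) = 0
  ten : ∀ k j : ℤ, j ≠ 0 → Q (10, k, j) = 0
  eleven : ∀ k j : ℤ, ¬(0 ≤ j ∧ j < c.m) → Q (11, k, j) = 0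
  other : ∀ x, x ∉ ({0, 1, 7, 8, 9, 10, 11} : Finset ℕ) → ∀ k j : ℤ, Q (x, k, j) = 0

/-- Keeps the registers of the first `k` copies. -/
def below (k : ℕ) (Q : Mem) : Mem := fun a => if (k : ℤ) ≤ a.2.1 then 0 else Q a

theorem Clean.below_eq {Q : Mem} (h : Clean c Q) : below c.ℓ Q = Q := by
  funext a
  simp only [below]
  split_ifs with ha
  · by_contra hne
    have := h.row a (Ne.symm hne)
    omega
  · rfl

theorem Clean.below_zero {Q : Mem} (h : Clean c Q) : below 0 Q = 0 := by
  funext a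
  simp only [below]
  split_ifs with ha
  · rfl
  · by_contra hne
    have := h.row a hne
    push_cast at ha
    omega

theorem Clean.clear_below {Q : Mem} (h : Clean c Q) (k : ℕ) :
    clear 1 k c.n (clear 7 k c.m (trim k 0 0 0 (clear 11 k c.m (below (k + 1) Q)))) =
      below k Q := by
  funext ⟨x, k', j⟩
  by_cases hk : k' = k
  · subst hk
    have e : below (k + 1) Q (x, (k : ℤ), j) = Q (x, k, j) := by simp [below]
    have e' : below k Q (x, (k : ℤ), j) = 0 := by simp [below]
    rw [e']
    by_cases hx : x ∈ ({0, 1, 7, 8, 9, 10, 11} : Finset ℕ)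
    · simp only [Finset.mem_insert, Finset.mem_singleton] at hx
      rcases hx with rfl | rfl | rfl | rfl | rfl | rfl | rfl
      · have := h.zero k j
        simp only [clear, trim, e, Prod.mk.injEq]; simp; omega
      · have := h.one k j
        simp only [clear, trim, e, Prod.mk.injEq]; simp; omega
      · have := h.seven k j
        simp only [clear, trim, e, Prod.mk.injEq]; simp; omega
      · have := h.eight k j
        simp only [clear, trim, e, Prod.mk.injEq]; simp; omega
      · have := h.nine k j
        simp only [clear, trim, e, Prod.mk.injEq]; simp; omega
      · have := h.ten k j
        simp only [clear, trim, e, Prod.mk.injEq]; simp; omega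
      · have := h.eleven k j
        simp only [clear, trim, e, Prod.mk.injEq]; simp; omega
    · have := h.other x hx k j
      simp only [Finset.mem_insert, Finset.mem_singleton, not_or] at hx
      simp [clear, trim, e, this, hx]
  · simp [clear, trim, hk, below]
    split_ifs <;> first | rfl | omega

/-- The contribution of copy `k` to the amplitude of `Q`, if the first attempt with all flags `0` is
attempt `t₀`. -/
noncomputable def rowAmp (c : Par) (k t₀ : ℕ) (Q : Mem) : ℝ :=
  (if ∀ l < c.m, Q (11, k, l) = cellOf c k l Q then 1 else 0) *
    ((∏ i ∈ Finset.range c.T, attAmp c (if i = t₀ then Q (0, k, 0) else Q (8, k, i))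
      (Q (9, k, i))) *
    ((∏ l ∈ Finset.range c.m, ampl (unifProb c.q) c.m (Q (7, k, l))) *
      ∏ l ∈ Finset.range c.n, ampl (unifProb c.q) c.m (Q (1, k, l))))

theorem copyStep_eval {t₀ : ℕ} {Q : Mem} (hc : c.Ok S) (hf : QSupp c k 0 0 0 0 f) (hQ : Clean c Q)
    (h : FirstAt c k t₀ Q) (hcount : Q (10, k, 0) = countZero k c.T Q) :
    copyStep c k f (below (k + 1) Q) = (rowAmp c k t₀ Q : ℂ) * f (below k Q) := by
  set P := below (k + 1) Q with hP
  have e : ∀ x j, P (x, (k : ℤ), j) = Q (x, k, j) := fun x j => by simp [hP, below]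
  set P' := clear 11 k c.m P with hP'
  have e' : ∀ x, x ≠ 11 → ∀ j, P' (x, (k : ℤ), j) = Q (x, k, j) := fun x hx j => by
    simp [hP', clear, hx, e]
  have ecell : ∀ l, cellOf c k l P = cellOf c k l Q := fun l => by simp [cellOf, rowVal, e]
  have h' : FirstAt c k t₀ P' := by
    constructor
    · exact h.lt
    · simpa [e'] using h.before
    · simpa [e'] using h.flags
    · simpa [e'] using h.value
    · simpa [e'] using h.nonneg
  have hcz : countZero k c.T P' = Q (10, k, 0) := by simp [hcount, countZero, e']
  have htrim : trim k c.T (countZero k c.T P') (if t₀ < c.T then P' (0, k, 0) else 0) P' = P' := by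
    funext ⟨x, k', j⟩
    rw [if_pos h.lt, hcz]
    simp only [trim, Prod.mk.injEq]
    split_ifs with h1 h2 h3
    · obtain ⟨h1, rfl, h2⟩ := h1
      rcases h1 with rfl | rfl
      · rw [e' _ (by norm_num), hQ.eight _ _ (by omega)]
      · rw [e' _ (by norm_num), hQ.nine _ _ (by omega)]
    · obtain ⟨rfl, rfl, rfl⟩ := h2
      rw [e' _ (by norm_num)]
    · obtain ⟨rfl, rfl, rfl⟩ := h3
      rfl
    · rfl
  have hclear := hQ.clear_below k
  rw [← hP, ← hP'] at hclear
  have heval := attempts_eval (f := sampleRow c 7 k c.m (sampleRow c 1 k c.n f)) (t := c.T) h'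
  rw [htrim] at heval
  rw [copyStep, locates_eval hc (attempts_supp hc le_rfl
    (sampleRow_seven_supp hc (sampleRow_one_supp hc hf))), heval, sampleRow_eval, sampleRow_eval,
    hclear]
  simp only [ecell, e]
  have e1 : ∀ l : ℕ, clear 7 k c.m (trim k 0 0 0 P') (1, (k : ℤ), (l : ℤ)) =
      Q (1, k, l) := fun l => by simp [clear, trim, e']
  have e7 : ∀ l : ℕ, trim k 0 0 0 P' (7, (k : ℤ), (l : ℤ)) = Q (7, k, l) :=
    fun l => by simp [trim, e']
  simp only [e1, e7, e' 8 (by norm_num), e' 9 (by norm_num), e' 0 (by norm_num), rowAmp]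
  split_ifs
  · push_cast
    ring
  · simp

theorem copies_eval {t₀ : ℕ → ℕ} {Q : Mem} (hc : c.Ok S) (hQ : Clean c Q)
    (h : ∀ k < c.ℓ, FirstAt c k (t₀ k) Q)
    (hcount : ∀ k < c.ℓ, Q (10, (k : ℕ), 0) = countZero k c.T Q) :
    copies c c.ℓ ⇑(Finsupp.single (0 : Mem) (1 : ℂ)) Q =
      ((∏ k ∈ Finset.range c.ℓ, rowAmp c k (t₀ k) Q : ℝ) : ℂ) := by
  have key : ∀ k ≤ c.ℓ, copies c k ⇑(Finsupp.single (0 : Mem) (1 : ℂ)) (below k Q) =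
      ((∏ k ∈ Finset.range k, rowAmp c k (t₀ k) Q : ℝ) : ℂ) := by
    intro k hk
    induction k with
    | zero => simp [copies, hQ.below_zero]
    | succ k ih =>
      rw [copies, copyStep_eval hc (copies_supp hc (qSupp_single hc.q_pos)) hQ (h k (by omega))
        (hcount k (by omega)), ih (by omega), Finset.prod_range_succ]
      push_cast
      ring
  rw [← key _ le_rfl, hQ.below_eq]

end

end QRed



namespace QRed

/-! ## Components of the final state -/

theorem Povm.weight_nonneg {n N ℓ : ℕ} [NeZero N] (M : Povm n N ℓ) (t : Fin n → ZMod N)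
    (φ : EdcpSpace n N ℓ) : 0 ≤ M.weight t φ := (M.pos t).re_inner_nonneg_right φ

theorem Povm.weight_smul {n N ℓ : ℕ} [NeZero N] (M : Povm n N ℓ) (t : Fin n → ZMod N)
    (a : ℝ) (φ : EdcpSpace n N ℓ) : M.weight t ((a : ℂ) • φ) = a ^ 2 * M.weight t φ := by
  simp only [Povm.weight, map_smul, inner_smul_left, inner_smul_right, Complex.conj_ofReal]
  rw [← mul_assoc, ← Complex.ofReal_mul, Complex.re_ofReal_mul, sq]

theorem Povm.weight_zero {n N ℓ : ℕ} [NeZero N] (M : Povm n N ℓ) (t : Fin n → ZMod N) :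
    M.weight t 0 = 0 := by simp [Povm.weight]

/-- Extends a finite sequence by `0` to the integers. -/
def extendZero {N : ℕ} (f : Fin N → ℤ) (j : ℤ) : ℤ :=
  if h : 0 ≤ j ∧ j.toNat < N then f ⟨j.toNat, h.2⟩ else 0

theorem extendZero_of_not {N : ℕ} (f : Fin N → ℤ) {j : ℤ} (h : ¬(0 ≤ j ∧ j < N)) :
    extendZero f j = 0 := dif_neg (by omega)

@[simp] theorem extendZero_fin {N : ℕ} (f : Fin N → ℤ) (i : Fin N) : extendZero f (i : ℕ) = f i := by
  simp [extendZero]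

theorem extendZero_nat {N : ℕ} (f : Fin N → ℤ) {i : ℕ} (h : i < N) :
    extendZero f i = f ⟨i, h⟩ := extendZero_fin f ⟨i, h⟩

/-- The basis state with label `ω` of the output registers and `h` of the rest. -/
def combine {n N ℓ : ℕ} (h : Mem) (ω : EdcpBasis n N ℓ) : Mem := fun a =>
  if a.1 = 0 ∧ (0 ≤ a.2.1 ∧ a.2.1 < ℓ) ∧ a.2.2 = 0 then extendZero (fun k => (ω k).1) a.2.1
  else if a.1 = 1 ∧ (0 ≤ a.2.1 ∧ a.2.1 < ℓ) ∧ (0 ≤ a.2.2 ∧ a.2.2 < n) then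
    h a * N + extendZero (fun k => extendZero (fun i => (((ω k).2 i).val : ℤ)) a.2.2) a.2.1
  else h a

section

variable {n N ℓ : ℕ}

theorem combine_zero (h : Mem) (ω : EdcpBasis n N ℓ) (k : Fin ℓ) :
    combine h ω (0, (k : ℕ), 0) = (ω k).1 := by
  simp [combine]

theorem combine_one (h : Mem) (ω : EdcpBasis n N ℓ) (k : Fin ℓ) (i : Fin n) :
    combine h ω (1, (k : ℕ), (i : ℕ)) = h (1, (k : ℕ), (i : ℕ)) * N + (((ω k).2 i).val : ℤ) := by
  simp [combine]

theorem combine_of_two_le (h : Mem) (ω : EdcpBasis n N ℓ) {x : ℕ} (hx : 2 ≤ x) (p : ℤ × ℤ) :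
    combine h ω (x, p) = h (x, p) := by
  have h0 : x ≠ 0 := by omega
  have h1 : x ≠ 1 := by omega
  simp [combine, h0, h1]

variable [NeZero N]

theorem outLabel_combine (h : Mem) (ω : EdcpBasis n N ℓ) : outLabel n N ℓ (combine h ω) = ω := by
  funext k
  refine Prod.ext (combine_zero h ω k) (funext fun i => ?_)
  simp [outLabel, combine_one]

theorem eq_combine {Q : Mem} {ω : EdcpBasis n N ℓ} (hω : outLabel n N ℓ Q = ω) :
    Q = combine (restLabel n N ℓ Q) ω := by
  funext a
  subst hω
  simp only [combine]
  split_ifs with h0 h1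
  · obtain ⟨x, k, j⟩ := a
    obtain ⟨rfl, ⟨h2, h3⟩, rfl⟩ : x = 0 ∧ (0 ≤ k ∧ k < ℓ) ∧ j = 0 := h0
    lift k to ℕ using h2
    rw [extendZero_nat _ (by exact_mod_cast h3)]
    rfl
  · obtain ⟨x, k, j⟩ := a
    obtain ⟨rfl, ⟨h2, h3⟩, h4, h5⟩ : x = 1 ∧ (0 ≤ k ∧ k < ℓ) ∧ 0 ≤ j ∧ j < n := h1
    lift k to ℕ using h2
    lift j to ℕ using h4
    have hk : k < ℓ := by exact_mod_cast h3
    have hj : j < n := by exact_mod_cast h5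
    simp only
    rw [extendZero_nat _ hk, extendZero_nat _ hj]
    simp only [restLabel, outLabel, ZMod.val_intCast]
    simp [hk, hj, Int.ediv_mul_add_emod]
  · simp [restLabel, h0, h1]

theorem restLabel_combine {h : Mem} (h0 : ∀ k : Fin ℓ, h (0, (k : ℕ), 0) = 0)
    (ω : EdcpBasis n N ℓ) : restLabel n N ℓ (combine h ω) = h := by
  have hN : (0 : ℤ) < N := by exact_mod_cast NeZero.pos N
  funext ⟨x, k, j⟩
  by_cases hx : (x = 0 ∧ (0 ≤ k ∧ k < ℓ) ∧ j = 0)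
  · simp only [restLabel, if_pos hx]
    obtain ⟨rfl, ⟨h2, h3⟩, rfl⟩ := hx
    lift k to ℕ using h2
    exact (h0 ⟨k, by exact_mod_cast h3⟩).symm
  · by_cases hy : x = 1 ∧ (0 ≤ k ∧ k < ℓ) ∧ (0 ≤ j ∧ j < n)
    · simp only [restLabel, if_neg hx, if_pos hy]
      obtain ⟨rfl, ⟨h2, h3⟩, h4, h5⟩ := hy
      lift k to ℕ using h2
      lift j to ℕ using h4
      have := combine_one h ω ⟨k, by exact_mod_cast h3⟩ ⟨j, by exact_mod_cast h5⟩
      simp only at this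
      rw [this, mul_comm, Int.mul_add_ediv_left _ _ hN.ne', Int.ediv_eq_zero_of_lt (by positivity)
        (by exact_mod_cast ZMod.val_lt _), add_zero]
    · simp [restLabel, combine, hx, hy]

open Classical in
/-- The component of the state vector `ket` with the label `h` of the rest. -/
noncomputable def component (n N ℓ : ℕ) (ket : Mem →₀ ℂ) (h : Mem) : EdcpSpace n N ℓ :=
  ∑ Q ∈ ket.support with restLabel n N ℓ Q = h, lp.single 2 (outLabel n N ℓ Q) (ket Q)

/-- For a fixed `h` there is exactly one basis state for each label `ω`, so no amplitudes are
merged. Zero entries at the output cells are required because `restLabel` erases those cells. -/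
theorem component_apply (ket : Mem →₀ ℂ) {h : Mem} (h0 : ∀ k : Fin ℓ, h (0, (k : ℕ), 0) = 0)
    (ω : EdcpBasis n N ℓ) : component n N ℓ ket h ω = ket (combine h ω) := by
  classical
  rw [component, lp.coeFn_sum, Finset.sum_apply, Finset.sum_eq_single (combine h ω)]
  · simp [outLabel_combine]
  · intro Q hQ hne
    rw [Finset.mem_filter] at hQ
    rw [lp.single_apply, Pi.single_eq_of_ne]
    intro h'
    exact hne (by rw [← hQ.2]; exact eq_combine h'.symm)
  · intro hQ
    rw [Finset.mem_filter, not_and', Finsupp.mem_support_iff, not_not] at hQ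
    rw [hQ (restLabel_combine h0 ω)]
    simp

/-- All weights are nonnegative, so any family of components with distinct labels gives a lower
bound; labels that do not occur have component 0. -/
theorem sum_weight_le_outcomeProb {ι : Type*} (M : Povm n N ℓ) (t : Fin n → ZMod N)
    (ket : Mem →₀ ℂ) (I : Finset ι) (lab : ι → Mem) (hinj : Set.InjOn lab I) :
    ∑ g ∈ I, M.weight t (component n N ℓ ket (lab g)) ≤ outcomeProb M t ket := by
  classical
  have h1 : outcomeProb M t ket =
      ∑ h ∈ ket.support.image (restLabel n N ℓ), M.weight t (component n N ℓ ket h) := by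
    unfold outcomeProb component
    congr!
  rw [h1, ← Finset.sum_image (f := fun h => M.weight t (component n N ℓ ket h)) hinj]
  rw [← Finset.sum_filter_ne_zero (Finset.image lab I)]
  refine Finset.sum_le_sum_of_subset_of_nonneg (fun h hh => ?_) fun h _ _ => M.weight_nonneg t _
  have hne := (Finset.mem_filter.1 hh).2
  by_contra hmem
  refine hne ?_
  rw [component, Finset.sum_eq_zero, Povm.weight_zero]
  intro Q hQ
  rw [Finset.mem_filter] at hQ
  exact absurd (Finset.mem_image.2 ⟨Q, hQ.1, hQ.2⟩) hmem

end

end QRed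



namespace QRed

/-! ## Good components are coset states -/

/-- The interval of length `q / 8` that contains `v`. -/
def cell {q : ℕ} (v : ZMod q) : ℤ := 8 * (v.val : ℤ) / q

/-- `v` has a representative of absolute value below `q / 8`. -/
def Short {q : ℕ} (v : ZMod q) : Prop := ∃ t : ℤ, 8 * |t| < q ∧ (t : ZMod q) = v

/-- Two integers in one interval of length `q / 8` differ by less than `q / 8`, and the difference
of the standard representatives is a representative of `u - v`. -/
theorem short_of_cell_eq {q : ℕ} [NeZero q] {u v : ZMod q} (h : cell u = cell v) :
    Short (u - v) := by
  have hq : (0 : ℤ) < q := by exact_mod_cast NeZero.pos q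
  refine ⟨(u.val : ℤ) - v.val, ?_, by simp⟩
  have h1 := Int.emod_add_mul_ediv (8 * (u.val : ℤ)) q
  have h2 := Int.emod_add_mul_ediv (8 * (v.val : ℤ)) q
  rw [cell, cell] at h
  rw [← h] at h2
  have h3 := Int.emod_nonneg (8 * (u.val : ℤ)) hq.ne'
  have h4 := Int.emod_lt_of_pos (8 * (u.val : ℤ)) hq
  have h5 := Int.emod_nonneg (8 * (v.val : ℤ)) hq.ne'
  have h6 := Int.emod_lt_of_pos (8 * (v.val : ℤ)) hq
  rw [← abs_of_pos (show (0 : ℤ) < 8 by norm_num), ← abs_mul, abs_lt]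
  constructor <;> linarith

theorem cell_nonneg {q : ℕ} (v : ZMod q) : 0 ≤ cell v := Int.ediv_nonneg (by positivity) (by positivity)

/-- The image of the linear map `A` contains no short vectors. -/
def NoShort {m n q : ℕ} (A : Matrix (Fin m) (Fin n) (ZMod q)) : Prop :=
  ∀ x, (∀ i, Short ((A *ᵥ x) i)) → x = 0

/-- The parameters `c` belong to the LWE samples `(A, b)`. -/
structure Par.Samples (c : Par) (A : Matrix (Fin c.m) (Fin c.n) (ZMod c.q))
    (b : Fin c.m → ZMod c.q) : Prop where
  A : ∀ (i : Fin c.m) (j : Fin c.n), c.A i j = ((A i j).val : ℤ)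
  b : ∀ i : Fin c.m, c.b i = ((b i).val : ℤ)

theorem cellOf_eq {c : Par} [NeZero c.q] {A : Matrix (Fin c.m) (Fin c.n) (ZMod c.q)}
    {b : Fin c.m → ZMod c.q} (h : c.Samples A b) (k : ℕ) (i : Fin c.m) (Q : Mem) :
    cellOf c k i Q = cell ((Q (7, k, (i : ℕ)) : ZMod c.q) +
      (A *ᵥ fun l => (Q (1, k, (l : ℕ)) : ZMod c.q)) i - (Q (0, k, 0) : ZMod c.q) * b i) := by
  rw [cellOf, cell, ← ZMod.val_intCast]
  congr 4
  rw [rowVal, Finset.sum_range, h.b]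
  simp only [h.A]
  push_cast
  simp only [Matrix.mulVec, dotProduct, ZMod.natCast_zmod_val]
  ring

/-- The truncated amplitudes of the coset states that the program produces. -/
noncomputable def truncAmp (c : Par) (j : ℤ) : ℝ :=
  if |j| ≤ c.R then ampl (flagProb c j) c.H 0 else 0

theorem truncAmp_sq_finite (c : Par) : (Function.support fun j => truncAmp c j ^ 2).Finite := by
  refine (Set.finite_Icc (-(c.R : ℤ)) c.R).subset fun j hj => ?_
  rw [Set.mem_Icc, ← abs_le]
  by_contra h
  exact hj (by simp [truncAmp, h])

theorem summable_truncAmp_sq (c : Par) : Summable fun j => truncAmp c j ^ 2 :=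
  summable_of_hasFiniteSupport (truncAmp_sq_finite c)

/-- The product of coset states with truncated amplitudes. -/
noncomputable def truncState (c : Par) (s : Fin c.n → ZMod c.q)
    (x : Fin c.ℓ → Fin c.n → ZMod c.q) : EdcpSpace c.n c.q c.ℓ :=
  ⟨edcpAmp (truncAmp c) s x, memlp_edcpAmp _ (summable_truncAmp_sq c) s x⟩

theorem attAmp_zero (c : Par) {S : ℕ} (hc : c.Ok S) (j : ℤ) :
    attAmp c j 0 = truncAmp c j * √(1 / (2 * c.R + 1 : ℝ)) := by
  rw [attAmp, truncAmp, ampl_unif (by positivity) (by exact_mod_cast hc.R_le)]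
  by_cases h : |j| ≤ c.R
  · have h' := abs_le.1 h
    rw [if_pos h, if_pos (by push_cast; omega)]
    push_cast
    rfl
  · rw [if_neg h, if_neg (by rw [abs_le] at h; push_cast; omega)]
    simp

/-- The data of one copy that are visible in the rest of the memory: the shift and the mask, the
first successful attempt, and the values and the flags of all attempts. -/
abbrev RowData (c : Par) : Type :=
  ((Fin c.n → ZMod c.q) × (Fin c.m → ZMod c.q)) × (_ : Fin c.T) × (Fin c.T → ℤ × ℤ)

/-- The possible values and flags of attempt `t`, if attempt `t₀` is the first successful one. -/
noncomputable def attSet (c : Par) (t₀ t : Fin c.T) : Finset (ℤ × ℤ) :=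
  if t = t₀ then {(0, 0)}
  else Finset.Icc (-(c.R : ℤ)) c.R ×ˢ
    (if t < t₀ then Finset.Ico 1 (2 ^ c.H) else Finset.Ico 0 (2 ^ c.H))

open Classical in
/-- Shifts and masks for which the interval numbers reveal nothing about the output register. -/
noncomputable def goodPairs (c : Par) [NeZero c.q] (A : Matrix (Fin c.m) (Fin c.n) (ZMod c.q))
    (e : Fin c.m → ℤ) : Finset ((Fin c.n → ZMod c.q) × (Fin c.m → ZMod c.q)) :=
  Finset.univ.filter fun p => ∀ i, ∀ j : ℤ, |j| ≤ c.R →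
    cell (p.2 i + (A *ᵥ p.1) i - (j : ZMod c.q) * (e i : ZMod c.q)) = cell (p.2 i + (A *ᵥ p.1) i)

/-- The good data of one copy. -/
noncomputable def goodRows (c : Par) [NeZero c.q] (A : Matrix (Fin c.m) (Fin c.n) (ZMod c.q))
    (e : Fin c.m → ℤ) : Finset (RowData c) :=
  goodPairs c A e ×ˢ Finset.univ.sigma fun t₀ => Fintype.piFinset (attSet c t₀)

/-- The contents of the cell `(x, j)` of a row with given data, apart from the output. -/
def rowRest {c : Par} (A : Matrix (Fin c.m) (Fin c.n) (ZMod c.q)) (d : RowData c) (x : ℕ) (j : ℤ) :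
    ℤ :=
  if x = 7 then extendZero (fun i => ((d.1.2 i).val : ℤ)) j
  else if x = 8 then extendZero (fun t => (d.2.2 t).1) j
  else if x = 9 then extendZero (fun t => (d.2.2 t).2) j
  else if x = 10 then if j = 0 then ∑ t, if (d.2.2 t).2 = 0 then 1 else 0 else 0
  else if x = 11 then extendZero (fun i => cell (d.1.2 i + (A *ᵥ d.1.1) i)) j
  else 0

/-- The label of the rest of the memory for given data. -/
def restOf {c : Par} (A : Matrix (Fin c.m) (Fin c.n) (ZMod c.q)) (g : Fin c.ℓ → RowData c) : Mem :=
  fun a => extendZero (fun k => rowRest A (g k) a.1 a.2.2) a.2.1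

section

variable {c : Par}

theorem attSet_nonneg {t₀ t : Fin c.T} {p : ℤ × ℤ} (h : p ∈ attSet c t₀ t) : 0 ≤ p.2 := by
  unfold attSet at h
  split_ifs at h <;> simp at h <;> first | (rw [h]) | omega

theorem attSet_self {t₀ : Fin c.T} {p : ℤ × ℤ} (h : p ∈ attSet c t₀ t₀) : p = (0, 0) := by
  simpa [attSet] using h

theorem attSet_lt {t₀ t : Fin c.T} (ht : t < t₀) {p : ℤ × ℤ} (h : p ∈ attSet c t₀ t) :
    1 ≤ p.2 := by
  rw [attSet, if_neg ht.ne, if_pos ht] at h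
  simp at h
  exact h.2.1

theorem restOf_row (A : Matrix (Fin c.m) (Fin c.n) (ZMod c.q)) (g : Fin c.ℓ → RowData c)
    (k : Fin c.ℓ) (x : ℕ) (j : ℤ) : restOf A g (x, (k : ℕ), j) = rowRest A (g k) x j := by
  simp [restOf]

theorem countZero_combine (A : Matrix (Fin c.m) (Fin c.n) (ZMod c.q)) (g : Fin c.ℓ → RowData c)
    (ω : EdcpBasis c.n c.q c.ℓ) (k : Fin c.ℓ) :
    combine (restOf A g) ω (10, (k : ℕ), 0) = countZero k c.T (combine (restOf A g) ω) := by
  have e9 : ∀ t : Fin c.T, combine (restOf A g) ω (9, (k : ℕ), (t : ℕ)) = ((g k).2.2 t).2 :=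
    fun t => by rw [combine_of_two_le _ _ (by norm_num), restOf_row]; simp [rowRest]
  rw [countZero, Finset.sum_range, combine_of_two_le _ _ (by norm_num), restOf_row]
  simp only [e9]
  simp [rowRest]

variable [NeZero c.q] {A : Matrix (Fin c.m) (Fin c.n) (ZMod c.q)} {s : Fin c.n → ZMod c.q}
  {e : Fin c.m → ℤ} {S : ℕ} {g : Fin c.ℓ → RowData c}

theorem mem_goodPairs {p : (Fin c.n → ZMod c.q) × (Fin c.m → ZMod c.q)} :
    p ∈ goodPairs c A e ↔ ∀ i, ∀ j : ℤ, |j| ≤ c.R →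
      cell (p.2 i + (A *ᵥ p.1) i - (j : ZMod c.q) * (e i : ZMod c.q)) =
        cell (p.2 i + (A *ᵥ p.1) i) := by
  simp [goodPairs]

theorem mem_goodRows {d : RowData c} : d ∈ goodRows c A e ↔
    d.1 ∈ goodPairs c A e ∧ ∀ t, d.2.2 t ∈ attSet c d.2.1 t := by
  simp [goodRows, Fintype.mem_piFinset]

/-- Mask, values and flags are stored literally, and the first successful attempt is the first one
whose flags are 0. The shift is not stored; two shifts with the same interval numbers have images
with a short difference, so they agree by `NoShort`. -/
theorem restOf_injOn (hA : NoShort A) :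
    Set.InjOn (restOf A) (Fintype.piFinset fun _ : Fin c.ℓ => goodRows c A e) := by
  intro g hg g' hg' h
  rw [Finset.mem_coe, Fintype.mem_piFinset] at hg hg'
  funext k
  have hr : ∀ x j, rowRest A (g k) x j = rowRest A (g' k) x j := fun x j => by
    rw [← restOf_row, ← restOf_row, h]
  have h1 := (mem_goodRows.1 (hg k)).2
  have h2 := (mem_goodRows.1 (hg' k)).2
  generalize g k = d at *
  generalize g' k = d' at *
  obtain ⟨⟨x, w⟩, t₀, τ⟩ := d
  obtain ⟨⟨x', w'⟩, t₀', τ'⟩ := d'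
  have hw : w = w' := by
    funext i
    have := hr 7 (i : ℕ)
    simp only [rowRest, if_true, extendZero_fin] at this
    exact ZMod.val_injective _ (by exact_mod_cast this)
  have hτ : τ = τ' := by
    funext t
    have e8 := hr 8 (t : ℕ)
    have e9 := hr 9 (t : ℕ)
    simp [rowRest] at e8 e9
    exact Prod.ext e8 e9
  subst hw hτ
  have ht : t₀ = t₀' := by
    rcases lt_trichotomy t₀ t₀' with h | h | h
    · have a1 := attSet_lt h (h2 t₀)
      have a2 := attSet_self (h1 t₀)
      rw [a2] at a1
      simp at a1
    · exact h
    · have a1 := attSet_lt h (h1 t₀')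
      have a2 := attSet_self (h2 t₀')
      rw [a2] at a1
      simp at a1
  subst ht
  have hx : x - x' = 0 := by
    refine hA _ fun i => ?_
    have := hr 11 (i : ℕ)
    simp [rowRest] at this
    have := short_of_cell_eq this
    rwa [add_sub_add_left_eq_sub, ← Pi.sub_apply, ← Matrix.mulVec_sub] at this
  rw [sub_eq_zero.1 hx]

/-- The square root of the weight of the component of given data, for one copy. -/
noncomputable def rowWeight (c : Par) (d : RowData c) : ℝ :=
  √(1 / c.q) ^ c.m * √(1 / c.q) ^ c.n *
    (∏ t, if t = d.2.1 then √(1 / (2 * c.R + 1 : ℝ)) * √(∑' j, truncAmp c j ^ 2)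
      else attAmp c (d.2.2 t).1 (d.2.2 t).2)

theorem clean_combine (g : Fin c.ℓ → RowData c) (ω : EdcpBasis c.n c.q c.ℓ) :
    Clean c (combine (restOf A g) ω) := by
  have key : ∀ x : ℕ, 2 ≤ x → ∀ k j : ℤ, (∀ k' : Fin c.ℓ, rowRest A (g k') x j = 0) →
      combine (restOf A g) ω (x, k, j) = 0 := by
    intro x hx k j h0
    rw [combine_of_two_le _ _ hx, restOf]
    unfold extendZero
    split_ifs with h
    · exact h0 _
    · rfl
  constructor
  · rintro ⟨x, k, j⟩ h
    by_contra hk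
    have hk' : ¬(0 ≤ k ∧ k < c.ℓ) := hk
    refine h ?_
    simp only [combine, hk', false_and, and_false, if_false, restOf]
    exact extendZero_of_not _ hk'
  · intro k j hj
    simp [combine, hj, restOf, rowRest, extendZero]
  · intro k j hj
    simp [combine, hj, restOf, rowRest, extendZero]
  · exact fun k j hj => key 7 (by norm_num) k j fun k' => by
      simp [rowRest, extendZero_of_not _ hj]
  · exact fun k j hj => key 8 (by norm_num) k j fun k' => by
      simp [rowRest, extendZero_of_not _ hj]
  · exact fun k j hj => key 9 (by norm_num) k j fun k' => by
      simp [rowRest, extendZero_of_not _ hj]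
  · exact fun k j hj => key 10 (by norm_num) k j fun k' => by simp [rowRest, hj]
  · exact fun k j hj => key 11 (by norm_num) k j fun k' => by
      simp [rowRest, extendZero_of_not _ hj]
  · intro x hx k j
    simp at hx
    exact key x (by omega) k j fun k' => by simp [rowRest, hx]

theorem firstAt_combine (hg : g ∈ Fintype.piFinset fun _ : Fin c.ℓ => goodRows c A e)
    (ω : EdcpBasis c.n c.q c.ℓ) (k : Fin c.ℓ) :
    FirstAt c k (g k).2.1 (combine (restOf A g) ω) := by
  rw [Fintype.mem_piFinset] at hg
  have h1 := (mem_goodRows.1 (hg k)).2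
  have e9 : ∀ t : Fin c.T, combine (restOf A g) ω (9, (k : ℕ), (t : ℕ)) = ((g k).2.2 t).2 :=
    fun t => by rw [combine_of_two_le _ _ (by norm_num), restOf_row]; simp [rowRest]
  have e8 : ∀ t : Fin c.T, combine (restOf A g) ω (8, (k : ℕ), (t : ℕ)) = ((g k).2.2 t).1 :=
    fun t => by rw [combine_of_two_le _ _ (by norm_num), restOf_row]; simp [rowRest]
  refine ⟨(g k).2.1.2, fun t ht => ?_, ?_, ?_, fun t ht => ?_⟩
  · have := attSet_lt (c := c) (t₀ := (g k).2.1) (t := ⟨t, ht.trans (g k).2.1.2⟩) ht (h1 _)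
    rwa [← e9] at this
  · rw [e9, attSet_self (h1 _)]
  · rw [e8, attSet_self (h1 _)]
  · by_cases htT : t < c.T
    · have := attSet_nonneg (h1 ⟨t, htT⟩)
      rwa [← e9] at this
    · rw [(clean_combine g ω).nine _ _ (by omega)]

/-- With `y` in the output register, the located vector is `w + A (y - j s) - j e`. For good `(x,
w)` the stored intervals, those of `w + A x`, are also the intervals of `w + A x - j e`. Agreement
then makes `A (x - (y - j s))` short, hence `y = x + j s`; the converse is immediate. -/
theorem cells_iff (hA : NoShort A) (hS : c.Samples A (lweVector A s e))
    (hg : g ∈ Fintype.piFinset fun _ : Fin c.ℓ => goodRows c A e)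
    (ω : EdcpBasis c.n c.q c.ℓ) (k : Fin c.ℓ) (hj : |(ω k).1| ≤ c.R) :
    (∀ l < c.m, combine (restOf A g) ω (11, (k : ℕ), l) =
      cellOf c k l (combine (restOf A g) ω)) ↔ (ω k).2 = (g k).1.1 + (ω k).1 • s := by
  rw [Fintype.mem_piFinset] at hg
  have h1 := fun i => mem_goodPairs.1 (mem_goodRows.1 (hg k)).1 i _ hj
  have e11 : ∀ l : Fin c.m, combine (restOf A g) ω (11, (k : ℕ), (l : ℕ)) =
      cell ((g k).1.2 l + (A *ᵥ (g k).1.1) l) := fun l => by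
    rw [combine_of_two_le _ _ (by norm_num), restOf_row]; simp [rowRest]
  have e1 : (fun i : Fin c.n => (combine (restOf A g) ω (1, (k : ℕ), (i : ℕ)) : ZMod c.q)) =
      (ω k).2 := by
    have := congrFun (outLabel_combine (restOf A g) ω) k
    rw [← this]
    rfl
  have ec : ∀ l : Fin c.m, cellOf c k l (combine (restOf A g) ω) =
      cell ((g k).1.2 l + (A *ᵥ ((ω k).2 - (ω k).1 • s)) l - ((ω k).1 : ZMod c.q) * (e l : ZMod c.q)) := by
    intro l
    rw [cellOf_eq hS, e1, combine_zero, combine_of_two_le _ _ (by norm_num), restOf_row,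
      Matrix.mulVec_sub, Matrix.mulVec_smul, lweVector]
    congr 1
    simp [rowRest]
    ring
  have hall : (∀ l < c.m, combine (restOf A g) ω (11, (k : ℕ), l) =
      cellOf c k l (combine (restOf A g) ω)) ↔ ∀ l : Fin c.m,
      cell ((g k).1.2 l + (A *ᵥ (g k).1.1) l - ((ω k).1 : ZMod c.q) * (e l : ZMod c.q)) =
      cell ((g k).1.2 l + (A *ᵥ ((ω k).2 - (ω k).1 • s)) l -
        ((ω k).1 : ZMod c.q) * (e l : ZMod c.q)) := by
    simp only [h1, ← ec, ← e11]
    exact ⟨fun h l => h l l.2, fun h l hl => h ⟨l, hl⟩⟩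
  rw [hall, ← sub_eq_iff_eq_add]
  constructor
  · intro h
    rw [eq_comm, ← sub_eq_zero]
    refine hA _ fun i => ?_
    have := short_of_cell_eq (h i)
    rwa [sub_sub_sub_cancel_right, add_sub_add_left_eq_sub, ← Pi.sub_apply, ← Matrix.mulVec_sub]
      at this
  · intro h l
    rw [h]

/-- Only two factors depend on the output label: the interval condition, which enforces `y = x + j
s`, and the amplitude of attempt `t₀`, proportional to `truncAmp`. The remaining factors, together
with the norm of `truncAmp`, form `rowWeight`. -/
theorem rowAmp_combine (hc : c.Ok S) (hA : NoShort A) (hS : c.Samples A (lweVector A s e))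
    (hσ : 0 < ∑' j, truncAmp c j ^ 2)
    (hg : g ∈ Fintype.piFinset fun _ : Fin c.ℓ => goodRows c A e)
    (ω : EdcpBasis c.n c.q c.ℓ) (k : Fin c.ℓ) :
    rowAmp c k (g k).2.1 (combine (restOf A g) ω) =
      rowWeight c (g k) * cosetAmp (truncAmp c) s (g k).1.1 (ω k) := by
  have hfirst := firstAt_combine hg ω k
  have e9 : ∀ t : Fin c.T, combine (restOf A g) ω (9, (k : ℕ), (t : ℕ)) = ((g k).2.2 t).2 :=
    fun t => by rw [combine_of_two_le _ _ (by norm_num), restOf_row]; simp [rowRest]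
  have e8 : ∀ t : Fin c.T, combine (restOf A g) ω (8, (k : ℕ), (t : ℕ)) = ((g k).2.2 t).1 :=
    fun t => by rw [combine_of_two_le _ _ (by norm_num), restOf_row]; simp [rowRest]
  have e0 := combine_zero (restOf A g) ω k
  have hq : (0 : ℤ) < c.q := by exact_mod_cast hc.q_pos
  have hq2 : (c.q : ℤ) ≤ 2 ^ c.m := by exact_mod_cast hc.q_le
  have e7 : ∀ l : Fin c.m, combine (restOf A g) ω (7, (k : ℕ), (l : ℕ)) = (((g k).1.2 l).val : ℤ) :=
    fun t => by rw [combine_of_two_le _ _ (by norm_num), restOf_row]; simp [rowRest]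
  have e1 : ∀ l : Fin c.n, combine (restOf A g) ω (1, (k : ℕ), (l : ℕ)) = (((ω k).2 l).val : ℤ) :=
    fun l => by rw [combine_one, restOf_row]; simp [rowRest]
  have u7 : ∀ v : ZMod c.q, ampl (unifProb c.q) c.m (v.val : ℤ) = √(1 / c.q) := fun v => by
    rw [ampl_unif hq hq2, if_pos ⟨by positivity, by exact_mod_cast ZMod.val_lt _⟩]
    simp
  rw [rowAmp, Finset.prod_range, Finset.prod_range, Finset.prod_range]
  simp only [e0, e1, e7, e8, e9, u7, Finset.prod_const, Finset.card_univ, Fintype.card_fin]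
  have hprod : (∏ t : Fin c.T, attAmp c (if (t : ℕ) = ((g k).2.1 : ℕ) then (ω k).1
      else ((g k).2.2 t).1) ((g k).2.2 t).2) =
      (∏ t, if t = (g k).2.1 then √(1 / (2 * c.R + 1 : ℝ)) * √(∑' j, truncAmp c j ^ 2)
      else attAmp c ((g k).2.2 t).1 ((g k).2.2 t).2) *
        (truncAmp c (ω k).1 / √(∑' j, truncAmp c j ^ 2)) := by
    have h0 : √(∑' j, truncAmp c j ^ 2) ≠ 0 := (Real.sqrt_pos.2 hσ).ne'
    have hF : ((g k).2.2 (g k).2.1).2 = 0 := by rw [← e9]; exact hfirst.flags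
    have herase : ∀ t ∈ Finset.univ.erase (g k).2.1,
        attAmp c (if (t : ℕ) = ((g k).2.1 : ℕ) then (ω k).1 else ((g k).2.2 t).1) ((g k).2.2 t).2 =
        if t = (g k).2.1 then √(1 / (2 * c.R + 1 : ℝ)) * √(∑' j, truncAmp c j ^ 2)
          else attAmp c ((g k).2.2 t).1 ((g k).2.2 t).2 := fun t ht => by
      have hne := (Finset.mem_erase.1 ht).1
      rw [if_neg (fun h => hne (Fin.ext h)), if_neg hne]
    rw [← Finset.mul_prod_erase Finset.univ _ (Finset.mem_univ (g k).2.1),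
      Finset.prod_congr rfl herase, ← Finset.mul_prod_erase Finset.univ
        (fun t => if t = (g k).2.1 then √(1 / (2 * c.R + 1 : ℝ)) * √(∑' j, truncAmp c j ^ 2)
          else attAmp c ((g k).2.2 t).1 ((g k).2.2 t).2) (Finset.mem_univ (g k).2.1),
      if_pos rfl, if_pos rfl, hF, attAmp_zero c hc]
    field_simp
  rw [hprod, rowWeight, cosetAmp]
  by_cases hj : |(ω k).1| ≤ c.R
  · have := cells_iff hA hS hg ω k hj
    by_cases hy : (ω k).2 = (g k).1.1 + (ω k).1 • s
    · rw [if_pos (this.2 hy), if_pos hy]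
      ring
    · rw [if_neg (fun h => hy (this.1 h)), if_neg hy]
      ring
  · have : truncAmp c (ω k).1 = 0 := if_neg hj
    rw [this]
    simp

theorem component_restOf (hc : c.Ok S) (hA : NoShort A) (hS : c.Samples A (lweVector A s e))
    (hσ : 0 < ∑' j, truncAmp c j ^ 2) {ket : Mem →₀ ℂ}
    (hket : ⇑ket = copies c c.ℓ ⇑(Finsupp.single (0 : Mem) (1 : ℂ)))
    (hg : g ∈ Fintype.piFinset fun _ : Fin c.ℓ => goodRows c A e) :
    component c.n c.q c.ℓ ket (restOf A g) =
      ((∏ k, rowWeight c (g k) : ℝ) : ℂ) • truncState c s fun k => (g k).1.1 := by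
  refine lp.ext (funext fun ω => ?_)
  rw [component_apply _ (fun k => by rw [restOf_row]; simp [rowRest]), hket, lp.coeFn_smul]
  have h := copies_eval (t₀ := fun k => if hk : k < c.ℓ then ((g ⟨k, hk⟩).2.1 : ℕ) else 0) hc
    (clean_combine (A := A) g ω)
    (fun k hk => by rw [dif_pos hk]; exact firstAt_combine hg ω ⟨k, hk⟩)
    (fun k hk => countZero_combine A g ω ⟨k, hk⟩)
  rw [h, Finset.prod_range]
  have : ∀ k : Fin c.ℓ, rowAmp c k (if hk : (k : ℕ) < c.ℓ then ((g ⟨k, hk⟩).2.1 : ℕ) else 0)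
      (combine (restOf A g) ω) = rowWeight c (g k) * cosetAmp (truncAmp c) s (g k).1.1 (ω k) :=
    fun k => by rw [dif_pos k.2]; exact rowAmp_combine hc hA hS hσ hg ω k
  rw [Finset.prod_congr rfl (fun k _ => this k), Finset.prod_mul_distrib]
  simp [truncState, edcpAmp]

/-- The weight of a component is the product of the row weights squared times that of a coset state.
As the data of the copies vary independently, the sum over all choices is an `ℓ`-th power. -/
theorem sum_goodRows_le_outcomeProb (hc : c.Ok S) (hA : NoShort A)
    (hS : c.Samples A (lweVector A s e)) (hσ : 0 < ∑' j, truncAmp c j ^ 2) {ket : Mem →₀ ℂ}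
    (hket : ⇑ket = copies c c.ℓ ⇑(Finsupp.single (0 : Mem) (1 : ℂ))) (M : Povm c.n c.q c.ℓ) {w : ℝ}
    (hw : ∀ x, w ≤ M.weight s (truncState c s x)) :
    (∑ d ∈ goodRows c A e, rowWeight c d ^ 2) ^ c.ℓ * w ≤ outcomeProb M s ket := by
  refine le_trans ?_ (sum_weight_le_outcomeProb M s ket _ _ (restOf_injOn (e := e) hA))
  have hpow : (∑ d ∈ goodRows c A e, rowWeight c d ^ 2) ^ c.ℓ =
      ∑ g ∈ Fintype.piFinset fun _ : Fin c.ℓ => goodRows c A e, ∏ k, rowWeight c (g k) ^ 2 := by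
    have := Finset.prod_univ_sum (fun _ : Fin c.ℓ => goodRows c A e)
      (fun _ d => rowWeight c d ^ 2)
    simpa using this
  rw [hpow, Finset.sum_mul]
  refine Finset.sum_le_sum fun g hg => ?_
  rw [component_restOf hc hA hS hσ hket hg, Povm.weight_smul, Finset.prod_pow]
  exact mul_le_mul_of_nonneg_left (hw _) (sq_nonneg _)

end

end QRed



namespace QRed

/-! ## The total weight of the good components -/

section

variable {c : Par} {S : ℕ}

theorem truncAmp_sq (c : Par) {j : ℤ} (hj : |j| ≤ c.R) :
    truncAmp c j ^ 2 = ampl (flagProb c j) c.H 0 ^ 2 := by rw [truncAmp, if_pos hj]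

theorem tsum_truncAmp_sq (c : Par) :
    ∑' j, truncAmp c j ^ 2 = ∑ j ∈ Finset.Icc (-(c.R : ℤ)) c.R, truncAmp c j ^ 2 := by
  refine tsum_eq_sum fun j hj => ?_
  rw [Finset.mem_Icc, ← abs_le] at hj
  simp [truncAmp, hj]

/-- The probability that an attempt succeeds. -/
noncomputable def attProb (c : Par) : ℝ := (∑' j, truncAmp c j ^ 2) / (2 * c.R + 1)

theorem sum_ampl_sq (p : ℕ → ℤ → ℝ) (K : ℕ) :
    ∑ Y ∈ Finset.Ico (0 : ℤ) (2 ^ K), ampl p K Y ^ 2 = 1 := by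
  rw [← (hasSum_ampl_sq p K).tsum_eq]
  refine (tsum_eq_sum fun Y hY => ?_).symm
  by_contra h
  have := ampl_support (fun h' => h (by rw [h']; norm_num) : ampl p K Y ≠ 0)
  exact hY (Finset.mem_Ico.2 this)

theorem sum_ampl_sq_pos (p : ℕ → ℤ → ℝ) (K : ℕ) :
    ∑ Y ∈ Finset.Ico (1 : ℤ) (2 ^ K), ampl p K Y ^ 2 = 1 - ampl p K 0 ^ 2 := by
  rw [← sum_ampl_sq p K, eq_sub_iff_add_eq, add_comm, 
    ← Finset.sum_insert (f := fun Y => ampl p K Y ^ 2) (by simp : (0 : ℤ) ∉ Finset.Ico 1 (2 ^ K))]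
  refine Finset.sum_congr ?_ fun _ _ => rfl
  have : (0 : ℤ) < 2 ^ K := by positivity
  ext Y
  simp only [Finset.mem_insert, Finset.mem_Ico]
  omega

theorem attAmp_sq (hc : c.Ok S) {j : ℤ} (hj : j ∈ Finset.Icc (-(c.R : ℤ)) c.R) (Y : ℤ) :
    attAmp c j Y ^ 2 = 1 / (2 * c.R + 1) * ampl (flagProb c j) c.H Y ^ 2 := by
  rw [Finset.mem_Icc] at hj
  rw [attAmp, ampl_unif (by positivity) (by exact_mod_cast hc.R_le),
    if_pos (by push_cast; omega), mul_pow, Real.sq_sqrt (by positivity)]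
  push_cast
  ring

/-- Before `t₀` the attempts must fail, after `t₀` they are unrestricted. At `t₀` a single element
carries the whole success probability, since the value has moved to the output and is summed over
within the coset state. -/
theorem sum_attSet (hc : c.Ok S) (t₀ t : Fin c.T) :
    (∑ d ∈ attSet c t₀ t, if t = t₀ then attProb c else attAmp c d.1 d.2 ^ 2) =
      if t = t₀ then attProb c else if t < t₀ then 1 - attProb c else 1 := by
  have hcard : ((Finset.Icc (-(c.R : ℤ)) c.R).card : ℝ) = 2 * c.R + 1 := by
    rw [Int.card_Icc, show (c.R : ℤ) + 1 - -c.R = ((2 * c.R + 1 : ℕ) : ℤ) by push_cast; ring,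
      Int.toNat_natCast]
    push_cast
    rfl
  have hN : (0 : ℝ) < 2 * c.R + 1 := by positivity
  by_cases h : t = t₀
  · simp [h, attSet]
  · simp only [if_neg h, attSet]
    rw [Finset.sum_product]
    rw [Finset.sum_congr rfl fun j hj => Finset.sum_congr rfl fun Y _ => attAmp_sq hc hj Y]
    simp only [← Finset.mul_sum]
    by_cases h' : t < t₀
    · simp only [if_pos h', sum_ampl_sq_pos]
      rw [Finset.sum_sub_distrib, Finset.sum_const, nsmul_eq_mul, hcard, attProb, tsum_truncAmp_sq,
        Finset.sum_congr rfl fun j hj => (truncAmp_sq c (abs_le.2 (Finset.mem_Icc.1 hj))).symm]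
      field_simp
    · simp only [if_neg h', sum_ampl_sq, Finset.sum_const, nsmul_eq_mul, hcard]
      field_simp

theorem prod_range_first (a b : ℝ) {t₀ T : ℕ} (h : t₀ < T) :
    (∏ t ∈ Finset.range T, if t = t₀ then a else if t < t₀ then b else 1) = b ^ t₀ * a := by
  induction T with
  | zero => omega
  | succ T ih =>
    rw [Finset.prod_range_succ]
    rcases Nat.lt_succ_iff_lt_or_eq.1 h with h' | rfl
    · rw [ih h', if_neg (by omega), if_neg (by omega), mul_one]
    · rw [if_pos rfl, Finset.prod_congr rfl (g := fun _ => b), Finset.prod_const, Finset.card_range]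
      intro t ht
      rw [Finset.mem_range] at ht
      rw [if_neg (by omega), if_pos ht]

/-- In terms of probabilities: a uniform pair of shift and mask is good, and independently one of
`T` attempts succeeds. The latter is the geometric sum over the first success `t₀`. -/
theorem sum_goodRows [NeZero c.q] (hc : c.Ok S) (A : Matrix (Fin c.m) (Fin c.n) (ZMod c.q))
    (e : Fin c.m → ℤ) :
    ∑ d ∈ goodRows c A e, rowWeight c d ^ 2 =
      (goodPairs c A e).card / ((c.q : ℝ) ^ c.m * (c.q : ℝ) ^ c.n) *
        (1 - (1 - attProb c) ^ c.T) := by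
  have hN : (0 : ℝ) < 2 * c.R + 1 := by positivity
  have hw : ∀ d : RowData c, rowWeight c d ^ 2 = 1 / ((c.q : ℝ) ^ c.m * (c.q : ℝ) ^ c.n) *
      ∏ t, if t = d.2.1 then attProb c else attAmp c (d.2.2 t).1 (d.2.2 t).2 ^ 2 := by
    intro d
    rw [rowWeight, mul_pow, mul_pow, ← pow_mul, mul_comm c.m, pow_mul, ← pow_mul √(1 / (c.q : ℝ)) c.n,
      mul_comm c.n, pow_mul, Real.sq_sqrt (by positivity), ← Finset.prod_pow]
    congr 1
    · simp [mul_comm]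
    · refine Finset.prod_congr rfl fun t _ => ?_
      split_ifs
      · rw [mul_pow, Real.sq_sqrt (by positivity),
          Real.sq_sqrt (tsum_nonneg fun _ => sq_nonneg _), attProb]
        ring
      · rfl
  simp only [hw]
  rw [← Finset.mul_sum, goodRows, Finset.sum_product]
  simp only [Finset.sum_const, nsmul_eq_mul]
  have hsum : ∑ x ∈ Finset.univ.sigma fun t₀ => Fintype.piFinset (attSet c t₀),
      (∏ t, if t = x.1 then attProb c else attAmp c (x.2 t).1 (x.2 t).2 ^ 2) =
        1 - (1 - attProb c) ^ c.T := by
    rw [Finset.sum_sigma]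
    have h1 : ∀ t₀ : Fin c.T, (∑ x ∈ Fintype.piFinset (attSet c t₀),
        ∏ t, if t = t₀ then attProb c else attAmp c (x t).1 (x t).2 ^ 2) =
        (1 - attProb c) ^ (t₀ : ℕ) * attProb c := by
      intro t₀
      rw [← Finset.prod_univ_sum (attSet c t₀)
        (fun t d => if t = t₀ then attProb c else attAmp c d.1 d.2 ^ 2)]
      simp only [sum_attSet hc]
      rw [← prod_range_first _ _ t₀.2, Finset.prod_range]
      simp only [Fin.ext_iff, Fin.lt_def]
    simp only [h1]
    rw [← Finset.sum_range (fun t => (1 - attProb c) ^ t * attProb c), ← Finset.sum_mul]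
    have := mul_neg_geom_sum (1 - attProb c) c.T
    rw [← this]
    ring
  rw [hsum]
  ring

end

end QRed



namespace QRed

/-! ## Comparison of coset states -/

section

variable {n N ℓ : ℕ}

theorem Povm.weight_le_norm_sq [NeZero N] (M : Povm n N ℓ) (t : Fin n → ZMod N)
    (φ : EdcpSpace n N ℓ) : M.weight t φ ≤ ‖φ‖ ^ 2 := by
  have h : ∑ t, M.weight t φ = ‖φ‖ ^ 2 := by
    simp only [Povm.weight]
    rw [← Complex.re_sum, ← inner_sum, ← sum_apply, M.sum_op]
    exact inner_self_eq_norm_sq (𝕜 := ℂ) φ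
  rw [← h]
  exact Finset.single_le_sum (fun t _ => M.weight_nonneg t φ) (Finset.mem_univ t)

/-- Positivity at `φ - 2 ψ` combined with the parallelogram law for the form of `M_t`. This loses a
factor 2, but the error is quadratic in the distance, which is what the overlap of two states
controls directly. -/
theorem Povm.weight_ge_of_norm_sub [NeZero N] (M : Povm n N ℓ) (t : Fin n → ZMod N)
    (φ ψ : EdcpSpace n N ℓ) : M.weight t φ / 2 - ‖φ - ψ‖ ^ 2 ≤ M.weight t ψ := by
  have h1 := M.weight_le_norm_sq t (φ - ψ)
  have h2 := M.weight_nonneg t (φ - (2 : ℂ) • ψ)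
  have e : M.weight t (φ - (2 : ℂ) • ψ) =
      2 * M.weight t ψ + 2 * M.weight t (φ - ψ) - M.weight t φ := by
    simp only [Povm.weight, map_sub, map_smul, inner_sub_left, inner_sub_right, inner_smul_left,
      inner_smul_right, Complex.sub_re, Complex.mul_re]
    simp
    ring
  linarith

/-- Coset amplitudes are normalized, so `discreteGaussian` may be replaced by `gaussianWeight`. -/
theorem cosetAmp_div (D : ℤ → ℝ) {Z : ℝ} (hZ : 0 < Z) (s x : Fin n → ZMod N) :
    cosetAmp (fun j => D j / Z) s x = cosetAmp D s x := by
  funext p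
  simp only [cosetAmp, div_pow, tsum_div_const]
  rw [Real.sqrt_div' _ (sq_nonneg Z), Real.sqrt_sq hZ.le]
  split_ifs
  · field_simp
  · rfl

/-- The labels of the coset of `x`. -/
def cosetEmb (s x : Fin n → ZMod N) : ℤ ↪ ℤ × (Fin n → ZMod N) where
  toFun j := (j, x + j • s)
  inj' _ _ h := congrArg Prod.fst h

theorem cosetAmp_emb (D : ℤ → ℝ) (s x : Fin n → ZMod N) (j : ℤ) :
    cosetAmp D s x (cosetEmb s x j) = D j / √(∑' i, D i ^ 2) := if_pos rfl

theorem cosetAmp_of_not (D : ℤ → ℝ) {s x : Fin n → ZMod N} {p : ℤ × (Fin n → ZMod N)}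
    (h : p ∉ Set.range (cosetEmb s x)) : cosetAmp D s x p = 0 :=
  if_neg fun h' => h ⟨p.1, Prod.ext rfl h'.symm⟩

theorem sum_cosetAmp_mul (D D' : ℤ → ℝ) (s x : Fin n → ZMod N) (I : Finset ℤ) :
    ∑ p ∈ I.map (cosetEmb s x),
      cosetAmp D s x p * cosetAmp D' s x p =
      (∑ j ∈ I, D j * D' j) / (√(∑' j, D j ^ 2) * √(∑' j, D' j ^ 2)) := by
  rw [Finset.sum_map, Finset.sum_div]
  refine Finset.sum_congr rfl fun j _ => ?_
  rw [cosetAmp_emb, cosetAmp_emb, div_mul_div_comm]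

/-- Both states are products over the copies and live on the same cosets, so the inner product is a
power of the overlap for one copy; finite support of `D'` reduces everything to finite sums. -/
theorem inner_edcpAmp {D D' : ℤ → ℝ} (s : Fin n → ZMod N) (x : Fin ℓ → Fin n → ZMod N)
    {I : Finset ℤ} (hI : ∀ j ∉ I, D' j = 0) {φ ψ : EdcpSpace n N ℓ} (hφ : ⇑φ = edcpAmp D s x)
    (hψ : ⇑ψ = edcpAmp D' s x) :
    inner ℂ φ ψ = (((∑ j ∈ I, D j * D' j) / (√(∑' j, D j ^ 2) * √(∑' j, D' j ^ 2))) ^ ℓ : ℝ) := by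
  classical
  rw [lp.inner_eq_tsum]
  have h1 : ∀ ω, inner ℂ (φ ω) (ψ ω) =
      ((∏ k, cosetAmp D s (x k) (ω k) * cosetAmp D' s (x k) (ω k) : ℝ) : ℂ) := by
    intro ω
    rw [hφ, hψ, edcpAmp, edcpAmp, Finset.prod_mul_distrib]
    simp [mul_comm]
  simp only [h1]
  rw [tsum_eq_sum (s := Fintype.piFinset fun k =>
    I.map (cosetEmb s (x k)))]
  · rw [← Complex.ofReal_sum]
    rw [← Finset.prod_univ_sum (fun k => I.map (cosetEmb s (x k)))
      (fun k p => cosetAmp D s (x k) p * cosetAmp D' s (x k) p)]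
    simp only [sum_cosetAmp_mul, Finset.prod_const, Finset.card_univ, Fintype.card_fin]
  · intro ω hω
    rw [Fintype.mem_piFinset, not_forall] at hω
    obtain ⟨k, hk⟩ := hω
    rw [Complex.ofReal_eq_zero]
    refine Finset.prod_eq_zero (Finset.mem_univ k) ?_
    rw [Finset.mem_map] at hk
    by_cases h2 : ω k ∈ Set.range (cosetEmb s (x k))
    · obtain ⟨j, hj⟩ := h2
      have : D' j = 0 := hI _ fun h3 => hk ⟨_, h3, hj⟩
      rw [← hj, cosetAmp_emb D', this]
      simp
    · rw [cosetAmp_of_not D' h2, mul_zero]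

theorem norm_sq_edcpAmp_le {D : ℤ → ℝ} (hD : Summable fun j => D j ^ 2) (s : Fin n → ZMod N)
    (x : Fin ℓ → Fin n → ZMod N) {φ : EdcpSpace n N ℓ} (hφ : ⇑φ = edcpAmp D s x) :
    ‖φ‖ ^ 2 ≤ 1 := by
  classical
  have h0 : ‖φ‖ ^ 2 = ∑' ω : EdcpBasis n N ℓ, ∏ k, cosetAmp D s (x k) (ω k) ^ 2 := by
    have := lp.norm_rpow_eq_tsum (p := 2) (by norm_num) φ
    simp only [ENNReal.toReal_ofNat, Real.rpow_ofNat] at this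
    rw [this]
    refine tsum_congr fun ω => ?_
    rw [hφ, edcpAmp, Complex.norm_real, Real.norm_eq_abs, sq_abs, Finset.prod_pow]
  have h1 : ∀ k, ∑' p, cosetAmp D s (x k) p ^ 2 ≤ 1 := by
    intro k
    rw [← (cosetEmb s (x k)).injective.tsum_eq]
    · simp only [cosetAmp_emb, div_pow, tsum_div_const]
      rw [Real.sq_sqrt (tsum_nonneg fun _ => sq_nonneg _)]
      exact div_self_le_one _
    · intro p hp
      by_contra h
      exact hp (by simp [cosetAmp_of_not D h])
  rw [h0]
  refine Real.tsum_le_of_sum_le (fun ω => Finset.prod_nonneg fun _ _ => sq_nonneg _) fun u => ?_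
  have hsub : u ⊆ Fintype.piFinset fun k => u.image fun ω => ω k := fun ω hω => by
    rw [Fintype.mem_piFinset]
    exact fun k => Finset.mem_image_of_mem _ hω
  refine (Finset.sum_le_sum_of_subset_of_nonneg hsub
    fun ω _ _ => Finset.prod_nonneg fun _ _ => sq_nonneg _).trans ?_
  rw [← Finset.prod_univ_sum (fun k => u.image fun ω => ω k)
    (fun k p => cosetAmp D s (x k) p ^ 2)]
  exact Finset.prod_le_one (fun k _ => Finset.sum_nonneg fun _ _ => sq_nonneg _) fun k _ =>
    ((summable_cosetAmp_sq D hD s (x k)).sum_le_tsum _ fun _ _ => sq_nonneg _).trans (h1 k)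

/-- The overlap of two sequences of amplitudes with close squares. -/
theorem overlap_ge {D D' : ℤ → ℝ} {I : Finset ℤ} {η : ℝ} (hD : ∀ j, 0 ≤ D j)
    (hD' : ∀ j, 0 ≤ D' j) (hI : ∀ j ∉ I, D' j = 0) (hpos : 0 < ∑' j, D j ^ 2)
    (hη : ∑ j ∈ I, |D' j ^ 2 - D j ^ 2| + (∑' j, D j ^ 2 - ∑ j ∈ I, D j ^ 2) ≤
      η * ∑' j, D j ^ 2) (hη' : η ≤ 3 / 4) (hη0 : 0 ≤ η) :
    1 - η ≤ (∑ j ∈ I, D j * D' j) / (√(∑' j, D j ^ 2) * √(∑' j, D' j ^ 2)) := by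
  have e' : ∑' j, D' j ^ 2 = ∑ j ∈ I, D' j ^ 2 := tsum_eq_sum fun j hj => by simp [hI j hj]
  set a := ∑' j, D j ^ 2
  set b := ∑ j ∈ I, D' j ^ 2
  set d := ∑ j ∈ I, |D' j ^ 2 - D j ^ 2|
  set a' := ∑ j ∈ I, D j ^ 2
  -- Termwise: a product of two nonnegative numbers is at least the square of the smaller, which is
  -- half of the sum of the squares minus their difference.
  have h1 : (b + a' - d) / 2 ≤ ∑ j ∈ I, D j * D' j := by
    rw [← Finset.sum_add_distrib, ← Finset.sum_sub_distrib, Finset.sum_div]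
    refine Finset.sum_le_sum fun j _ => ?_
    have hx := hD j
    have hy := hD' j
    rcases abs_cases (D' j ^ 2 - D j ^ 2) with ⟨h, h'⟩ | ⟨h, h'⟩ <;> rw [h]
    · have : D j ≤ D' j := by nlinarith
      nlinarith
    · have : D' j ≤ D j := by nlinarith
      nlinarith
  have h2 : a' - d ≤ b := by
    rw [sub_le_iff_le_add, ← Finset.sum_add_distrib]
    refine Finset.sum_le_sum fun j _ => ?_
    have := neg_abs_le (D' j ^ 2 - D j ^ 2)
    linarith
  have h3 : a / 4 ≤ b := by nlinarith
  have hb : 0 < b := by linarith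
  have hsa := Real.sqrt_pos.2 hpos
  have hsb := Real.sqrt_pos.2 hb
  rw [e', le_div_iff₀ (by positivity)]
  have qa := Real.sq_sqrt hpos.le
  have qb := Real.sq_sqrt hb.le
  -- `η ≤ 3 / 4` leaves `b ≥ a / 4`. This allows the error `η a` to be replaced by `2 η √a √b`.
  have h4 : √a ≤ 2 * √b := by
    rw [Real.sqrt_le_left (by positivity)]
    rw [mul_pow, qb]
    linarith
  set u := √a
  set v := √b
  have h5 : η * (u * u) ≤ η * (2 * v * u) := by
    refine mul_le_mul_of_nonneg_left ?_ hη0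
    nlinarith
  nlinarith [sq_nonneg (u - v)]

/-- Since neither norm exceeds 1, `‖φ - ψ‖² ≤ 2 - 2 (1 - η) ^ ℓ`, and by Bernoulli's inequality this
is at most `2 ℓ η`. -/
theorem weight_edcpAmp_ge [NeZero N] {D D' : ℤ → ℝ} {I : Finset ℤ} {η : ℝ}
    (hs : Summable fun j => D j ^ 2) (hs' : Summable fun j => D' j ^ 2) (hD : ∀ j, 0 ≤ D j)
    (hD' : ∀ j, 0 ≤ D' j) (hI : ∀ j ∉ I, D' j = 0) (hpos : 0 < ∑' j, D j ^ 2)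
    (hη : ∑ j ∈ I, |D' j ^ 2 - D j ^ 2| + (∑' j, D j ^ 2 - ∑ j ∈ I, D j ^ 2) ≤
      η * ∑' j, D j ^ 2) (hη' : η ≤ 3 / 4) (hη0 : 0 ≤ η)
    (M : Povm n N ℓ) (t s : Fin n → ZMod N) (x : Fin ℓ → Fin n → ZMod N) {φ ψ : EdcpSpace n N ℓ}
    (hφ : ⇑φ = edcpAmp D s x) (hψ : ⇑ψ = edcpAmp D' s x) :
    M.weight t φ / 2 - 2 * ℓ * η ≤ M.weight t ψ := by
  refine le_trans ?_ (M.weight_ge_of_norm_sub t φ ψ)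
  have h1 := norm_sq_edcpAmp_le hs s x hφ
  have h2 := norm_sq_edcpAmp_le hs' s x hψ
  have h3 := overlap_ge hD hD' hI hpos hη hη' hη0
  have h4 := one_add_mul_le_pow (show (-2 : ℝ) ≤ -η by linarith) ℓ
  have h5 : (1 - η) ^ ℓ ≤ ((∑ j ∈ I, D j * D' j) / (√(∑' j, D j ^ 2) * √(∑' j, D' j ^ 2))) ^ ℓ :=
    pow_le_pow_left₀ (by linarith) h3 _
  have h6 := norm_sub_sq (𝕜 := ℂ) φ ψ
  rw [inner_edcpAmp s x hI hφ hψ] at h6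
  simp only [RCLike.re_to_complex, Complex.ofReal_re] at h6
  have h7 : (1 + -η) ^ ℓ = (1 - η) ^ ℓ := by ring
  rw [h7] at h4
  linarith

end

end QRed



namespace QRed

/-! ## Discrete Gaussians -/

theorem gaussianWeight_pos (s : ℝ) (j : ℤ) : 0 < gaussianWeight s j := Real.exp_pos _

theorem gaussianWeight_eq {s : ℝ} (j : ℤ) :
    gaussianWeight s j = Real.exp (-Real.pi * (1 / s ^ 2) * (j : ℝ) ^ 2) := by
  rw [gaussianWeight]
  congr 1
  ring

theorem summable_exp_neg_mul_int_sq {a : ℝ} (ha : 0 < a) :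
    Summable fun j : ℤ => Real.exp (-Real.pi * a * (j : ℝ) ^ 2) := by
  have him : 0 < (Complex.I * ((a : ℝ) : ℂ)).im := by simpa using ha
  have h := ((summable_jacobiTheta₂_term_iff 0 _).2 him).norm
  refine h.congr fun j => ?_
  rw [norm_jacobiTheta₂_term]
  congr 1
  rw [Complex.mul_im, Complex.I_re, Complex.I_im, Complex.ofReal_re, Complex.ofReal_im,
    Complex.zero_im]
  ring

theorem summable_gaussianWeight {s : ℝ} (hs : 0 < s) : Summable (gaussianWeight s) := by
  refine (summable_exp_neg_mul_int_sq (show 0 < 1 / s ^ 2 by positivity)).congr fun j => ?_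
  rw [gaussianWeight_eq]

theorem one_le_tsum_gaussianWeight {s : ℝ} (hs : 0 < s) : 1 ≤ ∑' j, gaussianWeight s j := by
  have := (summable_gaussianWeight hs).le_tsum 0 fun j _ => (gaussianWeight_pos s j).le
  simpa [gaussianWeight] using this

theorem tsum_gaussianWeight {s : ℝ} (hs : 0 < s) :
    ∑' j, gaussianWeight s j = s * ∑' j, gaussianWeight s⁻¹ j := by
  have h := Real.tsum_exp_neg_mul_int_sq (show 0 < 1 / s ^ 2 by positivity)
  simp only [gaussianWeight_eq]
  rw [h, ← Real.sqrt_eq_rpow, Real.sqrt_div zero_le_one, Real.sqrt_one, Real.sqrt_sq hs.le,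
    one_div_one_div]
  congr 1
  refine tsum_congr fun j => ?_
  congr 1
  field_simp

theorem le_tsum_gaussianWeight {s : ℝ} (hs : 0 < s) : s ≤ ∑' j, gaussianWeight s j := by
  rw [tsum_gaussianWeight hs]
  exact le_mul_of_one_le_right hs.le (one_le_tsum_gaussianWeight (inv_pos.2 hs))

/-- After Poisson summation the scaling contributes `√2`, and the dual sum decreases because the
dual width shrinks. -/
theorem tsum_gaussianWeight_sqrt_two {s : ℝ} (hs : 0 < s) :
    ∑' j, gaussianWeight (√2 * s) j ≤ √2 * ∑' j, gaussianWeight s j := by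
  have h2 : (0 : ℝ) < √2 := by positivity
  rw [tsum_gaussianWeight hs, tsum_gaussianWeight (mul_pos h2 hs), mul_assoc]
  refine mul_le_mul_of_nonneg_left (mul_le_mul_of_nonneg_left ?_ hs.le) h2.le
  refine Summable.tsum_le_tsum (fun j => ?_) (summable_gaussianWeight (by positivity))
    (summable_gaussianWeight (by positivity))
  rw [gaussianWeight_eq, gaussianWeight_eq, Real.exp_le_exp]
  have : 1 / (s⁻¹) ^ 2 ≤ 1 / ((√2 * s)⁻¹) ^ 2 := by
    simp only [inv_pow, one_div, inv_inv, mul_pow]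
    rw [Real.sq_sqrt (by norm_num)]
    nlinarith [sq_nonneg s]
  have hj := mul_nonneg Real.pi_pos.le (sq_nonneg (j : ℝ))
  nlinarith

/-- On `P` one half of the exponent is bounded by `-π K / 2`; the other half is a Gaussian of width
`√2 s`, whose total mass exceeds that of width `s` by at most `√2`. -/
theorem gaussian_tail {s K : ℝ} (hs : 0 < s) {P : Set ℤ}
    (hP : ∀ j ∈ P, K * s ^ 2 ≤ (j : ℝ) ^ 2) :
    ∑' j, P.indicator (gaussianWeight s) j ≤
      √2 * Real.exp (-(Real.pi * K / 2)) * ∑' j, gaussianWeight s j := by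
  have h2 : (0 : ℝ) < √2 := by positivity
  calc ∑' j, P.indicator (gaussianWeight s) j
      ≤ ∑' j, Real.exp (-(Real.pi * K / 2)) * gaussianWeight (√2 * s) j := by
        refine Summable.tsum_le_tsum (fun j => ?_) ((summable_gaussianWeight hs).indicator P)
          ((summable_gaussianWeight (by positivity)).mul_left _)
        by_cases hj : j ∈ P
        · rw [Set.indicator_of_mem hj, gaussianWeight, gaussianWeight, ← Real.exp_add,
            Real.exp_le_exp, mul_pow, Real.sq_sqrt (by norm_num)]
          have h := hP j hj
          rw [← le_div_iff₀ (by positivity)] at h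
          have e1 : -Real.pi * (j : ℝ) ^ 2 / s ^ 2 = -Real.pi * ((j : ℝ) ^ 2 / s ^ 2) := by ring
          have e2 : -Real.pi * (j : ℝ) ^ 2 / (2 * s ^ 2) =
            -Real.pi * ((j : ℝ) ^ 2 / s ^ 2) / 2 := by field_simp
          rw [e1, e2]
          nlinarith [Real.pi_pos]
        · rw [Set.indicator_of_notMem hj]
          have := gaussianWeight_pos (√2 * s) j
          positivity
    _ = Real.exp (-(Real.pi * K / 2)) * ∑' j, gaussianWeight (√2 * s) j := tsum_mul_left
    _ ≤ Real.exp (-(Real.pi * K / 2)) * (√2 * ∑' j, gaussianWeight s j) := by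
        gcongr
        exact tsum_gaussianWeight_sqrt_two hs
    _ = _ := by ring

theorem gaussianWeight_sq {r : ℝ} (j : ℤ) : gaussianWeight r j ^ 2 = gaussianWeight (r / √2) j := by
  rw [gaussianWeight, gaussianWeight, ← Real.exp_nat_mul, div_pow, Real.sq_sqrt (by norm_num)]
  congr 1
  push_cast
  field_simp

/-! ## Accuracy of the amplitudes -/

theorem abs_prod_sub_prod_le {ι : Type*} (I : Finset ι) {a b : ι → ℝ}
    (ha : ∀ i ∈ I, 0 ≤ a i ∧ a i ≤ 1) (hb : ∀ i ∈ I, 0 ≤ b i ∧ b i ≤ 1) {ε : ℝ}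
    (h : ∀ i ∈ I, |a i - b i| ≤ ε) : |∏ i ∈ I, a i - ∏ i ∈ I, b i| ≤ I.card * ε := by
  classical
  induction I using Finset.induction_on with
  | empty => simp
  | insert i I hi ih =>
    rw [Finset.prod_insert hi, Finset.prod_insert hi, Finset.card_insert_of_notMem hi]
    have h1 := ih (fun j hj => ha j (Finset.mem_insert_of_mem hj))
      (fun j hj => hb j (Finset.mem_insert_of_mem hj))
      (fun j hj => h j (Finset.mem_insert_of_mem hj))
    have h2 := h i (Finset.mem_insert_self i I)
    have h3 := ha i (Finset.mem_insert_self i I)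
    have h4 : |∏ j ∈ I, b j| ≤ 1 := by
      rw [Finset.abs_prod]
      refine Finset.prod_le_one (fun _ _ => abs_nonneg _) fun j hj => ?_
      have := hb j (Finset.mem_insert_of_mem hj)
      rw [abs_of_nonneg this.1]
      exact this.2
    rw [show a i * ∏ j ∈ I, a j - b i * ∏ j ∈ I, b j =
      a i * (∏ j ∈ I, a j - ∏ j ∈ I, b j) + (a i - b i) * ∏ j ∈ I, b j by ring]
    refine (abs_add_le _ _).trans ?_
    rw [abs_mul, abs_mul, abs_of_nonneg h3.1]
    push_cast
    have h5 : a i * |∏ j ∈ I, a j - ∏ j ∈ I, b j| ≤ |∏ j ∈ I, a j - ∏ j ∈ I, b j| :=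
      mul_le_of_le_one_left (abs_nonneg _) h3.2
    have h6 : |a i - b i| * |∏ j ∈ I, b j| ≤ |a i - b i| :=
      mul_le_of_le_one_right (abs_nonneg _) h4
    linarith

theorem sum_bits {K : ℕ} {z : ℤ} (h0 : 0 ≤ z) (h : z < 2 ^ K) :
    ∑ i ∈ Finset.range K, z / 2 ^ i % 2 * 2 ^ i = z := by
  have key : ∀ k : ℕ, ∑ i ∈ Finset.range k, z / 2 ^ i % 2 * 2 ^ i = z - 2 ^ k * (z / 2 ^ k) := by
    intro k
    induction k with
    | zero => simp
    | succ k ih =>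
      rw [Finset.sum_range_succ, ih, pow_succ, ← Int.ediv_ediv_of_nonneg (by positivity)]
      have := Int.emod_def (z / 2 ^ k) 2
      rw [this]
      ring
  rw [key, Int.ediv_eq_zero_of_lt h0 h]
  ring

/-- All quantities are measured by `Y = 2 ^ (B + κ + 1)`. A nonzero truncation bound forces `1 / r ≤
Y`; the precision gives `1 / V ≤ Y⁻³²`, and `W = Y ^ 16` gives `δ ≤ 7 Y⁻¹⁴`. The initial error is
thus below `50 Y⁻²⁸`, dominated by `δ² ≤ 49 Y⁻²⁸`, and fewer than `18 (B + κ + 1)` doublings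
multiply it by at most `Y ^ 18`. -/
theorem expFix_factor_error {κ B m : ℕ} {r : ℝ} (hr : 0 < r) (hκ : 2 ≤ κ)
    (hR : 1 ≤ truncation κ B m r) {i : ℕ} (hi : i < 2 * (B + κ + 1)) :
    |(expFix (2 ^ precision κ B m) ⌊(2 : ℝ) ^ precision κ B m * r⌋ (piFix (precision κ B m))
      (2 ^ (16 * (B + κ + 1))) (16 * (B + κ + 1) + i) : ℝ) / 2 ^ precision κ B m -
        Real.exp (-(2 * Real.pi / r ^ 2 * 2 ^ i))| ≤ 50 / (2 ^ (B + κ + 1)) ^ 10 := by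
  set Y : ℝ := 2 ^ (B + κ + 1) with hY
  have hY8 : 8 ≤ Y := by
    calc (8 : ℝ) = 2 ^ 3 := by norm_num
      _ ≤ Y := pow_le_pow_right₀ (by norm_num) (by omega)
  have hY0 : 0 < Y := by linarith
  have hrY : 1 / r ≤ Y := by
    have h1 := truncation_le (κ := κ) (B := B) (m := m) (r := r)
    have h2 : (1 : ℝ) ≤ truncation κ B m r := by exact_mod_cast hR
    have h3 : (Nat.sqrt κ : ℝ) ≤ Y := by
      have : Nat.sqrt κ ≤ 2 ^ (B + κ + 1) := (Nat.sqrt_le_self κ).trans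
        (Nat.lt_two_pow_self.le.trans (Nat.pow_le_pow_right (by norm_num) (by omega)))
      rw [hY]
      exact_mod_cast this
    rw [div_le_iff₀ hr]
    exact (h2.trans h1).trans (mul_le_mul_of_nonneg_right h3 hr.le)
  set L := precision κ B m with hL
  have hVY : Y ^ 32 ≤ (2 : ℝ) ^ L := by
    rw [hY, ← pow_mul]
    exact pow_le_pow_right₀ (by norm_num) (by rw [hL, precision]; omega)
  have hW : (2 : ℝ) ^ (16 * (B + κ + 1)) = Y ^ 16 := by rw [hY, ← pow_mul]; congr 1; ring
  set y := 1 / Y with hy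
  have hy0 : 0 < y := by positivity
  have hy8 : y ≤ 1 / 8 := one_div_le_one_div_of_le (by norm_num) hY8
  have hyY : y * Y = 1 := by rw [hy]; field_simp
  have hV1 : 1 / (2 : ℝ) ^ L ≤ y ^ 32 := by
    rw [hy, one_div_pow]
    exact one_div_le_one_div_of_le (by positivity) hVY
  have hr2 : 1 / r ^ 2 ≤ Y ^ 2 := by rw [← one_div_pow]; gcongr
  have hr3 : 1 / r ^ 3 ≤ Y ^ 3 := by rw [← one_div_pow]; gcongr
  have hpi := Real.pi_lt_d2
  have hpi0 := Real.pi_pos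
  set δ := 2 * Real.pi / (r ^ 2 * Y ^ 16) with hδ
  have hδ0 : 0 ≤ δ := by positivity
  have hδ1 : δ ≤ 7 * y ^ 14 := by
    have : δ = 2 * Real.pi * (1 / r ^ 2) * y ^ 16 := by rw [hδ, hy]; field_simp
    rw [this]
    calc 2 * Real.pi * (1 / r ^ 2) * y ^ 16 ≤ 7 * Y ^ 2 * y ^ 16 := by gcongr; linarith
      _ = 7 * y ^ 14 * (y * Y) ^ 2 := by ring
      _ = _ := by rw [hyY]; ring
  have hy14 : y ^ 14 ≤ 1 / 8 := (pow_le_of_le_one hy0.le (by linarith) (by norm_num)).trans hy8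
  have hrV : 2 ≤ (2 : ℝ) ^ L * r := by
    have h1 : 1 / Y ≤ r := (one_div_le hr hY0).1 hrY
    calc (2 : ℝ) ≤ Y ^ 31 * 1 := by
          have := one_le_pow₀ (n := 30) (show (1 : ℝ) ≤ Y by linarith)
          nlinarith [pow_succ Y 30]
      _ = Y ^ 32 * (1 / Y) := by field_simp
      _ ≤ _ := by gcongr
  have h0 := expFix_zero_error (r := r) (V := 2 ^ L) (D := ⌊(2 : ℝ) ^ L * r⌋)
    (W := 2 ^ (16 * (B + κ + 1))) (p := piFix L) (by positivity) (by positivity) hr (by push_cast; rfl)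
    (by push_cast; exact hrV) (by push_cast; exact piFix_approx L)
    (by push_cast; rw [hW, ← hδ]; linarith)
  have h1 := expFix_error (by positivity) (piFix_bounds (by rw [hL, precision]; omega)).1
    (by positivity) (by push_cast; rw [hW]; exact hδ0) h0 (16 * (B + κ + 1) + i)
  push_cast at h1
  rw [hW, ← hδ] at h1
  have e1 : δ * 2 ^ (16 * (B + κ + 1) + i) = 2 * Real.pi / r ^ 2 * 2 ^ i := by
    rw [pow_add, hW, hδ]
    field_simp
  rw [e1] at h1
  have hV0 : 0 ≤ 1 / (2 : ℝ) ^ L := by positivity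
  refine (le_add_of_nonneg_right hV0).trans (h1.trans ?_)
  have h2 : (2 : ℝ) ^ (16 * (B + κ + 1) + i) ≤ Y ^ 18 := by
    rw [hY, ← pow_mul]
    exact pow_le_pow_right₀ (by norm_num) (by omega)
  have h3 : 2 / Y ^ 16 * ((84 / r ^ 2 + 32 / r ^ 3) / 2 ^ L) ≤ 232 * y ^ 45 := by
    calc 2 / Y ^ 16 * ((84 / r ^ 2 + 32 / r ^ 3) / 2 ^ L)
        = 2 * y ^ 16 * ((84 * (1 / r ^ 2) + 32 * (1 / r ^ 3)) * (1 / 2 ^ L)) := by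
          rw [hy]; field_simp
      _ ≤ 2 * y ^ 16 * ((84 * Y ^ 3 + 32 * Y ^ 3) * y ^ 32) := by
          have : Y ^ 2 ≤ Y ^ 3 := pow_le_pow_right₀ (by linarith) (by norm_num)
          have := hr2.trans this
          gcongr
      _ = 232 * y ^ 45 * (y * Y) ^ 3 := by ring
      _ = _ := by rw [hyY]; ring
  have h4 : y ^ 32 ≤ y ^ 28 * (1 / 8) := by
    rw [show y ^ 32 = y ^ 28 * y ^ 4 by ring]
    gcongr
    exact (pow_le_of_le_one hy0.le (by linarith) (by norm_num)).trans hy8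
  have h5 : y ^ 45 ≤ y ^ 28 * (1 / 512) := by
    rw [show y ^ 45 = y ^ 28 * (y ^ 14 * y ^ 3) by ring]
    gcongr
    calc y ^ 14 * y ^ 3 ≤ 1 * (1 / 8) ^ 3 := by gcongr; linarith
      _ = 1 / 512 := by norm_num
  have h6 : δ ^ 2 ≤ 49 * y ^ 28 := by
    calc δ ^ 2 ≤ (7 * y ^ 14) ^ 2 := by gcongr
      _ = _ := by ring
  have h7 : 0 < y ^ 28 := by positivity
  calc (2 : ℝ) ^ (16 * (B + κ + 1) + i) * (1 / 2 ^ L +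
        2 / Y ^ 16 * ((84 / r ^ 2 + 32 / r ^ 3) / 2 ^ L) + δ ^ 2 + 1 / 2 ^ L)
      ≤ Y ^ 18 * (50 * y ^ 28) := by
        gcongr
        linarith
    _ = 50 * y ^ 10 * (y * Y) ^ 18 := by ring
    _ = _ := by rw [hyY, hy, one_div_pow]; ring

end QRed



/-! ### Truncated amplitudes compared with the Gaussian, and the success rate of the attempts -/

namespace QRed

section

variable {κ B m n q ℓ : ℕ} {r : ℝ} {A : Matrix (Fin m) (Fin n) (ZMod q)} {b : Fin m → ZMod q}

theorem flagProb_eq {c : Par} (hV : 0 < c.V) (j : ℤ) (i : ℕ) (Y : ℤ) :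
    flagProb c j i Y = if j * j / 2 ^ i % 2 = 0 then 1 else (c.u i : ℝ) / c.V := by
  have hV' : ((c.V : ℤ) : ℝ) ≠ 0 := by exact_mod_cast hV.ne'
  unfold flagProb
  split_ifs with h
  · rw [h, zero_mul, sub_zero, div_self hV']
  · rw [Int.emod_two_ne_zero.1 h, one_mul, sub_sub_cancel]
    rfl

theorem truncAmp_sq_eq {c : Par} (hV : 0 < c.V) (hu : ∀ i, 0 ≤ c.u i ∧ c.u i ≤ c.V) {j : ℤ}
    (hj : |j| ≤ c.R) : truncAmp c j ^ 2 = ∏ i ∈ Finset.range c.H, flagProb c j i 0 := by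
  rw [truncAmp_sq c hj, ampl_zero, ← Finset.prod_pow]
  refine Finset.prod_congr rfl fun i _ => ?_
  rw [Real.sq_sqrt (clamp_nonneg _), clamp, flagProb_eq hV]
  have hV' : (0 : ℝ) < c.V := by exact_mod_cast hV
  have h0 : (0 : ℝ) ≤ c.u i / c.V := div_nonneg (by exact_mod_cast (hu i).1) hV'.le
  have h1 : (c.u i : ℝ) / c.V ≤ 1 := (div_le_one hV').2 (by exact_mod_cast (hu i).2)
  split_ifs
  · simp
  · rw [min_eq_right h1, max_eq_right h0]

theorem mkPar_u_bounds (κ B ℓ : ℕ) (r : ℝ) (A : Matrix (Fin m) (Fin n) (ZMod q))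
    (b : Fin m → ZMod q) (i : ℕ) :
    0 ≤ (mkPar κ B r ℓ A b).u i ∧ (mkPar κ B r ℓ A b).u i ≤ (mkPar κ B r ℓ A b).V := by
  have := expFix_bounds (V := 2 ^ precision κ B m) (D := ⌊(2 : ℝ) ^ precision κ B m * r⌋)
    (W := 2 ^ (16 * (B + κ + 1))) (by positivity)
    (piFix_bounds (L := precision κ B m) (by rw [precision]; omega)).1 (by positivity)
    (16 * (B + κ + 1) + i)
  simpa [mkPar] using this

theorem mkPar_V_pos (κ B ℓ : ℕ) (r : ℝ) (A : Matrix (Fin m) (Fin n) (ZMod q))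
    (b : Fin m → ZMod q) : 0 < (mkPar κ B r ℓ A b).V := by simp [mkPar]

/-- The binary expansion of `j²` writes `exp (-2 π j² / r²)` as a product of factors `exp (-2 π 2 ^
i / r²)`, and the flags realize an approximation of each factor; the errors of the factors add up.
-/
theorem truncAmp_error (hr : 0 < r) (hκ : 2 ≤ κ) (hB : r ≤ 2 ^ (B + 1)) {j : ℤ}
    (hj : |j| ≤ (mkPar κ B r ℓ A b).R) :
    |truncAmp (mkPar κ B r ℓ A b) j ^ 2 - gaussianWeight r j ^ 2| ≤ 1 / (2 ^ (B + κ + 1)) ^ 6 := by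
  rw [truncAmp_sq_eq (mkPar_V_pos κ B ℓ r A b) (mkPar_u_bounds κ B ℓ r A b) hj]
  have hV := mkPar_V_pos κ B ℓ r A b
  have hu := mkPar_u_bounds κ B ℓ r A b
  -- For `j = 0` no flag is rotated and both squares are exactly 1. Any other `j` shows that `R ≥
  -- 1`, which supplies the lower bound for `r` needed by the error estimate.
  by_cases hj0 : j = 0
  · subst hj0
    simp only [flagProb_eq hV, gaussianWeight]
    simp
  set Y : ℝ := 2 ^ (B + κ + 1) with hY
  have hY8 : 8 ≤ Y := by
    calc (8 : ℝ) = 2 ^ 3 := by norm_num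
      _ ≤ Y := pow_le_pow_right₀ (by norm_num) (by omega)
  have hR : 1 ≤ truncation κ B m r := by
    have : 1 ≤ |j| := Int.one_le_abs hj0
    have h2 : ((mkPar κ B r ℓ A b).R : ℤ) = truncation κ B m r :=
      Int.toNat_of_nonneg (truncation_nonneg hr)
    omega
  have hjj : j * j < 2 ^ (2 * (B + κ + 1)) := by
    have h1 := truncation_bound (κ := κ) (m := m) hr hB
    have h2 := truncation_le (κ := κ) (B := B) (m := m) (r := r)
    have h3 : ((mkPar κ B r ℓ A b).R : ℝ) < 2 ^ (B + κ + 1) := by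
      have h4 : ((mkPar κ B r ℓ A b).R : ℝ) = (truncation κ B m r : ℝ) := by
        exact_mod_cast Int.toNat_of_nonneg (truncation_nonneg (κ := κ) (B := B) (m := m) hr)
      have h5 : (Nat.sqrt κ : ℝ) < 2 ^ κ := by
        exact_mod_cast (Nat.sqrt_le_self κ).trans_lt Nat.lt_two_pow_self
      rw [h4]
      calc (truncation κ B m r : ℝ) ≤ Nat.sqrt κ * r := h2
        _ < 2 ^ κ * r := by gcongr
        _ ≤ 2 ^ κ * 2 ^ (B + 1) := by gcongr
        _ = 2 ^ (B + κ + 1) := by rw [← pow_add]; congr 1; ring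
    have h4 : ((mkPar κ B r ℓ A b).R : ℤ) < 2 ^ (B + κ + 1) := by exact_mod_cast h3
    rw [← abs_mul_abs_self]
    calc |j| * |j| ≤ (mkPar κ B r ℓ A b).R * (mkPar κ B r ℓ A b).R := by gcongr
      _ < 2 ^ (B + κ + 1) * 2 ^ (B + κ + 1) := by gcongr
      _ = _ := by rw [← pow_add]; congr 1; ring
  have hprod : gaussianWeight r j ^ 2 = ∏ i ∈ Finset.range (2 * (B + κ + 1)),
      if j * j / 2 ^ i % 2 = 0 then 1 else Real.exp (-(2 * Real.pi / r ^ 2 * 2 ^ i)) := by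
    have h1 : ∀ i ∈ Finset.range (2 * (B + κ + 1)), (if j * j / 2 ^ i % 2 = 0 then 1 else
        Real.exp (-(2 * Real.pi / r ^ 2 * 2 ^ i))) =
        Real.exp (-(2 * Real.pi / r ^ 2) * ((j * j / 2 ^ i % 2 * 2 ^ i : ℤ) : ℝ)) := by
      intro i _
      split_ifs with h
      · rw [h]; simp
      · rw [Int.emod_two_ne_zero.1 h]
        congr 1
        push_cast
        ring
    rw [Finset.prod_congr rfl h1, ← Real.exp_sum, ← Finset.mul_sum, ← Int.cast_sum,
      sum_bits (mul_self_nonneg j) hjj, gaussianWeight, ← Real.exp_nat_mul]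
    congr 1
    push_cast
    ring
  have hH : (mkPar κ B r ℓ A b).H = 2 * (B + κ + 1) := rfl
  rw [hprod, hH]
  refine (abs_prod_sub_prod_le (Finset.range (2 * (B + κ + 1))) (ε := 50 / Y ^ 10)
    (fun i _ => ?_) (fun i _ => ?_) (fun i hi => ?_)).trans ?_
  · rw [flagProb_eq hV]
    have hV' : (0 : ℝ) < (mkPar κ B r ℓ A b).V := by exact_mod_cast hV
    split_ifs
    · norm_num
    · exact ⟨div_nonneg (by exact_mod_cast (hu i).1) hV'.le,
        (div_le_one hV').2 (by exact_mod_cast (hu i).2)⟩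
  · split_ifs
    · norm_num
    · refine ⟨(Real.exp_pos _).le, Real.exp_le_one_iff.2 ?_⟩
      have := Real.pi_pos
      rw [neg_nonpos]
      positivity
  · rw [flagProb_eq hV]
    split_ifs
    · simp; positivity
    · have := expFix_factor_error hr hκ hR (Finset.mem_range.1 hi)
      simpa [mkPar] using this
  · rw [Finset.card_range]
    have h1 : ((2 * (B + κ + 1) : ℕ) : ℝ) ≤ 2 * Y := by
      push_cast
      have : ((B + κ + 1 : ℕ) : ℝ) ≤ Y := by
        rw [hY]
        exact_mod_cast (Nat.lt_two_pow_self (n := B + κ + 1)).le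
      push_cast at this
      linarith
    calc ((2 * (B + κ + 1) : ℕ) : ℝ) * (50 / Y ^ 10) ≤ 2 * Y * (50 / Y ^ 10) := by gcongr
      _ = 100 / Y ^ 3 * (1 / Y ^ 6) := by field_simp; norm_num
      _ ≤ 1 * (1 / Y ^ 6) := by
        gcongr
        rw [div_le_one (by positivity)]
        calc (100 : ℝ) ≤ 8 ^ 3 := by norm_num
          _ ≤ Y ^ 3 := by gcongr
      _ = _ := one_mul _

theorem quarter_le_sqrt_sq (κ : ℕ) : (κ : ℝ) / 4 ≤ (Nat.sqrt κ : ℝ) ^ 2 := by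
  have h1 : κ < (Nat.sqrt κ + 1) ^ 2 := by rw [sq]; exact Nat.lt_succ_sqrt κ
  rcases Nat.eq_zero_or_pos κ with rfl | h
  · simp
  have h2 : 1 ≤ Nat.sqrt κ := Nat.sqrt_pos.2 h
  have h3 : κ ≤ 4 * (Nat.sqrt κ) ^ 2 := by nlinarith
  have : (κ : ℝ) ≤ 4 * (Nat.sqrt κ : ℝ) ^ 2 := by exact_mod_cast h3
  linarith

/-- The two roundings in `truncation` cost less than 1 each, so `|j| ≥ R + 1` gives `√κ r ≤ |j| +
1`, with the integer square root of `κ`, and `1 ≤ |j|`. -/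
theorem le_two_mul_of_truncation_lt (hr : 0 < r) {j : ℤ}
    (hj : ¬|j| ≤ (mkPar κ B r ℓ A b).R) : Nat.sqrt κ * r ≤ 2 * |(j : ℝ)| := by
  have h2 : ((mkPar κ B r ℓ A b).R : ℤ) = truncation κ B m r :=
    Int.toNat_of_nonneg (truncation_nonneg hr)
  rw [h2, not_le] at hj
  have h3 : (truncation κ B m r : ℝ) + 1 ≤ |(j : ℝ)| := by exact_mod_cast hj
  have h4 := (abs_ediv_sub_le (Nat.sqrt κ * ⌊(2 : ℝ) ^ precision κ B m * r⌋)
    (show (0 : ℤ) < 2 ^ precision κ B m by positivity)).2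
  have h5 := (Int.sub_one_lt_floor ((2 : ℝ) ^ precision κ B m * r)).le
  have h6 : (Nat.sqrt κ : ℝ) ≤ 2 ^ precision κ B m := by
    have : Nat.sqrt κ ≤ 2 ^ precision κ B m := (Nat.sqrt_le_self κ).trans
      (Nat.lt_two_pow_self.le.trans (Nat.pow_le_pow_right (by norm_num) (by rw [precision]; omega)))
    exact_mod_cast this
  have h0 : (0 : ℝ) ≤ truncation κ B m r := by exact_mod_cast truncation_nonneg hr
  change _ ≤ (truncation κ B m r : ℝ) + 1 at h4
  push_cast at h4
  set V : ℝ := 2 ^ precision κ B m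
  have hV : 0 < V := by positivity
  have h7 : (Nat.sqrt κ : ℝ) * r - 1 ≤ Nat.sqrt κ * (⌊V * r⌋ : ℝ) / V := by
    rw [le_div_iff₀ hV]
    calc ((Nat.sqrt κ : ℝ) * r - 1) * V = Nat.sqrt κ * (V * r - 1) + (Nat.sqrt κ - V) := by ring
      _ ≤ Nat.sqrt κ * (V * r - 1) := by linarith
      _ ≤ _ := by gcongr
  linarith

theorem exp_neg_eighth_ge (κ : ℕ) : (1 : ℝ) / 2 ^ κ ≤ Real.exp (-(κ / 8 : ℝ)) := by
  rw [Real.exp_neg, ← one_div]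
  refine one_div_le_one_div_of_le (Real.exp_pos _) ?_
  rw [show (κ / 8 : ℝ) = κ * (1 / 8) by ring, Real.exp_nat_mul]
  gcongr
  have := Real.exp_one_lt_d9
  have h8 : Real.exp (1 / 8) ≤ Real.exp 1 := Real.exp_le_exp.2 (by norm_num)
  by_contra h
  have h1 : (2 : ℝ) ^ 8 < Real.exp (1 / 8) ^ 8 := by gcongr; linarith
  rw [← Real.exp_nat_mul] at h1
  norm_num at h1
  linarith

theorem summable_gaussianWeight_sq (hr : 0 < r) : Summable fun j => gaussianWeight r j ^ 2 := by
  simp only [gaussianWeight_sq]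
  exact summable_gaussianWeight (by positivity)

/-- Inside the truncation there are at most `Y²` values with error at most `Y⁻⁶`, where `Y = 2 ^ (B
+ κ + 1)`; outside, the tail bound applies to the squared weights, which form a Gaussian of width `r
/ √2`. -/
theorem truncAmp_close (hr : 0 < r) (hκ : 2 ≤ κ) (hB : r ≤ 2 ^ (B + 1)) :
    ∑ j ∈ Finset.Icc (-((mkPar κ B r ℓ A b).R : ℤ)) (mkPar κ B r ℓ A b).R,
        |truncAmp (mkPar κ B r ℓ A b) j ^ 2 - gaussianWeight r j ^ 2| +
      (∑' j, gaussianWeight r j ^ 2 - ∑ j ∈ Finset.Icc (-((mkPar κ B r ℓ A b).R : ℤ))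
        (mkPar κ B r ℓ A b).R, gaussianWeight r j ^ 2) ≤
      3 * Real.exp (-(κ / 8 : ℝ)) * ∑' j, gaussianWeight r j ^ 2 := by
  set R := (mkPar κ B r ℓ A b).R with hR
  set I := Finset.Icc (-(R : ℤ)) R with hI
  have hs := summable_gaussianWeight_sq hr
  have h1 : 1 ≤ ∑' j, gaussianWeight r j ^ 2 := by
    simp only [gaussianWeight_sq]
    exact one_le_tsum_gaussianWeight (by positivity)
  set G := ∑' j, gaussianWeight r j ^ 2 with hG
  have e1 : ∑ j ∈ I, |truncAmp (mkPar κ B r ℓ A b) j ^ 2 - gaussianWeight r j ^ 2| ≤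
      Real.exp (-(κ / 8 : ℝ)) * G := by
    have hY0 : (0 : ℝ) < 2 ^ (B + κ + 1) := by positivity
    have hcard : (I.card : ℝ) ≤ (2 ^ (B + κ + 1)) ^ 2 := by
      rw [hI, Int.card_Icc, show (R : ℤ) + 1 - -R = ((2 * R + 1 : ℕ) : ℤ) by push_cast; ring,
        Int.toNat_natCast, ← pow_mul, mul_comm (B + κ + 1) 2]
      exact_mod_cast truncation_bound (κ := κ) (m := m) hr hB
    calc ∑ j ∈ I, |truncAmp (mkPar κ B r ℓ A b) j ^ 2 - gaussianWeight r j ^ 2|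
        ≤ ∑ j ∈ I, 1 / (2 ^ (B + κ + 1)) ^ 6 := Finset.sum_le_sum fun j hj =>
          truncAmp_error hr hκ hB (abs_le.2 (Finset.mem_Icc.1 hj))
      _ = I.card * (1 / (2 ^ (B + κ + 1)) ^ 6) := by rw [Finset.sum_const, nsmul_eq_mul]
      _ ≤ (2 ^ (B + κ + 1)) ^ 2 * (1 / (2 ^ (B + κ + 1)) ^ 6) := by gcongr
      _ = 1 / (2 ^ (B + κ + 1)) ^ 4 := by field_simp
      _ ≤ 1 / 2 ^ κ := by
        gcongr
        rw [← pow_mul]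
        exact pow_le_pow_right₀ (by norm_num) (by omega)
      _ ≤ Real.exp (-(κ / 8 : ℝ)) := exp_neg_eighth_ge κ
      _ ≤ _ := le_mul_of_one_le_right (Real.exp_pos _).le h1
  have e2 : G - ∑ j ∈ I, gaussianWeight r j ^ 2 ≤ 2 * Real.exp (-(κ / 8 : ℝ)) * G := by
    have h2 := hs.sum_add_tsum_compl (s := I)
    rw [← hG] at h2
    have h3 : G - ∑ j ∈ I, gaussianWeight r j ^ 2 =
        ∑' j, ((I : Set ℤ)ᶜ).indicator (gaussianWeight (r / √2)) j := by
      rw [← h2, add_sub_cancel_left, tsum_subtype ((I : Set ℤ)ᶜ) (fun j => gaussianWeight r j ^ 2)]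
      simp only [gaussianWeight_sq]
    -- `K = κ / 8` because an omitted `j` has `j² ≥ (κ / 4) r² / 4 = (κ / 8) (r / √2)²`.
    have h4 := gaussian_tail (s := r / √2) (K := κ / 8) (P := (I : Set ℤ)ᶜ) (by positivity) ?_
    · rw [h3]
      refine h4.trans ?_
      simp only [← gaussianWeight_sq, ← hG]
      have h5 : √2 ≤ 2 := by rw [Real.sqrt_le_left (by norm_num)]; norm_num
      have h6 : Real.exp (-(Real.pi * (κ / 8) / 2)) ≤ Real.exp (-(κ / 8 : ℝ)) := by
        rw [Real.exp_le_exp]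
        have := Real.pi_gt_three
        have hk : (0 : ℝ) ≤ κ := by positivity
        nlinarith
      gcongr
    · intro j hj
      have hj' : ¬|j| ≤ R := fun h => hj (by
        rw [Finset.mem_coe, hI, Finset.mem_Icc]; exact abs_le.1 h)
      have h5 := le_two_mul_of_truncation_lt (κ := κ) (B := B) (ℓ := ℓ) (A := A) (b := b) hr hj'
      have h6 := quarter_le_sqrt_sq κ
      rw [div_pow, Real.sq_sqrt (by norm_num)]
      have h7 : (Nat.sqrt κ * r) ^ 2 ≤ (2 * |(j : ℝ)|) ^ 2 := by gcongr
      rw [mul_pow, mul_pow, sq_abs] at h7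
      have h8 : (κ : ℝ) / 4 * r ^ 2 ≤ (Nat.sqrt κ : ℝ) ^ 2 * r ^ 2 := by gcongr
      nlinarith
  linarith

theorem truncAmp_nonneg (c : Par) (j : ℤ) : 0 ≤ truncAmp c j := by
  unfold truncAmp
  split_ifs
  · rw [ampl_zero]
    exact Finset.prod_nonneg fun _ _ => Real.sqrt_nonneg _
  · rfl

theorem three_mul_exp_le (hκ : 16 ≤ κ) : 3 * Real.exp (-(κ / 8 : ℝ)) ≤ 3 / 4 := by
  have h1 : Real.exp (-(κ / 8 : ℝ)) ≤ Real.exp (-2) := by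
    rw [Real.exp_le_exp]
    have : (16 : ℝ) ≤ κ := by exact_mod_cast hκ
    linarith
  have h2 : Real.exp (-2) ≤ 1 / 4 := by
    rw [Real.exp_neg, ← one_div]
    refine one_div_le_one_div_of_le (by norm_num) ?_
    have := Real.exp_one_gt_d9
    rw [show (2 : ℝ) = 1 + 1 by norm_num, Real.exp_add]
    nlinarith
  linarith

theorem weight_truncState_ge [NeZero q] (hr : 0 < r) (hκ : 16 ≤ κ) (hB : r ≤ 2 ^ (B + 1))
    (M : Povm n q ℓ) (t s : Fin n → ZMod q) (x : Fin ℓ → Fin n → ZMod q) :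
    M.weight t (gEdcpState hr s x) / 2 - 6 * ℓ * Real.exp (-(κ / 8 : ℝ)) ≤
      M.weight t (truncState (mkPar κ B r ℓ A b) s x) := by
  have h := weight_edcpAmp_ge (D := gaussianWeight r) (D' := truncAmp (mkPar κ B r ℓ A b))
    (φ := gEdcpState hr s x) (ψ := truncState (mkPar κ B r ℓ A b) s x)
    (summable_gaussianWeight_sq hr) (summable_truncAmp_sq _)
    (fun j => (gaussianWeight_pos r j).le) (truncAmp_nonneg _)
    (fun j hj => if_neg fun h => hj (Finset.mem_Icc.2 (abs_le.1 h)))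
    (by
      simp only [gaussianWeight_sq]
      exact zero_lt_one.trans_le (one_le_tsum_gaussianWeight (by positivity)))
    (truncAmp_close hr (by omega) hB) (three_mul_exp_le hκ) (by positivity) M t s x
    (by
      funext ω
      change edcpAmp (discreteGaussian r) s x ω = _
      simp only [edcpAmp]
      rw [show discreteGaussian r = fun j => gaussianWeight r j / ∑' i, gaussianWeight r i from rfl]
      simp only [cosetAmp_div _ (zero_lt_one.trans_le (one_le_tsum_gaussianWeight hr))])
    rfl
  calc _ = M.weight t (gEdcpState hr s x) / 2 - 2 * ℓ * (3 * Real.exp (-(κ / 8 : ℝ))) := by ring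
    _ ≤ _ := h

theorem quarter_le_tsum_truncAmp_sq (hr : 0 < r) (hκ : 16 ≤ κ) (hB : r ≤ 2 ^ (B + 1)) :
    (∑' j, gaussianWeight r j ^ 2) / 4 ≤ ∑' j, truncAmp (mkPar κ B r ℓ A b) j ^ 2 := by
  have h1 := truncAmp_close (ℓ := ℓ) (A := A) (b := b) hr (show 2 ≤ κ by omega) hB
  have h2 := three_mul_exp_le hκ
  rw [tsum_truncAmp_sq]
  have h0 : 0 ≤ ∑' j, gaussianWeight r j ^ 2 := tsum_nonneg fun _ => sq_nonneg _
  have h3 : ∑ j ∈ Finset.Icc (-((mkPar κ B r ℓ A b).R : ℤ)) (mkPar κ B r ℓ A b).R,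
      gaussianWeight r j ^ 2 - ∑ j ∈ Finset.Icc (-((mkPar κ B r ℓ A b).R : ℤ))
        (mkPar κ B r ℓ A b).R, |truncAmp (mkPar κ B r ℓ A b) j ^ 2 - gaussianWeight r j ^ 2| ≤
      ∑ j ∈ Finset.Icc (-((mkPar κ B r ℓ A b).R : ℤ)) (mkPar κ B r ℓ A b).R,
        truncAmp (mkPar κ B r ℓ A b) j ^ 2 := by
    rw [← Finset.sum_sub_distrib]
    refine Finset.sum_le_sum fun j _ => ?_
    have := neg_abs_le (truncAmp (mkPar κ B r ℓ A b) j ^ 2 - gaussianWeight r j ^ 2)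
    linarith
  have h4 := mul_le_mul_of_nonneg_right h2 h0
  linarith

theorem tsum_truncAmp_sq_pos (hr : 0 < r) (hκ : 16 ≤ κ) (hB : r ≤ 2 ^ (B + 1)) :
    0 < ∑' j, truncAmp (mkPar κ B r ℓ A b) j ^ 2 := by
  refine lt_of_lt_of_le ?_ (quarter_le_tsum_truncAmp_sq hr hκ hB)
  simp only [gaussianWeight_sq]
  have := one_le_tsum_gaussianWeight (show 0 < r / √2 by positivity)
  linarith

theorem attProb_le_one {c : Par} : attProb c ≤ 1 := by
  have hN : (0 : ℝ) < 2 * c.R + 1 := by positivity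
  rw [attProb, div_le_one hN, tsum_truncAmp_sq]
  have h : ∀ j ∈ Finset.Icc (-(c.R : ℤ)) c.R, truncAmp c j ^ 2 ≤ 1 := fun j hj => by
    rw [truncAmp_sq c (abs_le.2 (Finset.mem_Icc.1 hj)), ← sum_ampl_sq (flagProb c j) c.H]
    exact Finset.single_le_sum (f := fun Y => ampl (flagProb c j) c.H Y ^ 2)
      (fun _ _ => sq_nonneg _) (by simp)
  refine (Finset.sum_le_sum h).trans ?_
  rw [Finset.sum_const, nsmul_eq_mul, mul_one, Int.card_Icc,
    show (c.R : ℤ) + 1 - -c.R = ((2 * c.R + 1 : ℕ) : ℤ) by push_cast; ring, Int.toNat_natCast]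
  push_cast
  rfl

/-- With `G` the total squared Gaussian weight, the numerator is at least `G / 4`, while `2 R + 1 ≤
2 κ r + 1 ≤ 5 κ G` follows from `G ≥ r / 2` and `G ≥ 1`. -/
theorem attProb_ge (hr : 0 < r) (hκ : 16 ≤ κ) (hB : r ≤ 2 ^ (B + 1)) :
    1 / (20 * κ) ≤ attProb (mkPar κ B r ℓ A b) := by
  have h1 := quarter_le_tsum_truncAmp_sq (ℓ := ℓ) (A := A) (b := b) hr hκ hB
  simp only [gaussianWeight_sq] at h1
  have h2 := one_le_tsum_gaussianWeight (show 0 < r / √2 by positivity)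
  have h3 := le_tsum_gaussianWeight (show 0 < r / √2 by positivity)
  have hκ' : (16 : ℝ) ≤ κ := by exact_mod_cast hκ
  set G := ∑' j, gaussianWeight (r / √2) j
  have h4 : r / 2 ≤ r / √2 := by
    have : √2 ≤ 2 := by rw [Real.sqrt_le_left (by norm_num)]; norm_num
    gcongr
  have hR : ((mkPar κ B r ℓ A b).R : ℝ) ≤ κ * r := by
    have h5 : ((mkPar κ B r ℓ A b).R : ℝ) = (truncation κ B m r : ℝ) := by
      exact_mod_cast Int.toNat_of_nonneg (truncation_nonneg (κ := κ) (B := B) (m := m) hr)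
    rw [h5]
    refine truncation_le.trans ?_
    gcongr
    exact_mod_cast Nat.sqrt_le_self κ
  rw [attProb, div_le_div_iff₀ (by positivity) (by positivity)]
  have h6 : r / 2 ≤ G := h4.trans h3
  have h7 : κ * (r / 2) ≤ κ * G := by gcongr
  have h8 : κ * 1 ≤ κ * G := by gcongr
  have h9 : κ * (G / 4) ≤ κ * ∑' j, truncAmp (mkPar κ B r ℓ A b) j ^ 2 := by gcongr
  linarith

/-- The number `T = 80 κ ℓ` is chosen so that the expected number of successes is at least `4 ℓ`,
and `exp (-4 ℓ) ≤ 1 / (4 ℓ)`. -/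
theorem attempts_fail_le (hr : 0 < r) (hκ : 16 ≤ κ) (hℓ : 1 ≤ ℓ) (hB : r ≤ 2 ^ (B + 1)) :
    (1 - attProb (mkPar κ B r ℓ A b)) ^ (mkPar κ B r ℓ A b).T ≤ 1 / (4 * ℓ) := by
  have h1 := attProb_ge (ℓ := ℓ) (A := A) (b := b) hr hκ hB
  have hκ' : (16 : ℝ) ≤ κ := by exact_mod_cast hκ
  have hℓ' : (1 : ℝ) ≤ ℓ := by exact_mod_cast hℓ
  set p := attProb (mkPar κ B r ℓ A b) with hp
  have h2 : 1 - p ≤ Real.exp (-p) := Real.one_sub_le_exp_neg p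
  have h3 : (0 : ℝ) ≤ 1 - p := by linarith [attProb_le_one (c := mkPar κ B r ℓ A b)]
  calc (1 - p) ^ (mkPar κ B r ℓ A b).T ≤ Real.exp (-p) ^ (mkPar κ B r ℓ A b).T := by gcongr
    _ = Real.exp (-(p * (80 * (κ * ℓ)))) := by
      rw [← Real.exp_nat_mul]
      simp only [mkPar]
      push_cast
      congr 1
      ring
    _ ≤ Real.exp (-(4 * ℓ)) := by
      rw [Real.exp_le_exp, neg_le_neg_iff]
      calc (4 * ℓ : ℝ) = 1 / (20 * κ) * (80 * (κ * ℓ)) := by field_simp; norm_num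
        _ ≤ _ := by gcongr
    _ ≤ 1 / (4 * ℓ) := by
      rw [Real.exp_neg, ← one_div]
      refine one_div_le_one_div_of_le (by positivity) ?_
      linarith [Real.add_one_le_exp (4 * ℓ : ℝ)]

end

end QRed



namespace QRed

/-! ## Shifts that keep the interval -/

section

variable {q : ℕ} [NeZero q]

theorem cell_lt (v : ZMod q) : cell v < 8 := by
  have hq : (0 : ℤ) < q := by exact_mod_cast NeZero.pos q
  have h : (v.val : ℤ) < q := by exact_mod_cast ZMod.val_lt v
  rw [cell, Int.ediv_lt_iff_lt_mul hq]
  linarith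

theorem cell_mono {u v : ZMod q} (h : u.val ≤ v.val) : cell u ≤ cell v := by
  have hq : (0 : ℤ) < q := by exact_mod_cast NeZero.pos q
  exact Int.ediv_le_ediv hq (by exact_mod_cast Nat.mul_le_mul_left 8 h)

/-- The residues at which the interval changes. -/
noncomputable def jumps (q : ℕ) [NeZero q] : Finset (ZMod q) :=
  Finset.univ.filter fun u => cell u ≠ cell (u + 1)

theorem val_add_one_cases (u : ZMod q) : (u + 1).val = u.val + 1 ∨ u + 1 = 0 := by
  by_cases h : u.val + 1 < q
  · left
    rw [ZMod.val_add, ZMod.val_one_eq_one_mod, Nat.add_mod_mod, Nat.mod_eq_of_lt h]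
  · right
    have h1 : u.val + 1 = q := by have := ZMod.val_lt u; omega
    have h2 : ((u.val + 1 : ℕ) : ZMod q) = 0 := by rw [h1]; simp
    simpa using h2

/-- Along the representatives `0, …, q - 1` the interval number increases at every jump, so `cell (u
+ 1)` separates the jumps and takes only 8 values; the wrap-around at `q - 1` accounts for the value
0. -/
theorem card_jumps_le : (jumps q).card ≤ 8 := by
  have key : ∀ u ∈ jumps q, ∀ v ∈ jumps q, u.val < v.val → cell (u + 1) ≠ cell (v + 1) := by
    intro u hu v hv huv
    rw [jumps, Finset.mem_filter] at hu hv
    have hu1 : (u + 1).val = u.val + 1 := by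
      rcases val_add_one_cases u with h | h
      · exact h
      · have h1 := congrArg ZMod.val h
        rw [ZMod.val_add, ZMod.val_one_eq_one_mod, Nat.add_mod_mod, ZMod.val_zero,
          Nat.mod_eq_of_lt (by have := ZMod.val_lt v; omega)] at h1
        omega
    have h1 : cell u < cell (u + 1) := lt_of_le_of_ne (cell_mono (by omega)) hu.2
    rcases val_add_one_cases v with h | h
    · have h2 : cell v < cell (v + 1) := lt_of_le_of_ne (cell_mono (by omega)) hv.2
      have h3 : cell (u + 1) ≤ cell v := cell_mono (by omega)
      omega
    · have h4 : cell (v + 1) = 0 := by rw [h]; simp [cell]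
      have h5 := cell_nonneg u
      omega
  have hmaps : ∀ u ∈ jumps q, cell (u + 1) ∈ Finset.Ico (0 : ℤ) 8 := fun u _ =>
    Finset.mem_Ico.2 ⟨cell_nonneg _, cell_lt _⟩
  have := Finset.card_le_card_of_injOn (fun u : ZMod q => cell (u + 1)) hmaps ?_
  · simpa using this
  · intro u hu v hv h
    rcases lt_trichotomy u.val v.val with h1 | h1 | h1
    · exact absurd h (key u hu v hv h1)
    · exact ZMod.val_injective q h1
    · exact absurd h.symm (key v hv u hu h1)

theorem exists_jump {D : ℕ} (v : ZMod q) (h : cell (v + (D : ZMod q)) ≠ cell v) :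
    ∃ d < D, v + (d : ZMod q) ∈ jumps q := by
  induction D with
  | zero => simp at h
  | succ D ih =>
    by_cases h' : cell (v + (D : ZMod q)) = cell v
    · refine ⟨D, by omega, ?_⟩
      rw [jumps, Finset.mem_filter]
      refine ⟨Finset.mem_univ _, fun h2 => h ?_⟩
      rw [← h', h2]
      congr 1
      push_cast
      ring
    · obtain ⟨d, hd, hd'⟩ := ih h'
      exact ⟨d, by omega, hd'⟩

open Classical in
/-- The residues that change the interval under a shift by at most `D`. -/
noncomputable def unstable (q : ℕ) [NeZero q] (D : ℕ) : Finset (ZMod q) :=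
  Finset.univ.filter fun v => ∃ z : ℤ, |z| ≤ D ∧ cell (v - (z : ZMod q)) ≠ cell v

/-- A shift that changes the interval passes a jump. Hence an unstable residue is one of at most 8
jumps displaced by one of `2 D` amounts. -/
theorem card_unstable_le (D : ℕ) : (unstable q D).card ≤ 16 * D := by
  classical
  have hsub : unstable q D ⊆ (Finset.Ico (-(D : ℤ)) D ×ˢ jumps q).image
      fun p => p.2 - (p.1 : ZMod q) := by
    intro v hv
    rw [unstable, Finset.mem_filter] at hv
    obtain ⟨_, z, hz, hne⟩ := hv
    rw [abs_le] at hz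
    rw [Finset.mem_image]
    rcases le_or_gt z 0 with h0 | h0
    · obtain ⟨k, rfl⟩ : ∃ k : ℕ, z = -k := ⟨(-z).toNat, by omega⟩
      obtain ⟨d, hd, hd'⟩ := exists_jump (D := k) v (by
        convert hne using 2
        push_cast
        ring)
      refine ⟨(d, v + d), Finset.mem_product.2 ⟨Finset.mem_Ico.2 (by omega), hd'⟩, ?_⟩
      simp
    · obtain ⟨k, rfl⟩ : ∃ k : ℕ, z = k := ⟨z.toNat, by omega⟩
      obtain ⟨d, hd, hd'⟩ := exists_jump (D := k) (v - (k : ZMod q)) (by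
        rw [sub_add_cancel]
        exact fun h => hne (by simpa using h.symm))
      refine ⟨((d : ℤ) - k, v - k + d), Finset.mem_product.2 ⟨Finset.mem_Ico.2 (by omega), hd'⟩, ?_⟩
      push_cast
      ring
  calc (unstable q D).card ≤ _ := Finset.card_le_card hsub
    _ ≤ (Finset.Ico (-(D : ℤ)) D ×ˢ jumps q).card := Finset.card_image_le
    _ = (D + D) * (jumps q).card := by
      rw [Finset.card_product, Int.card_Ico]
      congr 1
      omega
    _ ≤ (D + D) * 8 := Nat.mul_le_mul_left _ card_jumps_le
    _ = 16 * D := by ring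

theorem card_filter_apply_mem {m : ℕ} (i : Fin m) (s : Finset (ZMod q)) :
    (Finset.univ.filter fun w : Fin m → ZMod q => w i ∈ s).card * q = s.card * q ^ m := by
  classical
  have h1 : (Finset.univ.filter fun w : Fin m → ZMod q => w i ∈ s) =
      Fintype.piFinset (Function.update (fun _ => Finset.univ) i s) := by
    ext w
    rw [Finset.mem_filter, Fintype.mem_piFinset]
    constructor
    · intro h k
      by_cases hk : k = i
      · subst hk; simpa using h.2
      · simp [hk]
    · intro h
      simpa using h i
  rw [h1, Fintype.card_piFinset, ← Finset.mul_prod_erase _ _ (Finset.mem_univ i),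
    Function.update_self, Finset.prod_congr rfl (g := fun _ => q), Finset.prod_const,
    Finset.card_erase_of_mem (Finset.mem_univ i), Finset.card_univ, Fintype.card_fin, mul_assoc,
    ← pow_succ, Nat.sub_add_cancel (by have := i.2; omega)]
  intro k hk
  rw [Function.update_of_ne (Finset.mem_erase.1 hk).1, Finset.card_univ, ZMod.card]

/-- For each `x`, translation by `A x` permutes the masks, so the masked coordinate is uniform
whatever `A` is. -/
theorem card_bad_pairs {m n : ℕ} (A : Matrix (Fin m) (Fin n) (ZMod q)) (i : Fin m) (D : ℕ) :
    (Finset.univ.filter fun p : (Fin n → ZMod q) × (Fin m → ZMod q) =>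
      p.2 i + (A *ᵥ p.1) i ∈ unstable q D).card * q ≤ 16 * D * (q ^ n * q ^ m) := by
  classical
  have h1 : (Finset.univ.filter fun p : (Fin n → ZMod q) × (Fin m → ZMod q) =>
      p.2 i + (A *ᵥ p.1) i ∈ unstable q D).card =
      ((Finset.univ : Finset (Fin n → ZMod q)) ×ˢ
        Finset.univ.filter fun w : Fin m → ZMod q => w i ∈ unstable q D).card := by
    refine Finset.card_bij' (fun p _ => (p.1, p.2 + A *ᵥ p.1)) (fun p _ => (p.1, p.2 - A *ᵥ p.1))
      ?_ ?_ ?_ ?_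
    · intro p hp
      simpa using hp
    · intro p hp
      simpa using hp
    · intro p _
      simp
    · intro p _
      simp
  rw [h1, Finset.card_product, mul_assoc, card_filter_apply_mem, Finset.card_univ, Fintype.card_fun,
    ZMod.card, Fintype.card_fin]
  calc q ^ n * ((unstable q D).card * q ^ m) ≤ q ^ n * (16 * D * q ^ m) := by
        gcongr
        exact card_unstable_le D
    _ = _ := by ring

end

/-- The products `j e_i` are at most `R |e_i|` in absolute value, so coordinate `i` spoils a
fraction of at most `16 R |e_i| / q ≤ 1 / (2 m ℓ)` of the pairs; a union bound over the `m`
coordinates gives `1 / (2 ℓ)`. -/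
theorem card_goodPairs_ge {c : Par} [NeZero c.q] (A : Matrix (Fin c.m) (Fin c.n) (ZMod c.q))
    (e : Fin c.m → ℤ) (he : ∀ i, 32 * c.m * c.ℓ * c.R * (e i).natAbs ≤ c.q) :
    (c.q : ℝ) ^ c.n * (c.q : ℝ) ^ c.m ≤ (goodPairs c A e).card +
      (c.q : ℝ) ^ c.n * (c.q : ℝ) ^ c.m / (2 * c.ℓ) ∨ c.ℓ = 0 := by
  classical
  rcases Nat.eq_zero_or_pos c.ℓ with hℓ | hℓ
  · exact Or.inr hℓ
  left
  have hq : 0 < c.q := NeZero.pos _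
  set bad : Fin c.m → Finset ((Fin c.n → ZMod c.q) × (Fin c.m → ZMod c.q)) := fun i =>
    Finset.univ.filter fun p => p.2 i + (A *ᵥ p.1) i ∈ unstable c.q (c.R * (e i).natAbs) with hbad
  have hcover : (Finset.univ : Finset ((Fin c.n → ZMod c.q) × (Fin c.m → ZMod c.q))) ⊆
      goodPairs c A e ∪ Finset.univ.biUnion bad := by
    intro p _
    rw [Finset.mem_union, or_iff_not_imp_left, mem_goodPairs]
    intro h
    push Not at h
    obtain ⟨i, j, hj, hne⟩ := h
    rw [Finset.mem_biUnion]
    refine ⟨i, Finset.mem_univ _, ?_⟩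
    simp only [hbad, unstable, Finset.mem_filter, Finset.mem_univ, true_and]
    refine ⟨j * e i, ?_, by push_cast; exact hne⟩
    rw [abs_mul]
    push_cast
    gcongr
  have hcard := (Finset.card_le_card hcover).trans (Finset.card_union_le _ _)
  rw [Finset.card_univ, Fintype.card_prod, Fintype.card_fun, Fintype.card_fun, ZMod.card,
    Fintype.card_fin, Fintype.card_fin] at hcard
  have hb : ∀ i, ((bad i).card : ℝ) * (2 * c.ℓ * c.m) ≤ (c.q : ℝ) ^ c.n * (c.q : ℝ) ^ c.m := by
    intro i
    have h1 := card_bad_pairs A i (c.R * (e i).natAbs)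
    have h2 : (bad i).card * (2 * c.ℓ * c.m) * c.q ≤ c.q ^ c.n * c.q ^ c.m * c.q := by
      calc (bad i).card * (2 * c.ℓ * c.m) * c.q = (bad i).card * c.q * (2 * c.ℓ * c.m) := by ring
        _ ≤ 16 * (c.R * (e i).natAbs) * (c.q ^ c.n * c.q ^ c.m) * (2 * c.ℓ * c.m) := by gcongr
        _ = 32 * c.m * c.ℓ * c.R * (e i).natAbs * (c.q ^ c.n * c.q ^ c.m) := by ring
        _ ≤ c.q * (c.q ^ c.n * c.q ^ c.m) := by gcongr; exact he i
        _ = _ := by ring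
    exact_mod_cast Nat.le_of_mul_le_mul_right h2 hq
  have hU : ((Finset.univ.biUnion bad).card : ℝ) ≤ (c.q : ℝ) ^ c.n * (c.q : ℝ) ^ c.m / (2 * c.ℓ) := by
    rw [le_div_iff₀ (by positivity)]
    rcases Nat.eq_zero_or_pos c.m with hm | hm
    · have : IsEmpty (Fin c.m) := by rw [hm]; infer_instance
      simp [Finset.univ_eq_empty]
      positivity
    · have h1 : ((Finset.univ.biUnion bad).card : ℝ) ≤ ∑ i, ((bad i).card : ℝ) := by
        exact_mod_cast Finset.card_biUnion_le
      have h2 : (∑ i, ((bad i).card : ℝ)) * (2 * c.ℓ * c.m) ≤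
          c.m * ((c.q : ℝ) ^ c.n * (c.q : ℝ) ^ c.m) := by
        rw [Finset.sum_mul]
        refine (Finset.sum_le_sum fun i _ => hb i).trans ?_
        simp
      have hm' : (0 : ℝ) < c.m := by exact_mod_cast hm
      have h3 : ((Finset.univ.biUnion bad).card : ℝ) * (2 * c.ℓ) * c.m ≤
          ((c.q : ℝ) ^ c.n * (c.q : ℝ) ^ c.m) * c.m := by
        calc ((Finset.univ.biUnion bad).card : ℝ) * (2 * c.ℓ) * c.m
            ≤ (∑ i, ((bad i).card : ℝ)) * (2 * c.ℓ) * c.m := by gcongr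
          _ = (∑ i, ((bad i).card : ℝ)) * (2 * c.ℓ * c.m) := by ring
          _ ≤ _ := h2
          _ = _ := by ring
      exact le_of_mul_le_mul_right h3 hm'
  have hc : (c.q : ℝ) ^ c.n * (c.q : ℝ) ^ c.m ≤
      (goodPairs c A e).card + (Finset.univ.biUnion bad).card := by exact_mod_cast hcard
  linarith

/-- For good samples the components with coset states carry a constant part of the weight. -/
theorem sum_goodRows_ge {κ B m n q ℓ S : ℕ} [NeZero q] {r : ℝ}
    {A : Matrix (Fin m) (Fin n) (ZMod q)} {b : Fin m → ZMod q} (hr : 0 < r) (hκ : 16 ≤ κ)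
    (hℓ : 1 ≤ ℓ) (hB : r ≤ 2 ^ (B + 1)) (hc : (mkPar κ B r ℓ A b).Ok S) (e : Fin m → ℤ)
    (he : ∀ i, 32 * m * ℓ * (truncation κ B m r).toNat * (e i).natAbs ≤ q) :
    haveI : NeZero (mkPar κ B r ℓ A b).q := ‹NeZero q›
    1 / 4 ≤ (∑ d ∈ goodRows (mkPar κ B r ℓ A b) A e, rowWeight (mkPar κ B r ℓ A b) d ^ 2) ^ ℓ := by
  have inst : NeZero (mkPar κ B r ℓ A b).q := ‹NeZero q›
  have hℓ' : (1 : ℝ) ≤ ℓ := by exact_mod_cast hℓ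
  have hq0 : (0 : ℝ) < q := by exact_mod_cast NeZero.pos q
  have hgood := (card_goodPairs_ge (c := mkPar κ B r ℓ A b) A e he).resolve_right (by
    simp only [mkPar]; omega)
  have hfail := attempts_fail_le (A := A) (b := b) hr hκ hℓ hB
  have hsum := sum_goodRows hc A e
  rw [hsum]
  set g : ℝ := ((goodPairs (mkPar κ B r ℓ A b) A e).card : ℝ)
  set f := (1 - attProb (mkPar κ B r ℓ A b)) ^ (mkPar κ B r ℓ A b).T
  have e1 : (mkPar κ B r ℓ A b).q = q := rfl
  have e2 : (mkPar κ B r ℓ A b).n = n := rfl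
  have e3 : (mkPar κ B r ℓ A b).m = m := rfl
  have e4 : (mkPar κ B r ℓ A b).ℓ = ℓ := rfl
  rw [e1, e2, e3, e4] at hgood
  rw [e1, e2, e3]
  have hQ : (0 : ℝ) < (q : ℝ) ^ m * (q : ℝ) ^ n := by positivity
  have h1 : 1 - 1 / (2 * ℓ : ℝ) ≤ g / ((q : ℝ) ^ m * (q : ℝ) ^ n) := by
    rw [le_div_iff₀ hQ]
    have : (1 - 1 / (2 * ℓ : ℝ)) * ((q : ℝ) ^ m * (q : ℝ) ^ n) =
      (q : ℝ) ^ n * (q : ℝ) ^ m - (q : ℝ) ^ n * (q : ℝ) ^ m / (2 * ℓ) := by ring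
    linarith
  have h2 : 1 - 1 / (4 * ℓ : ℝ) ≤ 1 - f := by linarith
  have h3 : 1 / (2 * ℓ : ℝ) ≤ 1 / 2 := by
    refine one_div_le_one_div_of_le (by norm_num) (by linarith)
  have h4 : 1 / (4 * ℓ : ℝ) ≤ 1 / 4 := by
    refine one_div_le_one_div_of_le (by norm_num) (by linarith)
  -- Failure probabilities `1 / (2 ℓ)` for the pairs and `1 / (4 ℓ)` for the attempts add up to `3 /
  -- (4 ℓ)` per copy, and Bernoulli's inequality leaves 1/4 for all copies together.
  have h5 : 1 - 3 / (4 * ℓ : ℝ) ≤ g / ((q : ℝ) ^ m * (q : ℝ) ^ n) * (1 - f) := by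
    calc 1 - 3 / (4 * ℓ : ℝ) ≤ (1 - 1 / (2 * ℓ : ℝ)) * (1 - 1 / (4 * ℓ : ℝ)) := by
          have : (1 - 1 / (2 * ℓ : ℝ)) * (1 - 1 / (4 * ℓ : ℝ)) =
            1 - 3 / (4 * ℓ) + 1 / (2 * ℓ) * (1 / (4 * ℓ)) := by field_simp; ring
          rw [this]
          have : (0 : ℝ) ≤ 1 / (2 * ℓ) * (1 / (4 * ℓ)) := by positivity
          linarith
      _ ≤ _ := mul_le_mul h1 h2 (by linarith) (le_trans (by linarith) h1)
  have h6 : 3 / (4 * ℓ : ℝ) ≤ 3 / 4 := by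
    rw [div_le_div_iff₀ (by positivity) (by norm_num)]
    linarith
  have h7 := one_add_mul_le_pow (show (-2 : ℝ) ≤ -(3 / (4 * ℓ : ℝ)) by linarith) ℓ
  calc (1 : ℝ) / 4 = 1 + ℓ * -(3 / (4 * ℓ : ℝ)) := by field_simp; ring
    _ ≤ (1 + -(3 / (4 * ℓ : ℝ))) ^ ℓ := h7
    _ ≤ _ := pow_le_pow_left₀ (by linarith) (by linarith) _

end QRed



namespace QRed

/-! ## Random matrices have no short vectors in their images -/

section

variable {q : ℕ} [NeZero q]

-- A residue annihilated by `o` is `q k / o` for an integer `k`, and a short representative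
-- corresponds to `8 |k| < o`.
open Classical in
theorem card_short_image_le {o : ℕ} (ho : 0 < o) (T : Finset (ZMod q))
    (hT : ∀ t ∈ T, Short t ∧ o • t = 0) :
    T.card ≤ ((Finset.Ioo (-(o : ℤ)) (o : ℤ)).filter fun k : ℤ => 8 * |k| < (o : ℤ)).card := by
  have hq : (0 : ℤ) < q := by exact_mod_cast NeZero.pos q
  have ho' : (0 : ℤ) < o := by exact_mod_cast ho
  have hsub : T ⊆ ((Finset.Ioo (-(o : ℤ)) (o : ℤ)).filter fun k : ℤ => 8 * |k| < (o : ℤ)).image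
      fun k => ((q * k / o : ℤ) : ZMod q) := by
    intro t ht
    obtain ⟨⟨z, hz, rfl⟩, h0⟩ := hT t ht
    have h1 : ((o * z : ℤ) : ZMod q) = 0 := by
      rw [nsmul_eq_mul] at h0
      push_cast
      exact h0
    rw [ZMod.intCast_zmod_eq_zero_iff_dvd] at h1
    obtain ⟨k, hk⟩ := h1
    have h2 : 8 * |k| < o := by
      have h3 : (q : ℤ) * |k| = o * |z| := by
        have := congrArg abs hk
        rw [abs_mul, abs_mul, abs_of_pos hq, abs_of_pos ho'] at this
        exact this.symm
      have h4 : (o : ℤ) * (8 * |z|) < o * q := by gcongr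
      have h5 : (q : ℤ) * (8 * |k|) < q * o := by linarith
      exact lt_of_mul_lt_mul_left h5 hq.le
    rw [Finset.mem_image]
    refine ⟨k, ?_, ?_⟩
    · have := abs_nonneg k
      rw [Finset.mem_filter, Finset.mem_Ioo, ← abs_lt]
      exact ⟨by omega, h2⟩
    · rw [← hk, Int.mul_ediv_cancel_left _ ho'.ne']
  exact (Finset.card_le_card hsub).trans Finset.card_image_le

theorem card_short_le_one {o : ℕ} (ho : o ≤ 8) :
    ((Finset.Ioo (-(o : ℤ)) (o : ℤ)).filter fun k : ℤ => 8 * |k| < (o : ℤ)).card ≤ 1 := by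
  rw [Finset.card_le_one]
  have key : ∀ k ∈ (Finset.Ioo (-(o : ℤ)) (o : ℤ)).filter fun k : ℤ => 8 * |k| < (o : ℤ), k = 0 := by
    intro k hk
    have := (Finset.mem_filter.1 hk).2
    have h1 := abs_nonneg k
    rw [← abs_eq_zero]
    omega
  intro a ha b hb
  rw [key a ha, key b hb]

/-- There are at most `2 ⌊(o - 1) / 8⌋ + 1` such integers, and `(o - 1) / 4 + 1 ≤ 3 o / 8` once `o ≥
6`. -/
theorem card_short_mul_le {o : ℕ} (ho : 8 < o) :
    ((Finset.Ioo (-(o : ℤ)) (o : ℤ)).filter fun k : ℤ => 8 * |k| < (o : ℤ)).card * 8 ≤ 3 * o := by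
  have hsub : ((Finset.Ioo (-(o : ℤ)) (o : ℤ)).filter fun k : ℤ => 8 * |k| < (o : ℤ)) ⊆
      Finset.Icc (-(((o - 1) / 8 : ℕ) : ℤ)) (((o - 1) / 8 : ℕ) : ℤ) := by
    intro k hk
    have := (Finset.mem_filter.1 hk).2
    rw [Finset.mem_Icc, ← abs_le]
    omega
  have h := Finset.card_le_card hsub
  rw [Int.card_Icc] at h
  omega

/-- The inner product with `x`. -/
def dotProductAddHom {n : ℕ} (x : Fin n → ZMod q) : (Fin n → ZMod q) →+ ZMod q where
  toFun a := a ⬝ᵥ x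
  map_zero' := zero_dotProduct x
  map_add' a b := add_dotProduct a b x

/-- The order of the group of all inner products with `x`. -/
noncomputable def spanOrder {n : ℕ} (x : Fin n → ZMod q) : ℕ :=
  Nat.card (dotProductAddHom x).range

theorem spanOrder_pos {n : ℕ} (x : Fin n → ZMod q) : 0 < spanOrder x := Nat.card_pos

omit [NeZero q] in
theorem spanOrder_nsmul_dotProduct {n : ℕ} (x a : Fin n → ZMod q) :
    spanOrder x • (a ⬝ᵥ x) = 0 := by
  have h := card_nsmul_eq_zero' (x := (⟨a ⬝ᵥ x, a, rfl⟩ : (dotProductAddHom x).range))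
  exact congrArg Subtype.val h

omit [NeZero q] in
theorem spanOrder_nsmul {n : ℕ} (x : Fin n → ZMod q) (i : Fin n) : spanOrder x • x i = 0 := by
  simpa using spanOrder_nsmul_dotProduct x (Pi.single i 1)

theorem one_lt_spanOrder {n : ℕ} {x : Fin n → ZMod q} (hx : x ≠ 0) : 1 < spanOrder x := by
  rcases (Nat.succ_le_of_lt (spanOrder_pos x)).lt_or_eq with h | h
  · exact h
  · exact absurd (funext fun i => by simpa [← h] using spanOrder_nsmul x i) hx

theorem card_ker_mul_spanOrder {n : ℕ} (x : Fin n → ZMod q) :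
    Nat.card (dotProductAddHom x).ker * spanOrder x = q ^ n := by
  rw [spanOrder, ← AddSubgroup.index_ker, AddSubgroup.card_mul_index]
  simp

-- Every coordinate of `x` is itself an inner product with `x`, hence annihilated by `o`, and a
-- cyclic group has at most `o` such elements.
open Classical in
theorem card_spanOrder_eq_le {n : ℕ} {o : ℕ} (ho : 0 < o) :
    (Finset.univ.filter fun x : Fin n → ZMod q => spanOrder x = o).card ≤ o ^ n := by
  have h : (Finset.univ.filter fun x : Fin n → ZMod q => spanOrder x = o) ⊆
      Fintype.piFinset fun _ : Fin n => Finset.univ.filter fun z : ZMod q => o • z = 0 := by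
    intro x hx
    rw [Fintype.mem_piFinset]
    intro i
    have := spanOrder_nsmul x i
    rw [(Finset.mem_filter.1 hx).2] at this
    simpa using this
  refine (Finset.card_le_card h).trans ?_
  rw [Fintype.card_piFinset_const]
  exact Nat.pow_le_pow_left (IsAddCyclic.card_nsmul_eq_zero_le ho) n

open Classical in
/-- The vectors whose inner product with `x` is short. -/
noncomputable def shortSet {n : ℕ} (x : Fin n → ZMod q) : Finset (Fin n → ZMod q) :=
  Finset.univ.filter fun a => Short (a ⬝ᵥ x)

-- The fibres of the inner product are cosets of its kernel, and its short values are counted by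
-- `card_short_image_le`.
open Classical in
theorem card_shortSet_le {n : ℕ} (x : Fin n → ZMod q) :
    (shortSet x).card ≤ Nat.card (dotProductAddHom x).ker *
      ((Finset.Ioo (-(spanOrder x : ℤ)) (spanOrder x : ℤ)).filter
        fun k : ℤ => 8 * |k| < (spanOrder x : ℤ)).card := by
  refine (Finset.card_le_mul_card_image (f := fun a => a ⬝ᵥ x) (shortSet x)
    (Nat.card (dotProductAddHom x).ker) ?_).trans (Nat.mul_le_mul_left _
      (card_short_image_le (spanOrder_pos x) _ ?_))
  · intro b hb
    obtain ⟨a₀, ha₀, rfl⟩ := Finset.mem_image.1 hb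
    have hker : Nat.card (dotProductAddHom x).ker =
        (Finset.univ.filter fun a : Fin n → ZMod q => a ⬝ᵥ x = 0).card := by
      rw [← Fintype.card_subtype, ← Nat.card_eq_fintype_card]
      rfl
    rw [hker]
    refine Finset.card_le_card_of_injOn (fun a => a - a₀) ?_ (fun a _ b _ h => sub_left_injective h)
    intro a ha
    have := (Finset.mem_filter.1 ha).2
    simp [sub_dotProduct, this]
  · intro t ht
    obtain ⟨a, ha, rfl⟩ := Finset.mem_image.1 ht
    exact ⟨(Finset.mem_filter.1 ha).2, spanOrder_nsmul_dotProduct x a⟩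

theorem card_shortSet_mul_le {n : ℕ} (x : Fin n → ZMod q) (h : spanOrder x ≤ 8) :
    (shortSet x).card * spanOrder x ≤ q ^ n := by
  rw [← card_ker_mul_spanOrder x]
  exact Nat.mul_le_mul_right _ ((card_shortSet_le x).trans
    ((Nat.mul_le_mul_left _ (card_short_le_one h)).trans (mul_one _).le))

theorem card_shortSet_mul_eight_le {n : ℕ} (x : Fin n → ZMod q) (h : 8 < spanOrder x) :
    (shortSet x).card * 8 ≤ 3 * q ^ n := by
  have h1 := Nat.mul_le_mul_right 8 (card_shortSet_le x)
  have h2 := Nat.mul_le_mul_left (Nat.card (dotProductAddHom x).ker) (card_short_mul_le h)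
  have h3 := card_ker_mul_spanOrder x
  rw [← h3]
  calc _ ≤ _ := h1
    _ = _ := mul_assoc _ _ _
    _ ≤ _ := h2
    _ = _ := by ring

open Classical in
theorem card_not_noShort_le {m n : ℕ} :
    (Finset.univ.filter fun A : Fin m → Fin n → ZMod q => ¬NoShort (Matrix.of A)).card ≤
      ∑ x ∈ Finset.univ.filter fun x : Fin n → ZMod q => x ≠ 0, (shortSet x).card ^ m := by
  have h : (Finset.univ.filter fun A : Fin m → Fin n → ZMod q => ¬NoShort (Matrix.of A)) ⊆
      (Finset.univ.filter fun x : Fin n → ZMod q => x ≠ 0).biUnion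
        fun x => Fintype.piFinset fun _ : Fin m => shortSet x := by
    intro A hA
    have := (Finset.mem_filter.1 hA).2
    rw [NoShort] at this
    push Not at this
    obtain ⟨x, hx, hx0⟩ := this
    rw [Finset.mem_biUnion]
    refine ⟨x, by simpa using hx0, ?_⟩
    rw [Fintype.mem_piFinset]
    intro i
    rw [shortSet, Finset.mem_filter]
    exact ⟨Finset.mem_univ _, hx i⟩
  refine (Finset.card_le_card h).trans (Finset.card_biUnion_le.trans ?_)
  simp only [Fintype.card_piFinset_const, le_refl]

open Classical in
theorem shortSet_ratio_pow_le {m n : ℕ} {x : Fin n → ZMod q} (hx : x ≠ 0) :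
    (((shortSet x).card : ℝ) / (q : ℝ) ^ n) ^ m ≤
      (∑ o ∈ Finset.Icc 2 8, if spanOrder x = o then ((1 : ℝ) / o) ^ m else 0) + (3 / 8) ^ m := by
  have hq : (0 : ℝ) < (q : ℝ) ^ n := by
    have : (0 : ℝ) < q := by exact_mod_cast NeZero.pos q
    positivity
  have h2 := one_lt_spanOrder hx
  rcases le_or_gt (spanOrder x) 8 with h | h
  · have h1 : ((shortSet x).card : ℝ) / (q : ℝ) ^ n ≤ 1 / spanOrder x := by
      rw [div_le_div_iff₀ hq (by exact_mod_cast spanOrder_pos x), one_mul]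
      exact_mod_cast card_shortSet_mul_le x h
    rw [Finset.sum_ite_eq, if_pos (Finset.mem_Icc.2 ⟨h2, h⟩)]
    have := pow_le_pow_left₀ (by positivity) h1 m
    have h3 : (0 : ℝ) ≤ (3 / 8) ^ m := by positivity
    linarith
  · have h1 : ((shortSet x).card : ℝ) / (q : ℝ) ^ n ≤ 3 / 8 := by
      rw [div_le_div_iff₀ hq (by norm_num)]
      exact_mod_cast card_shortSet_mul_eight_le x h
    have := pow_le_pow_left₀ (by positivity) h1 m
    have h3 : (0 : ℝ) ≤ ∑ o ∈ Finset.Icc 2 8, if spanOrder x = o then ((1 : ℝ) / o) ^ m else 0 :=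
      Finset.sum_nonneg fun o _ => by split_ifs <;> positivity
    linarith

-- For an order `o ≤ 8` the only short value is 0: there are at most `o ^ n` vectors `x`, each with
-- probability at most `o ^ (-m)`, and `m ≥ n + 5` leaves at most `2⁻⁵` for each of the seven
-- orders. For larger orders the probability `3 / 8` per row beats the crude count `q ^ n`.
open Classical in
theorem sum_shortSet_ratio_le {m n : ℕ} (hnm : n + 5 ≤ m) :
    ∑ x ∈ Finset.univ.filter fun x : Fin n → ZMod q => x ≠ 0,
      (((shortSet x).card : ℝ) / (q : ℝ) ^ n) ^ m ≤ 7 / 32 + (q : ℝ) ^ n * (3 / 8) ^ m := by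
  refine (Finset.sum_le_sum fun x hx =>
    shortSet_ratio_pow_le (Finset.mem_filter.1 hx).2).trans ?_
  refine (Finset.sum_le_sum_of_subset_of_nonneg (Finset.subset_univ _) fun x _ _ =>
    add_nonneg (Finset.sum_nonneg fun o _ => by split_ifs <;> positivity) (by positivity)).trans ?_
  rw [Finset.sum_add_distrib, Finset.sum_comm]
  refine add_le_add ?_ (by simp)
  have h : ∀ o ∈ Finset.Icc 2 8, (∑ x : Fin n → ZMod q,
      if spanOrder x = o then ((1 : ℝ) / o) ^ m else 0) ≤ 1 / 32 := by
    intro o ho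
    have ho2 : 2 ≤ o := (Finset.mem_Icc.1 ho).1
    have ho' : (2 : ℝ) ≤ o := by exact_mod_cast ho2
    rw [← Finset.sum_filter, Finset.sum_const, nsmul_eq_mul]
    have h1 : ((Finset.univ.filter fun x : Fin n → ZMod q => spanOrder x = o).card : ℝ) ≤
        (o : ℝ) ^ n := by exact_mod_cast card_spanOrder_eq_le (by omega)
    obtain ⟨k, rfl⟩ := Nat.exists_eq_add_of_le hnm
    calc _ ≤ (o : ℝ) ^ n * (1 / o) ^ (n + 5 + k) := by gcongr
      _ = (1 / o) ^ (5 + k) := by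
        rw [add_assoc, pow_add, ← mul_assoc, ← mul_pow, mul_one_div_cancel (by positivity),
          one_pow, one_mul]
      _ ≤ (1 / o) ^ 5 := pow_le_pow_of_le_one (by positivity)
          ((div_le_one (by positivity)).2 (by linarith)) (by omega)
      _ ≤ (1 / 2) ^ 5 := by gcongr
      _ = 1 / 32 := by norm_num
  refine (Finset.sum_le_sum h).trans ?_
  norm_num

-- From `3 ^ n ≤ q ^ n ≤ 2 ^ m` one gets `8 ^ n ≤ 9 ^ n ≤ 4 ^ m`, so `3 n ≤ 2 m`, and `m ≥ 15` gives
-- the required gap `m ≥ n + 5`. The failure probability is at most `7 / 32 + (3 / 4) ^ m ≤ 3 / 4`.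
open Classical in
theorem quarter_le_card_noShort {m n : ℕ} (hq : 3 ≤ q) (hm : 15 ≤ m) (h : q ^ n ≤ 2 ^ m) :
    (1 / 4 : ℝ) * Fintype.card (Fin m → Fin n → ZMod q) ≤
      (Finset.univ.filter fun A : Fin m → Fin n → ZMod q => NoShort (Matrix.of A)).card := by
  have h3 : 3 * n ≤ 2 * m := by
    have h1 : 2 ^ (3 * n) ≤ 2 ^ (2 * m) := by
      calc 2 ^ (3 * n) = 8 ^ n := by rw [pow_mul]; norm_num
        _ ≤ 9 ^ n := Nat.pow_le_pow_left (by norm_num) n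
        _ = (3 ^ n) ^ 2 := by rw [← pow_mul, mul_comm, pow_mul]; norm_num
        _ ≤ (2 ^ m) ^ 2 := by
          exact Nat.pow_le_pow_left ((Nat.pow_le_pow_left hq n).trans h) 2
        _ = 2 ^ (2 * m) := by rw [← pow_mul, mul_comm]
    exact (Nat.pow_le_pow_iff_right (by norm_num)).1 h1
  have hN : (0 : ℝ) < (q : ℝ) ^ n := by
    have : (0 : ℝ) < q := by exact_mod_cast NeZero.pos q
    positivity
  have hcard : (Fintype.card (Fin m → Fin n → ZMod q) : ℝ) = ((q : ℝ) ^ n) ^ m := by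
    simp [ZMod.card]
  have hbad : ((Finset.univ.filter fun A : Fin m → Fin n → ZMod q =>
      ¬NoShort (Matrix.of A)).card : ℝ) ≤ 3 / 4 * ((q : ℝ) ^ n) ^ m := by
    have h1 : ((Finset.univ.filter fun A : Fin m → Fin n → ZMod q =>
        ¬NoShort (Matrix.of A)).card : ℝ) ≤
        ∑ x ∈ Finset.univ.filter fun x : Fin n → ZMod q => x ≠ 0, ((shortSet x).card : ℝ) ^ m := by
      exact_mod_cast card_not_noShort_le (q := q) (m := m) (n := n)
    have h2 := sum_shortSet_ratio_le (q := q) (m := m) (n := n) (by omega)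
    simp only [div_pow _ ((q : ℝ) ^ n)] at h2
    rw [← Finset.sum_div, div_le_iff₀ (by positivity)] at h2
    have h4 : (q : ℝ) ^ n * (3 / 8) ^ m ≤ 1 / 2 := by
      calc (q : ℝ) ^ n * (3 / 8) ^ m ≤ 2 ^ m * (3 / 8) ^ m := by
            gcongr
            exact_mod_cast h
        _ = (3 / 4) ^ m := by rw [← mul_pow]; norm_num
        _ ≤ (3 / 4) ^ 15 := pow_le_pow_of_le_one (by norm_num) (by norm_num) hm
        _ ≤ 1 / 2 := by norm_num
    refine h1.trans (h2.trans (mul_le_mul_of_nonneg_right (by linarith) (by positivity)))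
  have hsum := Finset.card_filter_add_card_filter_not (s := Finset.univ)
    fun A : Fin m → Fin n → ZMod q => NoShort (Matrix.of A)
  rw [Finset.card_univ] at hsum
  have hsum' : ((Finset.univ.filter fun A : Fin m → Fin n → ZMod q =>
      NoShort (Matrix.of A)).card : ℝ) + ((Finset.univ.filter fun A : Fin m → Fin n → ZMod q =>
      ¬NoShort (Matrix.of A)).card : ℝ) = Fintype.card (Fin m → Fin n → ZMod q) := by
    exact_mod_cast hsum
  rw [hcard] at hsum' ⊢
  linarith

end

/-- The extra summand makes the induction close: with `y = 2 ^ (-(n + 2))`, the product `(1/4 + y)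
(1 - y)` is at least `1/4 + y / 2` exactly because `y ≤ 1/4`. -/
theorem quarter_le_prod_one_sub (n : ℕ) :
    1 / 4 + (1 / 2 : ℝ) ^ (n + 2) ≤ ∏ j ∈ Finset.range (n + 1), (1 - (1 / 2 : ℝ) ^ (j + 1)) := by
  induction n with
  | zero => norm_num
  | succ n ih =>
    rw [Finset.prod_range_succ]
    set y : ℝ := (1 / 2) ^ (n + 2) with hy
    have h0 : 0 < y := by positivity
    have h1 : y ≤ 1 / 4 := by
      rw [hy, pow_add]
      have : (1 / 2 : ℝ) ^ n ≤ 1 := pow_le_one₀ (by norm_num) (by norm_num)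
      linarith
    have h2 : (1 / 2 : ℝ) ^ (n + 1 + 2) = y / 2 := by rw [hy]; ring
    rw [h2]
    nlinarith [mul_le_mul_of_nonneg_right ih (by linarith : (0 : ℝ) ≤ 1 - y)]

-- For `q = 2` one has `m = n`, and the gap used for larger moduli is missing. But modulo 2 only 0
-- is short, so invertible matrices qualify, and their share is `∏ (1 - 2 ^ (-j))`.
open Classical in
theorem quarter_le_card_noShort_two (n : ℕ) :
    (1 / 4 : ℝ) * Fintype.card (Fin n → Fin n → ZMod 2) ≤
      (Finset.univ.filter fun A : Fin n → Fin n → ZMod 2 => NoShort (Matrix.of A)).card := by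
  have h1 : (Nat.card (GL (Fin n) (ZMod 2)) : ℝ) ≤
      (Finset.univ.filter fun A : Fin n → Fin n → ZMod 2 => NoShort (Matrix.of A)).card := by
    rw [Nat.card_eq_fintype_card, ← Finset.card_univ]
    refine Nat.cast_le.2 (Finset.card_le_card_of_injOn
      (fun A : GL (Fin n) (ZMod 2) => Matrix.of.symm A.val) ?_ ?_)
    · intro A _
      simp only [Finset.coe_filter, Finset.mem_univ, true_and, Set.mem_ofPred_eq]
      intro x hx
      have h0 : (A.val) *ᵥ x = 0 := by
        funext i
        obtain ⟨t, ht, h⟩ := hx i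
        have : t = 0 := by
          rw [← abs_eq_zero]
          have := abs_nonneg t
          push_cast at ht
          omega
        rw [this] at h
        simpa using h.symm
      have := congrArg (fun v => (A⁻¹).val *ᵥ v) h0
      simpa [Matrix.mulVec_mulVec, ← Units.val_mul] using this
    · intro A _ B _ h
      exact Units.ext h
  refine le_trans ?_ h1
  have : Fact (Nat.Prime 2) := ⟨Nat.prime_two⟩
  rw [Matrix.card_GL_field]
  rcases n with _ | n
  · norm_num
  have h2 : ((∏ i : Fin (n + 1), (Fintype.card (ZMod 2) ^ (n + 1) -
      Fintype.card (ZMod 2) ^ (i : ℕ)) : ℕ) : ℝ) =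
      (2 : ℝ) ^ ((n + 1) * (n + 1)) * ∏ j ∈ Finset.range (n + 1), (1 - (1 / 2 : ℝ) ^ (j + 1)) := by
    rw [ZMod.card, Fin.prod_univ_eq_prod_range fun i => 2 ^ (n + 1) - 2 ^ i,
      ← Finset.prod_range_reflect, Nat.cast_prod, pow_mul]
    conv_rhs => rw [← Finset.card_range (n + 1), ← Finset.prod_const, Finset.card_range,
      ← Finset.prod_mul_distrib]
    refine Finset.prod_congr rfl fun j hj => ?_
    obtain ⟨k, rfl⟩ := Nat.exists_eq_add_of_le (Nat.le_of_lt_succ (Finset.mem_range.1 hj))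
    rw [show j + k + 1 - 1 - j = k by omega,
      Nat.cast_sub (Nat.pow_le_pow_right (by norm_num) (by omega))]
    push_cast
    rw [mul_sub, mul_one, show j + k + 1 = k + (j + 1) by omega, pow_add _ k, mul_assoc, ← mul_pow]
    norm_num
  rw [h2]
  have h3 := quarter_le_prod_one_sub n
  have h4 : (0 : ℝ) < (1 / 2) ^ (n + 2) := by positivity
  have h5 : (Fintype.card (Fin (n + 1) → Fin (n + 1) → ZMod 2) : ℝ) =
      2 ^ ((n + 1) * (n + 1)) := by
    simp [ZMod.card, ← pow_mul]
  rw [h5, mul_comm]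
  gcongr
  linarith

end QRed



namespace QRed

/-! ## The success probability on LWE samples -/

theorem pow_le_two_pow_of_eq_ceil {m n q : ℕ} (hq : 2 ≤ q)
    (hm : m = ⌈(n : ℝ) * Real.logb 2 q⌉₊) : q ^ n ≤ 2 ^ m := by
  have h : (n : ℝ) * Real.logb 2 q ≤ m := hm ▸ Nat.le_ceil _
  have hq' : (0 : ℝ) < q := by exact_mod_cast (by omega : 0 < q)
  have h1 : (q : ℝ) ^ n ≤ 2 ^ m := by
    rw [← Real.rpow_natCast 2 m, ← Real.logb_le_iff_le_rpow (by norm_num) (by positivity),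
      Real.logb_pow]
    exact h
  exact_mod_cast h1

theorem one_le_logb_two {q : ℕ} (hq : 2 ≤ q) : 1 ≤ Real.logb 2 q := by
  rw [Real.le_logb_iff_rpow_le (by norm_num) (by exact_mod_cast (by omega : 0 < q))]
  simpa using hq

theorem le_of_eq_ceil {m n q : ℕ} (hq : 2 ≤ q) (hm : m = ⌈(n : ℝ) * Real.logb 2 q⌉₊) : n ≤ m := by
  have h : (n : ℝ) * Real.logb 2 q ≤ m := hm ▸ Nat.le_ceil _
  have h1 := mul_le_mul_of_nonneg_left (one_le_logb_two hq) (Nat.cast_nonneg (α := ℝ) n)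
  exact_mod_cast (show (n : ℝ) ≤ m by linarith)

open Classical in
theorem quarter_le_card_noShort_of_eq_ceil {m n q : ℕ} [NeZero q] (hq : 2 ≤ q)
    (hm : m = ⌈(n : ℝ) * Real.logb 2 q⌉₊) (h15 : 15 ≤ m) :
    (1 / 4 : ℝ) * Fintype.card (Fin m → Fin n → ZMod q) ≤
      (Finset.univ.filter fun A : Fin m → Fin n → ZMod q => NoShort (Matrix.of A)).card := by
  rcases hq.lt_or_eq with h | h
  · exact quarter_le_card_noShort h h15 (pow_le_two_pow_of_eq_ceil hq hm)
  · subst h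
    have : m = n := by
      rw [hm]
      simp
    subst this
    exact quarter_le_card_noShort_two m

theorem discreteGaussian_nonneg (s : ℝ) (j : ℤ) : 0 ≤ discreteGaussian s j :=
  div_nonneg (gaussianWeight_pos s j).le (tsum_nonneg fun i => (gaussianWeight_pos s i).le)

theorem hasSum_discreteGaussian {s : ℝ} (hs : 0 < s) : HasSum (discreteGaussian s) 1 := by
  have h := (summable_gaussianWeight hs).hasSum.div_const (∑' i, gaussianWeight s i)
  rwa [div_self (zero_lt_one.trans_le (one_le_tsum_gaussianWeight hs)).ne'] at h

theorem sum_discreteGaussian_ge {s K : ℝ} (hs : 0 < s) (F : Finset ℤ)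
    (hF : ∀ j ∉ F, K * s ^ 2 ≤ (j : ℝ) ^ 2) :
    1 - √2 * Real.exp (-(Real.pi * K / 2)) ≤ ∑ j ∈ F, discreteGaussian s j := by
  have h1 := one_le_tsum_gaussianWeight hs
  have h := gaussian_tail hs (P := (F : Set ℤ)ᶜ) fun j hj => hF j (by simpa using hj)
  rw [← tsum_subtype] at h
  have h2 := (summable_gaussianWeight hs).sum_add_tsum_compl (s := F)
  have h3 : ∑ j ∈ F, discreteGaussian s j =
      (∑ j ∈ F, gaussianWeight s j) / ∑' j, gaussianWeight s j := by
    rw [Finset.sum_div]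
    rfl
  rw [h3, le_div_iff₀ (by linarith)]
  linarith

theorem half_le_pow_of_mul_le {m : ℕ} {t x : ℝ} (ht1 : t ≤ 1) (hx : 1 - t ≤ x)
    (h : m * t ≤ 1 / 2) : 1 / 2 ≤ x ^ m := by
  have h1 := one_add_mul_le_pow (show -2 ≤ -t by linarith) m
  have h2 : (1 + -t) ^ m ≤ x ^ m := pow_le_pow_left₀ (by linarith) (by linarith) m
  linarith

theorem summable_prod_mul_of_bounded {m : ℕ} {D : ℤ → ℝ} (h0 : ∀ j, 0 ≤ D j) (hD : Summable D)
    {f : (Fin m → ℤ) → ℝ} {C : ℝ} (hf0 : ∀ e, 0 ≤ f e) (hf : ∀ e, f e ≤ C) :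
    Summable fun e : Fin m → ℤ => (∏ k, D (e k)) * f e := by
  have hprod : Summable fun e : Fin m → ℤ => ∏ k, D (e k) := by
    refine summable_of_sum_le (c := (∑' j, D j) ^ m)
      (fun e => Finset.prod_nonneg fun k _ => h0 _) fun u => ?_
    classical
    have hsub : u ⊆ Fintype.piFinset fun k => u.image fun e => e k := fun e he =>
      Fintype.mem_piFinset.2 fun k => Finset.mem_image_of_mem _ he
    refine (Finset.sum_le_sum_of_subset_of_nonneg hsub fun e _ _ =>
      Finset.prod_nonneg fun k _ => h0 _).trans ?_
    rw [← Finset.prod_univ_sum (fun k => u.image fun e => e k) fun _ j => D j]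
    refine (Finset.prod_le_prod (fun k _ => Finset.sum_nonneg fun j _ => h0 j)
      fun k _ => hD.sum_le_tsum _ fun j _ => h0 j).trans ?_
    simp
  refine Summable.of_nonneg_of_le
    (fun e => mul_nonneg (Finset.prod_nonneg fun k _ => h0 _) (hf0 e)) (fun e => ?_)
    (hprod.mul_right C)
  exact mul_le_mul_of_nonneg_left (hf e) (Finset.prod_nonneg fun k _ => h0 _)

theorem pow_mul_le_tsum_prod_mul {m : ℕ} {D : ℤ → ℝ} (h0 : ∀ j, 0 ≤ D j) (hD : Summable D)
    {f : (Fin m → ℤ) → ℝ} {C w : ℝ} (hf0 : ∀ e, 0 ≤ f e) (hf : ∀ e, f e ≤ C) (F : Finset ℤ)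
    (hw : ∀ e : Fin m → ℤ, (∀ i, e i ∈ F) → w ≤ f e) :
    (∑ j ∈ F, D j) ^ m * w ≤ ∑' e : Fin m → ℤ, (∏ k, D (e k)) * f e := by
  have h := (summable_prod_mul_of_bounded h0 hD hf0 hf).sum_le_tsum
    (Fintype.piFinset fun _ => F) fun e _ =>
      mul_nonneg (Finset.prod_nonneg fun k _ => h0 _) (hf0 e)
  refine le_trans ?_ h
  have h1 := Finset.prod_univ_sum (fun _ : Fin m => F) fun _ j => D j
  rw [Finset.prod_const, Finset.card_univ, Fintype.card_fin] at h1
  rw [h1, Finset.sum_mul]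
  exact Finset.sum_le_sum fun e he => mul_le_mul_of_nonneg_left
    (hw e (Fintype.mem_piFinset.1 he)) (Finset.prod_nonneg fun k _ => h0 _)

-- All terms are nonnegative, so the average may be restricted to matrices without short vectors in
-- the image (at least a quarter) and to error vectors with entries in `F` (probability at least
-- `p`).
open Classical in
theorem lweSuccess_ge {m n q : ℕ} [NeZero q] {α w p : ℝ} (hα : 0 < α)
    {succ : Matrix (Fin m) (Fin n) (ZMod q) → (Fin m → ZMod q) → (Fin n → ZMod q) → ℝ}
    (h0 : ∀ A b s, 0 ≤ succ A b s) (hw0 : 0 ≤ w) (hp0 : 0 ≤ p) (F : Finset ℤ)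
    (hp : p ≤ (∑ j ∈ F, discreteGaussian (α * q) j) ^ m)
    (hA : (1 / 4 : ℝ) * Fintype.card (Fin m → Fin n → ZMod q) ≤
      (Finset.univ.filter fun A : Fin m → Fin n → ZMod q => NoShort (Matrix.of A)).card)
    (hw : ∀ (A : Matrix (Fin m) (Fin n) (ZMod q)) (s : Fin n → ZMod q) (e : Fin m → ℤ),
      NoShort A → (∀ i, e i ∈ F) → w ≤ succ A (lweVector A s e) s) :
    1 / 4 * (p * w) ≤ lweSuccess m n q α succ := by
  have hs : 0 < α * q := mul_pos hα (by exact_mod_cast NeZero.pos q)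
  have hN : (0 : ℝ) < Fintype.card (Fin n → ZMod q) := by exact_mod_cast Fintype.card_pos
  have hM : (0 : ℝ) < Fintype.card (Fin m → Fin n → ZMod q) := by exact_mod_cast Fintype.card_pos
  have hterm : ∀ (A : Fin m → Fin n → ZMod q) (s : Fin n → ZMod q),
      0 ≤ ∑' e : Fin m → ℤ, (∏ k, discreteGaussian (α * q) (e k)) *
        succ (Matrix.of A) (lweVector (Matrix.of A) s e) s := fun A s => tsum_nonneg fun e =>
    mul_nonneg (Finset.prod_nonneg fun k _ => discreteGaussian_nonneg _ _) (h0 _ _ _)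
  have hgood : ∀ (A : Fin m → Fin n → ZMod q) (s : Fin n → ZMod q), NoShort (Matrix.of A) →
      p * w ≤ ∑' e : Fin m → ℤ, (∏ k, discreteGaussian (α * q) (e k)) *
        succ (Matrix.of A) (lweVector (Matrix.of A) s e) s := fun A s h => by
    refine (mul_le_mul_of_nonneg_right hp hw0).trans
      (pow_mul_le_tsum_prod_mul (discreteGaussian_nonneg _) (hasSum_discreteGaussian hs).summable
        (C := ∑ b, succ (Matrix.of A) b s) (fun e => h0 _ _ _) (fun e => ?_) F
        fun e he => hw _ s e h he)
    -- `b` ranges over a finite set, so the sum over all `b` is a bound uniform in `e`, as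
    -- summability of the infinite sum requires.
    exact Finset.single_le_sum (f := fun b => succ (Matrix.of A) b s) (fun b _ => h0 _ _ _)
      (Finset.mem_univ _)
  rw [lweSuccess, le_div_iff₀ (by positivity)]
  have hsum : ∑ A ∈ Finset.univ.filter fun A : Fin m → Fin n → ZMod q => NoShort (Matrix.of A),
      ∑ _s : Fin n → ZMod q, p * w ≤ ∑ A : Fin m → Fin n → ZMod q, ∑ s : Fin n → ZMod q,
        ∑' e : Fin m → ℤ, (∏ k, discreteGaussian (α * q) (e k)) *
          succ (Matrix.of A) (lweVector (Matrix.of A) s e) s :=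
    (Finset.sum_le_sum fun A hA => Finset.sum_le_sum fun s _ =>
      hgood A s (Finset.mem_filter.1 hA).2).trans
    (Finset.sum_le_sum_of_subset_of_nonneg (Finset.subset_univ _) fun A _ _ =>
      Finset.sum_nonneg fun s _ => hterm A s)
  refine le_trans ?_ hsum
  rw [Finset.sum_const, Finset.sum_const, nsmul_eq_mul, nsmul_eq_mul, Finset.card_univ]
  calc _ = 1 / 4 * (Fintype.card (Fin m → Fin n → ZMod q) : ℝ) *
        (Fintype.card (Fin n → ZMod q) * (p * w)) := by ring
    _ ≤ _ := mul_le_mul_of_nonneg_right hA (by positivity)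

/-- `R |j| ≤ (√κ r) (α q √κ) = κ r α q`: the factor `κ` in the bound on `r` consists of a `√κ` for
the truncation and a `√κ` for the size of the errors. The factor `q ^ (n / m) ≥ 1` is not needed. -/
theorem error_box_le {κ B m n q ℓ : ℕ} [NeZero q] {α r : ℝ} (hα : 0 < α) (hr : 0 < r)
    (hκ : 1 ≤ κ) (hm : 1 ≤ m) (hℓ : 1 ≤ ℓ)
    (hbound : r < 1 / (32 * m * κ * α * ℓ * (q : ℝ) ^ ((n : ℝ) / m))) {j : ℤ}
    (hj : |(j : ℝ)| ≤ α * q * √κ) :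
    32 * m * ℓ * (truncation κ B m r).toNat * j.natAbs ≤ q := by
  have hq : (1 : ℝ) ≤ q := by exact_mod_cast NeZero.pos q
  have hκ' : (1 : ℝ) ≤ κ := by exact_mod_cast hκ
  have hm' : (1 : ℝ) ≤ m := by exact_mod_cast hm
  have hℓ' : (1 : ℝ) ≤ ℓ := by exact_mod_cast hℓ
  have hpow : 1 ≤ (q : ℝ) ^ ((n : ℝ) / m) := Real.one_le_rpow hq (by positivity)
  have hr1 : r * (32 * m * κ * α * ℓ) ≤ 1 := by
    rw [lt_div_iff₀ (by positivity)] at hbound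
    refine le_trans ?_ hbound.le
    exact mul_le_mul_of_nonneg_left (le_mul_of_one_le_right (by positivity) hpow) hr.le
  have hR : (((truncation κ B m r).toNat : ℕ) : ℝ) ≤ √κ * r := by
    have h1 : (((truncation κ B m r).toNat : ℕ) : ℝ) = (truncation κ B m r : ℝ) := by
      exact_mod_cast congrArg (Int.cast (R := ℝ)) (Int.toNat_of_nonneg (truncation_nonneg hr))
    rw [h1]
    refine truncation_le.trans ?_
    gcongr
    exact Real.nat_sqrt_le_real_sqrt
  have hj' : ((j.natAbs : ℕ) : ℝ) ≤ α * q * √κ := by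
    rwa [Nat.cast_natAbs, Int.cast_abs]
  have h : (32 * m * ℓ * ((truncation κ B m r).toNat : ℕ) * (j.natAbs : ℕ) : ℝ) ≤ q := by
    calc (32 * m * ℓ * ((truncation κ B m r).toNat : ℕ) * (j.natAbs : ℕ) : ℝ)
        ≤ 32 * m * ℓ * (√κ * r) * (α * q * √κ) := by gcongr
      _ = r * (32 * m * (√κ * √κ) * α * ℓ) * q := by ring
      _ = r * (32 * m * κ * α * ℓ) * q := by rw [Real.mul_self_sqrt (by positivity)]
      _ ≤ 1 * q := by gcongr
      _ = q := one_mul _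
  exact_mod_cast h

theorem outcomeProb_nonneg {n N ℓ : ℕ} [NeZero N] (M : Povm n N ℓ) (t : Fin n → ZMod N)
    (ket : Mem →₀ ℂ) : 0 ≤ outcomeProb M t ket :=
  Finset.sum_nonneg fun _ _ => M.weight_nonneg t _

theorem reductionProb_nonneg (P : Prog) (κ : ℕ) (r : ℝ) {m n q ℓ : ℕ} [NeZero q]
    (M : Povm n q ℓ) (A : Matrix (Fin m) (Fin n) (ZMod q)) (b : Fin m → ZMod q)
    (t : Fin n → ZMod q) : 0 ≤ reductionProb P κ r M A b t := by
  refine Multiset.sum_nonneg fun x hx => ?_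
  obtain ⟨c, _, rfl⟩ := Multiset.mem_map.1 hx
  exact outcomeProb_nonneg M t _

/-- The good components carry at least 1/4 of the weight, and on each of them the measurement
answers `s` with probability at least `w`. The smallness of the errors is assumed for every `B`,
since `B` becomes known only through the run. -/
theorem reductionProb_ge {κ E m n q ℓ : ℕ} [NeZero q] {r ε w : ℝ} (hr : 0 < r) (hE : r ≤ 2 ^ E)
    (hEκ : E ≤ 2 ^ κ) (hq : q ≤ 2 ^ m) (hκ : 16 ≤ κ) (hℓ : 1 ≤ ℓ) {M : Povm n q ℓ}
    (hM : ∀ s x, ε ≤ M.weight s (gEdcpState hr s x)) (hw0 : 0 ≤ w)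
    (hw : w ≤ ε / 2 - 6 * ℓ * Real.exp (-(κ / 8 : ℝ)))
    {A : Matrix (Fin m) (Fin n) (ZMod q)} (hA : NoShort A) (s : Fin n → ZMod q) {e : Fin m → ℤ}
    (he : ∀ B i, 32 * m * ℓ * (truncation κ B m r).toNat * (e i).natAbs ≤ q) :
    1 / 4 * w ≤ reductionProb reduction κ r M A (lweVector A s e) s := by
  obtain ⟨B, c, hB, hok, hrun, -, hket⟩ :=
    run_reduction (ℓ := ℓ) hr hE hEκ hq A (lweVector A s e)
  rw [reductionProb, hrun, Multiset.map_singleton, Multiset.sum_singleton]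
  have inst : NeZero (mkPar κ B r ℓ A (lweVector A s e)).q := ‹NeZero q›
  have h := sum_goodRows_le_outcomeProb (c := mkPar κ B r ℓ A (lweVector A s e)) (s := s) (e := e)
    hok hA ⟨fun i j => inputMem_matrix (κ := κ) (ℓ := ℓ) A _ i j, fun i => inputMem_vector (κ := κ) (ℓ := ℓ) A _ i⟩
    (tsum_truncAmp_sq_pos hr hκ hB) hket M (w := w) fun x => by
      have h1 := weight_truncState_ge (A := A) (b := lweVector A s e) hr hκ hB M s s x
      have h2 := hM s x
      exact (by linarith : w ≤ _).trans h1
  refine le_trans ?_ h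
  exact mul_le_mul_of_nonneg_right (sum_goodRows_ge hr hκ hℓ hB hok e (he B)) hw0

end QRed



/-! ### Asymptotic estimates and the assembly of the theorem -/

namespace QRed

open Filter

theorem eventually_pow_mul_exp_le (C : ℝ) (a : ℕ) :
    ∀ᶠ κ : ℕ in atTop, C * ((κ : ℝ) ^ a * Real.exp (-(κ / 8 : ℝ))) ≤ 1 / 4 := by
  have h1 : Tendsto (fun κ : ℕ => (κ : ℝ) / 8) atTop atTop :=
    tendsto_natCast_atTop_atTop.atTop_div_const (by norm_num)
  have h2 := ((Real.tendsto_pow_mul_exp_neg_atTop_nhds_zero a).comp h1).const_mul (C * 8 ^ a)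
  rw [mul_zero] at h2
  filter_upwards [h2.eventually_le_const (show (0 : ℝ) < 1 / 4 by norm_num)] with κ hκ
  refine le_trans (le_of_eq ?_) hκ
  simp only [Function.comp_apply]
  rw [div_pow]
  field_simp

theorem half_le_box_pow {κ m a : ℕ} {s : ℝ} (hs : 0 < s) (hm : m ≤ κ ^ a) (hm1 : 1 ≤ m)
    (h : 2 * ((κ : ℝ) ^ a * Real.exp (-(κ / 8 : ℝ))) ≤ 1 / 4) :
    1 / 2 ≤ (∑ j ∈ Finset.Icc (-⌊s * √κ⌋) ⌊s * √κ⌋, discreteGaussian s j) ^ m := by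
  have h1 := sum_discreteGaussian_ge (K := κ) hs (Finset.Icc (-⌊s * √κ⌋) ⌊s * √κ⌋) fun j hj => by
    rw [Finset.mem_Icc, ← abs_le, not_le, Int.floor_lt, Int.cast_abs] at hj
    rw [← sq_abs (j : ℝ)]
    calc (κ : ℝ) * s ^ 2 = (s * √κ) ^ 2 := by rw [mul_pow, Real.sq_sqrt (by positivity), mul_comm]
      _ ≤ |(j : ℝ)| ^ 2 := pow_le_pow_left₀ (by positivity) hj.le 2
  have hE : √2 * Real.exp (-(Real.pi * κ / 2)) ≤ 2 * Real.exp (-(κ / 8 : ℝ)) := by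
    have h2 : √2 ≤ 2 := Real.sqrt_le_iff.2 ⟨by norm_num, by norm_num⟩
    have h3 : (κ : ℝ) / 8 ≤ Real.pi * κ / 2 := by
      have := Real.pi_gt_three
      nlinarith [Nat.cast_nonneg (α := ℝ) κ]
    gcongr
  have hm' : (m : ℝ) ≤ (κ : ℝ) ^ a := by exact_mod_cast hm
  have hm1' : (1 : ℝ) ≤ m := by exact_mod_cast hm1
  have ht : m * (√2 * Real.exp (-(Real.pi * κ / 2))) ≤ 1 / 2 := by
    calc _ ≤ (κ : ℝ) ^ a * (2 * Real.exp (-(κ / 8 : ℝ))) := by gcongr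
      _ ≤ 1 / 2 := by linarith
  refine half_le_pow_of_mul_le ?_ h1 ht
  have h0 : 0 ≤ √2 * Real.exp (-(Real.pi * κ / 2)) := by positivity
  nlinarith

end QRed

theorem mainTheorem3 :
    ∃ P : QRed.Prog, ∀ (n q m ℓ : ℕ → ℕ) [∀ κ, NeZero (q κ)] (α r : ℕ → ℝ)
      (_hn : ∀ κ, 1 ≤ n κ) (_hq : ∀ κ, 2 ≤ q κ) (_hℓ : ∀ κ, 1 ≤ ℓ κ)
      (_hα : ∀ κ, 0 < α κ) (hr : ∀ κ, 0 < r κ)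
      (_hm : ∀ κ, m κ = ⌈(n κ : ℝ) * Real.logb 2 (q κ)⌉₊)
      (_hΩ : (fun κ : ℕ => (κ : ℝ)) =O[Filter.atTop] fun κ => (m κ : ℝ))
      (_hpoly : ∃ a : ℕ, ∀ᶠ κ : ℕ in Filter.atTop,
        m κ ≤ κ ^ a ∧ ℓ κ ≤ κ ^ a ∧ r κ ≤ 2 ^ (κ ^ a))
      (_hbound : ∀ᶠ κ : ℕ in Filter.atTop,
        r κ < 1 / (32 * m κ * κ * α κ * ℓ κ * (q κ : ℝ) ^ ((n κ : ℝ) / m κ))),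
      (∃ d : ℕ, ∀ᶠ κ : ℕ in Filter.atTop,
        ∀ (A : Matrix (Fin (m κ)) (Fin (n κ)) (ZMod (q κ))) (b : Fin (m κ) → ZMod (q κ)),
          ∀ c ∈ QRed.run (r κ) P (QRed.initial κ (ℓ κ) A b), c.time ≤ κ ^ d) ∧
      ∀ M : ∀ κ, QRed.Povm (n κ) (q κ) (ℓ κ),
        QRed.SolvesGEdcp n q ℓ hr M →
          QRed.SolvesLwe m n q α fun κ => QRed.reductionProb P κ (r κ) (M κ) := by
  refine ⟨QRed.reduction, ?_⟩
  intro n q m ℓ _ α r hn hq hℓ hα hr hm hΩ ⟨a, hpoly⟩ hbound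
  have hqm : ∀ κ, q κ ≤ 2 ^ m κ := fun κ =>
    (Nat.le_self_pow (Nat.one_le_iff_ne_zero.1 (hn κ)) _).trans
      (QRed.pow_le_two_pow_of_eq_ceil (hq κ) (hm κ))
  -- The reduction loses a constant factor 128; one more power of the secret size absorbs it.
  refine ⟨?_, fun M ⟨c, hM⟩ => ⟨c + 1, ?_⟩⟩
  · obtain ⟨d, hd⟩ := QRed.exists_time_bound n m ℓ
      (fun κ => QRed.le_of_eq_ceil (hq κ) (hm κ)) (hpoly.mono fun κ h => ⟨h.1, h.2.1⟩)
    refine ⟨d, ?_⟩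
    filter_upwards [hd, hpoly, QRed.eventually_pow_le_two_pow a] with κ h1 h2 h3 A b c hc
    obtain ⟨B, c', -, -, hrun, htime, -⟩ :=
      QRed.run_reduction (ℓ := ℓ κ) (hr κ) h2.2.2 h3 (hqm κ) A b
    rw [hrun, Multiset.mem_singleton] at hc
    exact hc ▸ htime.trans h1
  · obtain ⟨C, hC⟩ := hΩ.bound
    -- `m = Ω(κ)` serves only to make `m` large: `m = ⌈S⌉ ≥ 129` forces `S ≥ 128`, and it includes
    -- the bound 15 needed for random matrices.
    have hlarge : ∀ᶠ κ : ℕ in Filter.atTop, 129 ≤ m κ := by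
      filter_upwards [hC, Filter.eventually_ge_atTop (⌈|C| * 129⌉₊ + 1)] with κ h1 h2
      rw [Real.norm_natCast, Real.norm_natCast] at h1
      by_contra hlt
      have h3 : (m κ : ℝ) ≤ 129 := by exact_mod_cast (by omega : m κ ≤ 129)
      have h4 : (κ : ℝ) ≤ |C| * 129 := h1.trans (by
        gcongr
        exact le_abs_self C)
      have h5 : (κ : ℝ) ≤ ⌈|C| * 129⌉₊ := h4.trans (Nat.le_ceil _)
      have h6 : κ ≤ ⌈|C| * 129⌉₊ := by exact_mod_cast h5
      omega
    filter_upwards [hM, hlarge, hpoly, hbound, QRed.eventually_pow_le_two_pow a,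
      Filter.eventually_ge_atTop 16, QRed.eventually_pow_mul_exp_le 2 a,
      QRed.eventually_pow_mul_exp_le 6 (a + a * c)] with κ hM hlarge hpoly hbound h2 hκ hbox hexp
    set S := QRed.secretSize (n κ) (q κ) with hS
    have hS' : S = (n κ : ℝ) * Real.logb 2 (q κ) := rfl
    have hS128 : 128 ≤ S := by
      by_contra h
      have := Nat.ceil_le.2 (show (n κ : ℝ) * Real.logb 2 (q κ) ≤ (128 : ℕ) by
        rw [← hS']; push_cast; linarith)
      have := hm κ
      omega
    have hSm : S ≤ (κ : ℝ) ^ a := by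
      have h1 : S ≤ m κ := by
        rw [hm κ]
        exact Nat.le_ceil _
      have h3 : (m κ : ℝ) ≤ (κ : ℝ) ^ a := by exact_mod_cast hpoly.1
      linarith
    have hSc : 0 < S ^ c := by positivity
    have hℓκ : (ℓ κ : ℝ) ≤ (κ : ℝ) ^ a := by exact_mod_cast hpoly.2.1
    -- `S` and `ℓ` are at most `κ ^ a`, so the exponentially small approximation error is at most
    -- half of the remaining advantage `1 / (2 S ^ c)`.
    have hw : 1 / S ^ c / 4 ≤ 1 / S ^ c / 2 - 6 * ℓ κ * Real.exp (-(κ / 8 : ℝ)) := by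
      have h1 : 6 * ℓ κ * Real.exp (-(κ / 8 : ℝ)) * S ^ c ≤ 1 / 4 := by
        calc _ ≤ 6 * (κ : ℝ) ^ a * Real.exp (-(κ / 8 : ℝ)) * ((κ : ℝ) ^ a) ^ c := by gcongr
          _ = 6 * ((κ : ℝ) ^ (a + a * c) * Real.exp (-(κ / 8 : ℝ))) := by
            rw [pow_add, pow_mul]; ring
          _ ≤ 1 / 4 := hexp
      have h3 : 6 * ℓ κ * Real.exp (-(κ / 8 : ℝ)) ≤ 1 / 4 / S ^ c := by rwa [le_div_iff₀ hSc]
      have h4 : (1 : ℝ) / 4 / S ^ c = 1 / S ^ c / 4 := by ring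
      linarith
    have hs : 0 < α κ * q κ := mul_pos (hα κ) (by exact_mod_cast NeZero.pos (q κ))
    have h := QRed.lweSuccess_ge (hα κ) (p := 1 / 2) (w := 1 / 4 * (1 / S ^ c / 4))
      (succ := QRed.reductionProb QRed.reduction κ (r κ) (M κ))
      (fun A b s => QRed.reductionProb_nonneg _ _ _ _ _ _ _) (by positivity) (by norm_num)
      (Finset.Icc (-⌊α κ * q κ * √κ⌋) ⌊α κ * q κ * √κ⌋)
      (QRed.half_le_box_pow hs hpoly.1 (by omega) hbox)
      (QRed.quarter_le_card_noShort_of_eq_ceil (hq κ) (hm κ) (by omega))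
      (fun A s e hA he => QRed.reductionProb_ge (hr κ) hpoly.2.2 h2 (hqm κ) hκ (hℓ κ) hM
        (by positivity) hw hA s fun B i => QRed.error_box_le (hα κ) (hr κ) (by omega) (by omega)
          (hℓ κ) hbound (by
            have h1 := Finset.mem_Icc.1 (he i)
            rw [← abs_le, Int.le_floor, Int.cast_abs] at h1
            exact h1))
    refine le_trans ?_ h
    rw [pow_succ, div_le_iff₀ (by positivity)]
    -- The factors are 1/4 for the matrix, 1/2 for the error vector, 1/4 for the good components and
    -- `1 / (4 S ^ c)` for the measurement on truncated coset states.
    have h3 : 1 / 4 * (1 / 2 * (1 / 4 * (1 / S ^ c / 4))) * (S ^ c * S) = S / 128 := by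
      field_simp
      norm_num
    rw [h3]
    linarith
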